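/- **Setting.** Let $T>0$ and let $n,m,n_h,n_g,n_c$ be non-negative integers. Let $\ell(x,u)=\ell_1(x)+\ell_2(x)\cdot u$, $f(x,u)=f_1(x)+f_2(x)u$ and $c_i(x,u)=a_i(x)\cdot u+b_i(x)$ ($1\le i\le n_c$) be affine in $u$, with $\ell:\mathbb R^n\times\mathbb R^m\to\mathbb R$, $f:\mathbb R^n\times\mathbb R^m\to\mathbb R^n$, and let $g_i:\mathbb R^n\to\mathbb R$ ($1\le i\le n_g$), $\varphi:\mathbb R^n\to\mathbb R$, $h:\mathbb R^n\times\mathbb R^n\to\mathbb R^{n_h}$. Norms on $\mathbb R^k$ are Euclidean. A *trajectory* is a pair $(x,u)$ with $u\in L^\infty([0,T];\mathbb R^m)$ and $x\in W^{1,\infty}([0,T];\mathbb R^n)$ such that $\dot x=f(x,u)$; it is *feasible* if $h(x(0),x(T))=0$, and *admissible* if moreover $g_i(x(t))\le 0$ for all $t\in[0,T]$ and all $i$, and $c_i(x(t),u(t))\le0$ for a.e. $t$ and all $i$. The distance of two trajectories is $\|v-u\|_{L^1}+\|y(0)-x(0)\|$, and "locally" refers to this distance. Put $J(x,u)=\varphi(x(T))+\int_0^T\ell(x,u)\,dt$.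 The original problem is to minimize $J$ over the admissible trajectories. With $\psi(s)=-\log(-s)$ for $s<0$ and $\psi(s)=+\infty$ for $s\ge0$, the penalized problem with parameter $\epsilon>0$ is to minimize $$J_\epsilon(x,u)=J(x,u)+\epsilon\int_0^T\Big[\sum_{i=1}^{n_g}\psi(g_i(x(t)))+\sum_{i=1}^{n_c}\psi(c_i(x(t),u(t)))\Big]dt$$ over the feasible trajectories; a locally optimal solution of it is understood to have finite cost. **Assumptions.** 1. $\ell,f,g,c$ are of class $C^2$, and $\varphi,h$ are of class $C^1$. 2. For every local solution $(x,u)$ of the original problem and every $\delta>0$ there is an admissible trajectory $(y,v)$ at distance less than $\delta$ from $(x,u)$ such that $g_i(y(t))<0$ for all $t\in[0,T]$ and all $i$ and such that, for all large enough $k$, $c_i(y(t),v(t))\le-1/k$ for a.e. $t$ and all $i$. 3. $h^{-1}(\{0\})$ is closed and bounded. 4. There is $R$ such that $\|u\|_{L^\infty}\le R$ and $\|x(0)\|\le R$ for every admissible trajectory $(x,u)$. For every $R$ there is $R_x$ such that for all $u\in L^\infty$, $x^0\in\mathbb R^n$ with $\|u\|_{L^1}+\|x^0\|\le R$ the equation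 $\dot x=f(x,u)$, $x(0)=x^0$ has a solution on $[0,T]$ with $\|x\|_{L^\infty}\le R_x$. 5. For every admissible $(x,u)$ there are $\gamma>0$ and an integer $k\ge1$ such that, for a.e. $t$, with $I(t)=\{i: c_i(x(t),u(t))\ge-1/k\}$, one has $\gamma\|\xi\|\le\big\|\sum_{i\in I(t)}\xi_i a_i(x(t))\big\|$ for all $\xi\in\mathbb R^{I(t)}$. 6. There is no singular multiplier: for every admissible $(x,u)$, the only $(p,\mu,\nu,\lambda)$ with $p:[0,T]\to\mathbb R^n$ of bounded variation, $\mu_i$ finite non-negative measures on $[0,T]$, $0\le\nu_i\in L^\infty([0,T])$ and $\lambda\in\mathbb R^{n_h}$ that satisfies $$-dp=\Big[f_x'(x,u)^\top p+\sum_i\nu_i\,c_{i,x}'(x,u)\Big]dt+\sum_i g_i'(x)\,d\mu_i,\qquad p(0^-)=-h_{x(0)}'^\top\lambda,\quad p(T^+)=h_{x(T)}'^\top\lambda,$$ $$f_2(x)^\top p+\sum_i\nu_i\,a_i(x)=0\ \text{ a.e.},\qquad \int g_i(x)\,d\mu_i=0,\quad \int_0^T c_i(x,u)\,\nu_i\,dt=0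 \ \text{ for all } i$$ is $(p,\mu,\nu,\lambda)=0$. (Atoms of $\mu_i$ at $0$ and at $T$ are allowed; $p$ is taken right-continuous on $[0,T)$, with $p(T)=p(T^+)$.) **Claim.** For every $\epsilon_0>0$ there is a constant $K_c<+\infty$ such that for every $\epsilon\in(0,\epsilon_0)$ and every locally optimal solution $(x_\epsilon,u_\epsilon)$ of the penalized problem with parameter $\epsilon$ one has, for each $i=1,\dots,n_c$: $c_i(x_\epsilon,u_\epsilon)<0$ almost everywhere, and $$\|\epsilon\,\psi'\circ c_i(x_\epsilon,u_\epsilon)\|_{L^1}\le K_c .$$ -/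

import Mathlib

open MeasureTheory Set Filter

noncomputable section

/-- `ℝᵏ` with its Euclidean norm. -/
abbrev Vec (k : ℕ) : Type := EuclideanSpace ℝ (Fin k)

/-- The data of a control-affine optimal control problem on `[0, T]`: state in `ℝⁿ`, control in
`ℝᵐ`, `nh` initial-final equality constraints, `ng` pure state constraints and `nc` mixed
constraints. No property of the data is part of the structure. -/
structure OCP (n m nh ng nc : ℕ) where
  /-- time horizon -/
  T : ℝ
  /-- final cost -/
  φ : Vec n → ℝ
  /-- running cost, control-free part -/
  ℓ₁ : Vec n → ℝ
  /-- running cost, coefficient of the control -/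
  ℓ₂ : Vec n → Vec m
  /-- dynamics, control-free part -/
  f₁ : Vec n → Vec n
  /-- dynamics, coefficient of the control -/
  f₂ : Vec n → (Vec m →L[ℝ] Vec n)
  /-- initial-final constraint `h (x 0, x T) = 0` -/
  h : Vec n × Vec n → Vec nh
  /-- state constraints `g i (x t) ≤ 0` -/
  g : Fin ng → Vec n → ℝ
  /-- the rows of the coefficient of the control in the mixed constraints -/
  a : Fin nc → Vec n → Vec m
  /-- mixed constraints, control-free part -/
  b : Fin nc → Vec n → ℝ

/-- The log-barrier `ψ(s) = -log(-s)` for `s < 0`, and `+∞` otherwise. -/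
def logBarrier (s : ℝ) : EReal :=
  if s < 0 then ((-Real.log (-s) : ℝ) : EReal) else ⊤

/-- The derivative `ψ'` of the log-barrier; it is meaningful on `(-∞, 0)`, where `ψ` is finite. -/
def logBarrierDeriv (s : ℝ) : ℝ :=
  deriv (fun r : ℝ => (logBarrier r).toReal) s

/-- Integral over `[0, T]` of an extended-real function: the integral of the positive part minus
the integral of the negative part. -/
def extIntegral (T : ℝ) (w : ℝ → EReal) : EReal :=
  ((∫⁻ t in Icc 0 T, (w t).toENNReal : ENNReal) : EReal)
    - ((∫⁻ t in Icc 0 T, (-w t).toENNReal : ENNReal) : EReal)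

namespace OCP

variable {n m nh ng nc : ℕ} (P : OCP n m nh ng nc)

/-- Running cost `ℓ(x, u) = ℓ₁(x) + ℓ₂(x) . u`. -/
def ℓ (x : Vec n) (u : Vec m) : ℝ := P.ℓ₁ x + inner ℝ (P.ℓ₂ x) u

/-- Dynamics `f(x, u) = f₁(x) + f₂(x) . u`. -/
def f (x : Vec n) (u : Vec m) : Vec n := P.f₁ x + P.f₂ x u

/-- Mixed constraint `cᵢ(x, u) = aᵢ(x) . u + bᵢ(x)`. -/
def c (i : Fin nc) (x : Vec n) (u : Vec m) : ℝ := inner ℝ (P.a i x) u + P.b i x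

/-- Lebesgue measure on `[0, T]`. -/
def vol : Measure ℝ := volume.restrict (Icc 0 P.T)

/-- `u ∈ L∞([0,T]; ℝᵐ)`. -/
def IsControl (u : ℝ → Vec m) : Prop := MemLp u ⊤ P.vol

/-- `u ∈ L∞`, and `x` is the (Carathéodory, hence `W^{1,∞}`) solution on `[0, T]` of
`x' = f(x, u)` with initial value `x 0`, i.e. `x = x[u, x 0]` on `[0, T]`. -/
structure IsTrajectory (x : ℝ → Vec n) (u : ℝ → Vec m) : Prop where
  control : P.IsControl u
  continuousOn : ContinuousOn x (Icc 0 P.T)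
  integral_eq : ∀ t ∈ Icc 0 P.T, x t = x 0 + ∫ s in (0 : ℝ)..t, P.f (x s) (u s)

/-- A trajectory that satisfies the initial-final condition. -/
structure IsFeasible (x : ℝ → Vec n) (u : ℝ → Vec m) : Prop extends P.IsTrajectory x u where
  initial_final : P.h (x 0, x P.T) = 0

/-- `(u, x 0)` belongs to the admissible set `V^ad`, with associated state `x`. -/
structure IsAdmissible (x : ℝ → Vec n) (u : ℝ → Vec m) : Prop extends P.IsFeasible x u where
  state_le : ∀ t ∈ Icc 0 P.T, ∀ i, P.g i (x t) ≤ 0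
  mixed_le : ∀ᵐ t ∂P.vol, ∀ i, P.c i (x t) (u t) ≤ 0

/-- `(u, x 0)` belongs to the set of strictly admissible points of parameter `k`. -/
structure IsStrictlyAdmissible (k : ℕ) (x : ℝ → Vec n) (u : ℝ → Vec m) : Prop
    extends P.IsAdmissible x u where
  state_lt : ∀ t ∈ Icc 0 P.T, ∀ i, P.g i (x t) < 0
  mixed_le_neg : ∀ᵐ t ∂P.vol, ∀ i, P.c i (x t) (u t) ≤ -(1 / (k : ℝ))

/-- The distance `‖v - u‖_{L¹} + ‖y 0 - x 0‖` between two pairs (control, initial state). -/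
def dist (x : ℝ → Vec n) (u : ℝ → Vec m) (y : ℝ → Vec n) (v : ℝ → Vec m) : ℝ :=
  (∫ t, ‖v t - u t‖ ∂P.vol) + ‖y 0 - x 0‖

/-- The cost `J`. -/
def J (x : ℝ → Vec n) (u : ℝ → Vec m) : ℝ :=
  P.φ (x P.T) + ∫ t, P.ℓ (x t) (u t) ∂P.vol

/-- The fully penalized cost `J_ε`. -/
def Jpen (ε : ℝ) (x : ℝ → Vec n) (u : ℝ → Vec m) : EReal :=
  (P.J x u : EReal) + (ε : EReal) * extIntegral P.T (fun t =>
    (∑ i, logBarrier (P.g i (x t))) + ∑ i, logBarrier (P.c i (x t) (u t)))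

/-- Local solution of the original problem. -/
def IsLocalSolution (x : ℝ → Vec n) (u : ℝ → Vec m) : Prop :=
  P.IsAdmissible x u ∧ ∃ δ > 0, ∀ y v, P.IsAdmissible y v → P.dist x u y v ≤ δ →
    P.J x u ≤ P.J y v

/-- Local solution, with finite cost, of the penalized problem of parameter `ε`. -/
def IsPenalizedLocalSolution (ε : ℝ) (x : ℝ → Vec n) (u : ℝ → Vec m) : Prop :=
  P.IsFeasible x u ∧ P.Jpen ε x u ≠ ⊤ ∧
    ∃ δ > 0, ∀ y v, P.IsFeasible y v → P.dist x u y v ≤ δ → P.Jpen ε x u ≤ P.Jpen ε y v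

/-- Smoothness of the data: `ℓ, f, g, c` are `C²`; `φ, h` are `C¹`. -/
structure Smooth : Prop where
  ℓ_C2 : ContDiff ℝ 2 (fun z : Vec n × Vec m => P.ℓ z.1 z.2)
  f_C2 : ContDiff ℝ 2 (fun z : Vec n × Vec m => P.f z.1 z.2)
  g_C2 : ∀ i, ContDiff ℝ 2 (P.g i)
  c_C2 : ∀ i, ContDiff ℝ 2 (fun z : Vec n × Vec m => P.c i z.1 z.2)
  φ_C1 : ContDiff ℝ 1 P.φ
  h_C1 : ContDiff ℝ 1 P.h

/-- Interior accessibility: every local solution of the original problem lies in the closure, for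
the `L¹ × ℝⁿ` distance, of the inferior limit of the strictly admissible sets. -/
def InteriorAccessible : Prop :=
  ∀ x u, P.IsLocalSolution x u → ∀ δ > 0, ∃ y v,
    (∀ᶠ k : ℕ in atTop, P.IsStrictlyAdmissible k y v) ∧ P.dist x u y v < δ

/-- The set of admissible initial-final states is closed and bounded. -/
def BoundedEndpoints : Prop :=
  IsClosed (P.h ⁻¹' {0}) ∧ Bornology.IsBounded (P.h ⁻¹' {0})

/-- Admissible controls are uniformly bounded in `L∞`, and so are the admissible initial states. -/
def BoundedAdmissible : Prop :=
  ∃ R : ℝ, ∀ x u, P.IsAdmissible x u → (∀ᵐ t ∂P.vol, ‖u t‖ ≤ R) ∧ ‖x 0‖ ≤ R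

/-- For controls and initial states in a ball of `L¹ × ℝⁿ`, the state equation has a solution
on `[0, T]`, and these solutions are uniformly bounded. -/
def BoundedStates : Prop :=
  ∀ R : ℝ, ∃ Rx : ℝ, ∀ (u : ℝ → Vec m) (x₀ : Vec n), P.IsControl u →
    (∫ t, ‖u t‖ ∂P.vol) + ‖x₀‖ ≤ R →
      ∃ x, P.IsTrajectory x u ∧ x 0 = x₀ ∧ ∀ t ∈ Icc 0 P.T, ‖x t‖ ≤ Rx

/-- Qualification of the mixed constraints: along every admissible trajectory, the gradients with
respect to the control of the nearly active mixed constraints are linearly independent, with a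
lower bound that is uniform in time. (The gradient of `cᵢ(x, ·)` is `aᵢ(x)`; vectors indexed by
the nearly active constraints are extended by zero.) -/
def MixedQualified : Prop :=
  ∀ x u, P.IsAdmissible x u → ∃ γ > (0 : ℝ), ∃ k : ℕ, 1 ≤ k ∧ ∀ᵐ t ∂P.vol, ∀ ξ : Vec nc,
    (∀ i, P.c i (x t) (u t) < -(1 / (k : ℝ)) → ξ i = 0) →
      γ * ‖ξ‖ ≤ ‖∑ i, ξ i • P.a i (x t)‖

/-- `(p, μ, ν, lam)` satisfies at `(x, u)` the first-order conditions in which the cost has been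
given the weight `0`. The costate `p` is normalized to be right-continuous on `[0, T)`, and an atom
of `μ i` at `0` makes it jump from `p(0⁻)`, the value entering the initial transversality condition,
to `p 0`. -/
structure IsSingular (x : ℝ → Vec n) (u : ℝ → Vec m) (p : ℝ → Vec n) (μ : Fin ng → Measure ℝ)
    (ν : Fin nc → ℝ → ℝ) (lam : Vec nh) : Prop where
  p_bv : BoundedVariationOn p (Icc 0 P.T)
  μ_finite : ∀ i, IsFiniteMeasure (μ i)
  μ_supp : ∀ i, μ i (Icc 0 P.T)ᶜ = 0
  ν_mem : ∀ i, MemLp (ν i) ⊤ P.vol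
  ν_nonneg : ∀ i, ∀ᵐ t ∂P.vol, 0 ≤ ν i t
  /-- adjoint equation, integrated from `t` to `T`, with the final transversality condition -/
  adjoint_eq : ∀ t ∈ Icc 0 P.T,
    p t = (fderiv ℝ (fun z => P.h (x 0, z)) (x P.T)).adjoint lam
      + (∫ s in t..P.T, ((fderiv ℝ (fun z => P.f z (u s)) (x s)).adjoint (p s)
          + ∑ i, ν i s • gradient (fun z => P.c i z (u s)) (x s)))
      + ∑ i, ∫ s in Ioc t P.T, gradient (P.g i) (x s) ∂(μ i)
  /-- initial transversality condition `p(0⁻) = - h_{x(0)}'ᵀ lam` -/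
  initial_eq : p 0 + ∑ i, (μ i {0}).toReal • gradient (P.g i) (x 0)
      = -(fderiv ℝ (fun z => P.h (z, x P.T)) (x 0)).adjoint lam
  /-- stationarity with respect to the control -/
  control_eq : ∀ᵐ t ∂P.vol, (P.f₂ (x t)).adjoint (p t) + ∑ i, ν i t • P.a i (x t) = 0
  μ_compl : ∀ i, ∫ t, P.g i (x t) ∂(μ i) = 0
  ν_compl : ∀ i, ∫ t, P.c i (x t) (u t) * ν i t ∂P.vol = 0

/-- There is no singular multiplier: at every admissible trajectory, the only multiplier of the
first-order conditions without cost is zero. -/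
def NoSingularMultiplier : Prop :=
  ∀ x u, P.IsAdmissible x u → ∀ p μ ν lam, P.IsSingular x u p μ ν lam →
    (∀ t ∈ Icc 0 P.T, p t = 0) ∧ (∀ i, μ i = 0) ∧ (∀ i, ∀ᵐ t ∂P.vol, ν i t = 0) ∧ lam = 0

end OCP

end

noncomputable section

section HilbertAlternative

open Topology Pointwise

variable {X H : Type*} [NormedAddCommGroup X] [InnerProductSpace ℝ X] [CompleteSpace X]
  [NormedAddCommGroup H] [InnerProductSpace ℝ H] [CompleteSpace H]

/-- In a Hilbert space a closed convex nonempty set has an element of minimal norm. -/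
theorem exists_minimal_norm {S : Set H} (hne : S.Nonempty) (hc : IsClosed S) (hS : Convex ℝ S) :
    ∃ v ∈ S, ∀ w ∈ S, ‖v‖ ^ 2 ≤ inner ℝ v w := by
  obtain ⟨v, hv, hmin⟩ := exists_norm_eq_iInf_of_complete_convex hne hc.isComplete hS 0
  refine ⟨v, hv, fun w hw => ?_⟩
  have h := (norm_eq_iInf_iff_real_inner_le_zero hS hv).1 hmin w hw
  simp only [zero_sub, inner_neg_left, inner_sub_right, real_inner_self_eq_norm_sq] at h
  linarith

/-- Nested bounded closed convex sets of a Hilbert space have a common point. -/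
theorem nonempty_iInter_of_antitone_convex {D : ℕ → Set X} (hD : Antitone D)
    (hne : ∀ n, (D n).Nonempty) (hc : ∀ n, IsClosed (D n)) (hconv : ∀ n, Convex ℝ (D n))
    (hb : Bornology.IsBounded (D 0)) : (⋂ n, D n).Nonempty := by
  choose d hd hmin using fun n => exists_minimal_norm (hne n) (hc n) (hconv n)
  have hsq : ∀ n m, n ≤ m → ‖d m - d n‖ ^ 2 ≤ ‖d m‖ ^ 2 - ‖d n‖ ^ 2 := by
    intro n m hnm
    have h := hmin n (d m) (hD hnm (hd m))
    rw [norm_sub_sq_real, real_inner_comm]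
    linarith
  have hmono : Monotone fun n => ‖d n‖ ^ 2 := by
    intro n m hnm
    have := hsq n m hnm
    have h2 := sq_nonneg ‖d m - d n‖
    simp only
    linarith
  obtain ⟨R, hR⟩ := hb.exists_norm_le
  have hbdd : BddAbove (range fun n => ‖d n‖ ^ 2) := by
    refine ⟨R ^ 2, ?_⟩
    rintro _ ⟨n, rfl⟩
    have := hR (d n) (hD (Nat.zero_le n) (hd n))
    exact pow_le_pow_left₀ (norm_nonneg _) this 2
  have hlim := tendsto_atTop_ciSup hmono hbdd
  set L := ⨆ n, ‖d n‖ ^ 2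
  have hle : ∀ n, ‖d n‖ ^ 2 ≤ L := fun n => le_ciSup hbdd n
  have hcauchy : CauchySeq d := by
    refine Metric.cauchySeq_iff'.2 fun ε hε => ?_
    have hev : ∀ᶠ n in atTop, L - ε ^ 2 < ‖d n‖ ^ 2 :=
      hlim.eventually (lt_mem_nhds (by have := pow_pos hε 2; linarith))
    obtain ⟨N, hN⟩ := hev.exists
    refine ⟨N, fun n hn => ?_⟩
    rw [dist_eq_norm]
    have h1 := hsq N n hn
    have h2 := hle n
    exact lt_of_pow_lt_pow_left₀ 2 hε.le (by linarith)
  obtain ⟨x, hx⟩ := cauchySeq_tendsto_of_complete hcauchy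
  refine ⟨x, mem_iInter.2 fun n => (hc n).mem_of_tendsto hx ?_⟩
  filter_upwards [eventually_ge_atTop n] with m hm using hD hm (hd m)

/-- Alternative for a convex system in a Hilbert space: either the system `A d + b ∈ -C` has a
solution `d` in the bounded closed convex set `D`, or there is a nonzero multiplier. -/
theorem convex_system_alternative (A : X →L[ℝ] H) (b : H) {D : Set X} {C : Set H}
    (hDne : D.Nonempty) (hDc : IsClosed D) (hDconv : Convex ℝ D) (hDb : Bornology.IsBounded D)
    (hCne : C.Nonempty) (hCc : IsClosed C) (hCconv : Convex ℝ C) :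
    (∃ d ∈ D, ∃ r ∈ C, A d + b + r = 0) ∨
      ∃ q : H, q ≠ 0 ∧ ∀ d ∈ D, ∀ r ∈ C, 0 ≤ inner ℝ q (A d + b + r) := by
  set S : Set H := (A '' D + ({b} : Set H)) + C with hS
  have hmemS : ∀ d ∈ D, ∀ r ∈ C, A d + b + r ∈ S := fun d hd r hr =>
    add_mem_add (add_mem_add (mem_image_of_mem _ hd) rfl) hr
  have hSconv : Convex ℝ S :=
    ((hDconv.is_linear_image A.toLinearMap.isLinear).add (convex_singleton b)).add hCconv
  obtain ⟨d0, hd0⟩ := hDne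
  obtain ⟨r0, hr0⟩ := hCne
  have hSne : S.Nonempty := ⟨_, hmemS d0 hd0 r0 hr0⟩
  by_cases h0 : (0 : H) ∈ closure S
  · left
    set Ds : ℕ → Set X := fun n =>
      D ∩ (fun d => -(A d + b)) ⁻¹' Metric.cthickening (1 / ((n : ℝ) + 1)) C
    have hcont : Continuous fun d => -(A d + b) := by fun_prop
    have hanti : Antitone Ds := by
      intro n m hnm
      refine inter_subset_inter_right _ (preimage_mono (Metric.cthickening_mono ?_ _))
      exact one_div_le_one_div_of_le (by positivity) (by exact_mod_cast Nat.succ_le_succ hnm)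
    have hne : ∀ n, (Ds n).Nonempty := by
      intro n
      obtain ⟨s, hs, hlt⟩ := Metric.mem_closure_iff.1 h0 (1 / ((n : ℝ) + 1)) (by positivity)
      obtain ⟨_, ⟨_, ⟨d, hd, rfl⟩, b₁, hb₁, rfl⟩, r, hr, rfl⟩ := hs
      rw [mem_singleton_iff.1 hb₁] at hlt
      refine ⟨d, hd, Metric.mem_cthickening_of_dist_le _ r _ _ hr ?_⟩
      rw [dist_eq_norm] at hlt ⊢
      have : -(A d + b) - r = 0 - (A d + b + r) := by abel
      rw [this]
      exact hlt.le
    have hclosed : ∀ n, IsClosed (Ds n) := fun n =>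
      hDc.inter (Metric.isClosed_cthickening.preimage hcont)
    have hconv : ∀ n, Convex ℝ (Ds n) := by
      intro n x hx y hy s t hs ht hst
      refine ⟨hDconv hx.1 hy.1 hs ht hst, ?_⟩
      have := (hCconv.cthickening (1 / ((n : ℝ) + 1))) hx.2 hy.2 hs ht hst
      simp only [mem_preimage]
      convert this using 1
      simp only [map_add, map_smul]
      have hb : b = s • b + t • b := by rw [← add_smul, hst, one_smul]
      nth_rewrite 1 [hb]
      module
    obtain ⟨d, hd⟩ := nonempty_iInter_of_antitone_convex hanti hne hclosed hconv
      (hDb.subset inter_subset_left)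
    rw [mem_iInter] at hd
    have hC : -(A d + b) ∈ C := by
      rw [← hCc.closure_eq, Metric.closure_eq_iInter_cthickening]
      refine mem_iInter₂.2 fun ε hε => ?_
      obtain ⟨n, hn⟩ := exists_nat_one_div_lt hε
      exact Metric.cthickening_mono hn.le _ (hd n).2
    exact ⟨d, (hd 0).1, _, hC, by abel⟩
  · right
    obtain ⟨v, hv, hmin⟩ := exists_minimal_norm hSne.closure isClosed_closure hSconv.closure
    refine ⟨v, fun h => h0 (h ▸ hv), fun d hd r hr => ?_⟩
    exact (sq_nonneg _).trans (hmin _ (subset_closure (hmemS d hd r hr)))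

end HilbertAlternative
end

noncomputable section

/-- Lebesgue measure on `[0, T]`. -/
abbrev volOn (T : ℝ) : Measure ℝ := volume.restrict (Icc 0 T)

section IntervalIntegrals

variable {E F : Type*} [NormedAddCommGroup E] [NormedSpace ℝ E]
  [NormedAddCommGroup F] [NormedSpace ℝ F] {T : ℝ}

theorem intervalIntegral_eq_volOn {f : ℝ → E} {a b : ℝ} (ha : 0 ≤ a) (hab : a ≤ b) (hb : b ≤ T) :
    ∫ s in a..b, f s = ∫ s in Ioc a b, f s ∂volOn T := by
  rw [intervalIntegral.integral_of_le hab, Measure.restrict_restrict measurableSet_Ioc,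
    inter_eq_self_of_subset_left]
  exact fun x hx => ⟨ha.trans hx.1.le, hx.2.trans hb⟩

theorem intervalIntegral_eq_integral_volOn {f : ℝ → E} (hT : 0 ≤ T) :
    ∫ s in (0 : ℝ)..T, f s = ∫ s, f s ∂volOn T := by
  rw [intervalIntegral.integral_of_le hT, integral_Icc_eq_integral_Ioc]

omit [NormedSpace ℝ E] in
theorem integrable_volOn_intervalIntegrable {f : ℝ → E} (hf : Integrable f (volOn T)) {a b : ℝ}
    (ha : a ∈ Icc 0 T) (hb : b ∈ Icc 0 T) : IntervalIntegrable f volume a b := by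
  refine IntegrableOn.intervalIntegrable (IntegrableOn.mono_set hf ?_)
  exact uIcc_subset_Icc ha hb

theorem norm_intervalIntegral_le_volOn {f : ℝ → E} (hf : Integrable f (volOn T)) {a b : ℝ}
    (ha : a ∈ Icc 0 T) (hb : b ∈ Icc 0 T) :
    ‖∫ s in a..b, f s‖ ≤ ∫ s, ‖f s‖ ∂volOn T := by
  refine intervalIntegral.norm_integral_le_integral_norm_uIoc.trans ?_
  refine setIntegral_mono_set hf.norm (Eventually.of_forall fun _ => norm_nonneg _) ?_
  exact LE.le.eventuallyLE (uIoc_subset_uIcc.trans (uIcc_subset_Icc ha hb))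

theorem ae_volOn_mem : ∀ᵐ t ∂volOn T, t ∈ Icc 0 T := ae_restrict_mem measurableSet_Icc

theorem continuousOn_intervalIntegral_volOn {f : ℝ → E} (hf : Integrable f (volOn T))
    (hT : 0 ≤ T) : ContinuousOn (fun t => ∫ s in (0 : ℝ)..t, f s) (Icc 0 T) := by
  have h : IntegrableOn f (uIcc 0 T) := by rwa [uIcc_of_le hT]
  have := intervalIntegral.continuousOn_primitive_interval h
  rwa [uIcc_of_le hT] at this

theorem continuousOn_intervalIntegral_volOn_left {f : ℝ → E} (hf : Integrable f (volOn T))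
    (hT : 0 ≤ T) : ContinuousOn (fun t => ∫ s in t..T, f s) (Icc 0 T) := by
  have h : IntegrableOn f (uIcc 0 T) := by rwa [uIcc_of_le hT]
  have := intervalIntegral.continuousOn_primitive_interval_left h
  rwa [uIcc_of_le hT] at this

/-- Duality of the primitives from `0` and to `T`. -/
theorem integral_inner_primitive {G : Type*} [NormedAddCommGroup G]
    [InnerProductSpace ℝ G] [CompleteSpace G] {w ζ : ℝ → G}
    (hw : Integrable w (volOn T)) (hζ : Integrable ζ (volOn T)) :
    ∫ t, inner ℝ (w t) (∫ s in (0 : ℝ)..t, ζ s) ∂volOn T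
      = ∫ s, inner ℝ (∫ t in s..T, w t) (ζ s) ∂volOn T := by
  set Φ : ℝ → ℝ → ℝ := fun t s => {x : ℝ × ℝ | x.2 ≤ x.1}.indicator
    (fun x => inner ℝ (w x.1) (ζ x.2)) (t, s) with hΦ
  have hmeas : MeasurableSet {x : ℝ × ℝ | x.2 ≤ x.1} :=
      measurableSet_le measurable_snd measurable_fst
  have hint : Integrable (Function.uncurry Φ) ((volOn T).prod (volOn T)) := by
    have h1 : Integrable (fun x : ℝ × ℝ => inner ℝ (w x.1) (ζ x.2))
        ((volOn T).prod (volOn T)) := by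
      refine Integrable.mono' (hw.norm.mul_prod hζ.norm) ?_ ?_
      · exact hw.1.comp_fst.inner hζ.1.comp_snd
      · exact Eventually.of_forall fun x => norm_inner_le_norm _ _
    exact h1.indicator hmeas
  have hswap := integral_integral_swap hint
  have hL : ∀ᵐ t ∂volOn T, ∫ s, Φ t s ∂volOn T = inner ℝ (w t) (∫ s in (0 : ℝ)..t, ζ s) := by
    filter_upwards [ae_volOn_mem] with t ht
    rw [intervalIntegral_eq_volOn le_rfl ht.1 ht.2, ← integral_inner hζ.restrict,
      ← integral_indicator measurableSet_Ioc]
    refine integral_congr_ae ?_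
    have h0 : ∀ᵐ s ∂volOn T, s ≠ 0 := by
      refine ae_restrict_of_ae ?_
      exact (Measure.ae_ne volume 0)
    filter_upwards [ae_volOn_mem, h0] with s hs hs0
    have hpos : 0 < s := lt_of_le_of_ne hs.1 (Ne.symm hs0)
    simp only [hΦ, indicator_apply, mem_ofPred_eq, mem_Ioc, hpos, true_and]
  have hR : ∀ᵐ s ∂volOn T, ∫ t, Φ t s ∂volOn T = inner ℝ (∫ t in s..T, w t) (ζ s) := by
    filter_upwards [ae_volOn_mem] with s hs
    rw [intervalIntegral_eq_volOn hs.1 hs.2 le_rfl, real_inner_comm, ← integral_inner hw.restrict,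
      ← integral_indicator measurableSet_Ioc]
    refine integral_congr_ae ?_
    have h0 : ∀ᵐ t ∂volOn T, t ≠ s := by
      refine ae_restrict_of_ae ?_
      exact (Measure.ae_ne volume s)
    filter_upwards [ae_volOn_mem, h0] with t ht hts
    simp only [hΦ, indicator_apply, mem_ofPred_eq, mem_Ioc, ht.2, and_true]
    by_cases h : s ≤ t
    · rw [if_pos h, if_pos (lt_of_le_of_ne h (Ne.symm hts)), real_inner_comm]
    · rw [if_neg h, if_neg (fun h' => h h'.le)]
  rw [integral_congr_ae hL, integral_congr_ae hR] at hswap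
  exact hswap

end IntervalIntegrals

section Operators

variable {E F : Type*} [NormedAddCommGroup E] [NormedSpace ℝ E]
  [NormedAddCommGroup F] [NormedSpace ℝ F] {T : ℝ}

omit [NormedSpace ℝ E] in
theorem memLp_two_integrable {f : ℝ → E} (hf : MemLp f 2 (volOn T)) : Integrable f (volOn T) :=
  hf.integrable one_le_two

/-- Pointwise multiplication by a bounded operator-valued function. -/
def mulOp (K : ℝ → E →L[ℝ] F) (hK : MemLp K ⊤ (volOn T)) :
    Lp E 2 (volOn T) →L[ℝ] Lp F 2 (volOn T) :=
  (ContinuousLinearMap.id ℝ (E →L[ℝ] F)).holderL (volOn T) ⊤ 2 2 (hK.toLp K)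

theorem coeFn_mulOp (K : ℝ → E →L[ℝ] F) (hK : MemLp K ⊤ (volOn T)) (ζ : Lp E 2 (volOn T)) :
    mulOp K hK ζ =ᵐ[volOn T] fun t => K t (ζ t) := by
  have h := (ContinuousLinearMap.id ℝ (E →L[ℝ] F)).coeFn_holder (r := 2) (hK.toLp K) ζ
  filter_upwards [h, hK.coeFn_toLp] with t h1 h2
  have h3 : mulOp K hK ζ t = (ContinuousLinearMap.id ℝ (E →L[ℝ] F)).holder 2 (hK.toLp K) ζ t := rfl
  rw [h3, h1, h2]; rfl

/-- The integral over `[0, T]` as an operator on `L²`. -/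
def totalOp (E : Type*) [NormedAddCommGroup E] [NormedSpace ℝ E] [CompleteSpace E] (T : ℝ) :
    Lp E 2 (volOn T) →L[ℝ] E :=
  (ContinuousLinearMap.lsmul ℝ ℝ).lpPairing (volOn T) 2 2 (Lp.const 2 (volOn T) (1 : ℝ))

theorem totalOp_apply [CompleteSpace E] (ζ : Lp E 2 (volOn T)) :
    totalOp E T ζ = ∫ t, ζ t ∂volOn T := by
  rw [totalOp, ContinuousLinearMap.lpPairing_eq_integral]
  refine integral_congr_ae ?_
  filter_upwards [Lp.coeFn_const (p := 2) (μ := volOn T) (1 : ℝ)] with t ht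
  rw [ht]
  simp

theorem exists_integral_norm_le_L2 (E : Type*) [NormedAddCommGroup E] (T : ℝ) :
    ∃ C : ℝ, 0 ≤ C ∧ ∀ ζ : Lp E 2 (volOn T), ∫ t, ‖ζ t‖ ∂volOn T ≤ C * ‖ζ‖ := by
  refine ⟨(volOn T univ ^ (1 / (1 : ENNReal).toReal - 1 / (2 : ENNReal).toReal)).toReal,
    ENNReal.toReal_nonneg, fun ζ => ?_⟩
  have h := eLpNorm_le_eLpNorm_mul_rpow_measure_univ (μ := volOn T) (p := 1) (q := 2) one_le_two
    (Lp.aestronglyMeasurable ζ)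
  rw [integral_norm_eq_lintegral_enorm (Lp.aestronglyMeasurable ζ),
      ← eLpNorm_one_eq_lintegral_enorm,
    Lp.norm_def, mul_comm, ← ENNReal.toReal_mul]
  refine ENNReal.toReal_mono ?_ h
  refine ENNReal.mul_ne_top (Lp.eLpNorm_ne_top ζ) ?_
  exact ENNReal.rpow_ne_top_of_nonneg (by norm_num) (measure_ne_top _ _)

theorem aestronglyMeasurable_primitive {f : ℝ → E} (hf : Integrable f (volOn T)) (hT : 0 ≤ T) :
    AEStronglyMeasurable (fun t => ∫ s in (0 : ℝ)..t, f s) (volOn T) :=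
  (continuousOn_intervalIntegral_volOn hf hT).aestronglyMeasurable measurableSet_Icc

theorem memLp_primitive {f : ℝ → E} (hf : Integrable f (volOn T)) (hT : 0 ≤ T) (p : ENNReal) :
    MemLp (fun t => ∫ s in (0 : ℝ)..t, f s) p (volOn T) := by
  refine MemLp.of_bound (aestronglyMeasurable_primitive hf hT) (∫ s, ‖f s‖ ∂volOn T) ?_
  filter_upwards [ae_volOn_mem] with t ht
  exact norm_intervalIntegral_le_volOn hf ⟨le_rfl, hT⟩ ht

/-- The primitive vanishing at `0` as an operator on `L²`. -/
def primitiveOp (E : Type*) [NormedAddCommGroup E] [NormedSpace ℝ E] {T : ℝ} (hT : 0 ≤ T) :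
    Lp E 2 (volOn T) →L[ℝ] Lp E 2 (volOn T) :=
  LinearMap.mkContinuousOfExistsBound
    { toFun := fun ζ => (memLp_primitive (memLp_two_integrable (Lp.memLp ζ)) hT 2).toLp _
      map_add' := by
        intro f g
        rw [← MemLp.toLp_add]
        refine MemLp.toLp_congr _ _ ?_
        filter_upwards [ae_volOn_mem] with t ht
        simp only [Pi.add_apply]
        have hf := integrable_volOn_intervalIntegrable (memLp_two_integrable (Lp.memLp f))
          ⟨le_rfl, hT⟩ ht
        have hg := integrable_volOn_intervalIntegrable (memLp_two_integrable (Lp.memLp g))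
          ⟨le_rfl, hT⟩ ht
        rw [← intervalIntegral.integral_add hf hg, intervalIntegral_eq_volOn le_rfl ht.1 ht.2,
          intervalIntegral_eq_volOn le_rfl ht.1 ht.2]
        exact integral_congr_ae (ae_restrict_of_ae (Lp.coeFn_add f g))
      map_smul' := by
        intro c f
        rw [RingHom.id_apply, ← MemLp.toLp_const_smul]
        refine MemLp.toLp_congr _ _ ?_
        filter_upwards [ae_volOn_mem] with t ht
        simp only [Pi.smul_apply]
        rw [← intervalIntegral.integral_smul, intervalIntegral_eq_volOn le_rfl ht.1 ht.2,
          intervalIntegral_eq_volOn le_rfl ht.1 ht.2]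
        exact integral_congr_ae (ae_restrict_of_ae (Lp.coeFn_smul c f)) }
    (by
      obtain ⟨C, hC, hle⟩ := exists_integral_norm_le_L2 E T
      refine ⟨(measureUnivNNReal (volOn T) : ℝ) ^ (2 : ENNReal).toReal⁻¹ * C, fun ζ => ?_⟩
      simp only [LinearMap.coe_mk, AddHom.coe_mk]
      refine (Lp.norm_le_of_ae_bound (C := C * ‖ζ‖) (by positivity) ?_).trans (le_of_eq ?_)
      · filter_upwards [(memLp_primitive (memLp_two_integrable (Lp.memLp ζ)) hT 2).coeFn_toLp,
          ae_volOn_mem] with t h1 ht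
        rw [h1]
        exact (norm_intervalIntegral_le_volOn (memLp_two_integrable (Lp.memLp ζ))
          ⟨le_rfl, hT⟩ ht).trans (hle ζ)
      · ring)

theorem coeFn_primitiveOp (hT : 0 ≤ T) (ζ : Lp E 2 (volOn T)) :
    primitiveOp E hT ζ =ᵐ[volOn T] fun t => ∫ s in (0 : ℝ)..t, ζ s :=
  (memLp_primitive (memLp_two_integrable (Lp.memLp ζ)) hT 2).coeFn_toLp

end Operators
end

noncomputable section

section Alternative

variable {X Y Z W ι : Type*} [Fintype ι]
  [NormedAddCommGroup X] [InnerProductSpace ℝ X] [CompleteSpace X]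
  [NormedAddCommGroup Y] [InnerProductSpace ℝ Y] [CompleteSpace Y]
  [NormedAddCommGroup Z] [InnerProductSpace ℝ Z] [CompleteSpace Z]
  [NormedAddCommGroup W] [InnerProductSpace ℝ W] [CompleteSpace W]

/-- Alternative for a system of two linear equations and finitely many convex inequalities. -/
theorem mixed_system_alternative (c₁ : X →L[ℝ] Y) (c₂ : X →L[ℝ] Z) (c₃ : ι → X →L[ℝ] W)
    (b₂ : Z) (b₃ : ι → W) {D : Set X} {C : Set W}
    (hDne : D.Nonempty) (hDc : IsClosed D) (hDconv : Convex ℝ D) (hDb : Bornology.IsBounded D)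
    (hCne : C.Nonempty) (hCc : IsClosed C) (hCconv : Convex ℝ C) :
    (∃ d ∈ D, c₁ d = 0 ∧ c₂ d = b₂ ∧ ∀ i, -(c₃ i d + b₃ i) ∈ C) ∨
      ∃ (p : Y) (lam : Z) (ω : ι → W), ¬ (p = 0 ∧ lam = 0 ∧ ω = 0) ∧
        ∀ d ∈ D, ∀ ρ : ι → W, (∀ i, ρ i ∈ C) →
          0 ≤ inner ℝ p (c₁ d) + inner ℝ lam (c₂ d - b₂)
            + ∑ i, inner ℝ (ω i) (c₃ i d + b₃ i + ρ i) := by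
  set e₂ := (WithLp.prodContinuousLinearEquiv 2 ℝ Z (PiLp 2 fun _ : ι => W)).symm
  set e₁ := (WithLp.prodContinuousLinearEquiv 2 ℝ Y
    (WithLp 2 (Z × PiLp 2 fun _ : ι => W))).symm
  set e₃ := (PiLp.continuousLinearEquiv 2 ℝ (fun _ : ι => W)).symm
  set A : X →L[ℝ] WithLp 2 (Y × WithLp 2 (Z × PiLp 2 fun _ : ι => W)) :=
    e₁.toContinuousLinearMap ∘L (c₁.prod (e₂.toContinuousLinearMap ∘L
      (c₂.prod (e₃.toContinuousLinearMap ∘L (ContinuousLinearMap.pi c₃))))) with hA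
  set b : WithLp 2 (Y × WithLp 2 (Z × PiLp 2 fun _ : ι => W)) :=
    WithLp.toLp 2 (0, WithLp.toLp 2 (-b₂, WithLp.toLp 2 b₃)) with hb
  set C' : Set (WithLp 2 (Y × WithLp 2 (Z × PiLp 2 fun _ : ι => W))) :=
    {h | h.fst = 0 ∧ h.snd.fst = 0 ∧ ∀ i, h.snd.snd i ∈ C} with hC'
  have hc1 : Continuous fun h : WithLp 2 (Y × WithLp 2 (Z × PiLp 2 fun _ : ι => W)) => h.fst :=
    (WithLp.fstL 2 ℝ _ _).continuous
  have hc2 : Continuous fun h : WithLp 2 (Y × WithLp 2 (Z × PiLp 2 fun _ : ι => W)) => h.snd :=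
    (WithLp.sndL 2 ℝ _ _).continuous
  have hc3 : Continuous fun h : WithLp 2 (Z × PiLp 2 fun _ : ι => W) => h.fst :=
    (WithLp.fstL 2 ℝ _ _).continuous
  have hc4 : Continuous fun h : WithLp 2 (Z × PiLp 2 fun _ : ι => W) => h.snd :=
    (WithLp.sndL 2 ℝ _ _).continuous
  obtain ⟨w, hw⟩ := hCne
  have hC'ne : C'.Nonempty := by
    refine ⟨WithLp.toLp 2 (0, WithLp.toLp 2 (0, WithLp.toLp 2 fun _ => w)), ?_⟩
    simp [hC', hw]
  have hC'c : IsClosed C' := by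
    refine (isClosed_eq hc1 continuous_const).inter
      ((isClosed_eq (hc3.comp hc2) continuous_const).inter ?_)
    have : {h : WithLp 2 (Y × WithLp 2 (Z × PiLp 2 fun _ : ι => W)) | ∀ i, h.snd.snd i ∈ C}
        = ⋂ i, (fun h => h.snd.snd i) ⁻¹' C := by ext; simp
    change IsClosed {h : WithLp 2 (Y × WithLp 2 (Z × PiLp 2 fun _ : ι => W)) | ∀ i, h.snd.snd i ∈ C}
    rw [this]
    refine isClosed_iInter fun i => hCc.preimage ?_
    exact ((continuous_apply i).comp (PiLp.continuous_ofLp 2 _)).comp (hc4.comp hc2)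
  have hC'conv : Convex ℝ C' := by
    intro x hx y hy s t hs ht hst
    refine ⟨?_, ?_, fun i => ?_⟩
    · simp [hx.1, hy.1]
    · simp [hx.2.1, hy.2.1]
    · simpa using hCconv (hx.2.2 i) (hy.2.2 i) hs ht hst
  rcases convex_system_alternative A b hDne hDc hDconv hDb hC'ne hC'c hC'conv with
    ⟨d, hd, r, hr, h⟩ | ⟨q, hq, h⟩
  · left
    refine ⟨d, hd, ?_, ?_, fun i => ?_⟩
    · have := congrArg WithLp.fst h
      simpa [hA, hb, hr.1, e₁] using this
    · have := congrArg (fun x => x.snd.fst) h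
      simp [hA, hb, hr.2.1, e₁, e₂] at this
      exact sub_eq_zero.1 (by rw [sub_eq_add_neg]; exact this)
    · have := congrArg (fun x => x.snd.snd i) h
      simp [hA, hb, e₁, e₂, e₃] at this
      rw [neg_eq_of_add_eq_zero_right this]
      exact hr.2.2 i
  · right
    refine ⟨q.fst, q.snd.fst, fun i => q.snd.snd i, ?_, fun d hd ρ hρ => ?_⟩
    · rintro ⟨h1, h2, h3⟩
      refine hq ?_
      have h3' : q.snd.snd = 0 := by
        ext i : 1
        exact congrFun h3 i
      have h2' : q.snd = 0 := by
        have : q.snd = WithLp.toLp 2 (q.snd.fst, q.snd.snd) := rfl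
        rw [this, h2, h3']; rfl
      have : q = WithLp.toLp 2 (q.fst, q.snd) := rfl
      rw [this, h1, h2']; rfl
    · have := h d hd (WithLp.toLp 2 (0, WithLp.toLp 2 (0, WithLp.toLp 2 ρ)))
        (by simpa [hC'] using hρ)
      simpa [hA, hb, e₁, e₂, e₃, WithLp.prod_inner_apply, PiLp.inner_apply, sub_eq_add_neg,
        add_assoc] using this

end Alternative

section LpSets

variable {E : Type*} [NormedAddCommGroup E] [NormedSpace ℝ E] {α : Type*} [MeasurableSpace α]
  {μ : Measure α}

omit [NormedSpace ℝ E] in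
theorem isClosed_Lp_forall_ae {S : Set E} (hS : IsClosed S) :
    IsClosed {f : Lp E 2 μ | ∀ᵐ t ∂μ, f t ∈ S} := by
  refine isClosed_of_closure_subset fun f hf => ?_
  obtain ⟨u, hu, hlim⟩ := mem_closure_iff_seq_limit.1 hf
  obtain ⟨φ, -, hφ⟩ := (tendstoInMeasure_of_tendsto_Lp hlim).exists_seq_tendsto_ae
  have hall : ∀ᵐ t ∂μ, ∀ n, u n t ∈ S := ae_all_iff.2 hu
  filter_upwards [hφ, hall] with t ht1 ht2
  exact hS.mem_of_tendsto ht1 (Eventually.of_forall fun n => ht2 _)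

theorem convex_Lp_forall_ae {S : Set E} (hS : Convex ℝ S) :
    Convex ℝ {f : Lp E 2 μ | ∀ᵐ t ∂μ, f t ∈ S} := by
  intro f hf g hg s t hs ht hst
  have hf' : ∀ᵐ x ∂μ, f x ∈ S := hf
  have hg' : ∀ᵐ x ∂μ, g x ∈ S := hg
  change ∀ᵐ x ∂μ, (s • f + t • g : Lp E 2 μ) x ∈ S
  filter_upwards [hf', hg', Lp.coeFn_add (s • f) (t • g), Lp.coeFn_smul s f, Lp.coeFn_smul t g]
    with x h1 h2 h3 h4 h5
  rw [h3, Pi.add_apply, h4, h5]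
  exact hS h1 h2 hs ht hst

omit [NormedSpace ℝ E] in
theorem isBounded_Lp_unitBall [IsFiniteMeasure μ] :
    ∃ C, 0 ≤ C ∧ ∀ f : Lp E 2 μ, (∀ᵐ t ∂μ, ‖f t‖ ≤ 1) → ‖f‖ ≤ C := by
  refine ⟨(measureUnivNNReal μ : ℝ) ^ (2 : ENNReal).toReal⁻¹ * 1, by positivity, fun f hf => ?_⟩
  exact Lp.norm_le_of_ae_bound zero_le_one hf

end LpSets
end

noncomputable section

section Costate

variable {n m nh : ℕ} {ι : Type*} [Fintype ι]

/-- Right-hand side of the integrated adjoint equation of a linear system. -/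
def costate (T : ℝ) (A : ℝ → Vec n →L[ℝ] Vec n) (K : ι → ℝ → Vec n) (H₂ : Vec n →L[ℝ] Vec nh)
    (p : ℝ → Vec n) (lam : Vec nh) (ω : ι → ℝ → ℝ) (t : ℝ) : Vec n :=
  H₂.adjoint lam + ∫ s in t..T, ((A s).adjoint (p s) + ∑ i, ω i s • K i s)

/-- Normalized multipliers that satisfy, up to an error `δ` in `L¹`, the optimality system of the
linear system `z' = A z + B v`, `H₁ z(0) + H₂ z(T) = 0`, `k i + K i . z + D i . v ≤ 0`. -/
structure ApproxMultiplier (T : ℝ) (A : ℝ → Vec n →L[ℝ] Vec n) (B : ℝ → Vec m →L[ℝ] Vec n)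
    (H₁ H₂ : Vec n →L[ℝ] Vec nh) (k : ι → ℝ → ℝ) (K : ι → ℝ → Vec n) (D : ι → ℝ → Vec m)
    (δ : ℝ) (p : ℝ → Vec n) (lam : Vec nh) (ω : ι → ℝ → ℝ) : Prop where
  p_int : Integrable p (volOn T)
  ω_int : ∀ i, Integrable (ω i) (volOn T)
  ω_nonneg : ∀ i, ∀ᵐ t ∂volOn T, 0 ≤ ω i t
  mass : ‖lam‖ + ∫ t, ‖p t‖ ∂volOn T + ∑ i, ∫ t, ω i t ∂volOn T = 1
  residual : ∫ t, ‖costate T A K H₂ p lam ω t - p t‖ ∂volOn T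
    + ∫ t, ‖(B t).adjoint (p t) + ∑ i, ω i t • D i t‖ ∂volOn T
    + ‖H₁.adjoint lam + costate T A K H₂ p lam ω 0‖
    + ∑ i, ∫ t, ω i t * (-k i t) ∂volOn T ≤ δ

theorem exists_dual_ae {μ : Measure ℝ} [IsFiniteMeasure μ] {k : ℕ} {S : ℝ → Vec k}
    (hS : AEStronglyMeasurable S μ) :
    ∃ v : Lp (Vec k) 2 μ, (∀ᵐ t ∂μ, ‖v t‖ ≤ 1) ∧
      ∫ t, inner ℝ (S t) (v t) ∂μ = -∫ t, ‖S t‖ ∂μ := by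
  have hm : AEStronglyMeasurable (fun t => -(‖S t‖⁻¹ • S t)) μ :=
    (hS.norm.aemeasurable.inv.aestronglyMeasurable.smul hS).neg
  have hb : ∀ t, ‖-(‖S t‖⁻¹ • S t)‖ ≤ 1 := by
    intro t
    rw [norm_neg, norm_smul, norm_inv, norm_norm]
    exact inv_mul_le_one
  have hL : MemLp (fun t => -(‖S t‖⁻¹ • S t)) 2 μ := MemLp.of_bound hm 1 (Eventually.of_forall hb)
  refine ⟨hL.toLp _, ?_, ?_⟩
  · filter_upwards [hL.coeFn_toLp] with t ht
    rw [ht]; exact hb t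
  · rw [← integral_neg]
    refine integral_congr_ae ?_
    filter_upwards [hL.coeFn_toLp] with t ht
    rw [ht, inner_neg_right, inner_smul_right, real_inner_self_eq_norm_sq]
    by_cases h : ‖S t‖ = 0
    · simp [h]
    · field_simp

theorem exists_dual_vec {k : ℕ} (a : Vec k) : ∃ z : Vec k, ‖z‖ ≤ 1 ∧ inner ℝ a z = -‖a‖ := by
  refine ⟨-(‖a‖⁻¹ • a), ?_, ?_⟩
  · rw [norm_neg, norm_smul, norm_inv, norm_norm]
    exact inv_mul_le_one
  · rw [inner_neg_right, inner_smul_right, real_inner_self_eq_norm_sq]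
    by_cases h : ‖a‖ = 0
    · simp [h]
    · field_simp

theorem memLp_adjoint_apply {T : ℝ} {a b : ℕ} {A : ℝ → Vec a →L[ℝ] Vec b}
    (hA : MemLp A ⊤ (volOn T)) {p : ℝ → Vec b} {q : ENNReal} (hp : MemLp p q (volOn T)) :
    MemLp (fun t => (A t).adjoint (p t)) q (volOn T) := by
  have hA' : MemLp (fun t => (A t).adjoint) ⊤ (volOn T) :=
    hA.of_le ((ContinuousLinearMap.adjoint (𝕜 := ℝ) (E := Vec a)
      (F := Vec b)).continuous.comp_aestronglyMeasurable hA.1)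
      (Eventually.of_forall fun t => by simp)
  exact (ContinuousLinearMap.id ℝ (Vec b →L[ℝ] Vec a)).memLp_of_bilin q hA' hp

theorem memLp_sum_smul {T : ℝ} {k : ℕ} {K : ι → ℝ → Vec k}
    (hK : ∀ i, MemLp (K i) ⊤ (volOn T)) {ω : ι → ℝ → ℝ} {q : ENNReal}
    (hω : ∀ i, MemLp (ω i) q (volOn T)) :
    MemLp (fun t => ∑ i, ω i t • K i t) q (volOn T) :=
  memLp_finsetSum _ fun i _ =>
    (ContinuousLinearMap.lsmul ℝ ℝ : ℝ →L[ℝ] Vec k →L[ℝ] Vec k).memLp_of_bilin q (hω i) (hK i)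

theorem memLp_top_inner_right {T : ℝ} {k : ℕ} {K : ℝ → Vec k} (hK : MemLp K ⊤ (volOn T)) :
    MemLp (fun t => innerSL ℝ (K t)) ⊤ (volOn T) :=
  hK.of_le ((innerSL ℝ).continuous.comp_aestronglyMeasurable hK.1)
    (Eventually.of_forall fun t => by simp)

end Costate

section LinearSystem

variable {n m nh : ℕ} {ι : Type*} [Fintype ι] {T : ℝ} {A : ℝ → Vec n →L[ℝ] Vec n}
  {B : ℝ → Vec m →L[ℝ] Vec n} {H₁ H₂ : Vec n →L[ℝ] Vec nh} {k : ι → ℝ → ℝ} {K : ι → ℝ → Vec n}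
  {D : ι → ℝ → Vec m}

/-- The space of triples (velocity, control, initial state). -/
abbrev DirSpace (n m : ℕ) (T : ℝ) : Type :=
  WithLp 2 (Lp (Vec n) 2 (volOn T) × WithLp 2 (Lp (Vec m) 2 (volOn T) × Vec n))

/-- The state as a function of the velocity and the initial state. -/
def stateOp (n m : ℕ) {T : ℝ} (hT : 0 ≤ T) : DirSpace n m T →L[ℝ] Lp (Vec n) 2 (volOn T) :=
  (Lp.constL 2 (volOn T) ℝ).comp ((WithLp.sndL 2 ℝ _ _).comp (WithLp.sndL 2 ℝ _ _))
    + (primitiveOp (Vec n) hT).comp (WithLp.fstL 2 ℝ _ _)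

theorem coeFn_stateOp (hT : 0 ≤ T) (d : DirSpace n m T) :
    stateOp n m hT d =ᵐ[volOn T] fun t => d.snd.snd + ∫ s in (0 : ℝ)..t, d.fst s := by
  have h : stateOp n m hT d = Lp.constL 2 (volOn T) ℝ d.snd.snd + primitiveOp (Vec n) hT d.fst :=
      rfl
  rw [h]
  filter_upwards [Lp.coeFn_add (Lp.constL 2 (volOn T) ℝ d.snd.snd) (primitiveOp (Vec n) hT d.fst),
    coeFn_primitiveOp hT d.fst, Lp.coeFn_const (p := 2) (μ := volOn T) d.snd.snd] with t h1 h2 h3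
  rw [h1, Pi.add_apply, h2]
  congr 1

/-- The Lagrangian of the linear system, in terms of the residuals of the adjoint system. -/
theorem lagrangian_eq (hT : 0 ≤ T) (hA : MemLp A ⊤ (volOn T)) (hB : MemLp B ⊤ (volOn T))
    (hK : ∀ i, MemLp (K i) ⊤ (volOn T)) (hD : ∀ i, MemLp (D i) ⊤ (volOn T))
    (p : Lp (Vec n) 2 (volOn T)) (lam : Vec nh) (ω : ι → Lp ℝ 2 (volOn T)) (d : DirSpace n m T) :
    inner ℝ p (-d.fst + mulOp A hA (stateOp n m hT d) + mulOp B hB d.snd.fst)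
      + inner ℝ lam (H₁ d.snd.snd + H₂ (d.snd.snd + totalOp (Vec n) T d.fst))
      + ∑ i, inner ℝ (ω i) (mulOp (fun t => innerSL ℝ (K i t)) (memLp_top_inner_right (hK i))
          (stateOp n m hT d) + mulOp (fun t => innerSL ℝ (D i t)) (memLp_top_inner_right (hD i))
          d.snd.fst)
      = ∫ t, inner ℝ (costate T A K H₂ p lam (fun i => ω i) t - p t) (d.fst t) ∂volOn T
        + ∫ t, inner ℝ ((B t).adjoint (p t) + ∑ i, ω i t • D i t) (d.snd.fst t) ∂volOn T
        + inner ℝ (H₁.adjoint lam + costate T A K H₂ p lam (fun i => ω i) 0) d.snd.snd := by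
  set ζ := d.fst
  set v := d.snd.fst
  set z₀ := d.snd.snd
  set Zd := stateOp n m hT d with hZd
  have hpL : MemLp p 2 (volOn T) := Lp.memLp p
  have hωL : ∀ i, MemLp (ω i) 2 (volOn T) := fun i => Lp.memLp (ω i)
  set w : ℝ → Vec n := fun s => (A s).adjoint (p s) + ∑ i, ω i s • K i s with hw
  have hw2 : MemLp w 2 (volOn T) := (memLp_adjoint_apply hA hpL).add (memLp_sum_smul hK hωL)
  have hw1 : Integrable w (volOn T) := memLp_two_integrable hw2
  have hζ1 : Integrable ζ (volOn T) := memLp_two_integrable (Lp.memLp ζ)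
  -- pairings with the state and with the control
  have key : ∀ {k : ℕ} (A' : ℝ → Vec k →L[ℝ] Vec n) (hA' : MemLp A' ⊤ (volOn T))
      (K' : ι → ℝ → Vec k) (hK' : ∀ i, MemLp (K' i) ⊤ (volOn T)) (y : Lp (Vec k) 2 (volOn T)),
      inner ℝ p (mulOp A' hA' y) + ∑ i, inner ℝ (ω i)
        (mulOp (fun t => innerSL ℝ (K' i t)) (memLp_top_inner_right (hK' i)) y)
      = ∫ t, inner ℝ ((A' t).adjoint (p t) + ∑ i, ω i t • K' i t) (y t) ∂volOn T := by
    intro k A' hA' K' hK' y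
    simp only [L2.inner_def]
    rw [← integral_finsetSum _ (fun i _ => L2.integrable_inner _ _),
      ← integral_add (L2.integrable_inner _ _)
        (integrable_finsetSum _ (fun i _ => L2.integrable_inner _ _))]
    refine integral_congr_ae ?_
    filter_upwards [coeFn_mulOp A' hA' y, ae_all_iff.2 fun i =>
      coeFn_mulOp (fun t => innerSL ℝ (K' i t)) (memLp_top_inner_right (hK' i)) y] with t h1 h2
    rw [h1, inner_add_left, ContinuousLinearMap.adjoint_inner_left, sum_inner]
    congr 1
    refine Finset.sum_congr rfl fun i _ => ?_
    rw [h2 i, inner_smul_left]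
    simp [mul_comm]
  have hsplit : inner ℝ p (-ζ + mulOp A hA Zd + mulOp B hB v)
      + ∑ i, inner ℝ (ω i) (mulOp (fun t => innerSL ℝ (K i t)) (memLp_top_inner_right (hK i)) Zd
        + mulOp (fun t => innerSL ℝ (D i t)) (memLp_top_inner_right (hD i)) v)
      = -inner ℝ p ζ + ∫ t, inner ℝ (w t) (Zd t) ∂volOn T
        + ∫ t, inner ℝ ((B t).adjoint (p t) + ∑ i, ω i t • D i t) (v t) ∂volOn T := by
    rw [← key A hA K hK Zd, ← key B hB D hD v]
    simp only [inner_add_right, inner_neg_right, Finset.sum_add_distrib]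
    ring
  have hstate : ∫ t, inner ℝ (w t) (Zd t) ∂volOn T
      = inner ℝ (∫ s in (0 : ℝ)..T, w s) z₀ + ∫ t, inner ℝ (∫ s in t..T, w s) (ζ t) ∂volOn T := by
    rw [← integral_inner_primitive hw1 hζ1, intervalIntegral_eq_integral_volOn hT,
      real_inner_comm, ← integral_inner hw1, ← integral_add]
    · refine integral_congr_ae ?_
      filter_upwards [coeFn_stateOp hT d] with t ht
      rw [ht, inner_add_right, real_inner_comm (w t) z₀]
    · exact hw1.const_inner z₀
    · have := memLp_primitive hζ1 hT 2
      exact (memLp_one_iff_integrable.1 ((innerSL ℝ : Vec n →L[ℝ] Vec n →L[ℝ] ℝ).memLp_of_bilin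
        1 hw2 this))
  have hend : inner ℝ lam (H₁ z₀ + H₂ (z₀ + totalOp (Vec n) T ζ))
      = inner ℝ (H₁.adjoint lam + H₂.adjoint lam) z₀
        + ∫ t, inner ℝ (H₂.adjoint lam) (ζ t) ∂volOn T := by
    rw [integral_inner hζ1, totalOp_apply, inner_add_right, inner_add_left,
      ContinuousLinearMap.adjoint_inner_left, ContinuousLinearMap.adjoint_inner_left,
      ContinuousLinearMap.adjoint_inner_left, map_add, inner_add_right]
    ring
  have hI1 : Integrable (fun t => inner ℝ (∫ s in t..T, w s) (ζ t)) (volOn T) := by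
    have hc : MemLp (fun t => ∫ s in t..T, w s) 2 (volOn T) := by
      refine MemLp.of_bound ((continuousOn_intervalIntegral_volOn_left hw1 hT).aestronglyMeasurable
        measurableSet_Icc) (∫ s, ‖w s‖ ∂volOn T) ?_
      filter_upwards [ae_volOn_mem] with t ht
      exact norm_intervalIntegral_le_volOn hw1 ht ⟨hT, le_rfl⟩
    exact (memLp_one_iff_integrable.1 ((innerSL ℝ : Vec n →L[ℝ] Vec n →L[ℝ] ℝ).memLp_of_bilin
        1 hc (Lp.memLp ζ)))
  have hI2 : Integrable (fun t => inner ℝ (H₂.adjoint lam) (ζ t)) (volOn T) := hζ1.const_inner _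
  have hI3 : Integrable (fun t => inner ℝ (p t) (ζ t)) (volOn T) := L2.integrable_inner _ _
  have hI12 : Integrable (fun t => inner ℝ (H₂.adjoint lam) (ζ t)
      + inner ℝ (∫ s in t..T, w s) (ζ t)) (volOn T) := hI2.add hI1
  have hcost : ∫ t, inner ℝ (costate T A K H₂ p lam (fun i => ω i) t - p t) (ζ t) ∂volOn T
      = ∫ t, inner ℝ (H₂.adjoint lam) (ζ t) ∂volOn T
        + ∫ t, inner ℝ (∫ s in t..T, w s) (ζ t) ∂volOn T - inner ℝ p ζ := by
    rw [L2.inner_def, ← integral_add hI2 hI1, ← integral_sub hI12 hI3]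
    refine integral_congr_ae (Eventually.of_forall fun t => ?_)
    simp only [costate, inner_sub_left, inner_add_left, hw]
  have hc0 : costate T A K H₂ p lam (fun i => ω i) 0 = H₂.adjoint lam + ∫ s in (0 : ℝ)..T, w s :=
      rfl
  rw [hcost, hc0, hend]
  have := hsplit
  rw [hstate] at this
  simp only [inner_add_left] at this ⊢
  linarith

theorem costate_smul (p : ℝ → Vec n) (lam : Vec nh) (ω : ι → ℝ → ℝ) (c t : ℝ) :
    costate T A K H₂ (fun t => c • p t) (c • lam) (fun i t => c * ω i t) t
      = c • costate T A K H₂ p lam ω t := by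
  simp only [costate, map_smul, smul_add, ← intervalIntegral.integral_smul, Finset.smul_sum,
    mul_smul]

theorem ApproxMultiplier.of_lagrangian
    (hk : ∀ i, MemLp (k i) ⊤ (volOn T)) (hT : 0 ≤ T) (hA : MemLp A ⊤ (volOn T))
    (hB : MemLp B ⊤ (volOn T))
    (hK : ∀ i, MemLp (K i) ⊤ (volOn T)) (hD : ∀ i, MemLp (D i) ⊤ (volOn T))
    {δ : ℝ} (hδ : 0 < δ) {r : Vec nh} (hr : ‖r‖ ≤ δ)
    (hkδ : ∀ i, MemLp (fun t => k i t + δ) 2 (volOn T))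
    {p : Lp (Vec n) 2 (volOn T)} {lam : Vec nh} {ω : ι → Lp ℝ 2 (volOn T)}
    (hne : ¬ (p = 0 ∧ lam = 0 ∧ ω = 0))
    (hlag : ∀ (ζ : Lp (Vec n) 2 (volOn T)) (v : Lp (Vec m) 2 (volOn T)) (z₀ : Vec n),
      (∀ᵐ t ∂volOn T, ‖ζ t‖ ≤ 1) → (∀ᵐ t ∂volOn T, ‖v t‖ ≤ 1) → ‖z₀‖ ≤ 1 →
      ∀ ρ : ι → Lp ℝ 2 (volOn T), (∀ i, ∀ᵐ t ∂volOn T, ρ i t ∈ Ici (0 : ℝ)) →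
        0 ≤ ∫ t, inner ℝ (costate T A K H₂ p lam (fun i => ω i) t - p t) (ζ t) ∂volOn T
        + ∫ t, inner ℝ ((B t).adjoint (p t) + ∑ i, ω i t • D i t) (v t) ∂volOn T
        + inner ℝ (H₁.adjoint lam + costate T A K H₂ p lam (fun i => ω i) 0) z₀
        - inner ℝ lam r + ∑ i, inner ℝ (ω i) ((hkδ i).toLp _) + ∑ i, inner ℝ (ω i) (ρ i)) :
    ∃ p lam ω, ApproxMultiplier T A B H₁ H₂ k K D δ p lam ω := by
  classical
  have hωL : ∀ i, MemLp (ω i) 2 (volOn T) := fun i => Lp.memLp (ω i)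
  have hω1 : ∀ i, Integrable (ω i) (volOn T) := fun i => memLp_two_integrable (hωL i)
  have hpL : MemLp p 2 (volOn T) := Lp.memLp p
  have hp1 : Integrable p (volOn T) := memLp_two_integrable hpL
  have hzero : ∀ {E : Type} [NormedAddCommGroup E], ∀ᵐ t ∂volOn T, (0 : Lp E 2 (volOn T)) t = 0 :=
    fun {E} _ => Lp.coeFn_zero E 2 (volOn T)
  have hω0 : ∀ i, ∀ᵐ t ∂volOn T, 0 ≤ ω i t := by
    intro i
    refine ae_nonneg_of_forall_setIntegral_nonneg (hω1 i) fun S hS _ => ?_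
    set c : ℝ := -inner ℝ lam r + ∑ i, inner ℝ (ω i) ((hkδ i).toLp _) with hc
    have hlin : ∀ s : ℝ, 0 ≤ s → 0 ≤ c + s * ∫ t in S, ω i t ∂volOn T := by
      intro s hs
      have h := hlag 0 0 0 (by filter_upwards [hzero (E := Vec n)] with t ht
                               rw [ht, norm_zero]; exact zero_le_one)
        (by filter_upwards [hzero (E := Vec m)] with t ht
            rw [ht, norm_zero]; exact zero_le_one) (by simp)
        (Pi.single i (s • indicatorConstLp 2 hS (measure_ne_top _ _) (1 : ℝ))) (by
          intro j
          rcases eq_or_ne j i with rfl | hj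
          · rw [Pi.single_eq_same]
            filter_upwards [Lp.coeFn_smul s (indicatorConstLp 2 hS (measure_ne_top (volOn T) S)
              (1 : ℝ)),
              indicatorConstLp_coeFn (p := 2) (hs := hS) (hμs := measure_ne_top (volOn T) S)
                (c := (1 : ℝ))] with t h1 h2
            rw [h1, Pi.smul_apply, h2, mem_Ici, smul_eq_mul]
            exact mul_nonneg hs (indicator_nonneg (fun _ _ => zero_le_one) _)
          · rw [Pi.single_eq_of_ne hj]
            filter_upwards [hzero (E := ℝ)] with t ht
            exact ht.ge)
      have e0 : ∑ j, inner ℝ (ω j) ((Pi.single i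
          (s • indicatorConstLp 2 hS (measure_ne_top _ _) (1 : ℝ)) : ι → Lp ℝ 2 (volOn T)) j)
          = s * ∫ t in S, ω i t ∂volOn T := by
        rw [Finset.sum_eq_single i (fun j _ hj => by rw [Pi.single_eq_of_ne hj, inner_zero_right])
          (by simp), Pi.single_eq_same, inner_smul_right, real_inner_comm,
          L2.inner_indicatorConstLp_one]
      have e1 : ∫ t, inner ℝ (costate T A K H₂ p lam (fun i => ω i) t - p t)
          ((0 : Lp (Vec n) 2 (volOn T)) t) ∂volOn T = 0 := by
        refine integral_eq_zero_of_ae ?_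
        filter_upwards [hzero (E := Vec n)] with t ht
        rw [ht, inner_zero_right]; rfl
      have e2 : ∫ t, inner ℝ ((B t).adjoint (p t) + ∑ i, ω i t • D i t)
          ((0 : Lp (Vec m) 2 (volOn T)) t) ∂volOn T = 0 := by
        refine integral_eq_zero_of_ae ?_
        filter_upwards [hzero (E := Vec m)] with t ht
        rw [ht, inner_zero_right]; rfl
      rw [e0, e1, e2, inner_zero_right] at h
      rw [hc]
      linarith
    by_contra hneg
    rw [not_le] at hneg
    have h1 := hlin ((|c| + 1) / -(∫ t in S, ω i t ∂volOn T)) (by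
      apply div_nonneg <;> [positivity; linarith])
    have h2 : (|c| + 1) / -(∫ t in S, ω i t ∂volOn T) * ∫ t in S, ω i t ∂volOn T = -(|c| + 1) := by
      rw [div_neg, neg_mul, div_mul_cancel₀ _ hneg.ne]
    rw [h2] at h1
    have := le_abs_self c
    linarith
  set mass : ℝ := ‖lam‖ + ∫ t, ‖p t‖ ∂volOn T + ∑ i, ∫ t, ω i t ∂volOn T with hmass
  have hωi : ∀ i, 0 ≤ ∫ t, ω i t ∂volOn T := fun i => integral_nonneg_of_ae (hω0 i)
  have hpi : 0 ≤ ∫ t, ‖p t‖ ∂volOn T := integral_nonneg fun _ => norm_nonneg _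
  have hsum : 0 ≤ ∑ i, ∫ t, ω i t ∂volOn T := Finset.sum_nonneg fun i _ => hωi i
  have hmpos : 0 < mass := by
    refine lt_of_le_of_ne (by positivity) fun h0 => hne ?_
    have e1 : ‖lam‖ = 0 := by linarith [norm_nonneg lam]
    have e2 : ∫ t, ‖p t‖ ∂volOn T = 0 := by linarith [norm_nonneg lam]
    have e3 : ∑ i, ∫ t, ω i t ∂volOn T = 0 := by linarith [norm_nonneg lam]
    refine ⟨?_, norm_eq_zero.1 e1, ?_⟩
    · rw [integral_eq_zero_iff_of_nonneg (fun _ => norm_nonneg _) hp1.norm] at e2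
      refine Lp.ext ?_
      filter_upwards [e2, hzero (E := Vec n)] with t h1 h2
      rw [h2]; exact norm_eq_zero.1 h1
    · ext1 i
      have e4 := (Finset.sum_eq_zero_iff_of_nonneg (fun i _ => hωi i)).1 e3 i (Finset.mem_univ i)
      rw [integral_eq_zero_iff_of_nonneg_ae (hω0 i) (hω1 i)] at e4
      refine Lp.ext ?_
      filter_upwards [e4, hzero (E := ℝ)] with t h1 h2
      rw [Pi.zero_apply, h2]; exact h1
  set w : ℝ → Vec n := fun s => (A s).adjoint (p s) + ∑ i, ω i s • K i s with hw
  have hw2 : MemLp w 2 (volOn T) := (memLp_adjoint_apply hA hpL).add (memLp_sum_smul hK hωL)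
  have hw1 : Integrable w (volOn T) := memLp_two_integrable hw2
  have hcm : AEStronglyMeasurable (fun t => costate T A K H₂ p lam (fun i => ω i) t - p t)
      (volOn T) :=
    ((aestronglyMeasurable_const (b := H₂.adjoint lam)).add
      ((continuousOn_intervalIntegral_volOn_left hw1 hT).aestronglyMeasurable
        measurableSet_Icc)).sub hp1.1
  have hSm : AEStronglyMeasurable (fun t => (B t).adjoint (p t) + ∑ i, ω i t • D i t) (volOn T) :=
    ((memLp_adjoint_apply hB hpL).add (memLp_sum_smul hD hωL)).1
  obtain ⟨ζ, hζ, hζe⟩ := exists_dual_ae hcm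
  obtain ⟨v, hv, hve⟩ := exists_dual_ae hSm
  obtain ⟨z₀, hz, hze⟩ := exists_dual_vec (H₁.adjoint lam + costate T A K H₂ p lam (fun i => ω i) 0)
  have hmain := hlag ζ v z₀ hζ hv hz 0 (fun i => by
    filter_upwards [hzero (E := ℝ)] with t ht
    exact ht.ge)
  have hωk : ∀ i, Integrable (fun t => ω i t * (-k i t)) (volOn T) := fun i =>
    (memLp_one_iff_integrable.1 ((ContinuousLinearMap.mul ℝ ℝ).memLp_of_bilin 1
      (memLp_one_iff_integrable.2 (hω1 i))
      (hk i).neg))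
  have hkk : ∀ i, inner ℝ (ω i) ((hkδ i).toLp _)
      = -∫ t, ω i t * (-k i t) ∂volOn T + δ * ∫ t, ω i t ∂volOn T := by
    intro i
    rw [L2.inner_def, ← integral_const_mul, ← integral_neg, ← integral_add
      (f := fun t => -(ω i t * (-k i t)))
      (hωk i).neg ((hω1 i).const_mul δ)]
    refine integral_congr_ae ?_
    filter_upwards [(hkδ i).coeFn_toLp] with t ht
    rw [ht]
    simp only [RCLike.inner_apply, conj_trivial]
    ring
  rw [hζe, hve, hze] at hmain
  simp only [Pi.zero_apply, inner_zero_right, Finset.sum_const_zero, hkk, Finset.sum_add_distrib,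
    Finset.sum_neg_distrib, ← Finset.mul_sum] at hmain
  have hlr : -inner ℝ lam r ≤ ‖lam‖ * δ :=
    (neg_le_abs _).trans ((abs_real_inner_le_norm _ _).trans
      (mul_le_mul_of_nonneg_left hr (norm_nonneg _)))
  refine ⟨fun t => mass⁻¹ • p t, mass⁻¹ • lam, fun i t => mass⁻¹ * ω i t, ?_, ?_, ?_, ?_, ?_⟩
  · exact hp1.smul mass⁻¹
  · exact fun i => (hω1 i).const_mul _
  · intro i
    filter_upwards [hω0 i] with t ht
    positivity
  · simp only [norm_smul, integral_const_mul, ← Finset.mul_sum, norm_inv, Real.norm_eq_abs,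
      abs_of_pos hmpos]
    rw [← mul_add, ← mul_add, ← hmass]
    exact inv_mul_cancel₀ hmpos.ne'
  · have e1 : ∫ t, ‖(B t).adjoint (mass⁻¹ • p t) + ∑ i, (mass⁻¹ * ω i t) • D i t‖ ∂volOn T
        = mass⁻¹ * ∫ t, ‖(B t).adjoint (p t) + ∑ i, ω i t • D i t‖ ∂volOn T := by
      rw [← integral_const_mul]
      refine integral_congr_ae (Eventually.of_forall fun t => ?_)
      simp only
      rw [← abs_of_pos (inv_pos.2 hmpos), ← Real.norm_eq_abs, ← norm_smul, Real.norm_eq_abs,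
        abs_of_pos (inv_pos.2 hmpos)]
      simp only [map_smul, smul_add, Finset.smul_sum, mul_smul]
    rw [e1]
    simp only [costate_smul, ← smul_sub, map_smul, ← smul_add, norm_smul, integral_const_mul,
      mul_assoc, ← Finset.mul_sum, norm_inv, Real.norm_eq_abs, abs_of_pos hmpos]
    rw [← mul_add, ← mul_add, ← mul_add, inv_mul_le_iff₀ hmpos]
    have : δ * (‖lam‖ + ∑ i, ∫ t, ω i t ∂volOn T) ≤ δ * mass :=
      mul_le_mul_of_nonneg_left (by rw [hmass]; linarith) hδ.le
    linarith

/-- Alternative for a controlled linear system with constraints: it has an exact solution with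
margin `δ`, or approximate multipliers with residual `δ`. -/
theorem linear_system_alternative (hT : 0 ≤ T) (hA : MemLp A ⊤ (volOn T))
    (hB : MemLp B ⊤ (volOn T)) (hk : ∀ i, MemLp (k i) ⊤ (volOn T))
    (hK : ∀ i, MemLp (K i) ⊤ (volOn T)) (hD : ∀ i, MemLp (D i) ⊤ (volOn T))
    {δ : ℝ} (hδ : 0 < δ) {r : Vec nh} (hr : ‖r‖ ≤ δ) :
    (∃ (ζ : ℝ → Vec n) (v : ℝ → Vec m) (z₀ : Vec n), AEStronglyMeasurable ζ (volOn T) ∧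
      AEStronglyMeasurable v (volOn T) ∧ (∀ᵐ t ∂volOn T, ‖ζ t‖ ≤ 1) ∧ (∀ᵐ t ∂volOn T, ‖v t‖ ≤ 1) ∧
      ‖z₀‖ ≤ 1 ∧
      (∀ᵐ t ∂volOn T, ζ t = A t (z₀ + ∫ s in (0 : ℝ)..t, ζ s) + B t (v t)) ∧
      H₁ z₀ + H₂ (z₀ + ∫ s in (0 : ℝ)..T, ζ s) = r ∧
      ∀ᵐ t ∂volOn T, ∀ i, k i t + inner ℝ (K i t) (z₀ + ∫ s in (0 : ℝ)..t, ζ s)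
        + inner ℝ (D i t) (v t) ≤ -δ) ∨
    ∃ p lam ω, ApproxMultiplier T A B H₁ H₂ k K D δ p lam ω := by
  set Dset : Set (DirSpace n m T) := {d | (∀ᵐ t ∂volOn T, d.fst t ∈ Metric.closedBall (0 : Vec n) 1)
    ∧ (∀ᵐ t ∂volOn T, d.snd.fst t ∈ Metric.closedBall (0 : Vec m) 1)
    ∧ d.snd.snd ∈ Metric.closedBall (0 : Vec n) 1} with hDset
  set C : Set (Lp ℝ 2 (volOn T)) := {f | ∀ᵐ t ∂volOn T, f t ∈ Ici (0 : ℝ)} with hC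
  set f₁ : DirSpace n m T →L[ℝ] Lp (Vec n) 2 (volOn T) := WithLp.fstL 2 ℝ _ _ with hf₁
  set f₂ : DirSpace n m T →L[ℝ] Lp (Vec m) 2 (volOn T) :=
    (WithLp.fstL 2 ℝ _ _).comp (WithLp.sndL 2 ℝ _ _) with hf₂
  set f₃ : DirSpace n m T →L[ℝ] Vec n :=
    (WithLp.sndL 2 ℝ _ _).comp (WithLp.sndL 2 ℝ _ _) with hf₃
  have hDeq : Dset = f₁ ⁻¹' {f | ∀ᵐ t ∂volOn T, f t ∈ Metric.closedBall (0 : Vec n) 1}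
      ∩ (f₂ ⁻¹' {f | ∀ᵐ t ∂volOn T, f t ∈ Metric.closedBall (0 : Vec m) 1}
        ∩ f₃ ⁻¹' Metric.closedBall (0 : Vec n) 1) := rfl
  have hD0 : (0 : DirSpace n m T) ∈ Dset := by
    refine ⟨?_, ?_, by simp⟩
    · filter_upwards [Lp.coeFn_zero (Vec n) 2 (volOn T)] with t ht
      exact mem_closedBall_zero_iff.2 ((congrArg norm ht).trans norm_zero |>.le.trans zero_le_one)
    · filter_upwards [Lp.coeFn_zero (Vec m) 2 (volOn T)] with t ht
      exact mem_closedBall_zero_iff.2 ((congrArg norm ht).trans norm_zero |>.le.trans zero_le_one)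
  have hDc : IsClosed Dset := by
    rw [hDeq]
    exact ((isClosed_Lp_forall_ae Metric.isClosed_closedBall).preimage f₁.continuous).inter
      (((isClosed_Lp_forall_ae Metric.isClosed_closedBall).preimage f₂.continuous).inter
        (Metric.isClosed_closedBall.preimage f₃.continuous))
  have hDconv : Convex ℝ Dset := by
    rw [hDeq]
    exact ((convex_Lp_forall_ae (convex_closedBall _ _)).linear_preimage f₁.toLinearMap).inter
      (((convex_Lp_forall_ae (convex_closedBall _ _)).linear_preimage f₂.toLinearMap).inter
        ((convex_closedBall _ _).linear_preimage f₃.toLinearMap))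
  have hDb : Bornology.IsBounded Dset := by
    obtain ⟨C₁, hC₁, hle₁⟩ := isBounded_Lp_unitBall (E := Vec n) (μ := volOn T)
    obtain ⟨C₂, hC₂, hle₂⟩ := isBounded_Lp_unitBall (E := Vec m) (μ := volOn T)
    refine isBounded_iff_forall_norm_le.2 ⟨√(C₁ ^ 2 + √(C₂ ^ 2 + 1 ^ 2) ^ 2), fun d hd => ?_⟩
    rw [WithLp.prod_norm_eq_of_L2, WithLp.prod_norm_eq_of_L2 d.snd]
    have h1 := hle₁ d.fst (by filter_upwards [hd.1] with t ht; simpa using ht)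
    have h2 := hle₂ d.snd.fst (by filter_upwards [hd.2.1] with t ht; simpa using ht)
    have h3 : ‖d.snd.snd‖ ≤ 1 := by simpa using hd.2.2
    gcongr
  have hkδ : ∀ i, MemLp (fun t => k i t + δ) 2 (volOn T) := fun i =>
    ((hk i).mono_exponent le_top).add (memLp_const δ)
  rcases mixed_system_alternative
    (-f₁ + (mulOp A hA).comp (stateOp n m hT) + (mulOp B hB).comp f₂)
    (H₁.comp f₃ + H₂.comp (f₃ + (totalOp (Vec n) T).comp f₁))
    (fun i => (mulOp (fun t => innerSL ℝ (K i t)) (memLp_top_inner_right (hK i))).comp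
      (stateOp n m hT) + (mulOp (fun t => innerSL ℝ (D i t)) (memLp_top_inner_right
        (hD i))).comp f₂)
    r (fun i => (hkδ i).toLp _) (D := Dset) (C := C) ⟨0, hD0⟩ hDc hDconv hDb
    ⟨0, by filter_upwards [Lp.coeFn_zero ℝ 2 (volOn T)] with t ht; exact ht.ge⟩
    (isClosed_Lp_forall_ae isClosed_Ici) (convex_Lp_forall_ae (convex_Ici 0)) with
    ⟨d, hd, h1, h2, h3⟩ | ⟨p, lam, ω, hne, hall⟩
  · left
    refine ⟨d.fst, d.snd.fst, d.snd.snd, Lp.aestronglyMeasurable _, Lp.aestronglyMeasurable _, ?_,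
      ?_, ?_, ?_, ?_, ?_⟩
    · filter_upwards [hd.1] with t ht; simpa using ht
    · filter_upwards [hd.2.1] with t ht; simpa using ht
    · simpa using hd.2.2
    · have h1' : mulOp A hA (stateOp n m hT d) + mulOp B hB d.snd.fst = d.fst := by
        have : -d.fst + mulOp A hA (stateOp n m hT d) + mulOp B hB d.snd.fst = 0 := h1
        rw [add_assoc] at this
        exact (neg_add_eq_zero.1 this).symm
      filter_upwards [coeFn_mulOp A hA (stateOp n m hT d), coeFn_mulOp B hB d.snd.fst,
        coeFn_stateOp hT d, Lp.coeFn_add (mulOp A hA (stateOp n m hT d)) (mulOp B hB d.snd.fst)]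
        with t e1 e2 e3 e4
      rw [h1', Pi.add_apply, e1, e2, e3] at e4
      exact e4
    · have : H₁ d.snd.snd + H₂ (d.snd.snd + totalOp (Vec n) T d.fst) = r := h2
      rw [totalOp_apply] at this
      rwa [intervalIntegral_eq_integral_volOn hT]
    · refine ae_all_iff.2 fun i => ?_
      have h3i : ∀ᵐ t ∂volOn T, (-(mulOp (fun t => innerSL ℝ (K i t)) (memLp_top_inner_right (hK i))
        (stateOp n m hT d) + mulOp (fun t => innerSL ℝ (D i t)) (memLp_top_inner_right (hD i))
          d.snd.fst + (hkδ i).toLp _) : Lp ℝ 2 (volOn T)) t ∈ Ici (0 : ℝ) := h3 i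
      filter_upwards [h3i, Lp.coeFn_neg (mulOp (fun t => innerSL ℝ (K i t))
        (memLp_top_inner_right (hK i)) (stateOp n m hT d) + mulOp (fun t => innerSL ℝ (D i t))
          (memLp_top_inner_right (hD i)) d.snd.fst + (hkδ i).toLp _),
        Lp.coeFn_add (mulOp (fun t => innerSL ℝ (K i t))
        (memLp_top_inner_right (hK i)) (stateOp n m hT d) + mulOp (fun t => innerSL ℝ (D i t))
          (memLp_top_inner_right (hD i)) d.snd.fst) ((hkδ i).toLp _),
        Lp.coeFn_add (mulOp (fun t => innerSL ℝ (K i t))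
        (memLp_top_inner_right (hK i)) (stateOp n m hT d)) (mulOp (fun t => innerSL ℝ (D i t))
          (memLp_top_inner_right (hD i)) d.snd.fst), (hkδ i).coeFn_toLp,
        coeFn_mulOp (fun t => innerSL ℝ (K i t)) (memLp_top_inner_right (hK i)) (stateOp n m hT d),
        coeFn_mulOp (fun t => innerSL ℝ (D i t)) (memLp_top_inner_right (hD i)) d.snd.fst,
        coeFn_stateOp hT d] with t e1 e2 e3 e4 e5 e6 e7 e8
      rw [e2, Pi.neg_apply, e3, Pi.add_apply, e4, Pi.add_apply, e5, e6, e7, e8, mem_Ici] at e1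
      simp only [innerSL_apply_apply] at e1
      linarith
  · right
    -- the Lagrangian inequality
    have hlag : ∀ d ∈ Dset, ∀ ρ : ι → Lp ℝ 2 (volOn T), (∀ i, ρ i ∈ C) →
        0 ≤ ∫ t, inner ℝ (costate T A K H₂ p lam (fun i => ω i) t - p t) (d.fst t) ∂volOn T
        + ∫ t, inner ℝ ((B t).adjoint (p t) + ∑ i, ω i t • D i t) (d.snd.fst t) ∂volOn T
        + inner ℝ (H₁.adjoint lam + costate T A K H₂ p lam (fun i => ω i) 0) d.snd.snd
        - inner ℝ lam r + ∑ i, inner ℝ (ω i) ((hkδ i).toLp _) + ∑ i, inner ℝ (ω i) (ρ i) := by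
      intro d hd ρ hρ
      have h := hall d hd ρ hρ
      rw [← lagrangian_eq hT hA hB hK hD p lam ω d]
      simp only [inner_sub_right, inner_add_right, Finset.sum_add_distrib] at h ⊢
      refine h.trans (le_of_eq ?_)
      simp only [add_apply, neg_apply,
        ContinuousLinearMap.comp_apply, inner_add_right, inner_neg_right, map_add, hf₁, hf₂, hf₃,
        WithLp.fstL_apply, WithLp.sndL_apply, Finset.sum_add_distrib]
      ring
    exact ApproxMultiplier.of_lagrangian hk hT hA hB hK hD hδ hr hkδ hne fun ζ v z₀ hζ hv hz ρ hρ =>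
      hlag (WithLp.toLp 2 (ζ, WithLp.toLp 2 (v, z₀)))
        ⟨by filter_upwards [hζ] with t ht; simpa using ht,
          by filter_upwards [hv] with t ht; simpa using ht, by simpa using hz⟩ ρ hρ

end LinearSystem
end

noncomputable section

section Subsequences

open Topology

/-- Simultaneous extraction of subsequences for finitely many properties. -/
theorem exists_strictMono_forall {ι : Type*} [Finite ι] (Q : ι → (ℕ → ℕ) → Prop)
    (hsub : ∀ i (φ ψ : ℕ → ℕ), StrictMono ψ → Q i φ → Q i (φ ∘ ψ))
    (hex : ∀ i (φ : ℕ → ℕ), StrictMono φ → ∃ ψ : ℕ → ℕ, StrictMono ψ ∧ Q i (φ ∘ ψ)) :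
    ∃ φ : ℕ → ℕ, StrictMono φ ∧ ∀ i, Q i φ := by
  classical
  cases nonempty_fintype ι
  have h : ∀ s : Finset ι, ∃ φ : ℕ → ℕ, StrictMono φ ∧ ∀ i ∈ s, Q i φ := by
    intro s
    induction s using Finset.induction_on with
    | empty => exact ⟨id, strictMono_id, by simp⟩
    | insert a s _ ih =>
      obtain ⟨φ, hφ, hQ⟩ := ih
      obtain ⟨ψ, hψ, hQa⟩ := hex a φ hφ
      refine ⟨φ ∘ ψ, hφ.comp hψ, fun i hi => ?_⟩
      rcases Finset.mem_insert.1 hi with rfl | hi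
      · exact hQa
      · exact hsub i φ ψ hψ (hQ i hi)
  obtain ⟨φ, hφ, hQ⟩ := h Finset.univ
  exact ⟨φ, hφ, fun i => hQ i (Finset.mem_univ i)⟩

/-- Bounded sequences of functionals on a separable space have weak-* convergent subsequences. -/
theorem exists_subseq_tendsto_dual {E : Type*} [NormedAddCommGroup E] [NormedSpace ℝ E]
    [TopologicalSpace.SeparableSpace E] (f : ℕ → StrongDual ℝ E) {C : ℝ} (hf : ∀ k, ‖f k‖ ≤ C) :
    ∃ (Λ : StrongDual ℝ E) (φ : ℕ → ℕ), StrictMono φ ∧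
      ∀ x, Tendsto (fun k => f (φ k) x) atTop (𝓝 (Λ x)) := by
  obtain ⟨Λ, -, φ, hφ, hlim⟩ := WeakDual.isSeqCompact_closedBall ℝ E (0 : StrongDual ℝ E) C
    (x := fun k => StrongDual.toWeakDual (f k)) (fun k => by
      have : ‖f k‖ ≤ C := hf k
      simpa using this)
  refine ⟨WeakDual.toStrongDual Λ, φ, hφ, fun x => ?_⟩
  exact ((WeakDual.eval_continuous x).tendsto Λ).comp hlim

end Subsequences

section WeakLimits

open Topology

variable {T : ℝ} {m : ℕ}

/-- `ubar` is the weak limit of the uniformly bounded sequence `u`. -/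
structure BddWeakLim (T R : ℝ) (u : ℕ → ℝ → Vec m) (ubar : ℝ → Vec m) : Prop where
  meas : ∀ k, AEStronglyMeasurable (u k) (volOn T)
  bound : ∀ k, ∀ᵐ t ∂volOn T, ‖u k t‖ ≤ R
  meas_lim : AEStronglyMeasurable ubar (volOn T)
  bound_lim : ∀ᵐ t ∂volOn T, ‖ubar t‖ ≤ R
  tendsto : ∀ w : ℝ → Vec m, MemLp w 2 (volOn T) →
    Tendsto (fun k => ∫ t, inner ℝ (w t) (u k t) ∂volOn T) atTop
      (𝓝 (∫ t, inner ℝ (w t) (ubar t) ∂volOn T))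

theorem integrable_inner_of_bounded {w u : ℝ → Vec m} {R : ℝ} (hw : Integrable w (volOn T))
    (hu : AEStronglyMeasurable u (volOn T)) (hb : ∀ᵐ t ∂volOn T, ‖u t‖ ≤ R) :
    Integrable (fun t => inner ℝ (w t) (u t)) (volOn T) :=
  (innerSL ℝ : Vec m →L[ℝ] Vec m →L[ℝ] ℝ).integrable_of_bilin_of_bdd_right R hw hu hb

theorem BddWeakLim.comp {R : ℝ} {u : ℕ → ℝ → Vec m} {ubar : ℝ → Vec m}
    (h : BddWeakLim T R u ubar) {φ : ℕ → ℕ} (hφ : StrictMono φ) :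
    BddWeakLim T R (fun k => u (φ k)) ubar :=
  ⟨fun _ => h.meas _, fun _ => h.bound _, h.meas_lim, h.bound_lim,
    fun w hw => (h.tendsto w hw).comp hφ.tendsto_atTop⟩

/-- Products of a strongly and a weakly convergent sequence. -/
theorem BddWeakLim.tendsto_inner {R : ℝ} {u : ℕ → ℝ → Vec m} {ubar : ℝ → Vec m}
    (h : BddWeakLim T R u ubar) {w : ℕ → ℝ → Vec m} {wbar : ℝ → Vec m}
    (hw : ∀ k, Integrable (w k) (volOn T)) (hwbar : MemLp wbar 2 (volOn T))
    (hlim : Tendsto (fun k => ∫ t, ‖w k t - wbar t‖ ∂volOn T) atTop (𝓝 0)) :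
    Tendsto (fun k => ∫ t, inner ℝ (w k t) (u k t) ∂volOn T) atTop
      (𝓝 (∫ t, inner ℝ (wbar t) (ubar t) ∂volOn T)) := by
  have hwb : Integrable wbar (volOn T) := memLp_two_integrable hwbar
  have h1 : Tendsto (fun k => ∫ t, inner ℝ (w k t - wbar t) (u k t) ∂volOn T) atTop (𝓝 0) := by
    refine squeeze_zero_norm (a := fun k => (∫ t, ‖w k t - wbar t‖ ∂volOn T) * R) (fun k => ?_) ?_
    · rw [← integral_mul_const]
      refine norm_integral_le_of_norm_le (((hw k).sub hwb).norm.mul_const R) ?_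
      filter_upwards [h.bound k] with t ht
      exact (norm_inner_le_norm _ _).trans (mul_le_mul_of_nonneg_left ht (norm_nonneg _))
    · simpa using hlim.mul_const R
  have h2 := h1.add (h.tendsto wbar hwbar)
  rw [zero_add] at h2
  refine h2.congr fun k => ?_
  have hI : Integrable (fun t => inner ℝ (w k t - wbar t) (u k t)) (volOn T) :=
    integrable_inner_of_bounded ((hw k).sub hwb) (h.meas k) (h.bound k)
  rw [← integral_add hI
    (integrable_inner_of_bounded hwb (h.meas k) (h.bound k))]
  refine integral_congr_ae (Eventually.of_forall fun t => ?_)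
  simp only [inner_sub_left, sub_add_cancel]

theorem exists_bddWeakLim {R : ℝ} (hR : 0 ≤ R) (u : ℕ → ℝ → Vec m)
    (hu : ∀ k, AEStronglyMeasurable (u k) (volOn T)) (hb : ∀ k, ∀ᵐ t ∂volOn T, ‖u k t‖ ≤ R) :
    ∃ (ubar : ℝ → Vec m) (φ : ℕ → ℕ), StrictMono φ ∧ BddWeakLim T R (fun k => u (φ k)) ubar := by
  have hu2 : ∀ k, MemLp (u k) 2 (volOn T) := fun k => MemLp.of_bound (hu k) R (hb k)
  set C : ℝ := (measureUnivNNReal (volOn T) : ℝ) ^ (2 : ENNReal).toReal⁻¹ * R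
  have hC : ∀ k, ‖(hu2 k).toLp (u k)‖ ≤ C := fun k => by
    refine Lp.norm_le_of_ae_bound hR ?_
    filter_upwards [hb k, (hu2 k).coeFn_toLp] with t h1 h2
    rwa [h2]
  have : Fact ((2 : ENNReal) ≠ ⊤) := ⟨by norm_num⟩
  obtain ⟨Λ, φ, hφ, hlim⟩ := exists_subseq_tendsto_dual
    (fun k => InnerProductSpace.toDual ℝ _ ((hu2 k).toLp (u k))) (C := C)
    (fun k => by rw [LinearIsometryEquiv.norm_map]; exact hC k)
  set U : Lp (Vec m) 2 (volOn T) := (InnerProductSpace.toDual ℝ _).symm Λ with hU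
  have hUm : AEStronglyMeasurable U (volOn T) := Lp.aestronglyMeasurable _
  have hU1 : Integrable U (volOn T) := memLp_two_integrable (Lp.memLp U)
  have htend : ∀ w : ℝ → Vec m, MemLp w 2 (volOn T) →
      Tendsto (fun k => ∫ t, inner ℝ (w t) (u (φ k) t) ∂volOn T) atTop
      (𝓝 (∫ t, inner ℝ (w t) (U t) ∂volOn T)) := by
    intro w hw
    have h := hlim (hw.toLp w)
    have e1 : Λ (hw.toLp w) = ∫ t, inner ℝ (w t) (U t) ∂volOn T := by
      have : Λ (hw.toLp w) = inner ℝ U (hw.toLp w) := by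
        rw [hU, InnerProductSpace.toDual_symm_apply]
      rw [this, L2.inner_def]
      refine integral_congr_ae ?_
      filter_upwards [hw.coeFn_toLp] with t ht
      rw [ht, real_inner_comm]
    rw [e1] at h
    refine h.congr fun k => ?_
    rw [InnerProductSpace.toDual_apply_apply, L2.inner_def]
    refine integral_congr_ae ?_
    filter_upwards [hw.coeFn_toLp, (hu2 (φ k)).coeFn_toLp] with t h1 h2
    rw [h1, h2, real_inner_comm]
  refine ⟨U, φ, hφ, fun k => hu _, fun k => hb _, hUm, ?_, htend⟩
  refine ae_le_of_forall_setIntegral_le hU1.norm (integrable_const R) fun S hS _ => ?_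
  set w : ℝ → Vec m := S.indicator fun t => ‖U t‖⁻¹ • U t with hw
  have hwm : AEStronglyMeasurable w (volOn T) :=
    (hUm.norm.aemeasurable.inv.aestronglyMeasurable.smul hUm).indicator hS
  have hwb : ∀ t, ‖w t‖ ≤ S.indicator (fun _ => (1 : ℝ)) t := by
    intro t
    rw [hw, norm_indicator_eq_indicator_norm]
    refine indicator_le_indicator ?_
    rw [norm_smul, norm_inv, norm_norm]
    exact inv_mul_le_one
  have hwL : MemLp w 2 (volOn T) := MemLp.of_bound hwm 1 (Eventually.of_forall fun t =>
    (hwb t).trans (indicator_le_self' (fun _ _ => zero_le_one) t))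
  have hle : ∀ k, ∫ t, inner ℝ (w t) (u (φ k) t) ∂volOn T ≤ ∫ t in S, R ∂volOn T := by
    intro k
    rw [← integral_indicator hS]
    refine integral_mono_ae (integrable_inner_of_bounded (memLp_two_integrable hwL) (hu _) (hb
      (φ k)))
      ((integrable_const R).indicator hS) ?_
    filter_upwards [hb (φ k)] with t ht
    refine (real_inner_le_norm _ _).trans ((mul_le_mul (hwb t) ht (norm_nonneg _)
      (indicator_nonneg (fun _ _ => zero_le_one) t)).trans (le_of_eq ?_))
    by_cases h : t ∈ S <;> simp [h]
  have h := le_of_tendsto' (htend w hwL) hle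
  refine le_trans (le_of_eq ?_) h
  rw [← integral_indicator hS]
  refine integral_congr_ae (Eventually.of_forall fun t => ?_)
  by_cases h : t ∈ S
  · simp only [hw, h, indicator_of_mem, inner_smul_left, real_inner_self_eq_norm_sq]
    by_cases h0 : ‖U t‖ = 0
    · simp [h0]
    · simp only [map_inv₀, conj_trivial]
      field_simp
  · simp [hw, h]

end WeakLimits
end

noncomputable section

section MeasureLimits

open Topology CompactlySupported

variable {T : ℝ}

/-- `μ` is the weak limit of the measures on `[0, T]` with densities `w k`. -/
structure MeasureLim (T : ℝ) (w : ℕ → ℝ → ℝ) (μ : Measure ℝ) : Prop where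
  int : ∀ k, Integrable (w k) (volOn T)
  nonneg : ∀ k, ∀ᵐ t ∂volOn T, 0 ≤ w k t
  finite : IsFiniteMeasure μ
  supp : μ (Icc 0 T)ᶜ = 0
  tendsto : ∀ f : ℝ → ℝ, ContinuousOn f (Icc 0 T) →
    Tendsto (fun k => ∫ t, w k t * f t ∂volOn T) atTop (𝓝 (∫ t, f t ∂μ))

theorem MeasureLim.comp {w : ℕ → ℝ → ℝ} {μ : Measure ℝ} (h : MeasureLim T w μ) {φ : ℕ → ℕ}
    (hφ : StrictMono φ) : MeasureLim T (fun k => w (φ k)) μ :=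
  ⟨fun _ => h.int _, fun _ => h.nonneg _, h.finite, h.supp,
    fun f hf => (h.tendsto f hf).comp hφ.tendsto_atTop⟩

theorem integrable_mul_continuousOn {w f : ℝ → ℝ} (hw : Integrable w (volOn T))
    (hf : ContinuousOn f (Icc 0 T)) : Integrable (fun t => w t * f t) (volOn T) := by
  obtain ⟨B, hB⟩ := isCompact_Icc.exists_bound_of_continuousOn hf
  refine (ContinuousLinearMap.mul ℝ ℝ).integrable_of_bilin_of_bdd_right B hw
    (hf.aestronglyMeasurable measurableSet_Icc) ?_
  filter_upwards [ae_volOn_mem] with t ht using hB t ht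

/-- The functional on `C([0, T])` with density `w`. -/
def densityFunctional (hT : 0 ≤ T) (w : ℝ → ℝ) (hw : Integrable w (volOn T)) :
    StrongDual ℝ C(Icc (0 : ℝ) T, ℝ) :=
  LinearMap.mkContinuous
    { toFun := fun f => ∫ t, w t * IccExtend hT f t ∂volOn T
      map_add' := by
        intro f g
        rw [← integral_add (integrable_mul_continuousOn hw (f.continuous.Icc_extend'
          (h := hT)).continuousOn)
          (integrable_mul_continuousOn hw (g.continuous.Icc_extend' (h := hT)).continuousOn)]
        refine integral_congr_ae (Eventually.of_forall fun t => ?_)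
        simp only [IccExtend, Function.comp, ContinuousMap.add_apply, mul_add]
      map_smul' := by
        intro c f
        rw [RingHom.id_apply, smul_eq_mul, ← integral_const_mul]
        refine integral_congr_ae (Eventually.of_forall fun t => ?_)
        simp only [IccExtend, Function.comp, ContinuousMap.smul_apply, smul_eq_mul]
        ring }
    (∫ t, ‖w t‖ ∂volOn T) (by
      intro f
      simp only [LinearMap.coe_mk, AddHom.coe_mk]
      rw [← integral_mul_const]
      refine norm_integral_le_of_norm_le (hw.norm.mul_const _) (Eventually.of_forall fun t => ?_)
      rw [norm_mul]
      exact mul_le_mul_of_nonneg_left (f.norm_coe_le_norm _) (norm_nonneg _))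

theorem densityFunctional_apply (hT : 0 ≤ T) (w : ℝ → ℝ) (hw : Integrable w (volOn T))
    (f : C(Icc (0 : ℝ) T, ℝ)) :
    densityFunctional hT w hw f = ∫ t, w t * IccExtend hT f t ∂volOn T := rfl

theorem norm_densityFunctional_le (hT : 0 ≤ T) (w : ℝ → ℝ) (hw : Integrable w (volOn T)) :
    ‖densityFunctional hT w hw‖ ≤ ∫ t, ‖w t‖ ∂volOn T :=
  LinearMap.mkContinuous_norm_le _ (integral_nonneg fun _ => norm_nonneg _) _

/-- A sequence of nonnegative densities with bounded mass has a weakly convergent subsequence. -/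
theorem exists_measureLim (hT : 0 ≤ T) {C : ℝ} (w : ℕ → ℝ → ℝ)
    (hw : ∀ k, Integrable (w k) (volOn T)) (hw0 : ∀ k, ∀ᵐ t ∂volOn T, 0 ≤ w k t)
    (hC : ∀ k, ∫ t, w k t ∂volOn T ≤ C) :
    ∃ (μ : Measure ℝ) (φ : ℕ → ℕ), StrictMono φ ∧ MeasureLim T (fun k => w (φ k)) μ := by
  have hnorm : ∀ k, ∫ t, ‖w k t‖ ∂volOn T ≤ C := by
    intro k
    refine le_trans (le_of_eq (integral_congr_ae ?_)) (hC k)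
    filter_upwards [hw0 k] with t ht
    exact Real.norm_of_nonneg ht
  obtain ⟨Λ, φ, hφ, hlim⟩ := exists_subseq_tendsto_dual
    (fun k => densityFunctional hT (w k) (hw k)) (C := C)
    (fun k => (norm_densityFunctional_le hT _ _).trans (hnorm k))
  have hpos : ∀ f : C(Icc (0 : ℝ) T, ℝ), (∀ t, 0 ≤ f t) → 0 ≤ Λ f := by
    intro f hf
    refine ge_of_tendsto' (hlim f) fun k => ?_
    rw [densityFunctional_apply]
    refine integral_nonneg_of_ae ?_
    filter_upwards [hw0 (φ k)] with t ht
    exact mul_nonneg ht (hf _)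
  set Λ' : C_c(Icc (0 : ℝ) T, ℝ) →ₚ[ℝ] ℝ := PositiveLinearMap.mk₀
    { toFun := fun g => Λ g.toContinuousMap
      map_add' := fun f g => by rw [← map_add]; rfl
      map_smul' := fun c f => by rw [RingHom.id_apply, ← map_smul]; rfl }
    (fun g hg => hpos _ hg) with hΛ'
  set ν := RealRMK.rieszMeasure Λ'
  have hνf : ∀ f : C(Icc (0 : ℝ) T, ℝ), ∫ t, f t ∂ν = Λ f := by
    intro f
    exact RealRMK.integral_rieszMeasure Λ' ⟨f, HasCompactSupport.of_compactSpace f⟩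
  refine ⟨ν.map Subtype.val, φ, hφ, fun k => hw _, fun k => hw0 _, by infer_instance, ?_, ?_⟩
  · rw [Measure.map_apply measurable_subtype_coe measurableSet_Icc.compl]
    simp
  · intro f hf
    have hme : MeasurableEmbedding (Subtype.val : Icc (0 : ℝ) T → ℝ) :=
      MeasurableEmbedding.subtype_coe measurableSet_Icc
    rw [hme.integral_map]
    have h := hlim ⟨(Icc 0 T).domRestrict f, hf.domRestrict⟩
    rw [← hνf] at h
    refine h.congr fun k => ?_
    rw [densityFunctional_apply]
    refine integral_congr_ae ?_
    filter_upwards [ae_volOn_mem] with t ht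
    rw [IccExtend_of_mem _ _ ht]
    rfl

theorem MeasureLim.ae_mem {w : ℕ → ℝ → ℝ} {μ : Measure ℝ} (h : MeasureLim T w μ) :
    ∀ᵐ t ∂μ, t ∈ Icc 0 T := by
  rw [ae_iff]; exact h.supp

theorem MeasureLim.integrable_of_bound {E : Type*} [NormedAddCommGroup E] {w : ℕ → ℝ → ℝ}
    {μ : Measure ℝ} (h : MeasureLim T w μ) {f : ℝ → E} (hf : ContinuousOn f (Icc 0 T)) :
    Integrable f μ := by
  have := h.finite
  obtain ⟨B, hB⟩ := isCompact_Icc.exists_bound_of_continuousOn hf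
  have hr : μ.restrict (Icc 0 T) = μ := Measure.restrict_eq_self_of_ae_mem h.ae_mem
  have hm : AEStronglyMeasurable f (μ.restrict (Icc 0 T)) := hf.aestronglyMeasurable_of_isCompact
    isCompact_Icc measurableSet_Icc
  rw [hr] at hm
  refine Integrable.of_bound hm B ?_
  filter_upwards [h.ae_mem] with t ht using hB t ht

theorem MeasureLim.ae_no_atom {w : ℕ → ℝ → ℝ} {μ : Measure ℝ} (h : MeasureLim T w μ) :
    ∀ᵐ t ∂volOn T, μ {t} = 0 := by
  have := h.finite
  have hc : {t : ℝ | 0 < μ {a | id a = t}}.Countable :=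
    Measure.countable_meas_level_set_pos measurable_id
  refine ae_restrict_of_ae ?_
  rw [ae_iff]
  refine measure_mono_null ?_ (hc.measure_zero volume)
  intro t ht
  exact pos_iff_ne_zero.2 ht

theorem continuous_hat (t τ : ℝ) : Continuous fun s : ℝ => max 0 (1 - |s - t| / τ) := by fun_prop

theorem MeasureLim.tendsto_Ioc {w : ℕ → ℝ → ℝ} {μ : Measure ℝ} (h : MeasureLim T w μ)
    {f : ℝ → ℝ} (hf : ContinuousOn f (Icc 0 T)) {t : ℝ} (ht : t ∈ Icc 0 T) (hμ : μ {t} = 0) :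
    Tendsto (fun k => ∫ s in t..T, w k s * f s) atTop (𝓝 (∫ s in Ioc t T, f s ∂μ)) := by
  have := h.finite
  obtain ⟨B, hB⟩ := isCompact_Icc.exists_bound_of_continuousOn hf
  have hB0 : 0 ≤ B := (norm_nonneg _).trans (hB t ht)
  set κ : ℝ → ℝ → ℝ := fun τ s => max 0 (1 - |s - t| / τ) with hκ
  set χ : ℝ → ℝ → ℝ := fun τ s => max 0 (min 1 ((s - t) / τ)) with hχ
  have hκ0 : ∀ τ s, 0 ≤ κ τ s := fun τ s => le_max_left _ _
  have hκc : ∀ τ, Continuous (κ τ) := fun τ => continuous_hat t τ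
  have hχc : ∀ τ, Continuous (χ τ) := fun τ => by simp only [hχ]; fun_prop
  have hcmp : ∀ τ, 0 < τ → ∀ s, |(Ioi t).indicator (fun _ => (1 : ℝ)) s - χ τ s| ≤ κ τ s := by
    intro τ hτ s
    simp only [hχ, hκ]
    by_cases hs : t < s
    · rw [indicator_of_mem (mem_Ioi.2 hs), abs_of_pos (sub_pos.2 hs)]
      have h0 : 0 ≤ (s - t) / τ := div_nonneg (sub_pos.2 hs).le hτ.le
      rcases le_total ((s - t) / τ) 1 with h1 | h1
      · rw [min_eq_right h1, max_eq_right h0, abs_of_nonneg (by linarith)]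
        exact le_max_right _ _
      · rw [min_eq_left h1, max_eq_right zero_le_one]
        simp
    · rw [indicator_of_notMem (by simpa using hs)]
      have h0 : (s - t) / τ ≤ 0 := div_nonpos_of_nonpos_of_nonneg (by linarith) hτ.le
      rw [max_eq_left ((min_le_right _ _).trans h0)]
      simp
  -- the hat functions have small mass
  have hsmall : ∀ ε > 0, ∃ τ > 0, ∫ s, κ τ s ∂μ < ε := by
    have hlim : Tendsto (fun j : ℕ => ∫ s, κ (1 / ((j : ℝ) + 1)) s ∂μ) atTop
        (𝓝 (∫ s, (0 : ℝ) ∂μ)) := by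
      refine tendsto_integral_of_dominated_convergence (fun _ => 1)
        (fun j => (hκc _).aestronglyMeasurable) (integrable_const _) ?_ ?_
      · refine fun j => Eventually.of_forall fun s => ?_
        rw [Real.norm_of_nonneg (hκ0 _ _)]
        refine max_le zero_le_one ?_
        have : 0 ≤ |s - t| / (1 / ((j : ℝ) + 1)) := by positivity
        linarith
      · have hne : ∀ᵐ s ∂μ, s ≠ t := by
          rw [ae_iff]; simpa using hμ
        filter_upwards [hne] with s hs
        have hpos : 0 < |s - t| := abs_pos.2 (sub_ne_zero.2 hs)
        refine tendsto_const_nhds.congr' ?_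
        obtain ⟨N, hN⟩ := exists_nat_gt (1 / |s - t|)
        filter_upwards [eventually_ge_atTop N] with j hj
        simp only [hκ]
        rw [max_eq_left]
        rw [div_div_eq_mul_div, div_one]
        have h1 : 1 < N * |s - t| := by rwa [div_lt_iff₀ hpos] at hN
        have h2 : (N : ℝ) ≤ j := by exact_mod_cast hj
        nlinarith
    rw [integral_zero] at hlim
    intro ε hε
    obtain ⟨j, hj⟩ := (hlim.eventually (gt_mem_nhds hε)).exists
    exact ⟨_, by positivity, hj⟩
  have hind : ∀ k, ∫ s in t..T, w k s * f s
      = ∫ s, w k s * ((Ioi t).indicator (fun _ => (1 : ℝ)) s * f s) ∂volOn T := by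
    intro k
    rw [intervalIntegral_eq_volOn ht.1 ht.2 le_rfl, ← integral_indicator measurableSet_Ioc]
    refine integral_congr_ae ?_
    filter_upwards [ae_volOn_mem] with s hs
    by_cases h1 : t < s
    · simp [h1, hs.2]
    · simp [h1]
  have hindμ : ∫ s in Ioc t T, f s ∂μ = ∫ s, (Ioi t).indicator (fun _ => (1 : ℝ)) s * f s ∂μ := by
    rw [← integral_indicator measurableSet_Ioc]
    refine integral_congr_ae ?_
    filter_upwards [h.ae_mem] with s hs
    by_cases h1 : t < s
    · simp [h1, hs.2]
    · simp [h1]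
  have hfm : AEStronglyMeasurable f (volOn T) := hf.aestronglyMeasurable measurableSet_Icc
  have hfμ : Integrable f μ := h.integrable_of_bound hf
  simp only [hind, hindμ]
  rw [Metric.tendsto_atTop]
  intro ε hε
  obtain ⟨τ, hτ, hτε⟩ := hsmall (ε / (4 * (B + 1))) (by positivity)
  have hlim1 := h.tendsto (fun s => χ τ s * f s) ((hχc τ).continuousOn.mul hf)
  have hlim2 := h.tendsto (κ τ) (hκc τ).continuousOn
  have hBε : B * (ε / (4 * (B + 1))) ≤ ε / 4 := by
    rw [mul_div_assoc', div_le_div_iff₀ (by positivity) (by positivity)]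
    nlinarith
  obtain ⟨N1, hN1⟩ := (Metric.tendsto_atTop.1 hlim1) (ε / 4) (by positivity)
  obtain ⟨N2, hN2⟩ := eventually_atTop.1 (hlim2.eventually (gt_mem_nhds hτε))
  have hdiffμ : |∫ s, (Ioi t).indicator (fun _ => (1 : ℝ)) s * f s ∂μ - ∫ s, χ τ s * f s ∂μ|
      ≤ B * ∫ s, κ τ s ∂μ := by
    have hi1 : Integrable (fun s => (Ioi t).indicator (fun _ => (1 : ℝ)) s * f s) μ := by
      refine (hfμ.indicator measurableSet_Ioi (s := Ioi t)).congr (Eventually.of_forall fun s => ?_)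
      by_cases h1 : t < s <;> simp [h1]
    have hi2 : Integrable (fun s => χ τ s * f s) μ :=
      h.integrable_of_bound ((hχc τ).continuousOn.mul hf)
    rw [← integral_sub hi1 hi2, ← integral_const_mul, ← Real.norm_eq_abs]
    refine norm_integral_le_of_norm_le
      ((h.integrable_of_bound (hκc τ).continuousOn).const_mul B) ?_
    filter_upwards [h.ae_mem] with s hs
    rw [← sub_mul, norm_mul, mul_comm]
    exact mul_le_mul (hB s hs) (hcmp τ hτ s) (abs_nonneg _) hB0
  refine ⟨max N1 N2, fun k hk => ?_⟩
  have h1 := hN1 k ((le_max_left _ _).trans hk)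
  have h2 := hN2 k ((le_max_right _ _).trans hk)
  have hdiff : |∫ s, w k s * ((Ioi t).indicator (fun _ => (1 : ℝ)) s * f s) ∂volOn T
      - ∫ s, w k s * (χ τ s * f s) ∂volOn T| ≤ B * ∫ s, w k s * κ τ s ∂volOn T := by
    have hi1 : Integrable (fun s => w k s * ((Ioi t).indicator (fun _ => (1 : ℝ)) s * f s))
        (volOn T) := by
      refine ((integrable_mul_continuousOn (h.int k) hf).indicator
        measurableSet_Ioi (s := Ioi t)).congr (Eventually.of_forall fun s => ?_)
      by_cases h1 : t < s <;> simp [h1]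
    have hi2 : Integrable (fun s => w k s * (χ τ s * f s)) (volOn T) :=
      integrable_mul_continuousOn (h.int k) ((hχc τ).continuousOn.mul hf)
    rw [← integral_sub hi1 hi2, ← integral_const_mul, ← Real.norm_eq_abs]
    refine norm_integral_le_of_norm_le
      ((integrable_mul_continuousOn (h.int k) (hκc τ).continuousOn).const_mul B) ?_
    filter_upwards [ae_volOn_mem, h.nonneg k] with s hs hw
    rw [← mul_sub, ← sub_mul, norm_mul, norm_mul, Real.norm_of_nonneg hw]
    have := mul_le_mul (hcmp τ hτ s) (hB s hs) (norm_nonneg _) (hκ0 τ s)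
    calc w k s * (‖_‖ * ‖f s‖) ≤ w k s * (κ τ s * B) := mul_le_mul_of_nonneg_left this hw
      _ = B * (w k s * κ τ s) := by ring
  have h3 : B * ∫ s, w k s * κ τ s ∂volOn T ≤ ε / 4 :=
    (mul_le_mul_of_nonneg_left h2.le hB0).trans hBε
  have h4 : B * ∫ s, κ τ s ∂μ ≤ ε / 4 := (mul_le_mul_of_nonneg_left hτε.le hB0).trans hBε
  rw [Real.dist_eq] at h1 ⊢
  rw [abs_lt] at h1 ⊢
  have h5 := abs_le.1 (hdiff.trans h3)
  have h6 := abs_le.1 (hdiffμ.trans h4)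
  constructor <;> linarith [h5.1, h5.2, h6.1, h6.2, h1.1, h1.2]

end MeasureLimits
end

noncomputable section

section VectorLimits

open Topology

variable {T : ℝ}

theorem tendsto_vec_of_coord {n : ℕ} {α : Type*} {l : Filter α} {f : α → Vec n} {y : Vec n}
    (h : ∀ i, Tendsto (fun a => f a i) l (𝓝 (y i))) : Tendsto f l (𝓝 y) :=
  ((PiLp.continuous_toLp 2 (fun _ : Fin n => ℝ)).tendsto _).comp (tendsto_pi_nhds.2 h)

theorem tendsto_vec_of_inner {n : ℕ} {α : Type*} {l : Filter α} {f : α → Vec n} {y : Vec n}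
    (h : ∀ e : Vec n, Tendsto (fun a => inner ℝ e (f a)) l (𝓝 (inner ℝ e y))) :
    Tendsto f l (𝓝 y) :=
  tendsto_vec_of_coord fun i => by
    have := h (EuclideanSpace.single i 1)
    simpa [EuclideanSpace.inner_single_left] using this

theorem intervalIntegral_coord {n : ℕ} {w : ℝ → Vec n} (hw : Integrable w (volOn T)) {a b : ℝ}
    (ha : a ∈ Icc 0 T) (hb : b ∈ Icc 0 T) (i : Fin n) :
    (∫ s in a..b, w s) i = ∫ s in a..b, w s i :=
  ((EuclideanSpace.proj i : Vec n →L[ℝ] ℝ).intervalIntegral_comp_comm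
    (integrable_volOn_intervalIntegrable hw ha hb)).symm

theorem exists_tail_limit_real (hT : 0 ≤ T) {C : ℝ} (w : ℕ → ℝ → ℝ)
    (hw : ∀ k, Integrable (w k) (volOn T)) (hC : ∀ k, ∫ t, ‖w k t‖ ∂volOn T ≤ C) :
    ∃ (φ : ℕ → ℕ) (P : ℝ → ℝ), StrictMono φ ∧
      ∀ᵐ t ∂volOn T, Tendsto (fun k => ∫ s in t..T, w (φ k) s) atTop (𝓝 (P t)) := by
  have hpos : ∀ k, ∫ t, max (w k t) 0 ∂volOn T ≤ C := fun k =>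
    (integral_mono (hw k).pos_part (hw k).norm fun t =>
      max_le (le_abs_self _) (abs_nonneg _)).trans (hC k)
  have hneg : ∀ k, ∫ t, max (-w k t) 0 ∂volOn T ≤ C := fun k =>
    (integral_mono (hw k).neg_part (hw k).norm fun t =>
      max_le (neg_le_abs _) (abs_nonneg _)).trans (hC k)
  obtain ⟨μ₁, φ, hφ, h₁⟩ := exists_measureLim hT (fun k t => max (w k t) 0)
    (fun k => (hw k).pos_part) (fun k => Eventually.of_forall fun t => le_max_right _ _) hpos
  obtain ⟨μ₂, ψ, hψ, h₂⟩ := exists_measureLim hT (fun k t => max (-w (φ k) t) 0)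
    (fun k => (hw _).neg_part) (fun k => Eventually.of_forall fun t => le_max_right _ _)
    (fun k => hneg _)
  refine ⟨φ ∘ ψ, fun t => ∫ s in Ioc t T, (1 : ℝ) ∂μ₁ - ∫ s in Ioc t T, (1 : ℝ) ∂μ₂, hφ.comp hψ, ?_⟩
  filter_upwards [ae_volOn_mem, h₁.ae_no_atom, h₂.ae_no_atom] with t ht ht1 ht2
  have e1 := (h₁.comp hψ).tendsto_Ioc (f := fun _ => (1 : ℝ)) continuousOn_const ht ht1
  have e2 := h₂.tendsto_Ioc (f := fun _ => (1 : ℝ)) continuousOn_const ht ht2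
  have hTm : T ∈ Icc 0 T := ⟨hT, le_rfl⟩
  refine (e1.sub e2).congr fun k => ?_
  rw [← intervalIntegral.integral_sub]
  · refine intervalIntegral.integral_congr fun s _ => ?_
    simp only [mul_one, Function.comp]
    rcases le_total (w (φ (ψ k)) s) 0 with h | h
    · rw [max_eq_right h, max_eq_left (by linarith)]; ring
    · rw [max_eq_left h, max_eq_right (by linarith)]; ring
  · simpa using integrable_volOn_intervalIntegrable (hw (φ (ψ k))).pos_part ht hTm
  · simpa using integrable_volOn_intervalIntegrable (hw (φ (ψ k))).neg_part ht hTm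

/-- Primitives of a sequence that is bounded in `L¹` converge almost everywhere along a
subsequence. -/
theorem exists_tail_limit {n : ℕ} (hT : 0 ≤ T) {C : ℝ} (w : ℕ → ℝ → Vec n)
    (hw : ∀ k, Integrable (w k) (volOn T)) (hC : ∀ k, ∫ t, ‖w k t‖ ∂volOn T ≤ C) :
    ∃ (φ : ℕ → ℕ) (P : ℝ → Vec n), StrictMono φ ∧
      ∀ᵐ t ∂volOn T, Tendsto (fun k => ∫ s in t..T, w (φ k) s) atTop (𝓝 (P t)) := by
  have hwi : ∀ k i, Integrable (fun t => w k t i) (volOn T) := fun k i =>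
    (EuclideanSpace.proj i : Vec n →L[ℝ] ℝ).integrable_comp (hw k)
  obtain ⟨φ, hφ, hQ⟩ := exists_strictMono_forall
    (fun (i : Fin n) φ => ∃ P : ℝ → ℝ, ∀ᵐ t ∂volOn T,
      Tendsto (fun k => ∫ s in t..T, w (φ k) s i) atTop (𝓝 (P t)))
    (by
      rintro i φ ψ hψ ⟨P, hP⟩
      refine ⟨P, ?_⟩
      filter_upwards [hP] with t ht
      exact ht.comp hψ.tendsto_atTop)
    (by
      intro i φ hφ
      obtain ⟨ψ, P, hψ, hP⟩ := exists_tail_limit_real hT (C := C) (fun k t => w (φ k) t i)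
        (fun k => hwi _ i) (fun k => (integral_mono (hwi _ i).norm (hw _).norm
          fun t => PiLp.norm_apply_le _ i).trans (hC (φ k)))
      exact ⟨ψ, hψ, P, hP⟩)
  choose P hP using hQ
  refine ⟨φ, fun t => WithLp.toLp 2 fun i => P i t, hφ, ?_⟩
  filter_upwards [ae_all_iff.2 hP, ae_volOn_mem] with t ht htm
  refine tendsto_vec_of_coord fun i => ?_
  refine (ht i).congr fun k => ?_
  rw [intervalIntegral_coord (hw _) htm ⟨hT, le_rfl⟩]

/-- A sequence with uniformly convergent values, multiplied by densities of bounded mass. -/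
theorem MeasureLim.tendsto_error {E : Type*} [NormedAddCommGroup E] [NormedSpace ℝ E]
    {w : ℕ → ℝ → ℝ} {μ : Measure ℝ} (h : MeasureLim T w μ) {f : ℕ → ℝ → E} {fbar : ℝ → E}
    (hunif : TendstoUniformlyOn f fbar atTop (Icc 0 T)) (S : Set ℝ) :
    Tendsto (fun k => ∫ s in S, w k s • (f k s - fbar s) ∂volOn T) atTop (𝓝 0) := by
  have hmass := h.tendsto (fun _ => 1) continuousOn_const
  simp only [mul_one] at hmass
  set m := ∫ _, (1 : ℝ) ∂μ
  rw [Metric.tendsto_atTop]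
  intro ε hε
  have hm0 : 0 ≤ m := integral_nonneg fun _ => zero_le_one
  have hη : 0 < ε / (m + 2) := by positivity
  have h1 := Metric.tendstoUniformlyOn_iff.1 hunif _ hη
  have h2 := hmass.eventually (gt_mem_nhds (show m < m + 1 by linarith))
  obtain ⟨N, hN⟩ := eventually_atTop.1 (h1.and h2)
  refine ⟨N, fun k hk => ?_⟩
  obtain ⟨h3, h4⟩ := hN k hk
  rw [dist_zero_right]
  have h5 : ‖∫ s in S, w k s • (f k s - fbar s) ∂volOn T‖
      ≤ ∫ s in S, w k s * (ε / (m + 2)) ∂volOn T := by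
    refine norm_integral_le_of_norm_le ((h.int k).mul_const _).restrict (ae_restrict_of_ae ?_)
    filter_upwards [ae_volOn_mem, h.nonneg k] with s hs hw
    rw [norm_smul, Real.norm_of_nonneg hw, ← dist_eq_norm, dist_comm]
    exact mul_le_mul_of_nonneg_left (h3 s hs).le hw
  have h6 : ∫ s in S, w k s * (ε / (m + 2)) ∂volOn T ≤ ∫ s, w k s * (ε / (m + 2)) ∂volOn T := by
    refine setIntegral_le_integral ((h.int k).mul_const _) ?_
    filter_upwards [h.nonneg k] with s hw using mul_nonneg hw hη.le
  have h7 : (∫ s, w k s ∂volOn T) * (ε / (m + 2)) < ε := by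
    rw [mul_div_assoc', div_lt_iff₀ (by linarith)]
    nlinarith
  rw [← integral_mul_const] at h7
  linarith

theorem tendsto_real_of_error {w : ℕ → ℝ → ℝ} {μ : Measure ℝ} (h : MeasureLim T w μ)
    {f : ℕ → ℝ → ℝ} {fbar : ℝ → ℝ} (hf : ∀ k, ContinuousOn (f k) (Icc 0 T))
    (hfbar : ContinuousOn fbar (Icc 0 T))
    (hunif : TendstoUniformlyOn f fbar atTop (Icc 0 T)) :
    Tendsto (fun k => ∫ s, w k s * f k s ∂volOn T) atTop (𝓝 (∫ s, fbar s ∂μ)) := by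
  have h1 := (h.tendsto_error hunif univ).add (h.tendsto fbar hfbar)
  rw [zero_add] at h1
  refine h1.congr fun k => ?_
  have hi1 : Integrable (fun s => w k s • (f k s - fbar s)) (volOn T) :=
    integrable_mul_continuousOn (h.int k) ((hf k).sub hfbar)
  rw [setIntegral_univ, ← integral_add hi1 (integrable_mul_continuousOn (h.int k) hfbar)]
  refine integral_congr_ae (Eventually.of_forall fun t => ?_)
  simp only [smul_eq_mul]
  ring

theorem tendsto_real_of_error_Ioc {w : ℕ → ℝ → ℝ} {μ : Measure ℝ} (h : MeasureLim T w μ)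
    {f : ℕ → ℝ → ℝ} {fbar : ℝ → ℝ} (hf : ∀ k, ContinuousOn (f k) (Icc 0 T))
    (hfbar : ContinuousOn fbar (Icc 0 T))
    (hunif : TendstoUniformlyOn f fbar atTop (Icc 0 T)) {t : ℝ} (ht : t ∈ Icc 0 T)
    (hμ : μ {t} = 0) :
    Tendsto (fun k => ∫ s in t..T, w k s * f k s) atTop (𝓝 (∫ s in Ioc t T, fbar s ∂μ)) := by
  have h1 := (h.tendsto_error hunif (Ioc t T)).add (h.tendsto_Ioc hfbar ht hμ)
  rw [zero_add] at h1
  refine h1.congr fun k => ?_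
  have hi1 : Integrable (fun s => w k s • (f k s - fbar s)) (volOn T) :=
    integrable_mul_continuousOn (h.int k) ((hf k).sub hfbar)
  rw [intervalIntegral_eq_volOn ht.1 ht.2 le_rfl, intervalIntegral_eq_volOn ht.1 ht.2 le_rfl,
    ← integral_add hi1.restrict (integrable_mul_continuousOn (h.int k) hfbar).restrict]
  refine integral_congr_ae (Eventually.of_forall fun t => ?_)
  simp only [smul_eq_mul]
  ring

end VectorLimits

section StrongLimits

open Topology

variable {T : ℝ} {E F : Type*} [NormedAddCommGroup E] [NormedSpace ℝ E]
  [NormedAddCommGroup F] [NormedSpace ℝ F]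

/-- Uniform convergence times convergence in `L¹`. -/
theorem tendsto_L1_apply {K : ℕ → ℝ → E →L[ℝ] F} {Kbar : ℝ → E →L[ℝ] F} {q : ℕ → ℝ → E}
    {qbar : ℝ → E} (hKbar : ContinuousOn Kbar (Icc 0 T))
    (hunif : TendstoUniformlyOn K Kbar atTop (Icc 0 T)) (hq : ∀ k, Integrable (q k) (volOn T))
    (hqbar : Integrable qbar (volOn T))
    (hlim : Tendsto (fun k => ∫ t, ‖q k t - qbar t‖ ∂volOn T) atTop (𝓝 0)) :
    Tendsto (fun k => ∫ t, ‖K k t (q k t) - Kbar t (qbar t)‖ ∂volOn T) atTop (𝓝 0) := by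
  obtain ⟨B, hB⟩ := isCompact_Icc.exists_bound_of_continuousOn hKbar
  set m := ∫ t, ‖qbar t‖ ∂volOn T
  have hm : 0 ≤ m := integral_nonneg fun _ => norm_nonneg _
  have hmain : ∀ ε > 0, ∀ᶠ k in atTop, ∫ t, ‖K k t (q k t) - Kbar t (qbar t)‖ ∂volOn T
      ≤ (ε + B) * ∫ t, ‖q k t - qbar t‖ ∂volOn T + ε * m := by
    intro ε hε
    filter_upwards [Metric.tendstoUniformlyOn_iff.1 hunif ε hε] with k hk
    have hd : Integrable (fun t => ‖q k t - qbar t‖) (volOn T) := ((hq k).sub hqbar).norm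
    rw [← integral_const_mul, ← integral_const_mul, ← integral_add
      (hd.const_mul _) (hqbar.norm.const_mul _)]
    refine integral_mono_of_nonneg (Eventually.of_forall fun _ => norm_nonneg _)
      ((hd.const_mul _).add (hqbar.norm.const_mul _)) ?_
    filter_upwards [ae_volOn_mem] with t ht
    have h1 : K k t (q k t) - Kbar t (qbar t) = (K k t - Kbar t) (q k t - qbar t)
        + (K k t - Kbar t) (qbar t) + Kbar t (q k t - qbar t) := by
      simp only [sub_apply, map_sub]; abel
    have h2 : ‖K k t - Kbar t‖ ≤ ε := by
      rw [← dist_eq_norm, dist_comm]; exact (hk t ht).le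
    rw [h1]
    calc _ ≤ ‖(K k t - Kbar t) (q k t - qbar t)‖ + ‖(K k t - Kbar t) (qbar t)‖
          + ‖Kbar t (q k t - qbar t)‖ := norm_add₃_le
      _ ≤ ε * ‖q k t - qbar t‖ + ε * ‖qbar t‖ + B * ‖q k t - qbar t‖ := by
          gcongr
          · exact (ContinuousLinearMap.le_opNorm _ _).trans (by gcongr)
          · exact (ContinuousLinearMap.le_opNorm _ _).trans (by gcongr)
          · exact (ContinuousLinearMap.le_opNorm _ _).trans (by gcongr; exact hB t ht)
      _ = _ := by ring
  rw [Metric.tendsto_atTop]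
  intro ε hε
  have hη : 0 < ε / (2 * (m + 1)) := by positivity
  have h1 := hmain _ hη
  have h2 : Tendsto (fun k => (ε / (2 * (m + 1)) + B) * ∫ t, ‖q k t - qbar t‖ ∂volOn T) atTop
      (𝓝 0) := by simpa using hlim.const_mul (ε / (2 * (m + 1)) + B)
  obtain ⟨N, hN⟩ := eventually_atTop.1 (h1.and (h2.eventually (gt_mem_nhds (half_pos hε))))
  refine ⟨N, fun k hk => ?_⟩
  obtain ⟨h3, h4⟩ := hN k hk
  rw [dist_zero_right, Real.norm_of_nonneg (integral_nonneg fun _ => norm_nonneg _)]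
  have h5 : ε / (2 * (m + 1)) * m ≤ ε / 2 := by
    rw [div_mul_eq_mul_div, div_le_div_iff₀ (by positivity) (by positivity)]
    nlinarith
  linarith

/-- Completeness of `L¹`, in terms of functions. -/
theorem exists_L1_limit {q : ℕ → ℝ → ℝ} (hq : ∀ k, Integrable (q k) (volOn T)) {e : ℕ → ℝ}
    (he : Tendsto e atTop (𝓝 0))
    (hle : ∀ k l, ∫ t, ‖q k t - q l t‖ ∂volOn T ≤ e k + e l) :
    ∃ qbar : ℝ → ℝ, Integrable qbar (volOn T) ∧
      Tendsto (fun k => ∫ t, ‖q k t - qbar t‖ ∂volOn T) atTop (𝓝 0) := by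
  have hdist : ∀ k l, dist ((hq k).toL1 (q k)) ((hq l).toL1 (q l))
      = ∫ t, ‖q k t - q l t‖ ∂volOn T := by
    intro k l
    rw [dist_eq_norm, ← Integrable.toL1_sub, L1.norm_eq_integral_norm]
    refine integral_congr_ae ?_
    filter_upwards [((hq k).sub (hq l)).coeFn_toL1] with t ht
    rw [ht]; rfl
  have hc : CauchySeq fun k => (hq k).toL1 (q k) := by
    rw [Metric.cauchySeq_iff]
    intro ε hε
    obtain ⟨N, hN⟩ := eventually_atTop.1 (he.eventually (gt_mem_nhds (half_pos hε)))
    refine ⟨N, fun k hk l hl => ?_⟩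
    rw [hdist]
    linarith [hle k l, hN k hk, hN l hl]
  obtain ⟨L, hL⟩ := cauchySeq_tendsto_of_complete hc
  refine ⟨L, L1.integrable_coeFn L, ?_⟩
  have h := tendsto_iff_dist_tendsto_zero.1 hL
  refine h.congr fun k => ?_
  rw [dist_eq_norm, L1.norm_eq_integral_norm]
  refine integral_congr_ae ?_
  filter_upwards [Lp.coeFn_sub ((hq k).toL1 (q k)) L, (hq k).coeFn_toL1] with t h1 h2
  rw [h1, Pi.sub_apply, h2]

end StrongLimits
end

noncomputable section

section Gronwall

/-- Gronwall's lemma in integral form. -/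
theorem le_mul_exp_of_le_add_mul_integral {T L c : ℝ} (hT : 0 ≤ T) (hL : 0 ≤ L) {φ : ℝ → ℝ}
    (hc : ContinuousOn φ (Icc 0 T)) (h0 : ∀ t ∈ Icc 0 T, 0 ≤ φ t)
    (hle : ∀ t ∈ Icc 0 T, φ t ≤ c + L * ∫ s in (0 : ℝ)..t, φ s) :
    ∀ t ∈ Icc 0 T, φ t ≤ c * Real.exp (L * T) := by
  set ψ : ℝ → ℝ := IccExtend hT ((Icc 0 T).domRestrict φ) with hψ
  have hψc : Continuous ψ := hc.domRestrict.Icc_extend'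
  have hψe : ∀ t ∈ Icc 0 T, ψ t = φ t := fun t ht => by
    rw [hψ, IccExtend_of_mem _ _ ht]; rfl
  have hint : ∀ t ∈ Icc 0 T, ∫ s in (0 : ℝ)..t, φ s = ∫ s in (0 : ℝ)..t, ψ s := by
    intro t ht
    refine intervalIntegral.integral_congr fun s hs => ?_
    rw [uIcc_of_le ht.1] at hs
    exact (hψe s ⟨hs.1, hs.2.trans ht.2⟩).symm
  have hd : ∀ t, HasDerivAt (fun t => ∫ s in (0 : ℝ)..t, ψ s) (ψ t) t := fun t =>
    intervalIntegral.integral_hasDerivAt_right (hψc.intervalIntegrable _ _)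
      (hψc.stronglyMeasurableAtFilter _ _) hψc.continuousAt
  have hnn : ∀ t ∈ Icc 0 T, 0 ≤ ∫ s in (0 : ℝ)..t, ψ s := fun t ht => by
    rw [← hint t ht]
    exact intervalIntegral.integral_nonneg ht.1 fun s hs => h0 s ⟨hs.1, hs.2.trans ht.2⟩
  have hF : ∀ t ∈ Icc 0 T, ‖∫ s in (0 : ℝ)..t, ψ s‖ ≤ gronwallBound 0 L c (t - 0) := by
    refine norm_le_gronwallBound_of_norm_deriv_right_le (f' := ψ)
      (fun t _ => (hd t).continuousAt.continuousWithinAt) (fun t _ => (hd t).hasDerivWithinAt)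
      (by simp) ?_
    intro t ht
    have ht' : t ∈ Icc 0 T := ⟨ht.1, ht.2.le⟩
    rw [hψe t ht', Real.norm_of_nonneg (h0 t ht'), Real.norm_of_nonneg (hnn t ht'), ← hint t ht',
      add_comm]
    exact hle t ht'
  have hc0 : 0 ≤ c := by
    have := hle 0 ⟨le_rfl, hT⟩
    rw [intervalIntegral.integral_same, mul_zero, add_zero] at this
    exact (h0 0 ⟨le_rfl, hT⟩).trans this
  intro t ht
  have h1 := (le_abs_self _).trans (hF t ht)
  rw [← hint t ht, sub_zero] at h1
  refine (hle t ht).trans ?_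
  rcases hL.eq_or_lt with rfl | hL'
  · simp
  · rw [gronwallBound_of_K_ne_0 hL'.ne'] at h1
    simp only [zero_mul, zero_add] at h1
    have h2 := mul_le_mul_of_nonneg_left h1 hL
    have h3 : L * (c / L * (Real.exp (L * t) - 1)) = c * Real.exp (L * t) - c := by
      field_simp
    have h4 : c * Real.exp (L * t) ≤ c * Real.exp (L * T) :=
      mul_le_mul_of_nonneg_left (Real.exp_le_exp.2 (mul_le_mul_of_nonneg_left ht.2 hL)) hc0
    linarith

end Gronwall

namespace OCP

variable {n m nh ng nc : ℕ} {P : OCP n m nh ng nc}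

section Smoothness

theorem Smooth.f₁ (h : P.Smooth) : ContDiff ℝ 2 P.f₁ := by
  have := h.f_C2.comp (contDiff_id.prodMk (contDiff_const (c := (0 : Vec m))))
  convert this using 1
  ext x
  simp [OCP.f]

theorem Smooth.f₂ (h : P.Smooth) : ContDiff ℝ 2 P.f₂ := by
  rw [contDiff_clm_apply_iff]
  intro v
  have := (h.f_C2.comp (contDiff_id.prodMk (contDiff_const (c := v)))).sub h.f₁
  convert this using 1
  ext x
  simp [OCP.f]

theorem Smooth.b (h : P.Smooth) (i : Fin nc) : ContDiff ℝ 2 (P.b i) := by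
  have := (h.c_C2 i).comp (contDiff_id.prodMk (contDiff_const (c := (0 : Vec m))))
  convert this using 1
  ext x
  simp [OCP.c]

theorem Smooth.a (h : P.Smooth) (i : Fin nc) : ContDiff ℝ 2 (P.a i) := by
  rw [contDiff_euclidean]
  intro j
  have h1 : ContDiff ℝ 2 fun x => P.c i x (EuclideanSpace.single j (1 : ℝ)) - P.b i x :=
    ((h.c_C2 i).comp (contDiff_id.prodMk contDiff_const)).sub (h.b i)
  have h2 : (fun x => P.c i x (EuclideanSpace.single j (1 : ℝ)) - P.b i x)
      = fun x => P.a i x j := by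
    ext x
    simp [OCP.c, EuclideanSpace.inner_single_right]
  rwa [h2] at h1

theorem Smooth.ℓ₁ (h : P.Smooth) : ContDiff ℝ 2 P.ℓ₁ := by
  have := h.ℓ_C2.comp (contDiff_id.prodMk (contDiff_const (c := (0 : Vec m))))
  convert this using 1
  ext x
  simp [OCP.ℓ]

theorem Smooth.ℓ₂ (h : P.Smooth) : ContDiff ℝ 2 P.ℓ₂ := by
  rw [contDiff_euclidean]
  intro j
  have h1 : ContDiff ℝ 2 fun x => P.ℓ x (EuclideanSpace.single j (1 : ℝ)) - P.ℓ₁ x :=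
    (h.ℓ_C2.comp (contDiff_id.prodMk contDiff_const)).sub h.ℓ₁
  have h2 : (fun x => P.ℓ x (EuclideanSpace.single j (1 : ℝ)) - P.ℓ₁ x) = fun x => P.ℓ₂ x j := by
    ext x
    simp [OCP.ℓ, EuclideanSpace.inner_single_right]
  rwa [h2] at h1

variable (P) in
/-- Derivative of the dynamics with respect to the state. -/
def dynDeriv (x : Vec n) (u : Vec m) : Vec n →L[ℝ] Vec n :=
  fderiv ℝ P.f₁ x + (fderiv ℝ P.f₂ x).flip u

variable (P) in
/-- Gradient of a mixed constraint with respect to the state. -/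
def mixedGrad (i : Fin nc) (x : Vec n) (u : Vec m) : Vec n :=
  gradient (P.b i) x + (fderiv ℝ (P.a i) x).adjoint u

theorem Smooth.hasFDerivAt_f (h : P.Smooth) (x : Vec n) (u : Vec m) :
    HasFDerivAt (fun z => P.f z u) (P.dynDeriv x u) x := by
  have h1 := (h.f₁.differentiable (by norm_num) x).hasFDerivAt
  have h2 := (h.f₂.differentiable (by norm_num) x).hasFDerivAt
  exact h1.add (h2.clm_apply (hasFDerivAt_const u x) |>.congr_fderiv (by ext; simp))

theorem Smooth.fderiv_f (h : P.Smooth) (x : Vec n) (u : Vec m) :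
    fderiv ℝ (fun z => P.f z u) x = P.dynDeriv x u := (h.hasFDerivAt_f x u).fderiv

theorem Smooth.gradient_c (h : P.Smooth) (i : Fin nc) (x : Vec n) (u : Vec m) :
    gradient (fun z => P.c i z u) x = P.mixedGrad i x u := by
  refine HasGradientAt.gradient ?_
  have h1 := ((h.b i).differentiable (by norm_num) x).hasGradientAt
  have h2 := ((h.a i).differentiable (by norm_num) x).hasFDerivAt
  rw [hasGradientAt_iff_hasFDerivAt] at h1 ⊢
  have h3 := (h2.inner ℝ (hasFDerivAt_const u x)).add h1
  refine h3.congr_fderiv ?_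
  ext z
  simp [mixedGrad, add_comm, ContinuousLinearMap.adjoint_inner_left,
    real_inner_comm, fderivInnerCLM_apply]

theorem Smooth.continuous_gradient_g (h : P.Smooth) (i : Fin ng) :
    Continuous (gradient (P.g i)) :=
  (InnerProductSpace.toDual ℝ (Vec n)).symm.continuous.comp
    ((h.g_C2 i).continuous_fderiv (by norm_num))

theorem Smooth.continuous_gradient_b (h : P.Smooth) (i : Fin nc) :
    Continuous (gradient (P.b i)) :=
  (InnerProductSpace.toDual ℝ (Vec n)).symm.continuous.comp
    ((h.b i).continuous_fderiv (by norm_num))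

variable (P) in
/-- Partial derivative of `h` with respect to the initial state. -/
def hDeriv₀ (x y : Vec n) : Vec n →L[ℝ] Vec nh :=
  (fderiv ℝ P.h (x, y)).comp (ContinuousLinearMap.inl ℝ (Vec n) (Vec n))

variable (P) in
/-- Partial derivative of `h` with respect to the final state. -/
def hDeriv₁ (x y : Vec n) : Vec n →L[ℝ] Vec nh :=
  (fderiv ℝ P.h (x, y)).comp (ContinuousLinearMap.inr ℝ (Vec n) (Vec n))

theorem Smooth.fderiv_h₀ (h : P.Smooth) (x y : Vec n) :
    fderiv ℝ (fun z => P.h (z, y)) x = P.hDeriv₀ x y := by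
  have h1 := (h.h_C1.differentiable (by norm_num) (x, y)).hasFDerivAt
  exact (h1.comp x (hasFDerivAt_prodMk_left x y)).fderiv

theorem Smooth.fderiv_h₁ (h : P.Smooth) (x y : Vec n) :
    fderiv ℝ (fun z => P.h (x, z)) y = P.hDeriv₁ x y := by
  have h1 := (h.h_C1.differentiable (by norm_num) (x, y)).hasFDerivAt
  exact (h1.comp y (hasFDerivAt_prodMk_right x y)).fderiv

theorem Smooth.continuous_hDeriv₀ (h : P.Smooth) :
    Continuous fun z : Vec n × Vec n => P.hDeriv₀ z.1 z.2 :=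
  (h.h_C1.continuous_fderiv (by norm_num)).clm_comp continuous_const

theorem Smooth.continuous_hDeriv₁ (h : P.Smooth) :
    Continuous fun z : Vec n × Vec n => P.hDeriv₁ z.1 z.2 :=
  (h.h_C1.continuous_fderiv (by norm_num)).clm_comp continuous_const

end Smoothness

section Bounds

theorem _root_.memLp_top_ae_bound {T : ℝ} {E : Type*} [NormedAddCommGroup E] {u : ℝ → E}
    (hu : MemLp u ⊤ (volOn T)) : ∃ C : ℝ, 0 ≤ C ∧ ∀ᵐ t ∂volOn T, ‖u t‖ ≤ C := by
  refine ⟨(eLpNorm u ⊤ (volOn T)).toReal, ENNReal.toReal_nonneg, ?_⟩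
  filter_upwards [enorm_ae_le_eLpNormEssSup u (volOn T)] with t ht
  rw [← toReal_enorm]
  refine ENNReal.toReal_mono hu.2.ne ?_
  rwa [eLpNorm_exponent_top]

theorem IsTrajectory.integrable (hsm : P.Smooth) {x : ℝ → Vec n} {u : ℝ → Vec m}
    (hx : ContinuousOn x (Icc 0 P.T)) (hu : P.IsControl u) :
    Integrable (fun t => P.f (x t) (u t)) (volOn P.T) := by
  have hf1 : ContinuousOn (fun t => P.f₁ (x t)) (Icc 0 P.T) :=
    hsm.f₁.continuous.comp_continuousOn hx
  have hf2 : ContinuousOn (fun t => P.f₂ (x t)) (Icc 0 P.T) :=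
    hsm.f₂.continuous.comp_continuousOn hx
  refine Integrable.add (hf1.integrableOn_Icc) ?_
  obtain ⟨B, hB⟩ := isCompact_Icc.exists_bound_of_continuousOn hf2
  refine (ContinuousLinearMap.id ℝ (Vec m →L[ℝ] Vec n)).integrable_of_bilin_of_bdd_left B
    (hf2.aestronglyMeasurable measurableSet_Icc) ?_ (MemLp.integrable (μ := volOn P.T) le_top hu)
  filter_upwards [ae_volOn_mem] with t ht using hB t ht

/-- Uniqueness of the solution of the state equation. -/
theorem IsTrajectory.eqOn (hT : 0 ≤ P.T) (hsm : P.Smooth) {x y : ℝ → Vec n} {u : ℝ → Vec m}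
    (hx : P.IsTrajectory x u) (hy : P.IsTrajectory y u) (h0 : x 0 = y 0) :
    EqOn x y (Icc 0 P.T) := by
  obtain ⟨B₁, hB₁⟩ := isCompact_Icc.exists_bound_of_continuousOn hx.continuousOn
  obtain ⟨B₂, hB₂⟩ := isCompact_Icc.exists_bound_of_continuousOn hy.continuousOn
  set B := max B₁ B₂
  have hxB : ∀ t ∈ Icc 0 P.T, x t ∈ Metric.closedBall (0 : Vec n) B := fun t ht =>
    mem_closedBall_zero_iff.2 ((hB₁ t ht).trans (le_max_left _ _))
  have hyB : ∀ t ∈ Icc 0 P.T, y t ∈ Metric.closedBall (0 : Vec n) B := fun t ht =>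
    mem_closedBall_zero_iff.2 ((hB₂ t ht).trans (le_max_right _ _))
  obtain ⟨K₁, hK₁⟩ := ((hsm.f₁.of_le
    one_le_two).locallyLipschitz.locallyLipschitzOn).exists_lipschitzOnWith_of_compact
    (isCompact_closedBall (0 : Vec n) B)
  obtain ⟨K₂, hK₂⟩ := ((hsm.f₂.of_le
    one_le_two).locallyLipschitz.locallyLipschitzOn).exists_lipschitzOnWith_of_compact
    (isCompact_closedBall (0 : Vec n) B)
  obtain ⟨U, hU0, hU⟩ := memLp_top_ae_bound (T := P.T) hx.control
  have hdc : ContinuousOn (fun t => ‖x t - y t‖) (Icc 0 P.T) :=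
    (hx.continuousOn.sub hy.continuousOn).norm
  have hI : Integrable (fun t => ‖x t - y t‖) (volOn P.T) := hdc.integrableOn_Icc
  have hkey := le_mul_exp_of_le_add_mul_integral (L := K₁ + K₂ * U) (c := 0) hT (by positivity) hdc
    (fun t _ => norm_nonneg _) (by
    intro t ht
    have h0m : (0 : ℝ) ∈ Icc 0 P.T := ⟨le_rfl, hT⟩
    have e : x t - y t = ∫ s in (0 : ℝ)..t, (P.f (x s) (u s) - P.f (y s) (u s)) := by
      rw [hx.integral_eq t ht, hy.integral_eq t ht, h0, intervalIntegral.integral_sub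
        (integrable_volOn_intervalIntegrable
          (IsTrajectory.integrable hsm hx.continuousOn hx.control) h0m ht)
        (integrable_volOn_intervalIntegrable
          (IsTrajectory.integrable hsm hy.continuousOn hy.control) h0m ht)]
      abel
    rw [e, zero_add, ← intervalIntegral.integral_const_mul]
    refine intervalIntegral.norm_integral_le_of_norm_le ht.1 ?_
      ((integrable_volOn_intervalIntegrable hI h0m ht).const_mul _)
    have hU' : ∀ᵐ s, s ∈ Icc 0 P.T → ‖u s‖ ≤ U := (ae_restrict_iff' measurableSet_Icc).1 hU
    filter_upwards [hU'] with s hs hst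
    have hsm' : s ∈ Icc 0 P.T := ⟨hst.1.le, hst.2.trans ht.2⟩
    have e2 : P.f (x s) (u s) - P.f (y s) (u s)
        = (P.f₁ (x s) - P.f₁ (y s)) + (P.f₂ (x s) - P.f₂ (y s)) (u s) := by
      simp only [OCP.f, sub_apply]; abel
    have h1 := hK₁.norm_sub_le (hxB s hsm') (hyB s hsm')
    have h2 := hK₂.norm_sub_le (hxB s hsm') (hyB s hsm')
    rw [e2]
    calc _ ≤ ‖P.f₁ (x s) - P.f₁ (y s)‖ + ‖P.f₂ (x s) - P.f₂ (y s)‖ * ‖u s‖ :=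
          (norm_add_le _ _).trans (by gcongr; exact ContinuousLinearMap.le_opNorm _ _)
      _ ≤ K₁ * ‖x s - y s‖ + (K₂ * ‖x s - y s‖) * U := by
          gcongr
          exact hs hsm'
      _ = (K₁ + K₂ * U) * ‖x s - y s‖ := by ring)
  exact fun t ht => sub_eq_zero.1 (norm_le_zero_iff.1 ((hkey t ht).trans_eq (zero_mul _)))

/-- Admissible trajectories are uniformly bounded. -/
theorem exists_admissible_bound (hT : 0 ≤ P.T) (hsm : P.Smooth) (hbdd : P.BoundedAdmissible)
    (hstates : P.BoundedStates) : ∃ R : ℝ, 0 ≤ R ∧ ∀ x u, P.IsAdmissible x u →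
      (∀ t ∈ Icc 0 P.T, ‖x t‖ ≤ R) ∧ ∀ᵐ t ∂volOn P.T, ‖u t‖ ≤ R := by
  obtain ⟨R, hR⟩ := hbdd
  obtain ⟨Rx, hRx⟩ := hstates (R * P.T + R)
  refine ⟨max 0 (max R Rx), le_max_left _ _, fun x u hxu => ?_⟩
  obtain ⟨h1, h2⟩ := hR x u hxu
  refine ⟨?_, ?_⟩
  · obtain ⟨y, hy, hy0, hyb⟩ := hRx u (x 0) hxu.control (by
      refine add_le_add ?_ h2
      have h3 : ∫ t, ‖u t‖ ∂volOn P.T ≤ ∫ _, R ∂volOn P.T :=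
        integral_mono_ae (MemLp.integrable (μ := volOn P.T) le_top hxu.control).norm
          (integrable_const R) h1
      refine h3.trans (le_of_eq ?_)
      simp [hT, mul_comm])
    intro t ht
    rw [IsTrajectory.eqOn hT hsm hxu.toIsTrajectory hy hy0.symm ht]
    exact (hyb t ht).trans ((le_max_right _ _).trans (le_max_right _ _))
  · have h1' : ∀ᵐ t ∂volOn P.T, ‖u t‖ ≤ R := h1
    filter_upwards [h1'] with t ht
    exact ht.trans ((le_max_left _ _).trans (le_max_right _ _))

end Bounds

end OCP
end

noncomputable section

section UniformLimits

open Topology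

variable {n m : ℕ} {T : ℝ}

theorem tendstoUniformlyOn_comp_of_bound {F : Type*} [PseudoMetricSpace F] {S : Set ℝ} {R : ℝ}
    {G : Vec n → F} (hG : Continuous G) {x : ℕ → ℝ → Vec n} {xbar : ℝ → Vec n}
    (hx : ∀ k, ∀ t ∈ S, ‖x k t‖ ≤ R) (hxbar : ∀ t ∈ S, ‖xbar t‖ ≤ R)
    (h : TendstoUniformlyOn x xbar atTop S) :
    TendstoUniformlyOn (fun k t => G (x k t)) (fun t => G (xbar t)) atTop S :=
  UniformContinuousOn.comp_tendstoUniformlyOn_eventually (s := Metric.closedBall (0 : Vec n) R)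
    (Eventually.of_forall fun k t ht => mem_closedBall_zero_iff.2 (hx k t ht))
    (fun t ht => mem_closedBall_zero_iff.2 (hxbar t ht))
    ((isCompact_closedBall _ _).uniformContinuousOn_of_continuous hG.continuousOn) h

theorem tendsto_L1_of_tendstoUniformlyOn {E : Type*} [NormedAddCommGroup E] (hT : 0 ≤ T)
    {f : ℕ → ℝ → E} {fbar : ℝ → E} (h : TendstoUniformlyOn f fbar atTop (Icc 0 T)) :
    Tendsto (fun k => ∫ t, ‖f k t - fbar t‖ ∂volOn T) atTop (𝓝 0) := by
  rw [Metric.tendsto_atTop]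
  intro ε hε
  obtain ⟨N, hN⟩ := eventually_atTop.1 (Metric.tendstoUniformlyOn_iff.1 h (ε / (T + 1))
    (by positivity))
  refine ⟨N, fun k hk => ?_⟩
  rw [dist_zero_right]
  have h1 : ‖∫ t, ‖f k t - fbar t‖ ∂volOn T‖ ≤ ∫ t, ε / (T + 1) ∂volOn T := by
    refine norm_integral_le_of_norm_le (integrable_const _) ?_
    filter_upwards [ae_volOn_mem] with t ht
    rw [norm_norm, ← dist_eq_norm, dist_comm]
    exact (hN k hk t ht).le
  refine h1.trans_lt ?_
  simp only [integral_const, measureReal_restrict_apply_univ, Real.volume_real_Icc, sub_zero,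
    smul_eq_mul, max_eq_left hT]
  rw [mul_div_assoc', div_lt_iff₀ (by linarith)]
  nlinarith

theorem intervalIntegral_inner_eq {w v : ℝ → Vec n} {a b : ℝ} (ha : 0 ≤ a) (hab : a ≤ b)
    (hb : b ≤ T) : ∫ s in a..b, inner ℝ (w s) (v s)
      = ∫ s, inner ℝ ((Ioc a b).indicator w s) (v s) ∂volOn T := by
  rw [intervalIntegral_eq_volOn ha hab hb, ← integral_indicator measurableSet_Ioc]
  refine integral_congr_ae (Eventually.of_forall fun s => ?_)
  by_cases h : s ∈ Ioc a b <;> simp [h]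

theorem inner_intervalIntegral {w : ℝ → Vec n} (hw : Integrable w (volOn T)) (e : Vec n) {a b : ℝ}
    (ha : a ∈ Icc 0 T) (hb : b ∈ Icc 0 T) :
    inner ℝ e (∫ s in a..b, w s) = ∫ s in a..b, inner ℝ e (w s) :=
  ((innerSL ℝ e).intervalIntegral_comp_comm (integrable_volOn_intervalIntegrable hw ha hb)).symm

/-- Weak limits on subintervals. -/
theorem BddWeakLim.tendsto_intervalIntegral_inner {R : ℝ} {u : ℕ → ℝ → Vec m} {ubar : ℝ → Vec m}
    (h : BddWeakLim T R u ubar) {w : ℕ → ℝ → Vec m} {wbar : ℝ → Vec m}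
    (hw : ∀ k, Integrable (w k) (volOn T)) (hwbar : MemLp wbar 2 (volOn T))
    (hlim : Tendsto (fun k => ∫ t, ‖w k t - wbar t‖ ∂volOn T) atTop (𝓝 0)) {a b : ℝ}
    (ha : 0 ≤ a) (hab : a ≤ b) (hb : b ≤ T) :
    Tendsto (fun k => ∫ t in a..b, inner ℝ (w k t) (u k t)) atTop
      (𝓝 (∫ t in a..b, inner ℝ (wbar t) (ubar t))) := by
  simp only [intervalIntegral_inner_eq ha hab hb]
  refine h.tendsto_inner (fun k => (hw k).indicator measurableSet_Ioc)
    (hwbar.indicator measurableSet_Ioc) ?_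
  refine squeeze_zero (fun k => integral_nonneg fun _ => norm_nonneg _) (fun k => ?_) hlim
  refine integral_mono_of_nonneg (Eventually.of_forall fun _ => norm_nonneg _)
    ((hw k).sub (memLp_two_integrable hwbar)).norm (Eventually.of_forall fun t => ?_)
  by_cases h : t ∈ Ioc a b <;> simp [h]

theorem BddWeakLim.tendsto_intervalIntegral {R : ℝ} {u : ℕ → ℝ → Vec m} {ubar : ℝ → Vec m}
    (h : BddWeakLim T R u ubar) {a b : ℝ} (ha : 0 ≤ a) (hab : a ≤ b) (hb : b ≤ T) :
    Tendsto (fun k => ∫ t in a..b, u k t) atTop (𝓝 (∫ t in a..b, ubar t)) := by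
  refine tendsto_vec_of_inner fun e => ?_
  have hi : ∀ k, Integrable (u k) (volOn T) := fun k => Integrable.of_bound (h.meas k) R (h.bound k)
  have hib : Integrable ubar (volOn T) := Integrable.of_bound h.meas_lim R h.bound_lim
  have ham : a ∈ Icc 0 T := ⟨ha, hab.trans hb⟩
  have hbm : b ∈ Icc 0 T := ⟨ha.trans hab, hb⟩
  have h1 := h.tendsto_intervalIntegral_inner (w := fun _ _ => e) (wbar := fun _ => e)
    (fun _ => integrable_const e) (memLp_const e) (by simp) ha hab hb
  rw [inner_intervalIntegral hib e ham hbm]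
  exact h1.congr fun k => (inner_intervalIntegral (hi k) e ham hbm).symm

end UniformLimits

namespace OCP

open Topology

variable {n m nh ng nc : ℕ} {P : OCP n m nh ng nc}

theorem memLp_continuousOn {T : ℝ} {E : Type*} [NormedAddCommGroup E] {f : ℝ → E}
    (hf : ContinuousOn f (Icc 0 T)) (q : ENNReal) : MemLp f q (volOn T) := by
  obtain ⟨B, hB⟩ := isCompact_Icc.exists_bound_of_continuousOn hf
  refine MemLp.of_bound (hf.aestronglyMeasurable_of_isCompact isCompact_Icc measurableSet_Icc) B ?_
  filter_upwards [ae_volOn_mem] with t ht using hB t ht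

theorem memLp_top_clm_apply {T : ℝ} {E F : Type*} [NormedAddCommGroup E] [NormedSpace ℝ E]
    [NormedAddCommGroup F] [NormedSpace ℝ F] {K : ℝ → E →L[ℝ] F} {v : ℝ → E} {q : ENNReal}
    (hK : MemLp K ⊤ (volOn T)) (hv : MemLp v q (volOn T)) :
    MemLp (fun t => K t (v t)) q (volOn T) :=
  (ContinuousLinearMap.id ℝ (E →L[ℝ] F)).memLp_of_bilin q hK hv

/-- Integrals of the dynamics pass to the limit. -/
theorem tendsto_integral_dynamics (hT : 0 ≤ P.T) (hsm : P.Smooth) {R : ℝ}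
    {x : ℕ → ℝ → Vec n} {u : ℕ → ℝ → Vec m} {xbar : ℝ → Vec n} {ubar : ℝ → Vec m}
    (hxc : ∀ k, ContinuousOn (x k) (Icc 0 P.T)) (hxbc : ContinuousOn xbar (Icc 0 P.T))
    (hx : ∀ k, ∀ t ∈ Icc 0 P.T, ‖x k t‖ ≤ R) (hxbar : ∀ t ∈ Icc 0 P.T, ‖xbar t‖ ≤ R)
    (h : TendstoUniformlyOn x xbar atTop (Icc 0 P.T)) (hu : BddWeakLim P.T R u ubar)
    {t : ℝ} (ht : t ∈ Icc 0 P.T) :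
    Tendsto (fun k => ∫ s in (0 : ℝ)..t, P.f (x k s) (u k s)) atTop
      (𝓝 (∫ s in (0 : ℝ)..t, P.f (xbar s) (ubar s))) := by
  have h0 : (0 : ℝ) ∈ Icc 0 P.T := ⟨le_rfl, hT⟩
  have huL : ∀ k, P.IsControl (u k) := fun k => memLp_top_of_bound (hu.meas k) R (hu.bound k)
  have hubL : P.IsControl ubar := memLp_top_of_bound hu.meas_lim R hu.bound_lim
  have hf1 : ∀ y : ℝ → Vec n, ContinuousOn y (Icc 0 P.T) →
      ContinuousOn (fun t => P.f₁ (y t)) (Icc 0 P.T) := fun y hy =>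
    hsm.f₁.continuous.comp_continuousOn hy
  have hf2 : ∀ (e : Vec n) (y : ℝ → Vec n), ContinuousOn y (Icc 0 P.T) →
      ContinuousOn (fun t => (P.f₂ (y t)).adjoint e) (Icc 0 P.T) := fun e y hy =>
    (((ContinuousLinearMap.adjoint (𝕜 := ℝ) (E := Vec m) (F := Vec n)).continuous.comp
      hsm.f₂.continuous).clm_apply continuous_const).comp_continuousOn hy
  refine tendsto_vec_of_inner fun e => ?_
  have hsplit : ∀ (y : ℝ → Vec n) (v : ℝ → Vec m), ContinuousOn y (Icc 0 P.T) → P.IsControl v →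
      inner ℝ e (∫ s in (0 : ℝ)..t, P.f (y s) (v s)) = inner ℝ e (∫ s in (0 : ℝ)..t, P.f₁ (y s))
        + ∫ s in (0 : ℝ)..t, inner ℝ ((P.f₂ (y s)).adjoint e) (v s) := by
    intro y v hy hv
    have hi1 : Integrable (fun s => P.f₁ (y s)) (volOn P.T) := (hf1 y hy).integrableOn_Icc
    have hi2 : Integrable (fun s => inner ℝ ((P.f₂ (y s)).adjoint e) (v s)) (volOn P.T) :=
      memLp_one_iff_integrable.1 ((innerSL ℝ : Vec m →L[ℝ] Vec m →L[ℝ] ℝ).memLp_of_bilin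
        1 (memLp_continuousOn (hf2 e y hy) 1) (show MemLp v ⊤ (volOn P.T) from hv))
    rw [inner_intervalIntegral (IsTrajectory.integrable hsm hy hv) e h0 ht,
      inner_intervalIntegral hi1 e h0 ht, ← intervalIntegral.integral_add
        (integrable_volOn_intervalIntegrable (hi1.const_inner e) h0 ht)
        (integrable_volOn_intervalIntegrable hi2 h0 ht)]
    refine intervalIntegral.integral_congr fun s _ => ?_
    simp only [OCP.f, inner_add_right, ContinuousLinearMap.adjoint_inner_left]
  rw [hsplit xbar ubar hxbc hubL]
  simp only [fun k => hsplit (x k) (u k) (hxc k) (huL k)]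
  refine Tendsto.add ?_ ?_
  · refine ((innerSL ℝ e).continuous.tendsto _).comp ?_
    have h1 := tendsto_L1_of_tendstoUniformlyOn hT
      (tendstoUniformlyOn_comp_of_bound hsm.f₁.continuous hx hxbar h)
    rw [tendsto_iff_norm_sub_tendsto_zero]
    refine squeeze_zero (fun k => norm_nonneg _) (fun k => ?_) h1
    rw [← intervalIntegral.integral_sub
      (integrable_volOn_intervalIntegrable (hf1 _ (hxc k)).integrableOn_Icc h0 ht)
      (integrable_volOn_intervalIntegrable (hf1 _ hxbc).integrableOn_Icc h0 ht)]
    exact norm_intervalIntegral_le_volOn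
      (((hf1 _ (hxc k)).sub (hf1 _ hxbc)).integrableOn_Icc) h0 ht
  · exact hu.tendsto_intervalIntegral_inner (fun k => (hf2 e _ (hxc k)).integrableOn_Icc)
      (memLp_continuousOn (hf2 e _ hxbc) 2)
      (tendsto_L1_of_tendstoUniformlyOn hT (tendstoUniformlyOn_comp_of_bound
        (((ContinuousLinearMap.adjoint (𝕜 := ℝ) (E := Vec m) (F := Vec n)).continuous.comp
      hsm.f₂.continuous).clm_apply continuous_const) hx hxbar h)) le_rfl ht.1 ht.2

/-- A mixed constraint passes to the limit. -/
theorem tendsto_setIntegral_mixed (hT : 0 ≤ P.T) (hsm : P.Smooth) {R : ℝ}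
    {x : ℕ → ℝ → Vec n} {u : ℕ → ℝ → Vec m} {xbar : ℝ → Vec n} {ubar : ℝ → Vec m}
    (hxc : ∀ k, ContinuousOn (x k) (Icc 0 P.T)) (hxbc : ContinuousOn xbar (Icc 0 P.T))
    (hx : ∀ k, ∀ t ∈ Icc 0 P.T, ‖x k t‖ ≤ R) (hxbar : ∀ t ∈ Icc 0 P.T, ‖xbar t‖ ≤ R)
    (h : TendstoUniformlyOn x xbar atTop (Icc 0 P.T)) (hu : BddWeakLim P.T R u ubar)
    (i : Fin nc) {S : Set ℝ} (hS : MeasurableSet S) :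
    Tendsto (fun k => ∫ s in S, P.c i (x k s) (u k s) ∂volOn P.T) atTop
      (𝓝 (∫ s in S, P.c i (xbar s) (ubar s) ∂volOn P.T)) := by
  have ha : ∀ y : ℝ → Vec n, ContinuousOn y (Icc 0 P.T) →
      ContinuousOn (fun t => P.a i (y t)) (Icc 0 P.T) := fun y hy =>
    (hsm.a i).continuous.comp_continuousOn hy
  have hb : ∀ y : ℝ → Vec n, ContinuousOn y (Icc 0 P.T) →
      ContinuousOn (fun t => P.b i (y t)) (Icc 0 P.T) := fun y hy =>
    (hsm.b i).continuous.comp_continuousOn hy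
  have hsplit : ∀ (y : ℝ → Vec n) (v : ℝ → Vec m), ContinuousOn y (Icc 0 P.T) →
      AEStronglyMeasurable v (volOn P.T) → (∀ᵐ t ∂volOn P.T, ‖v t‖ ≤ R) →
      ∫ s in S, P.c i (y s) (v s) ∂volOn P.T
        = ∫ s, inner ℝ (S.indicator (fun s => P.a i (y s)) s) (v s) ∂volOn P.T
          + ∫ s in S, P.b i (y s) ∂volOn P.T := by
    intro y v hy hv hvb
    rw [← integral_indicator hS, ← integral_indicator hS, ← integral_add]
    · refine integral_congr_ae (Eventually.of_forall fun s => ?_)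
      by_cases h : s ∈ S <;> simp [h, OCP.c]
    · exact integrable_inner_of_bounded ((ha y hy).integrableOn_Icc.indicator hS) hv hvb
    · exact Integrable.indicator (hb y hy).integrableOn_Icc hS
  rw [hsplit xbar ubar hxbc hu.meas_lim hu.bound_lim]
  simp only [fun k => hsplit (x k) (u k) (hxc k) (hu.meas k) (hu.bound k)]
  refine Tendsto.add ?_ ?_
  · refine hu.tendsto_inner (fun k => Integrable.indicator (ha _ (hxc k)).integrableOn_Icc hS)
      ((memLp_continuousOn (ha _ hxbc) 2).indicator hS) ?_
    refine squeeze_zero (fun k => integral_nonneg fun _ => norm_nonneg _) (fun k => ?_)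
      (tendsto_L1_of_tendstoUniformlyOn hT (tendstoUniformlyOn_comp_of_bound
        (hsm.a i).continuous hx hxbar h))
    refine integral_mono_of_nonneg (Eventually.of_forall fun _ => norm_nonneg _)
      (((ha _ (hxc k)).sub (ha _ hxbc)).norm.integrableOn_Icc) (Eventually.of_forall fun t => ?_)
    by_cases h : t ∈ S <;> simp [h]
  · rw [tendsto_iff_norm_sub_tendsto_zero]
    refine squeeze_zero (fun k => norm_nonneg _) (fun k => ?_)
      (tendsto_L1_of_tendstoUniformlyOn hT (tendstoUniformlyOn_comp_of_bound
        (hsm.b i).continuous hx hxbar h))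
    have hi : Integrable (fun s => P.b i (x k s) - P.b i (xbar s)) (volOn P.T) :=
      ((hb _ (hxc k)).sub (hb _ hxbc)).integrableOn_Icc
    rw [← integral_sub (Integrable.restrict (hb _ (hxc k)).integrableOn_Icc)
      (Integrable.restrict (hb _ hxbc).integrableOn_Icc)]
    exact (norm_integral_le_integral_norm _).trans (setIntegral_le_integral hi.norm
      (Eventually.of_forall fun _ => norm_nonneg _))

/-- Sequential compactness of the set of admissible trajectories. -/
theorem exists_admissible_limit (hT : 0 ≤ P.T) (hsm : P.Smooth) {R : ℝ} (hR0 : 0 ≤ R)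
    (hR : ∀ x u, P.IsAdmissible x u →
      (∀ t ∈ Icc 0 P.T, ‖x t‖ ≤ R) ∧ ∀ᵐ t ∂volOn P.T, ‖u t‖ ≤ R)
    (x : ℕ → ℝ → Vec n) (u : ℕ → ℝ → Vec m) (hxu : ∀ k, P.IsAdmissible (x k) (u k)) :
    ∃ (φ : ℕ → ℕ) (xbar : ℝ → Vec n) (ubar : ℝ → Vec m), StrictMono φ ∧
      P.IsAdmissible xbar ubar ∧
      TendstoUniformlyOn (fun k => x (φ k)) xbar atTop (Icc 0 P.T) ∧
      BddWeakLim P.T R (fun k => u (φ k)) ubar := by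
  have h0 : (0 : ℝ) ∈ Icc 0 P.T := ⟨le_rfl, hT⟩
  have hTm : P.T ∈ Icc 0 P.T := ⟨hT, le_rfl⟩
  have hxc := fun k => (hxu k).continuousOn
  have hx := fun k => (hR _ _ (hxu k)).1
  have hub := fun k => (hR _ _ (hxu k)).2
  have hum : ∀ k, AEStronglyMeasurable (u k) (volOn P.T) := fun k => (hxu k).control.1
  -- bound on the velocities
  obtain ⟨B₁, hB₁⟩ := (isCompact_closedBall (0 : Vec n) R).exists_bound_of_continuousOn
    hsm.f₁.continuous.continuousOn
  obtain ⟨B₂, hB₂⟩ := (isCompact_closedBall (0 : Vec n) R).exists_bound_of_continuousOn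
    hsm.f₂.continuous.continuousOn
  have hxm : ∀ k, ∀ t ∈ Icc 0 P.T, x k t ∈ Metric.closedBall (0 : Vec n) R := fun k t ht =>
    mem_closedBall_zero_iff.2 (hx k t ht)
  have hB₁0 : 0 ≤ B₁ := (norm_nonneg _).trans (hB₁ _ (hxm 0 0 h0))
  have hB₂0 : 0 ≤ B₂ := (norm_nonneg _).trans (hB₂ _ (hxm 0 0 h0))
  set C : ℝ := B₁ + B₂ * R with hC
  have hC0 : 0 ≤ C := by positivity
  have hvel : ∀ k, ∀ᵐ t ∂volOn P.T, ‖P.f (x k t) (u k t)‖ ≤ C := by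
    intro k
    filter_upwards [ae_volOn_mem, hub k] with t ht hut
    refine (norm_add_le _ _).trans (add_le_add (hB₁ _ (hxm k t ht)) ?_)
    refine (ContinuousLinearMap.le_opNorm _ _).trans ?_
    exact mul_le_mul (hB₂ _ (hxm k t ht)) hut (norm_nonneg _) hB₂0
  have hfi : ∀ k, Integrable (fun t => P.f (x k t) (u k t)) (volOn P.T) := fun k =>
    IsTrajectory.integrable hsm (hxc k) (hxu k).control
  obtain ⟨ubar, φ₁, hφ₁, hu₁⟩ := exists_bddWeakLim hR0 u hum hub
  obtain ⟨wbar, φ₂, hφ₂, hw₂⟩ := exists_bddWeakLim hC0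
    (fun k t => P.f (x (φ₁ k) t) (u (φ₁ k) t)) (fun k => (hfi _).1) (fun k => hvel _)
  obtain ⟨ξ, -, φ₃, hφ₃, hξ⟩ := tendsto_subseq_of_bounded
    (Metric.isBounded_closedBall (x := (0 : Vec n)) (r := R))
    (x := fun k => x (φ₁ (φ₂ k)) 0) (fun k => hxm _ _ h0)
  set φ : ℕ → ℕ := fun k => φ₁ (φ₂ (φ₃ k)) with hφdef
  have hφ : StrictMono φ := hφ₁.comp (hφ₂.comp hφ₃)
  have hu : BddWeakLim P.T R (fun k => u (φ k)) ubar := hu₁.comp (hφ₂.comp hφ₃)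
  have hw : BddWeakLim P.T C (fun k t => P.f (x (φ k) t) (u (φ k) t)) wbar := hw₂.comp hφ₃
  have hwi : Integrable wbar (volOn P.T) := Integrable.of_bound hw.meas_lim C hw.bound_lim
  set xbar : ℝ → Vec n := fun t => ξ + ∫ s in (0 : ℝ)..t, wbar s with hxbar
  have hptw : ∀ t ∈ Icc 0 P.T, Tendsto (fun k => x (φ k) t) atTop (𝓝 (xbar t)) := by
    intro t ht
    refine (hξ.add (hw.tendsto_intervalIntegral le_rfl ht.1 ht.2)).congr fun k => ?_
    exact ((hxu (φ k)).integral_eq t ht).symm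
  have hxbc : ContinuousOn xbar (Icc 0 P.T) :=
    continuousOn_const.add (continuousOn_intervalIntegral_volOn hwi hT)
  have hxbb : ∀ t ∈ Icc 0 P.T, ‖xbar t‖ ≤ R := fun t ht =>
    le_of_tendsto' (hptw t ht).norm fun k => hx _ t ht
  have hlip : ∀ k, LipschitzOnWith ⟨C, hC0⟩ (x k) (Icc 0 P.T) := by
    intro k
    refine LipschitzOnWith.of_dist_le_mul fun s hs t ht => ?_
    rw [dist_eq_norm, dist_comm, Real.dist_eq, (hxu k).integral_eq s hs, (hxu k).integral_eq t ht,
      add_sub_add_left_eq_sub, intervalIntegral.integral_interval_sub_left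
        (integrable_volOn_intervalIntegrable (hfi k) h0 hs)
        (integrable_volOn_intervalIntegrable (hfi k) h0 ht), abs_sub_comm]
    refine intervalIntegral.norm_integral_le_of_norm_le_const_ae ?_
    filter_upwards [(ae_restrict_iff' measurableSet_Icc).1 (hvel k)] with r hr hrm
    exact hr (uIcc_subset_Icc ht hs (uIoc_subset_uIcc hrm))
  have hequi : EquicontinuousOn (fun k => x (φ k)) (Icc 0 P.T) :=
    (LipschitzOnWith.uniformEquicontinuousOn (fun k => x (φ k)) ⟨C, hC0⟩
      (fun k => hlip (φ k))).equicontinuousOn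
  have hunif : TendstoUniformlyOn (fun k => x (φ k)) xbar atTop (Icc 0 P.T) := by
    have h1 := (EquicontinuousOn.tendsto_uniformOnFun_iff_pi' (𝔖 := {Icc 0 P.T})
      (F := fun k => x (φ k)) (by simpa using isCompact_Icc) (by simpa using hequi)
      atTop xbar).2 (by
        rw [tendsto_pi_nhds]
        rintro ⟨t, ht⟩
        exact hptw t (by simpa using ht))
    exact (UniformOnFun.tendsto_iff_tendstoUniformlyOn.1 h1) _ rfl
  refine ⟨φ, xbar, ubar, hφ, ⟨⟨⟨?_, hxbc, ?_⟩, ?_⟩, ?_, ?_⟩, hunif, hu⟩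
  · exact memLp_top_of_bound hu.meas_lim R hu.bound_lim
  · intro t ht
    refine tendsto_nhds_unique (hptw t ht) ?_
    refine ((hptw 0 h0).add (tendsto_integral_dynamics hT hsm (fun k => hxc _) hxbc
      (fun k => hx _) hxbb hunif hu ht)).congr fun k => ?_
    exact ((hxu (φ k)).integral_eq t ht).symm
  · refine tendsto_nhds_unique ((hsm.h_C1.continuous.tendsto _).comp
      ((hptw 0 h0).prodMk_nhds (hptw P.T hTm))) ?_
    refine tendsto_const_nhds.congr fun k => ?_
    exact ((hxu (φ k)).initial_final).symm
  · intro t ht i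
    exact le_of_tendsto' (((hsm.g_C2 i).continuous.tendsto _).comp (hptw t ht))
      fun k => (hxu (φ k)).state_le t ht i
  · have hci : ∀ i, Integrable (fun t => P.c i (xbar t) (ubar t)) (volOn P.T) := fun i =>
      (integrable_inner_of_bounded
        ((hsm.a i).continuous.comp_continuousOn hxbc).integrableOn_Icc hu.meas_lim hu.bound_lim).add
        ((hsm.b i).continuous.comp_continuousOn hxbc).integrableOn_Icc
    refine ae_all_iff.2 fun i => ?_
    have hneg : ∀ᵐ t ∂volOn P.T, 0 ≤ -P.c i (xbar t) (ubar t) := by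
      refine ae_nonneg_of_forall_setIntegral_nonneg (hci i).neg fun S hS _ => ?_
      rw [integral_neg, neg_nonneg]
      refine le_of_tendsto' (tendsto_setIntegral_mixed hT hsm (fun k => hxc _) hxbc
        (fun k => hx _) hxbb hunif hu i hS) fun k => ?_
      refine integral_nonpos_of_ae (ae_restrict_of_ae ?_)
      have := (hxu (φ k)).mixed_le
      filter_upwards [this] with t ht using ht i
    exact hneg.mono fun t ht => neg_nonneg.1 ht

end OCP
end

noncomputable section

namespace OCP

open Topology

variable {n m nh ng nc : ℕ} {P : OCP n m nh ng nc}

/-- States that converge uniformly, along with controls that converge weakly, all of them being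
bounded by `R`. -/
structure StateLim (T R : ℝ) (x : ℕ → ℝ → Vec n) (u : ℕ → ℝ → Vec m) (xbar : ℝ → Vec n)
    (ubar : ℝ → Vec m) : Prop where
  cont : ∀ k, ContinuousOn (x k) (Icc 0 T)
  cont_lim : ContinuousOn xbar (Icc 0 T)
  bound : ∀ k, ∀ t ∈ Icc 0 T, ‖x k t‖ ≤ R
  bound_lim : ∀ t ∈ Icc 0 T, ‖xbar t‖ ≤ R
  unif : TendstoUniformlyOn x xbar atTop (Icc 0 T)
  weak : BddWeakLim T R u ubar

section

variable {T R : ℝ} {x : ℕ → ℝ → Vec n} {u : ℕ → ℝ → Vec m} {xbar : ℝ → Vec n} {ubar : ℝ → Vec m}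

theorem _root_.tendstoUniformlyOn_subseq {F : Type*} [PseudoMetricSpace F] {S : Set ℝ}
    {x : ℕ → ℝ → F} {xbar : ℝ → F} (h : TendstoUniformlyOn x xbar atTop S) {φ : ℕ → ℕ}
    (hφ : StrictMono φ) : TendstoUniformlyOn (fun k => x (φ k)) xbar atTop S := by
  intro s hs
  exact hφ.tendsto_atTop.eventually (h s hs)

theorem StateLim.comp (h : StateLim T R x u xbar ubar) {φ : ℕ → ℕ} (hφ : StrictMono φ) :
    StateLim T R (fun k => x (φ k)) (fun k => u (φ k)) xbar ubar :=
  ⟨fun _ => h.cont _, h.cont_lim, fun _ => h.bound _, h.bound_lim,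
    tendstoUniformlyOn_subseq h.unif hφ, h.weak.comp hφ⟩

theorem StateLim.unif_comp (h : StateLim T R x u xbar ubar) {F : Type*} [PseudoMetricSpace F]
    {G : Vec n → F} (hG : Continuous G) :
    TendstoUniformlyOn (fun k t => G (x k t)) (fun t => G (xbar t)) atTop (Icc 0 T) :=
  tendstoUniformlyOn_comp_of_bound hG h.bound h.bound_lim h.unif

theorem StateLim.tendsto_at (h : StateLim T R x u xbar ubar) {t : ℝ} (ht : t ∈ Icc 0 T) :
    Tendsto (fun k => x k t) atTop (𝓝 (xbar t)) := h.unif.tendsto_at ht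

theorem integrable_clm_apply {E F : Type*} [NormedAddCommGroup E] [NormedSpace ℝ E]
    [NormedAddCommGroup F] [NormedSpace ℝ F] {K : ℝ → E →L[ℝ] F} {q : ℝ → E}
    (hK : ContinuousOn K (Icc 0 T)) (hq : Integrable q (volOn T)) :
    Integrable (fun t => K t (q t)) (volOn T) :=
  memLp_one_iff_integrable.1
    (memLp_top_clm_apply (memLp_continuousOn hK ⊤) (memLp_one_iff_integrable.2 hq))

/-- Integrals on subintervals pass to the `L¹` limit. -/
theorem tendsto_intervalIntegral_of_L1 {E : Type*} [NormedAddCommGroup E] [NormedSpace ℝ E]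
    {q : ℕ → ℝ → E} {qbar : ℝ → E}
    (hq : ∀ k, Integrable (q k) (volOn T)) (hqbar : Integrable qbar (volOn T))
    (hlim : Tendsto (fun k => ∫ t, ‖q k t - qbar t‖ ∂volOn T) atTop (𝓝 0)) {a b : ℝ}
    (ha : a ∈ Icc 0 T) (hb : b ∈ Icc 0 T) :
    Tendsto (fun k => ∫ t in a..b, q k t) atTop (𝓝 (∫ t in a..b, qbar t)) := by
  rw [tendsto_iff_norm_sub_tendsto_zero]
  refine squeeze_zero (fun k => norm_nonneg _) (fun k => ?_) hlim
  rw [← intervalIntegral.integral_sub (integrable_volOn_intervalIntegrable (hq k) ha hb)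
      (integrable_volOn_intervalIntegrable hqbar ha hb)]
  exact norm_intervalIntegral_le_volOn ((hq k).sub hqbar) ha hb

/-- Integrals that are affine in the control, with a factor that converges in `L¹`, pass to the
limit. -/
theorem StateLim.tendsto_affine (h : StateLim T R x u xbar ubar) {E : Type*}
    [NormedAddCommGroup E] [NormedSpace ℝ E] {q : ℕ → ℝ → E} {qbar : ℝ → E}
    (hq : ∀ k, Integrable (q k) (volOn T)) (hqbar : MemLp qbar ⊤ (volOn T))
    (hlim : Tendsto (fun k => ∫ t, ‖q k t - qbar t‖ ∂volOn T) atTop (𝓝 0))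
    {L₀ : Vec n → E →L[ℝ] ℝ} {L₁ : Vec n → E →L[ℝ] Vec m} (hL₀ : Continuous L₀)
    (hL₁ : Continuous L₁) {t : ℝ} (ht : t ∈ Icc 0 T) :
    Tendsto (fun k => ∫ s in t..T, (L₀ (x k s) (q k s) + inner ℝ (L₁ (x k s) (q k s)) (u k s)))
      atTop (𝓝 (∫ s in t..T, (L₀ (xbar s) (qbar s)
        + inner ℝ (L₁ (xbar s) (qbar s)) (ubar s)))) := by
  have hTm : T ∈ Icc 0 T := ⟨ht.1.trans ht.2, le_rfl⟩
  have hqi : Integrable qbar (volOn T) := hqbar.integrable le_top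
  have hc0 : ∀ k, ContinuousOn (fun s => L₀ (x k s)) (Icc 0 T) := fun k =>
    hL₀.comp_continuousOn (h.cont k)
  have hc1 : ∀ k, ContinuousOn (fun s => L₁ (x k s)) (Icc 0 T) := fun k =>
    hL₁.comp_continuousOn (h.cont k)
  have hb0 : ContinuousOn (fun s => L₀ (xbar s)) (Icc 0 T) := hL₀.comp_continuousOn h.cont_lim
  have hb1 : ContinuousOn (fun s => L₁ (xbar s)) (Icc 0 T) := hL₁.comp_continuousOn h.cont_lim
  have hi0 := fun k => integrable_clm_apply (hc0 k) (hq k)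
  have hi1 := fun k => integrable_clm_apply (hc1 k) (hq k)
  have hj0 := integrable_clm_apply hb0 hqi
  have hj1 := integrable_clm_apply hb1 hqi
  have hk1 := fun k => integrable_inner_of_bounded (hi1 k) (h.weak.meas k) (h.weak.bound k)
  have hl1 := integrable_inner_of_bounded hj1 h.weak.meas_lim h.weak.bound_lim
  rw [intervalIntegral.integral_add (integrable_volOn_intervalIntegrable hj0 ht hTm)
    (integrable_volOn_intervalIntegrable hl1 ht hTm)]
  simp only [fun k => intervalIntegral.integral_add
    (integrable_volOn_intervalIntegrable (hi0 k) ht hTm)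
    (integrable_volOn_intervalIntegrable (hk1 k) ht hTm)]
  refine Tendsto.add ?_ ?_
  · exact tendsto_intervalIntegral_of_L1 hi0 hj0
      (tendsto_L1_apply hb0 (h.unif_comp hL₀) hq hqi hlim) ht hTm
  · exact h.weak.tendsto_intervalIntegral_inner hi1
      ((memLp_top_clm_apply (memLp_continuousOn hb1 ⊤) hqbar).mono_exponent le_top)
      (tendsto_L1_apply hb1 (h.unif_comp hL₁) hq hqi hlim) ht.1 ht.2 le_rfl

end

section

variable {R : ℝ} {x : ℕ → ℝ → Vec n} {u : ℕ → ℝ → Vec m} {xbar : ℝ → Vec n} {ubar : ℝ → Vec m}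

theorem Smooth.continuous_fderiv_f₁ (h : P.Smooth) : Continuous (fderiv ℝ P.f₁) :=
  h.f₁.continuous_fderiv (by norm_num)

theorem Smooth.continuous_fderiv_f₂ (h : P.Smooth) : Continuous (fderiv ℝ P.f₂) :=
  h.f₂.continuous_fderiv (by norm_num)

theorem Smooth.continuous_fderiv_a (h : P.Smooth) (i : Fin nc) :
    Continuous (fderiv ℝ (P.a i)) :=
  (h.a i).continuous_fderiv (by norm_num)

theorem Smooth.memLp_dynDeriv (hsm : P.Smooth) {x : ℝ → Vec n} {u : ℝ → Vec m}
    (hx : ContinuousOn x (Icc 0 P.T)) (hu : MemLp u ⊤ (volOn P.T)) :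
    MemLp (fun t => P.dynDeriv (x t) (u t)) ⊤ (volOn P.T) := by
  refine (memLp_continuousOn (hsm.continuous_fderiv_f₁.comp_continuousOn hx) ⊤).add ?_
  exact memLp_top_clm_apply (K := fun t => (fderiv ℝ P.f₂ (x t)).flip)
    (memLp_continuousOn (((ContinuousLinearMap.flipₗᵢ ℝ (Vec n) (Vec m)
      (Vec n)).continuous.comp hsm.continuous_fderiv_f₂).comp_continuousOn hx) ⊤) hu

theorem Smooth.memLp_mixedGrad (hsm : P.Smooth) (i : Fin nc) {x : ℝ → Vec n} {u : ℝ → Vec m}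
    (hx : ContinuousOn x (Icc 0 P.T)) (hu : MemLp u ⊤ (volOn P.T)) :
    MemLp (fun t => P.mixedGrad i (x t) (u t)) ⊤ (volOn P.T) := by
  refine (memLp_continuousOn ((hsm.continuous_gradient_b i).comp_continuousOn hx) ⊤).add ?_
  exact memLp_adjoint_apply
    (memLp_continuousOn ((hsm.continuous_fderiv_a i).comp_continuousOn hx) ⊤) hu

/-- Convergence of the contribution of the dynamics to the costate. -/
theorem StateLim.tendsto_dyn (h : StateLim P.T R x u xbar ubar) (hsm : P.Smooth)
    {p : ℕ → ℝ → Vec n} {pbar : ℝ → Vec n}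
    (hp : ∀ k, Integrable (p k) (volOn P.T)) (hpbar : MemLp pbar ⊤ (volOn P.T))
    (hlim : Tendsto (fun k => ∫ t, ‖p k t - pbar t‖ ∂volOn P.T) atTop (𝓝 0))
    {t : ℝ} (ht : t ∈ Icc 0 P.T) :
    Tendsto (fun k => ∫ s in t..P.T, (P.dynDeriv (x k s) (u k s)).adjoint (p k s)) atTop
      (𝓝 (∫ s in t..P.T, (P.dynDeriv (xbar s) (ubar s)).adjoint (pbar s))) := by
  have hTm : P.T ∈ Icc 0 P.T := ⟨ht.1.trans ht.2, le_rfl⟩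
  refine tendsto_vec_of_inner fun e => ?_
  have hI : ∀ (y : ℝ → Vec n) (v : ℝ → Vec m) (q : ℝ → Vec n), ContinuousOn y (Icc 0 P.T) →
      MemLp v ⊤ (volOn P.T) → Integrable q (volOn P.T) →
      inner ℝ e (∫ s in t..P.T, (P.dynDeriv (y s) (v s)).adjoint (q s))
        = ∫ s in t..P.T, (innerSL ℝ (fderiv ℝ P.f₁ (y s) e) (q s)
          + inner ℝ ((fderiv ℝ P.f₂ (y s) e).adjoint (q s)) (v s)) := by
    intro y v q hy hv hq
    rw [inner_intervalIntegral (memLp_one_iff_integrable.1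
      (memLp_adjoint_apply (hsm.memLp_dynDeriv hy hv) (memLp_one_iff_integrable.2 hq))) e ht hTm]
    refine intervalIntegral.integral_congr fun s _ => ?_
    rw [ContinuousLinearMap.adjoint_inner_right, ContinuousLinearMap.adjoint_inner_left, dynDeriv,
      add_apply, inner_add_left, real_inner_comm (q s) ((fderiv ℝ P.f₂ (y s)).flip (v s) e)]
    rfl
  rw [hI _ _ _ h.cont_lim (memLp_top_of_bound h.weak.meas_lim R h.weak.bound_lim)
    (hpbar.integrable le_top)]
  simp only [fun k => hI _ _ _ (h.cont k) (memLp_top_of_bound (h.weak.meas k) R (h.weak.bound k))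
    (hp k)]
  exact h.tendsto_affine hp hpbar hlim (L₀ := fun y => innerSL ℝ (fderiv ℝ P.f₁ y e))
    (L₁ := fun y => (fderiv ℝ P.f₂ y e).adjoint)
    ((innerSL ℝ).continuous.comp (hsm.continuous_fderiv_f₁.clm_apply continuous_const))
    ((ContinuousLinearMap.adjoint (𝕜 := ℝ) (E := Vec m) (F := Vec n)).continuous.comp
      (hsm.continuous_fderiv_f₂.clm_apply continuous_const)) ht

/-- Convergence of the contribution of a mixed constraint to the costate. -/
theorem StateLim.tendsto_mixed (h : StateLim P.T R x u xbar ubar) (hsm : P.Smooth) (i : Fin nc)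
    {ν : ℕ → ℝ → ℝ} {νbar : ℝ → ℝ}
    (hν : ∀ k, Integrable (ν k) (volOn P.T)) (hνbar : MemLp νbar ⊤ (volOn P.T))
    (hlim : Tendsto (fun k => ∫ t, ‖ν k t - νbar t‖ ∂volOn P.T) atTop (𝓝 0))
    {t : ℝ} (ht : t ∈ Icc 0 P.T) :
    Tendsto (fun k => ∫ s in t..P.T, ν k s • P.mixedGrad i (x k s) (u k s)) atTop
      (𝓝 (∫ s in t..P.T, νbar s • P.mixedGrad i (xbar s) (ubar s))) := by
  have hTm : P.T ∈ Icc 0 P.T := ⟨ht.1.trans ht.2, le_rfl⟩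
  refine tendsto_vec_of_inner fun e => ?_
  have hI : ∀ (y : ℝ → Vec n) (v : ℝ → Vec m) (q : ℝ → ℝ), ContinuousOn y (Icc 0 P.T) →
      MemLp v ⊤ (volOn P.T) → Integrable q (volOn P.T) →
      inner ℝ e (∫ s in t..P.T, q s • P.mixedGrad i (y s) (v s))
        = ∫ s in t..P.T, (ContinuousLinearMap.toSpanSingleton ℝ
            (inner ℝ e (gradient (P.b i) (y s)) : ℝ) (q s)
          + inner ℝ (ContinuousLinearMap.toSpanSingleton ℝ (fderiv ℝ (P.a i) (y s) e) (q s))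
            (v s)) := by
    intro y v q hy hv hq
    have hi : Integrable (fun s => q s • P.mixedGrad i (y s) (v s)) (volOn P.T) :=
      memLp_one_iff_integrable.1
        ((hsm.memLp_mixedGrad i hy hv).smul (memLp_one_iff_integrable.2 hq) (r := 1))
    rw [inner_intervalIntegral hi e ht hTm]
    refine intervalIntegral.integral_congr fun s _ => ?_
    simp [mixedGrad, ContinuousLinearMap.adjoint_inner_right, inner_add_right, inner_smul_left,
      inner_smul_right]
  rw [hI _ _ _ h.cont_lim (memLp_top_of_bound h.weak.meas_lim R h.weak.bound_lim)
    (hνbar.integrable le_top)]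
  simp only [fun k => hI _ _ _ (h.cont k) (memLp_top_of_bound (h.weak.meas k) R (h.weak.bound k))
    (hν k)]
  exact h.tendsto_affine hν hνbar hlim
    (L₀ := fun y => ContinuousLinearMap.toSpanSingleton ℝ (inner ℝ e (gradient (P.b i) y) : ℝ))
    (L₁ := fun y => ContinuousLinearMap.toSpanSingleton ℝ (fderiv ℝ (P.a i) y e))
    ((ContinuousLinearMap.toSpanSingletonCLE (𝕜 := ℝ)).continuous.comp
      (continuous_const.inner (hsm.continuous_gradient_b i)))
    ((ContinuousLinearMap.toSpanSingletonCLE (𝕜 := ℝ)).continuous.comp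
      ((hsm.continuous_fderiv_a i).clm_apply continuous_const)) ht

/-- Convergence of the contribution of a state constraint to the costate. -/
theorem StateLim.tendsto_state_Ioc (h : StateLim P.T R x u xbar ubar) (hsm : P.Smooth)
    (i : Fin ng) {η : ℕ → ℝ → ℝ} {μ : Measure ℝ} (hμ : MeasureLim P.T η μ)
    {t : ℝ} (ht : t ∈ Icc 0 P.T) (hat : μ {t} = 0) :
    Tendsto (fun k => ∫ s in t..P.T, η k s • gradient (P.g i) (x k s)) atTop
      (𝓝 (∫ s in Ioc t P.T, gradient (P.g i) (xbar s) ∂μ)) := by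
  have hTm : P.T ∈ Icc 0 P.T := ⟨ht.1.trans ht.2, le_rfl⟩
  refine tendsto_vec_of_inner fun e => ?_
  have hc : ∀ y : ℝ → Vec n, ContinuousOn y (Icc 0 P.T) →
      ContinuousOn (fun t => gradient (P.g i) (y t)) (Icc 0 P.T) := fun y hy =>
    (hsm.continuous_gradient_g i).comp_continuousOn hy
  have hG : Continuous fun y => (inner ℝ e (gradient (P.g i) y) : ℝ) :=
    continuous_const.inner (hsm.continuous_gradient_g i)
  rw [← integral_inner ((hμ.integrable_of_bound (hc _ h.cont_lim)).restrict)]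
  refine (tendsto_real_of_error_Ioc hμ (fun k => hG.comp_continuousOn (h.cont k))
    (hG.comp_continuousOn h.cont_lim) (h.unif_comp hG) ht hat).congr fun k => ?_
  have hi : Integrable (fun s => η k s • gradient (P.g i) (x k s)) (volOn P.T) :=
    memLp_one_iff_integrable.1 ((memLp_continuousOn (hc _ (h.cont k)) ⊤).smul
      (memLp_one_iff_integrable.2 (hμ.int k)) (r := 1))
  rw [inner_intervalIntegral hi e ht hTm]
  refine intervalIntegral.integral_congr fun s _ => ?_
  simp [inner_smul_right]

theorem StateLim.tendsto_state (h : StateLim P.T R x u xbar ubar) (hsm : P.Smooth)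
    (hT : 0 ≤ P.T) (i : Fin ng) {η : ℕ → ℝ → ℝ} {μ : Measure ℝ} (hμ : MeasureLim P.T η μ) :
    Tendsto (fun k => ∫ s in (0 : ℝ)..P.T, η k s • gradient (P.g i) (x k s)) atTop
      (𝓝 (∫ s, gradient (P.g i) (xbar s) ∂μ)) := by
  have h0 : (0 : ℝ) ∈ Icc 0 P.T := ⟨le_rfl, hT⟩
  have hTm : P.T ∈ Icc 0 P.T := ⟨hT, le_rfl⟩
  refine tendsto_vec_of_inner fun e => ?_
  have hc : ∀ y : ℝ → Vec n, ContinuousOn y (Icc 0 P.T) →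
      ContinuousOn (fun t => gradient (P.g i) (y t)) (Icc 0 P.T) := fun y hy =>
    (hsm.continuous_gradient_g i).comp_continuousOn hy
  have hG : Continuous fun y => (inner ℝ e (gradient (P.g i) y) : ℝ) :=
    continuous_const.inner (hsm.continuous_gradient_g i)
  rw [← integral_inner (hμ.integrable_of_bound (hc _ h.cont_lim))]
  refine (tendsto_real_of_error hμ (fun k => hG.comp_continuousOn (h.cont k))
    (hG.comp_continuousOn h.cont_lim) (h.unif_comp hG)).congr fun k => ?_
  have hi : Integrable (fun s => η k s • gradient (P.g i) (x k s)) (volOn P.T) :=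
    memLp_one_iff_integrable.1 ((memLp_continuousOn (hc _ (h.cont k)) ⊤).smul
      (memLp_one_iff_integrable.2 (hμ.int k)) (r := 1))
  rw [inner_intervalIntegral hi e h0 hTm,
    intervalIntegral_eq_integral_volOn hT]
  refine integral_congr_ae (Eventually.of_forall fun s => ?_)
  simp [inner_smul_right]

end

/-- Under the qualification condition, the mixed multipliers are controlled by their contribution
to the stationarity with respect to the control and by their defect of complementarity. -/
theorem MixedQualified.exists_bound (hqual : P.MixedQualified) (hsm : P.Smooth)
    {x : ℝ → Vec n} {u : ℝ → Vec m} (hxu : P.IsAdmissible x u) :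
    ∃ C : ℝ, 0 ≤ C ∧ ∀ᵐ t ∂volOn P.T, ∀ ξ : Fin nc → ℝ,
      ∑ i, |ξ i| ≤ C * (‖∑ i, ξ i • P.a i (x t)‖ + ∑ i, |ξ i| * (-P.c i (x t) (u t))) := by
  obtain ⟨γ, hγ, k, hk, hq⟩ := hqual x u hxu
  have hbd : ∃ M : ℝ, 0 ≤ M ∧ ∀ i, ∀ t ∈ Icc 0 P.T, ‖P.a i (x t)‖ ≤ M := by
    have : ∀ i, ∃ M, ∀ t ∈ Icc 0 P.T, ‖P.a i (x t)‖ ≤ M := fun i =>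
      isCompact_Icc.exists_bound_of_continuousOn
        ((hsm.a i).continuous.comp_continuousOn hxu.continuousOn)
    choose M hM using this
    refine ⟨∑ i, |M i|, Finset.sum_nonneg fun _ _ => abs_nonneg _, fun i t ht => ?_⟩
    exact ((hM i t ht).trans (le_abs_self _)).trans
      (Finset.single_le_sum (f := fun i => |M i|) (fun _ _ => abs_nonneg _) (Finset.mem_univ i))
  obtain ⟨M, hM0, hM⟩ := hbd
  have hk0 : (0 : ℝ) < k := by exact_mod_cast hk
  refine ⟨nc / γ * (1 + M * k) + k, by positivity, ?_⟩
  filter_upwards [hq, hxu.mixed_le, ae_volOn_mem] with t hqt hct ht ξ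
  set N : Finset (Fin nc) := Finset.univ.filter fun i => P.c i (x t) (u t) < -(1 / (k : ℝ))
    with hN
  set S : Vec m := ∑ i, ξ i • P.a i (x t) with hS
  set E : ℝ := ∑ i, |ξ i| * (-P.c i (x t) (u t)) with hE
  have hterm : ∀ i, 0 ≤ |ξ i| * (-P.c i (x t) (u t)) := fun i =>
    mul_nonneg (abs_nonneg _) (neg_nonneg.2 (hct i))
  have hsumN : ∑ i ∈ N, |ξ i| ≤ k * E := by
    have h1 : ∀ i ∈ N, |ξ i| ≤ k * (|ξ i| * (-P.c i (x t) (u t))) := by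
      intro i hi
      have hi' := (Finset.mem_filter.1 hi).2
      have h2 : 1 ≤ k * (-P.c i (x t) (u t)) := by
        have : 1 / (k : ℝ) ≤ -P.c i (x t) (u t) := by linarith
        calc (1 : ℝ) = k * (1 / k) := by field_simp
          _ ≤ _ := by gcongr
      nlinarith [abs_nonneg (ξ i)]
    calc ∑ i ∈ N, |ξ i| ≤ ∑ i ∈ N, k * (|ξ i| * (-P.c i (x t) (u t))) := Finset.sum_le_sum h1
      _ ≤ ∑ i, k * (|ξ i| * (-P.c i (x t) (u t))) :=
        Finset.sum_le_sum_of_subset_of_nonneg (Finset.subset_univ _)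
          fun i _ _ => mul_nonneg hk0.le (hterm i)
      _ = k * E := by rw [hE, Finset.mul_sum]
  set ζ : Vec nc := WithLp.toLp 2 fun i => if i ∈ N then 0 else ξ i with hζ
  have hζi : ∀ i, ζ i = if i ∈ N then 0 else ξ i := fun i => rfl
  have h2 := hqt ζ fun i hi => by
    rw [hζi, if_pos (by rw [hN]; exact Finset.mem_filter.2 ⟨Finset.mem_univ _, hi⟩)]
  have hsplit : ∑ i, ζ i • P.a i (x t) = S - ∑ i ∈ N, ξ i • P.a i (x t) := by
    rw [hS, ← Finset.sum_sdiff (f := fun i => ξ i • P.a i (x t)) (Finset.subset_univ N),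
      add_sub_cancel_right,
      ← Finset.sum_sdiff (f := fun i => ζ i • P.a i (x t)) (Finset.subset_univ N)]
    rw [Finset.sum_eq_zero (s := N) fun i hi => by rw [hζi, if_pos hi, zero_smul], add_zero]
    refine Finset.sum_congr rfl fun i hi => ?_
    rw [hζi, if_neg (Finset.mem_sdiff.1 hi).2]
  have h3 : ‖∑ i, ζ i • P.a i (x t)‖ ≤ ‖S‖ + M * (k * E) := by
    rw [hsplit]
    refine (norm_sub_le _ _).trans (add_le_add le_rfl ?_)
    calc ‖∑ i ∈ N, ξ i • P.a i (x t)‖ ≤ ∑ i ∈ N, |ξ i| * M := by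
          refine norm_sum_le_of_le _ fun i _ => ?_
          rw [norm_smul, Real.norm_eq_abs]
          exact mul_le_mul_of_nonneg_left (hM i t ht) (abs_nonneg _)
      _ = M * ∑ i ∈ N, |ξ i| := by rw [← Finset.sum_mul, mul_comm]
      _ ≤ M * (k * E) := by gcongr
  have h4 : ∑ i ∈ Finset.univ \ N, |ξ i| ≤ nc * ‖ζ‖ := by
    calc ∑ i ∈ Finset.univ \ N, |ξ i| ≤ ∑ i ∈ Finset.univ \ N, ‖ζ‖ := by
          refine Finset.sum_le_sum fun i hi => ?_
          have := PiLp.norm_apply_le ζ i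
          rwa [hζi, if_neg (Finset.mem_sdiff.1 hi).2, Real.norm_eq_abs] at this
      _ ≤ ∑ i : Fin nc, ‖ζ‖ := Finset.sum_le_sum_of_subset_of_nonneg (Finset.subset_univ _)
          fun _ _ _ => norm_nonneg _
      _ = nc * ‖ζ‖ := by simp
  have h5 : ‖ζ‖ ≤ (‖S‖ + M * (k * E)) / γ := by
    rw [le_div_iff₀ hγ, mul_comm]
    exact h2.trans h3
  have hE0 : 0 ≤ E := Finset.sum_nonneg fun i _ => hterm i
  calc ∑ i, |ξ i| = ∑ i ∈ Finset.univ \ N, |ξ i| + ∑ i ∈ N, |ξ i| :=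
        (Finset.sum_sdiff (Finset.subset_univ N)).symm
    _ ≤ nc * ((‖S‖ + M * (k * E)) / γ) + k * E :=
        add_le_add (h4.trans (by gcongr)) hsumN
    _ = nc / γ * (‖S‖ + M * k * E) + k * E := by ring
    _ ≤ nc / γ * ((1 + M * k) * (‖S‖ + E)) + k * (‖S‖ + E) := by
        have : 0 ≤ M * k * ‖S‖ := by positivity
        have h' : ‖S‖ + M * k * E ≤ (1 + M * k) * (‖S‖ + E) := by nlinarith
        have h'' : E ≤ ‖S‖ + E := by linarith [norm_nonneg S]
        gcongr
    _ = _ := by ring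

end OCP

end

noncomputable section

namespace OCP

open Topology

variable {n m nh ng nc : ℕ} {P : OCP n m nh ng nc}

/-- Products of functions bounded in `L¹` and of functions that converge uniformly to `0`. -/
theorem tendsto_integral_norm_smul_of_small {T : ℝ} {E : Type*} [NormedAddCommGroup E]
    [NormedSpace ℝ E] {w : ℕ → ℝ → ℝ} {ρ : ℕ → ℝ → E} {C : ℝ}
    (hw : ∀ k, Integrable (w k) (volOn T)) (hC : ∀ k, ∫ t, ‖w k t‖ ∂volOn T ≤ C)
    (hρ : ∀ ε > 0, ∀ᶠ k in atTop, ∀ᵐ t ∂volOn T, ‖ρ k t‖ ≤ ε) :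
    Tendsto (fun k => ∫ t, ‖w k t • ρ k t‖ ∂volOn T) atTop (𝓝 0) := by
  have hC0 : 0 ≤ C := (integral_nonneg fun _ => norm_nonneg _).trans (hC 0)
  rw [Metric.tendsto_nhds]
  intro ε hε
  filter_upwards [hρ (ε / (C + 1)) (by positivity)] with k hk
  rw [Real.dist_eq, sub_zero, abs_of_nonneg (integral_nonneg fun _ => norm_nonneg _)]
  calc ∫ t, ‖w k t • ρ k t‖ ∂volOn T ≤ ∫ t, ‖w k t‖ * (ε / (C + 1)) ∂volOn T := by
        refine integral_mono_of_nonneg (Eventually.of_forall fun _ => norm_nonneg _)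
          ((hw k).norm.mul_const _) ?_
        filter_upwards [hk] with t ht
        rw [norm_smul]
        exact mul_le_mul_of_nonneg_left ht (norm_nonneg _)
    _ = (∫ t, ‖w k t‖ ∂volOn T) * (ε / (C + 1)) := integral_mul_const _ _
    _ ≤ C * (ε / (C + 1)) := by gcongr; exact hC k
    _ < ε := by
        rw [mul_div_assoc', div_lt_iff₀ (by positivity)]
        nlinarith

theorem Smooth.memLp_c (hsm : P.Smooth) (i : Fin nc) {x : ℝ → Vec n} {u : ℝ → Vec m}
    (hx : ContinuousOn x (Icc 0 P.T)) (hu : MemLp u ⊤ (volOn P.T)) :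
    MemLp (fun t => P.c i (x t) (u t)) ⊤ (volOn P.T) := by
  refine MemLp.add ?_ (memLp_continuousOn ((hsm.b i).continuous.comp_continuousOn hx) ⊤)
  exact memLp_top_clm_apply (K := fun t => innerSL ℝ (P.a i (x t)))
    (memLp_continuousOn (((innerSL ℝ).continuous.comp (hsm.a i).continuous).comp_continuousOn hx) ⊤)
    hu

theorem integral_add_combination {T c : ℝ} {F₁ F₂ F₃ F₄ F₅ : ℝ → ℝ}
    (h₁ : Integrable F₁ (volOn T)) (h₂ : Integrable F₂ (volOn T)) (h₃ : Integrable F₃ (volOn T))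
    (h₄ : Integrable F₄ (volOn T)) (h₅ : Integrable F₅ (volOn T)) :
    ∫ t, F₁ t + c * F₂ t - F₃ t + F₄ t + F₅ t ∂volOn T
      = ∫ t, F₁ t ∂volOn T + c * ∫ t, F₂ t ∂volOn T - ∫ t, F₃ t ∂volOn T + ∫ t, F₄ t ∂volOn T
        + ∫ t, F₅ t ∂volOn T := by
  have h₂' : Integrable (fun t => c * F₂ t) (volOn T) := h₂.const_mul c
  have k₁ : Integrable (fun t => F₁ t + c * F₂ t) (volOn T) := h₁.add h₂'
  have k₂ : Integrable (fun t => F₁ t + c * F₂ t - F₃ t) (volOn T) := k₁.sub h₃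
  have k₃ : Integrable (fun t => F₁ t + c * F₂ t - F₃ t + F₄ t) (volOn T) := k₂.add h₄
  rw [integral_add k₃ h₅, integral_add k₂ h₄, integral_sub k₁ h₃, integral_add h₁ h₂',
    integral_const_mul]

theorem integrable_smul_memLp {T : ℝ} {E : Type*} [NormedAddCommGroup E] [NormedSpace ℝ E]
    {w : ℝ → ℝ} {K : ℝ → E} (hw : Integrable w (volOn T)) (hK : MemLp K ⊤ (volOn T)) :
    Integrable (fun t => w t • K t) (volOn T) :=
  memLp_one_iff_integrable.1 (hK.smul (memLp_one_iff_integrable.2 hw) (r := 1))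

theorem tendstoUniformlyOn_norm_le {T : ℝ} {E : Type*} [NormedAddCommGroup E]
    {f : ℕ → ℝ → E} {fbar : ℝ → E} (h : TendstoUniformlyOn f fbar atTop (Icc 0 T)) :
    ∀ ε > 0, ∀ᶠ k in atTop, ∀ t ∈ Icc 0 T, ‖f k t - fbar t‖ ≤ ε := by
  intro ε hε
  filter_upwards [Metric.tendstoUniformlyOn_iff.1 h ε hε] with k hk t ht
  rw [← dist_eq_norm, dist_comm]
  exact (hk t ht).le

section

variable {R : ℝ} {x : ℕ → ℝ → Vec n} {u : ℕ → ℝ → Vec m} {xbar : ℝ → Vec n} {ubar : ℝ → Vec m}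
  {p : ℕ → ℝ → Vec n} {pbar : ℝ → Vec n} {ν : Fin nc → ℕ → ℝ → ℝ} {ρ : ℕ → ℝ}

theorem Smooth.continuous_adjoint_f₂ (hsm : P.Smooth) :
    Continuous fun y => (P.f₂ y).adjoint :=
  (ContinuousLinearMap.adjoint (𝕜 := ℝ) (E := Vec m) (F := Vec n)).continuous.comp
    hsm.f₂.continuous

/-- The contribution of the costate to the stationarity with respect to the control. -/
theorem StateLim.tendsto_f₂ (h : StateLim P.T R x u xbar ubar) (hsm : P.Smooth)
    (hp : ∀ k, Integrable (p k) (volOn P.T)) (hpbar : MemLp pbar ⊤ (volOn P.T))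
    (hlim : Tendsto (fun k => ∫ t, ‖p k t - pbar t‖ ∂volOn P.T) atTop (𝓝 0)) :
    Tendsto (fun k => ∫ t, ‖(P.f₂ (x k t)).adjoint (p k t) - (P.f₂ (xbar t)).adjoint (pbar t)‖
      ∂volOn P.T) atTop (𝓝 0) :=
  tendsto_L1_apply (hsm.continuous_adjoint_f₂.comp_continuousOn h.cont_lim)
    (h.unif_comp hsm.continuous_adjoint_f₂) hp (hpbar.integrable le_top) hlim

theorem BddWeakLim.const {T R : ℝ} {u : ℕ → ℝ → Vec m} {ubar : ℝ → Vec m}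
    (h : BddWeakLim T R u ubar) : BddWeakLim T R (fun _ => ubar) ubar :=
  ⟨fun _ => h.meas_lim, fun _ => h.bound_lim, h.meas_lim, h.bound_lim,
    fun _ _ => tendsto_const_nhds⟩

/-- The defect of complementarity at the limit trajectory tends to `0`. -/
theorem StateLim.tendsto_defect (h : StateLim P.T R x u xbar ubar) (hsm : P.Smooth)
    (hR : 0 ≤ R)
    (hp : ∀ k, Integrable (p k) (volOn P.T)) (hpbar : MemLp pbar ⊤ (volOn P.T))
    (hlim : Tendsto (fun k => ∫ t, ‖p k t - pbar t‖ ∂volOn P.T) atTop (𝓝 0))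
    (hν : ∀ i k, Integrable (ν i k) (volOn P.T))
    (hmass : ∀ i k, ∫ t, ‖ν i k t‖ ∂volOn P.T ≤ 1)
    (hcbar : ∀ k, 0 ≤ ∑ i, ∫ t, ν i k t * (-P.c i (xbar t) (ubar t)) ∂volOn P.T)
    (hρ : Tendsto ρ atTop (𝓝 0))
    (hstat : ∀ k, ∫ t, ‖(P.f₂ (x k t)).adjoint (p k t) + ∑ i, ν i k t • P.a i (x k t)‖ ∂volOn P.T
      ≤ ρ k)
    (hcompl : ∀ k, ∑ i, ∫ t, ν i k t * (-P.c i (x k t) (u k t)) ∂volOn P.T ≤ ρ k) :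
    Tendsto (fun k => ∑ i, ∫ t, ν i k t * (-P.c i (xbar t) (ubar t)) ∂volOn P.T) atTop (𝓝 0) := by
  have hu : ∀ k, MemLp (u k) ⊤ (volOn P.T) := fun k =>
    memLp_top_of_bound (h.weak.meas k) R (h.weak.bound k)
  have hub : MemLp ubar ⊤ (volOn P.T) := memLp_top_of_bound h.weak.meas_lim R h.weak.bound_lim
  have hA := hsm.continuous_adjoint_f₂
  have hq : ∀ k, Integrable (fun t => (P.f₂ (x k t)).adjoint (p k t)) (volOn P.T) := fun k =>
    integrable_clm_apply (hA.comp_continuousOn (h.cont k)) (hp k)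
  have hqbar : MemLp (fun t => (P.f₂ (xbar t)).adjoint (pbar t)) ⊤ (volOn P.T) :=
    memLp_top_clm_apply (memLp_continuousOn (hA.comp_continuousOn h.cont_lim) ⊤) hpbar
  have hql := h.tendsto_f₂ hsm hp hpbar hlim
  have hS : ∀ k, Integrable (fun t => (P.f₂ (x k t)).adjoint (p k t)
      + ∑ i, ν i k t • P.a i (x k t)) (volOn P.T) := fun k =>
    (hq k).add (integrable_finsetSum _ fun i _ => integrable_smul_memLp (hν i k)
      (memLp_continuousOn ((hsm.a i).continuous.comp_continuousOn (h.cont k)) ⊤))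
  set r : Fin nc → ℕ → ℝ → ℝ := fun i k t =>
    inner ℝ (P.a i (x k t) - P.a i (xbar t)) (ubar t) + (P.b i (x k t) - P.b i (xbar t)) with hr
  have hrm : ∀ i k, MemLp (r i k) ⊤ (volOn P.T) := by
    intro i k
    have := ((hsm.memLp_c i (h.cont k) hub).sub (hsm.memLp_c i h.cont_lim hub))
    refine this.ae_eq (Eventually.of_forall fun t => ?_)
    simp only [hr, OCP.c, Pi.sub_apply, inner_sub_left]
    ring
  have hsmall : ∀ i, Tendsto (fun k => ∫ t, ‖ν i k t • r i k t‖ ∂volOn P.T) atTop (𝓝 0) := by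
    intro i
    refine tendsto_integral_norm_smul_of_small (hν i) (hmass i) fun ε hε => ?_
    filter_upwards [tendstoUniformlyOn_norm_le (h.unif_comp (hsm.a i).continuous)
      (ε / (2 * (R + 1))) (by positivity),
      tendstoUniformlyOn_norm_le (h.unif_comp (hsm.b i).continuous) (ε / 2) (by positivity)]
      with k h1 h2
    filter_upwards [h.weak.bound_lim, ae_volOn_mem] with t h3 ht
    refine (norm_add_le _ _).trans ?_
    have h4 : ‖(inner ℝ (P.a i (x k t) - P.a i (xbar t)) (ubar t) : ℝ)‖
        ≤ ε / (2 * (R + 1)) * R :=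
      (norm_inner_le_norm _ _).trans (mul_le_mul (h1 t ht) h3 (norm_nonneg _) (by positivity))
    have h5 : ε / (2 * (R + 1)) * R ≤ ε / 2 := by
      rw [div_mul_eq_mul_div, div_le_div_iff₀ (by positivity) (by norm_num)]
      nlinarith
    linarith [h2 t ht]
  have hup : Tendsto (fun k => ρ k + 2 * R * ρ k
      - ∫ t, inner ℝ ((P.f₂ (x k t)).adjoint (p k t)) (u k t) ∂volOn P.T
      + ∫ t, inner ℝ ((P.f₂ (x k t)).adjoint (p k t)) (ubar t) ∂volOn P.T
      + ∑ i, ∫ t, ‖ν i k t • r i k t‖ ∂volOn P.T) atTop (𝓝 0) := by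
    have h1 := h.weak.tendsto_inner hq (hqbar.mono_exponent le_top) hql
    have h2 := (BddWeakLim.const h.weak).tendsto_inner hq (hqbar.mono_exponent le_top) hql
    have h3 := tendsto_finsetSum (Finset.univ : Finset (Fin nc)) fun i _ => hsmall i
    have := ((((hρ.add (hρ.const_mul (2 * R))).sub h1).add h2).add h3)
    simpa using this
  refine squeeze_zero hcbar (fun k => ?_) hup
  have hI0 : ∀ i, Integrable (fun t => ν i k t * (-P.c i (xbar t) (ubar t))) (volOn P.T) :=
    fun i => integrable_smul_memLp (hν i k) (hsm.memLp_c i h.cont_lim hub).neg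
  have hI1 : ∀ i, Integrable (fun t => ν i k t * (-P.c i (x k t) (u k t))) (volOn P.T) :=
    fun i => integrable_smul_memLp (hν i k) (hsm.memLp_c i (h.cont k) (hu k)).neg
  have hI2 := (hS k).norm
  have hI3 := integrable_inner_of_bounded (hq k) (h.weak.meas k) (h.weak.bound k)
  have hI4 := integrable_inner_of_bounded (hq k) h.weak.meas_lim h.weak.bound_lim
  have hI5 : ∀ i, Integrable (fun t => ‖ν i k t • r i k t‖) (volOn P.T) := fun i =>
    (integrable_smul_memLp (hν i k) (hrm i k)).norm
  rw [← integral_finsetSum _ fun i _ => hI0 i]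
  have hJ1 := integrable_finsetSum (Finset.univ : Finset (Fin nc)) fun i _ => hI1 i
  have hJ5 := integrable_finsetSum (Finset.univ : Finset (Fin nc)) fun i _ => hI5 i
  calc ∫ t, ∑ i, ν i k t * (-P.c i (xbar t) (ubar t)) ∂volOn P.T
      ≤ ∫ t, ((((∑ i, ν i k t * (-P.c i (x k t) (u k t)))
          + 2 * R * ‖(P.f₂ (x k t)).adjoint (p k t) + ∑ i, ν i k t • P.a i (x k t)‖)
          - inner ℝ ((P.f₂ (x k t)).adjoint (p k t)) (u k t))
          + inner ℝ ((P.f₂ (x k t)).adjoint (p k t)) (ubar t))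
          + ∑ i, ‖ν i k t • r i k t‖ ∂volOn P.T := by
        refine integral_mono_ae (integrable_finsetSum _ fun i _ => hI0 i)
          ((((hJ1.add (hI2.const_mul _)).sub hI3).add hI4).add hJ5) ?_
        filter_upwards [h.weak.bound k, h.weak.bound_lim] with t h1 h2
        set q := (P.f₂ (x k t)).adjoint (p k t) with hqdef
        have e1 : ∑ i, ν i k t * (-P.c i (xbar t) (ubar t))
            = (∑ i, ν i k t * (-P.c i (x k t) (u k t)))
              + inner ℝ (q + ∑ i, ν i k t • P.a i (x k t)) (u k t - ubar t)
              - inner ℝ q (u k t) + inner ℝ q (ubar t) + ∑ i, ν i k t * r i k t := by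
          rw [inner_add_left, sum_inner]
          have : ∀ i, ν i k t * (-P.c i (xbar t) (ubar t)) = ν i k t * (-P.c i (x k t) (u k t))
              + inner ℝ (ν i k t • P.a i (x k t)) (u k t - ubar t) + ν i k t * r i k t := by
            intro i
            simp only [hr, OCP.c, real_inner_smul_left, inner_sub_right, inner_sub_left]
            ring
          rw [Finset.sum_congr rfl fun i _ => this i, Finset.sum_add_distrib,
            Finset.sum_add_distrib, inner_sub_right]
          ring
        have e2 : inner ℝ (q + ∑ i, ν i k t • P.a i (x k t)) (u k t - ubar t)
            ≤ 2 * R * ‖q + ∑ i, ν i k t • P.a i (x k t)‖ := by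
          refine (real_inner_le_norm _ _).trans ?_
          rw [mul_comm]
          refine mul_le_mul_of_nonneg_right ?_ (norm_nonneg _)
          linarith [norm_sub_le (u k t) (ubar t)]
        have e3 : ∑ i, ν i k t * r i k t ≤ ∑ i, ‖ν i k t • r i k t‖ :=
          Finset.sum_le_sum fun i _ => le_abs_self _
        change ∑ i, ν i k t * (-P.c i (xbar t) (ubar t)) ≤ _
        rw [e1]
        linarith
    _ = (∑ i, ∫ t, ν i k t * (-P.c i (x k t) (u k t)) ∂volOn P.T)
        + 2 * R * ∫ t, ‖(P.f₂ (x k t)).adjoint (p k t) + ∑ i, ν i k t • P.a i (x k t)‖ ∂volOn P.T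
        - ∫ t, inner ℝ ((P.f₂ (x k t)).adjoint (p k t)) (u k t) ∂volOn P.T
        + ∫ t, inner ℝ ((P.f₂ (x k t)).adjoint (p k t)) (ubar t) ∂volOn P.T
        + ∑ i, ∫ t, ‖ν i k t • r i k t‖ ∂volOn P.T := by
        rw [← integral_finsetSum _ fun i _ => hI1 i, ← integral_finsetSum _ fun i _ => hI5 i]
        exact integral_add_combination hJ1 hI2 hI3 hI4 hJ5
    _ ≤ _ := by
        have := mul_le_mul_of_nonneg_left (hstat k) (by positivity : 0 ≤ 2 * R)
        linarith [hcompl k]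

theorem ae_eq_zero_of_forall_integral_le {T : ℝ} {E : Type*} [NormedAddCommGroup E] {f : ℝ → E}
    (hf : Integrable f (volOn T)) {e : ℕ → ℝ} (he : Tendsto e atTop (𝓝 0))
    (hle : ∀ k, ∫ t, ‖f t‖ ∂volOn T ≤ e k) : ∀ᵐ t ∂volOn T, f t = 0 := by
  have h0 : ∫ t, ‖f t‖ ∂volOn T = 0 :=
    le_antisymm (ge_of_tendsto' he hle) (integral_nonneg fun _ => norm_nonneg _)
  filter_upwards [(integral_eq_zero_iff_of_nonneg (fun _ => norm_nonneg _) hf.norm).1 h0] with t ht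
  simpa using ht

/-- Convergence in `L¹` of the multipliers of the mixed constraints. -/
theorem StateLim.exists_mixed_limit (h : StateLim P.T R x u xbar ubar) (hsm : P.Smooth)
    (hR : 0 ≤ R) (hqual : P.MixedQualified) (hadm : P.IsAdmissible xbar ubar)
    (hp : ∀ k, Integrable (p k) (volOn P.T)) (hpbar : MemLp pbar ⊤ (volOn P.T))
    (hlim : Tendsto (fun k => ∫ t, ‖p k t - pbar t‖ ∂volOn P.T) atTop (𝓝 0))
    (hν : ∀ i k, Integrable (ν i k) (volOn P.T)) (hν0 : ∀ i k, ∀ᵐ t ∂volOn P.T, 0 ≤ ν i k t)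
    (hmass : ∀ i k, ∫ t, ν i k t ∂volOn P.T ≤ 1)
    (hρ : Tendsto ρ atTop (𝓝 0))
    (hstat : ∀ k, ∫ t, ‖(P.f₂ (x k t)).adjoint (p k t) + ∑ i, ν i k t • P.a i (x k t)‖ ∂volOn P.T
      ≤ ρ k)
    (hcompl : ∀ k, ∑ i, ∫ t, ν i k t * (-P.c i (x k t) (u k t)) ∂volOn P.T ≤ ρ k) :
    ∃ νbar : Fin nc → ℝ → ℝ, (∀ i, MemLp (νbar i) ⊤ (volOn P.T)) ∧
      (∀ i, ∀ᵐ t ∂volOn P.T, 0 ≤ νbar i t) ∧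
      (∀ i, Tendsto (fun k => ∫ t, ‖ν i k t - νbar i t‖ ∂volOn P.T) atTop (𝓝 0)) ∧
      (∀ᵐ t ∂volOn P.T, (P.f₂ (xbar t)).adjoint (pbar t) + ∑ i, νbar i t • P.a i (xbar t) = 0) ∧
      ∀ i, ∀ᵐ t ∂volOn P.T, P.c i (xbar t) (ubar t) * νbar i t = 0 := by
  have hub : MemLp ubar ⊤ (volOn P.T) := memLp_top_of_bound h.weak.meas_lim R h.weak.bound_lim
  have hA := hsm.continuous_adjoint_f₂
  have hq : ∀ k, Integrable (fun t => (P.f₂ (x k t)).adjoint (p k t)) (volOn P.T) := fun k =>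
    integrable_clm_apply (hA.comp_continuousOn (h.cont k)) (hp k)
  have hqbar : MemLp (fun t => (P.f₂ (xbar t)).adjoint (pbar t)) ⊤ (volOn P.T) :=
    memLp_top_clm_apply (memLp_continuousOn (hA.comp_continuousOn h.cont_lim) ⊤) hpbar
  have hqi := hqbar.integrable (μ := volOn P.T) le_top
  have hql := h.tendsto_f₂ hsm hp hpbar hlim
  have hmass' : ∀ i k, ∫ t, ‖ν i k t‖ ∂volOn P.T ≤ 1 := fun i k => by
    refine le_trans (le_of_eq (integral_congr_ae ?_)) (hmass i k)
    filter_upwards [hν0 i k] with t ht using Real.norm_of_nonneg ht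
  have hc : ∀ i, MemLp (fun t => -P.c i (xbar t) (ubar t)) ⊤ (volOn P.T) := fun i =>
    (hsm.memLp_c i h.cont_lim hub).neg
  have ha : ∀ i, MemLp (fun t => P.a i (xbar t)) ⊤ (volOn P.T) := fun i =>
    memLp_continuousOn ((hsm.a i).continuous.comp_continuousOn h.cont_lim) ⊤
  have hak : ∀ i k, MemLp (fun t => P.a i (x k t)) ⊤ (volOn P.T) := fun i k =>
    memLp_continuousOn ((hsm.a i).continuous.comp_continuousOn (h.cont k)) ⊤
  have hmix : ∀ᵐ t ∂volOn P.T, ∀ i, P.c i (xbar t) (ubar t) ≤ 0 := hadm.mixed_le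
  have hd0 : ∀ i k, 0 ≤ ∫ t, ν i k t * (-P.c i (xbar t) (ubar t)) ∂volOn P.T := fun i k =>
    integral_nonneg_of_ae (by
      filter_upwards [hν0 i k, hmix] with t h1 h2 using mul_nonneg h1 (neg_nonneg.2 (h2 i)))
  have hdef := h.tendsto_defect hsm hR hp hpbar hlim hν hmass'
    (fun k => Finset.sum_nonneg fun i _ => hd0 i k) hρ hstat hcompl
  set d : ℕ → ℝ := fun k => ∑ i, ∫ t, ν i k t * (-P.c i (xbar t) (ubar t)) ∂volOn P.T with hd
  -- defect of stationarity at the limit trajectory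
  set s : ℕ → ℝ := fun k => ∫ t, ‖(P.f₂ (xbar t)).adjoint (pbar t)
    + ∑ i, ν i k t • P.a i (xbar t)‖ ∂volOn P.T with hs
  have hIa : ∀ k, Integrable (fun t => ∑ i, ν i k t • P.a i (xbar t)) (volOn P.T) := fun k =>
    integrable_finsetSum _ fun i _ => integrable_smul_memLp (hν i k) (ha i)
  have hIs : ∀ k, Integrable (fun t => (P.f₂ (xbar t)).adjoint (pbar t)
    + ∑ i, ν i k t • P.a i (xbar t)) (volOn P.T) := fun k => hqi.add (hIa k)
  have hslim : Tendsto s atTop (𝓝 0) := by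
    have h3 := tendsto_finsetSum (Finset.univ : Finset (Fin nc)) fun i _ =>
      tendsto_integral_norm_smul_of_small (hν i) (hmass' i)
        (ρ := fun k t => P.a i (x k t) - P.a i (xbar t)) (fun ε hε => by
          filter_upwards [tendstoUniformlyOn_norm_le (h.unif_comp (hsm.a i).continuous) ε hε]
            with k hk
          filter_upwards [ae_volOn_mem] with t ht using hk t ht)
    have hup := (hρ.add hql).add h3
    simp only [Finset.sum_const_zero, add_zero] at hup
    refine squeeze_zero (fun k => integral_nonneg fun _ => norm_nonneg _) (fun k => ?_) hup
    have hI1 : Integrable (fun t => (P.f₂ (x k t)).adjoint (p k t)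
        + ∑ i, ν i k t • P.a i (x k t)) (volOn P.T) :=
      (hq k).add (integrable_finsetSum _ fun i _ => integrable_smul_memLp (hν i k) (hak i k))
    have hI2 : Integrable (fun t => (P.f₂ (x k t)).adjoint (p k t)
        - (P.f₂ (xbar t)).adjoint (pbar t)) (volOn P.T) := (hq k).sub hqi
    have hI3 : ∀ i, Integrable (fun t => ν i k t • (P.a i (x k t) - P.a i (xbar t)))
        (volOn P.T) := fun i => integrable_smul_memLp (hν i k) ((hak i k).sub (ha i))
    have hI4 := integrable_finsetSum (Finset.univ : Finset (Fin nc)) fun i _ => (hI3 i).norm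
    calc s k ≤ ∫ t, (‖(P.f₂ (x k t)).adjoint (p k t) + ∑ i, ν i k t • P.a i (x k t)‖
          + ‖(P.f₂ (x k t)).adjoint (p k t) - (P.f₂ (xbar t)).adjoint (pbar t)‖)
          + ∑ i, ‖ν i k t • (P.a i (x k t) - P.a i (xbar t))‖ ∂volOn P.T := by
          refine integral_mono (hIs k).norm ((hI1.norm.add hI2.norm).add hI4) fun t => ?_
          have e : (P.f₂ (xbar t)).adjoint (pbar t) + ∑ i, ν i k t • P.a i (xbar t)
              = ((P.f₂ (x k t)).adjoint (p k t) + ∑ i, ν i k t • P.a i (x k t))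
                - ((P.f₂ (x k t)).adjoint (p k t) - (P.f₂ (xbar t)).adjoint (pbar t))
                - ∑ i, ν i k t • (P.a i (x k t) - P.a i (xbar t)) := by
            simp only [smul_sub, Finset.sum_sub_distrib]
            abel
          simp only [e]
          exact (norm_sub_le _ _).trans (add_le_add (norm_sub_le _ _) (norm_sum_le _ _))
      _ ≤ _ := by
          have hI5 : Integrable (fun t =>
              ‖(P.f₂ (x k t)).adjoint (p k t) + ∑ i, ν i k t • P.a i (x k t)‖
              + ‖(P.f₂ (x k t)).adjoint (p k t) - (P.f₂ (xbar t)).adjoint (pbar t)‖)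
              (volOn P.T) := hI1.norm.add hI2.norm
          rw [integral_add hI5 hI4, integral_add hI1.norm hI2.norm,
            integral_finsetSum _ fun i _ => (hI3 i).norm]
          gcongr
          exact hstat k
  obtain ⟨C, hC0, hC⟩ := hqual.exists_bound hsm hadm
  -- Cauchy estimate
  have hcauchy : ∀ i k l, ∫ t, ‖ν i k t - ν i l t‖ ∂volOn P.T
      ≤ C * (s k + d k) + C * (s l + d l) := by
    intro i k l
    have hI4 : ∀ k i, Integrable (fun t => ν i k t * (-P.c i (xbar t) (ubar t))) (volOn P.T) :=
      fun k i => integrable_smul_memLp (hν i k) (hc i)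
    have hI5 : ∀ k, Integrable (fun t => ∑ i, ν i k t * (-P.c i (xbar t) (ubar t))) (volOn P.T) :=
      fun k => integrable_finsetSum _ fun i _ => hI4 k i
    have hI6 : ∀ k, Integrable (fun t => C * (‖(P.f₂ (xbar t)).adjoint (pbar t)
        + ∑ i, ν i k t • P.a i (xbar t)‖ + ∑ i, ν i k t * (-P.c i (xbar t) (ubar t))))
        (volOn P.T) := fun k => ((hIs k).norm.add (hI5 k)).const_mul C
    have hI7 : ∀ k, ∫ t, C * (‖(P.f₂ (xbar t)).adjoint (pbar t)
        + ∑ i, ν i k t • P.a i (xbar t)‖ + ∑ i, ν i k t * (-P.c i (xbar t) (ubar t))) ∂volOn P.T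
        = C * (s k + d k) := fun k => by
      rw [integral_const_mul, integral_add (hIs k).norm (hI5 k),
        integral_finsetSum _ fun i _ => hI4 k i]
    rw [← hI7 k, ← hI7 l, ← integral_add (hI6 k) (hI6 l)]
    refine integral_mono_ae ((hν i k).sub (hν i l)).norm ((hI6 k).add (hI6 l)) ?_
    have hpos : ∀ k, ∀ᵐ t ∂volOn P.T, ∀ i, 0 ≤ ν i k t := fun k => ae_all_iff.2 fun i => hν0 i k
    filter_upwards [hC, hmix, hpos k, hpos l] with t h1 h2 h3 h4
    have h5 := h1 fun i => ν i k t - ν i l t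
    have h6 : ‖ν i k t - ν i l t‖ ≤ ∑ i, |ν i k t - ν i l t| :=
      Finset.single_le_sum (f := fun i => |ν i k t - ν i l t|) (fun _ _ => abs_nonneg _)
        (Finset.mem_univ i)
    refine h6.trans (h5.trans ?_)
    rw [← mul_add]
    refine mul_le_mul_of_nonneg_left ?_ hC0
    have h7 : ∑ i, (ν i k t - ν i l t) • P.a i (xbar t)
        = ((P.f₂ (xbar t)).adjoint (pbar t) + ∑ i, ν i k t • P.a i (xbar t))
          - ((P.f₂ (xbar t)).adjoint (pbar t) + ∑ i, ν i l t • P.a i (xbar t)) := by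
      simp only [sub_smul, Finset.sum_sub_distrib]
      abel
    have h8 : ∑ i, |ν i k t - ν i l t| * (-P.c i (xbar t) (ubar t))
        ≤ ∑ i, ν i k t * (-P.c i (xbar t) (ubar t))
          + ∑ i, ν i l t * (-P.c i (xbar t) (ubar t)) := by
      rw [← Finset.sum_add_distrib]
      refine Finset.sum_le_sum fun i _ => ?_
      rw [← add_mul]
      refine mul_le_mul_of_nonneg_right ?_ (neg_nonneg.2 (h2 i))
      rw [abs_le]
      constructor <;> linarith [h3 i, h4 i]
    rw [h7]
    linarith [norm_sub_le ((P.f₂ (xbar t)).adjoint (pbar t) + ∑ i, ν i k t • P.a i (xbar t))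
      ((P.f₂ (xbar t)).adjoint (pbar t) + ∑ i, ν i l t • P.a i (xbar t))]
  have he : Tendsto (fun k => C * (s k + d k)) atTop (𝓝 0) := by
    simpa using (hslim.add hdef).const_mul C
  choose νbar hνi hνl using fun i => exists_L1_limit (hν i) he (hcauchy i)
  have hν0' : ∀ i, ∀ᵐ t ∂volOn P.T, 0 ≤ νbar i t := by
    intro i
    have h1 : Integrable (fun t => max (-νbar i t) 0) (volOn P.T) := (hνi i).neg.pos_part
    have h2 := ae_eq_zero_of_forall_integral_le h1 (hνl i) fun k => by
      refine integral_mono_ae h1.norm ((hν i k).sub (hνi i)).norm ?_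
      filter_upwards [hν0 i k] with t ht
      simp only [Real.norm_eq_abs]
      rw [abs_of_nonneg (le_max_right _ _)]
      exact max_le ((by linarith : -νbar i t ≤ ν i k t - νbar i t).trans (le_abs_self _))
        (abs_nonneg _)
    filter_upwards [h2] with t ht
    have := le_max_left (-νbar i t) 0
    linarith
  have hdiff : ∀ {E : Type} [NormedAddCommGroup E] [NormedSpace ℝ E] (i : Fin nc) (K : ℝ → E),
      MemLp K ⊤ (volOn P.T) →
      Tendsto (fun k => ∫ t, ‖(ν i k t - νbar i t) • K t‖ ∂volOn P.T) atTop (𝓝 0) := by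
    intro E _ _ i K hK
    obtain ⟨M, hM0, hM⟩ := memLp_top_ae_bound hK
    refine squeeze_zero (fun k => integral_nonneg fun _ => norm_nonneg _) (fun k => ?_)
      (by simpa using (hνl i).mul_const M)
    rw [← integral_mul_const]
    refine integral_mono_of_nonneg (Eventually.of_forall fun _ => norm_nonneg _)
      (((hν i k).sub (hνi i)).norm.mul_const M) ?_
    filter_upwards [hM] with t ht
    rw [norm_smul]
    exact mul_le_mul_of_nonneg_left ht (norm_nonneg _)
  have hstat' : ∀ᵐ t ∂volOn P.T,
      (P.f₂ (xbar t)).adjoint (pbar t) + ∑ i, νbar i t • P.a i (xbar t) = 0 := by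
    have hI : Integrable (fun t => (P.f₂ (xbar t)).adjoint (pbar t)
        + ∑ i, νbar i t • P.a i (xbar t)) (volOn P.T) :=
      hqi.add (integrable_finsetSum _ fun i _ => integrable_smul_memLp (hνi i) (ha i))
    have h3 := tendsto_finsetSum (Finset.univ : Finset (Fin nc)) fun i _ => hdiff i _ (ha i)
    have hup := hslim.add h3
    simp only [Finset.sum_const_zero, add_zero] at hup
    refine ae_eq_zero_of_forall_integral_le hI hup fun k => ?_
    have hI3 : ∀ i, Integrable (fun t => ‖(ν i k t - νbar i t) • P.a i (xbar t)‖) (volOn P.T) :=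
      fun i => (integrable_smul_memLp ((hν i k).sub (hνi i)) (ha i)).norm
    rw [← integral_finsetSum _ fun i _ => hI3 i,
      ← integral_add (hIs k).norm (integrable_finsetSum _ fun i _ => hI3 i)]
    refine integral_mono hI.norm ((hIs k).norm.add (integrable_finsetSum _ fun i _ => hI3 i))
      fun t => ?_
    have e : (P.f₂ (xbar t)).adjoint (pbar t) + ∑ i, νbar i t • P.a i (xbar t)
        = ((P.f₂ (xbar t)).adjoint (pbar t) + ∑ i, ν i k t • P.a i (xbar t))
          - ∑ i, (ν i k t - νbar i t) • P.a i (xbar t) := by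
      simp only [sub_smul, Finset.sum_sub_distrib]
      abel
    simp only [e]
    exact (norm_sub_le _ _).trans (add_le_add le_rfl (norm_sum_le _ _))
  have hcompl' : ∀ i, ∀ᵐ t ∂volOn P.T, P.c i (xbar t) (ubar t) * νbar i t = 0 := by
    intro i
    have hI : Integrable (fun t => νbar i t * (-P.c i (xbar t) (ubar t))) (volOn P.T) :=
      integrable_smul_memLp (hνi i) (hc i)
    have hup := hdef.add (hdiff i _ (hc i))
    rw [add_zero] at hup
    have := ae_eq_zero_of_forall_integral_le hI hup fun k => by
      have hI1 : Integrable (fun t => ν i k t * (-P.c i (xbar t) (ubar t))) (volOn P.T) :=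
        integrable_smul_memLp (hν i k) (hc i)
      have hI2 : Integrable (fun t => ‖(ν i k t - νbar i t) • (-P.c i (xbar t) (ubar t))‖)
        (volOn P.T) := (integrable_smul_memLp ((hν i k).sub (hνi i)) (hc i)).norm
      have h1 : ∫ t, ν i k t * (-P.c i (xbar t) (ubar t)) ∂volOn P.T ≤ d k :=
        Finset.single_le_sum
          (f := fun i => ∫ t, ν i k t * (-P.c i (xbar t) (ubar t)) ∂volOn P.T)
          (fun i _ => hd0 i k) (Finset.mem_univ i)
      refine le_trans ?_ (add_le_add h1 le_rfl)
      rw [← integral_add hI1 hI2]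
      refine integral_mono_ae hI.norm (hI1.add hI2) ?_
      filter_upwards [hmix, hν0 i k] with t h2 h3
      have h4 := mul_nonneg h3 (neg_nonneg.2 (h2 i))
      have e : νbar i t * (-P.c i (xbar t) (ubar t)) = ν i k t * (-P.c i (xbar t) (ubar t))
        - (ν i k t - νbar i t) • (-P.c i (xbar t) (ubar t)) := by rw [smul_eq_mul]; ring
      simp only [e]
      refine (norm_sub_le _ _).trans (add_le_add ?_ le_rfl)
      rw [Real.norm_of_nonneg h4]
    filter_upwards [this] with t ht
    linarith
  refine ⟨νbar, fun i => ?_, hν0', hνl, hstat', hcompl'⟩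
  obtain ⟨M, -, hM⟩ := memLp_top_ae_bound hqbar
  refine memLp_top_of_bound (hνi i).1 (C * M) ?_
  have hcall : ∀ᵐ t ∂volOn P.T, ∀ i, P.c i (xbar t) (ubar t) * νbar i t = 0 :=
    ae_all_iff.2 hcompl'
  have hpall : ∀ᵐ t ∂volOn P.T, ∀ i, 0 ≤ νbar i t := ae_all_iff.2 hν0'
  filter_upwards [hC, hstat', hcall, hM, hpall] with t h1 h2 h3 h4 h5
  have h6 := h1 fun i => νbar i t
  have h7 : ∑ i, |νbar i t| * (-P.c i (xbar t) (ubar t)) = 0 :=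
    Finset.sum_eq_zero fun i _ => by rw [abs_of_nonneg (h5 i)]; linarith [h3 i]
  have h8 : ∑ i, νbar i t • P.a i (xbar t) = -(P.f₂ (xbar t)).adjoint (pbar t) :=
    eq_neg_of_add_eq_zero_right h2
  rw [h7, h8, norm_neg, add_zero] at h6
  have h9 : ‖νbar i t‖ ≤ ∑ i, |νbar i t| :=
    Finset.single_le_sum (f := fun i => |νbar i t|) (fun _ _ => abs_nonneg _) (Finset.mem_univ i)
  exact h9.trans (h6.trans (mul_le_mul_of_nonneg_left h4 hC0))

end

end OCP

end

noncomputable section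

theorem BoundedVariationOn.of_norm_sub_le {E : Type*} [NormedAddCommGroup E] {f : ℝ → E}
    {M : ℝ → ℝ} {S : Set ℝ} (hM : BoundedVariationOn M S)
    (hle : ∀ s ∈ S, ∀ t ∈ S, s ≤ t → ‖f t - f s‖ ≤ M t - M s) : BoundedVariationOn f S := by
  refine ne_top_of_le_ne_top hM (iSup_mono fun q => Finset.sum_le_sum fun i _ => ?_)
  have h := hle _ (q.2.2.2 i) _ (q.2.2.2 (i + 1)) (q.2.2.1 (Nat.le_succ i))
  rw [edist_dist, edist_dist, dist_eq_norm, Real.dist_eq]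
  exact ENNReal.ofReal_le_ofReal (h.trans (le_abs_self _))

/-- A function defined by integration, from the right, of a density and of vector measures has
bounded variation. -/
theorem boundedVariationOn_tail {T : ℝ} (hT : 0 ≤ T) {n : ℕ} {ι : Type*} [Fintype ι]
    {F : ℝ → Vec n} (hF : Integrable F (volOn T)) {μ : ι → Measure ℝ} {G : ι → ℝ → Vec n}
    (hG : ∀ i, Integrable (G i) (μ i))
    {a : Vec n} : BoundedVariationOn
      (fun t => a + (∫ s in t..T, F s) + ∑ i, ∫ s in Ioc t T, G i s ∂μ i) (Icc 0 T) := by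
  set M : ℝ → ℝ := fun t => (∫ s in (0 : ℝ)..t, ‖F s‖) + ∑ i, ∫ s in Ioc 0 t, ‖G i s‖ ∂μ i with hM
  have hTm : T ∈ Icc 0 T := ⟨hT, le_rfl⟩
  have h0m : (0 : ℝ) ∈ Icc 0 T := ⟨le_rfl, hT⟩
  have hMd : ∀ s ∈ Icc 0 T, ∀ t ∈ Icc 0 T, s ≤ t →
      M t - M s = (∫ r in s..t, ‖F r‖) + ∑ i, ∫ r in Ioc s t, ‖G i r‖ ∂μ i := by
    intro s hs t ht hst
    have h1 : (∫ r in (0 : ℝ)..t, ‖F r‖) = (∫ r in (0 : ℝ)..s, ‖F r‖) + ∫ r in s..t, ‖F r‖ :=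
      (intervalIntegral.integral_add_adjacent_intervals
        (integrable_volOn_intervalIntegrable hF.norm h0m hs)
        (integrable_volOn_intervalIntegrable hF.norm hs ht)).symm
    have h2 : ∀ i, ∫ r in Ioc 0 t, ‖G i r‖ ∂μ i
        = (∫ r in Ioc 0 s, ‖G i r‖ ∂μ i) + ∫ r in Ioc s t, ‖G i r‖ ∂μ i := fun i => by
      rw [← Ioc_union_Ioc_eq_Ioc hs.1 hst]
      exact setIntegral_union (Ioc_disjoint_Ioc_of_le le_rfl) measurableSet_Ioc
        (hG i).norm.integrableOn (hG i).norm.integrableOn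
    simp only [hM, h1, Finset.sum_congr rfl fun i _ => h2 i, Finset.sum_add_distrib]
    ring
  have hmono : MonotoneOn M (Icc 0 T) := by
    intro s hs t ht hst
    have := hMd s hs t ht hst
    have h1 : 0 ≤ ∫ r in s..t, ‖F r‖ :=
      intervalIntegral.integral_nonneg hst fun _ _ => norm_nonneg _
    have h2 : 0 ≤ ∑ i, ∫ r in Ioc s t, ‖G i r‖ ∂μ i :=
      Finset.sum_nonneg fun i _ => integral_nonneg fun _ => norm_nonneg _
    linarith
  refine BoundedVariationOn.of_norm_sub_le (M := M) (hmono.boundedVariationOn (C := M T) ?_) ?_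
  · intro t ht
    rw [abs_of_nonneg]
    · exact hmono ht hTm ht.2
    · have := hmono h0m ht ht.1
      simpa [hM] using this
  · intro s hs t ht hst
    rw [hMd s hs t ht hst]
    have h1 : (∫ r in s..T, F r) = (∫ r in s..t, F r) + ∫ r in t..T, F r :=
      (intervalIntegral.integral_add_adjacent_intervals
        (integrable_volOn_intervalIntegrable hF hs ht)
        (integrable_volOn_intervalIntegrable hF ht hTm)).symm
    have h2 : ∀ i, ∫ r in Ioc s T, G i r ∂μ i
        = (∫ r in Ioc s t, G i r ∂μ i) + ∫ r in Ioc t T, G i r ∂μ i := fun i => by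
      rw [← Ioc_union_Ioc_eq_Ioc hst ht.2]
      exact setIntegral_union (Ioc_disjoint_Ioc_of_le le_rfl) measurableSet_Ioc
        (hG i).integrableOn (hG i).integrableOn
    have h3 : (a + (∫ r in t..T, F r) + ∑ i, ∫ r in Ioc t T, G i r ∂μ i)
        - (a + (∫ r in s..T, F r) + ∑ i, ∫ r in Ioc s T, G i r ∂μ i)
        = -((∫ r in s..t, F r) + ∑ i, ∫ r in Ioc s t, G i r ∂μ i) := by
      simp only [h1, Finset.sum_congr rfl fun i _ => h2 i, Finset.sum_add_distrib]
      abel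
    rw [h3, norm_neg]
    refine (norm_add_le _ _).trans (add_le_add
      (intervalIntegral.norm_integral_le_integral_norm hst)
      (norm_sum_le_of_le _ fun i _ => norm_integral_le_integral_norm _))

namespace OCP

open Topology

variable {n m nh ng nc : ℕ} {P : OCP n m nh ng nc}

variable (P) in
/-- Values of the constraints along a trajectory. -/
def constr (x : ℝ → Vec n) (u : ℝ → Vec m) : Fin ng ⊕ Fin nc → ℝ → ℝ :=
  Sum.elim (fun i t => P.g i (x t)) (fun i t => P.c i (x t) (u t))

variable (P) in
/-- Gradients of the constraints with respect to the state. -/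
def constrX (x : ℝ → Vec n) (u : ℝ → Vec m) : Fin ng ⊕ Fin nc → ℝ → Vec n :=
  Sum.elim (fun i t => gradient (P.g i) (x t)) (fun i t => P.mixedGrad i (x t) (u t))

variable (P) in
/-- Gradients of the constraints with respect to the control. -/
def constrU (x : ℝ → Vec n) : Fin ng ⊕ Fin nc → ℝ → Vec m :=
  Sum.elim (fun _ _ => 0) (fun i t => P.a i (x t))

variable (P) in
/-- Approximate multipliers of the constraints of the problem linearized at a trajectory. -/
def IsApproxMultiplier (x : ℝ → Vec n) (u : ℝ → Vec m) (δ : ℝ) (p : ℝ → Vec n) (lam : Vec nh)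
    (ω : Fin ng ⊕ Fin nc → ℝ → ℝ) : Prop :=
  ApproxMultiplier P.T (fun t => P.dynDeriv (x t) (u t)) (fun t => P.f₂ (x t))
    (P.hDeriv₀ (x 0) (x P.T)) (P.hDeriv₁ (x 0) (x P.T)) (P.constr x u) (P.constrX x u)
    (P.constrU x) δ p lam ω

theorem Smooth.memLp_constr (hsm : P.Smooth) {x : ℝ → Vec n} {u : ℝ → Vec m}
    (hx : ContinuousOn x (Icc 0 P.T)) (hu : MemLp u ⊤ (volOn P.T)) (i : Fin ng ⊕ Fin nc) :
    MemLp (P.constr x u i) ⊤ (volOn P.T) := by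
  rcases i with i | i
  · exact memLp_continuousOn ((hsm.g_C2 i).continuous.comp_continuousOn hx) ⊤
  · exact hsm.memLp_c i hx hu

theorem Smooth.memLp_constrX (hsm : P.Smooth) {x : ℝ → Vec n} {u : ℝ → Vec m}
    (hx : ContinuousOn x (Icc 0 P.T)) (hu : MemLp u ⊤ (volOn P.T)) (i : Fin ng ⊕ Fin nc) :
    MemLp (P.constrX x u i) ⊤ (volOn P.T) := by
  rcases i with i | i
  · exact memLp_continuousOn ((hsm.continuous_gradient_g i).comp_continuousOn hx) ⊤
  · exact hsm.memLp_mixedGrad i hx hu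

theorem Smooth.memLp_constrU (hsm : P.Smooth) {x : ℝ → Vec n}
    (hx : ContinuousOn x (Icc 0 P.T)) (i : Fin ng ⊕ Fin nc) :
    MemLp (P.constrU x i) ⊤ (volOn P.T) := by
  rcases i with i | i
  · exact MemLp.zero
  · exact memLp_continuousOn ((hsm.a i).continuous.comp_continuousOn hx) ⊤

theorem exists_bound_on_balls {F : Type*} [SeminormedAddCommGroup F] {G : Vec n → Vec m → F}
    (hG : Continuous fun z : Vec n × Vec m => G z.1 z.2) (R : ℝ) :
    ∃ C : ℝ, 0 ≤ C ∧ ∀ x u, ‖x‖ ≤ R → ‖u‖ ≤ R → ‖G x u‖ ≤ C := by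
  obtain ⟨C, hC⟩ := ((isCompact_closedBall (0 : Vec n) R).prod
    (isCompact_closedBall (0 : Vec m) R)).exists_bound_of_continuousOn hG.continuousOn
  refine ⟨max C 0, le_max_right _ _, fun x u hx hu => (hC (x, u) ⟨?_, ?_⟩).trans (le_max_left _ _)⟩
  · exact mem_closedBall_zero_iff.2 hx
  · exact mem_closedBall_zero_iff.2 hu

theorem Smooth.continuous_dynDeriv (hsm : P.Smooth) :
    Continuous fun z : Vec n × Vec m => P.dynDeriv z.1 z.2 :=
  (hsm.continuous_fderiv_f₁.comp continuous_fst).add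
    (((ContinuousLinearMap.flipₗᵢ ℝ (Vec n) (Vec m) (Vec n)).continuous.comp
      (hsm.continuous_fderiv_f₂.comp continuous_fst)).clm_apply continuous_snd)

theorem Smooth.continuous_mixedGrad (hsm : P.Smooth) (i : Fin nc) :
    Continuous fun z : Vec n × Vec m => P.mixedGrad i z.1 z.2 :=
  ((hsm.continuous_gradient_b i).comp continuous_fst).add
    (((ContinuousLinearMap.adjoint (𝕜 := ℝ) (E := Vec n) (F := Vec m)).continuous.comp
      ((hsm.continuous_fderiv_a i).comp continuous_fst)).clm_apply continuous_snd)

section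

variable {R : ℝ} {x : ℕ → ℝ → Vec n} {u : ℕ → ℝ → Vec m} {xbar : ℝ → Vec n} {ubar : ℝ → Vec m}
  {p : ℕ → ℝ → Vec n} {lam : ℕ → Vec nh} {ω : ℕ → Fin ng ⊕ Fin nc → ℝ → ℝ} {δ : ℕ → ℝ}

variable (P) in
/-- Density of the costate. -/
def costateDensity (x : ℝ → Vec n) (u : ℝ → Vec m) (p : ℝ → Vec n)
    (ω : Fin ng ⊕ Fin nc → ℝ → ℝ) (s : ℝ) : Vec n :=
  (P.dynDeriv (x s) (u s)).adjoint (p s) + ∑ i, ω i s • P.constrX x u i s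

theorem integrable_costateDensity (hsm : P.Smooth) {x : ℝ → Vec n} {u : ℝ → Vec m}
    (hx : ContinuousOn x (Icc 0 P.T)) (hu : MemLp u ⊤ (volOn P.T)) {p : ℝ → Vec n}
    (hp : Integrable p (volOn P.T)) {ω : Fin ng ⊕ Fin nc → ℝ → ℝ}
    (hω : ∀ i, Integrable (ω i) (volOn P.T)) :
    Integrable (P.costateDensity x u p ω) (volOn P.T) :=
  (memLp_one_iff_integrable.1 (memLp_adjoint_apply (hsm.memLp_dynDeriv hx hu)
    (memLp_one_iff_integrable.2 hp))).add
    (integrable_finsetSum _ fun i _ => integrable_smul_memLp (hω i) (hsm.memLp_constrX hx hu i))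

/-- The densities of the costates are bounded in `L¹`. -/
theorem exists_costateDensity_bound (hsm : P.Smooth) (R : ℝ) :
    ∃ C : ℝ, 0 ≤ C ∧ ∀ (x : ℝ → Vec n) (u : ℝ → Vec m) (δ : ℝ) (p : ℝ → Vec n) (lam : Vec nh)
      (ω : Fin ng ⊕ Fin nc → ℝ → ℝ), (∀ t ∈ Icc 0 P.T, ‖x t‖ ≤ R) →
      (∀ᵐ t ∂volOn P.T, ‖u t‖ ≤ R) → P.IsApproxMultiplier x u δ p lam ω →
      ∫ t, ‖P.costateDensity x u p ω t‖ ∂volOn P.T ≤ C := by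
  obtain ⟨CA, hCA0, hCA⟩ := exists_bound_on_balls hsm.continuous_dynDeriv R
  have hK : ∀ i : Fin ng ⊕ Fin nc, ∃ C : ℝ, 0 ≤ C ∧ ∀ (x : ℝ → Vec n) (u : ℝ → Vec m) (t : ℝ),
      ‖x t‖ ≤ R → ‖u t‖ ≤ R → ‖P.constrX x u i t‖ ≤ C := by
    intro i
    rcases i with i | i
    · obtain ⟨C, h0, hC⟩ := exists_bound_on_balls (m := m) (G := fun x _ => gradient (P.g i) x)
        ((hsm.continuous_gradient_g i).comp continuous_fst) R
      exact ⟨C, h0, fun x u t hx hu => hC _ _ hx hu⟩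
    · obtain ⟨C, h0, hC⟩ := exists_bound_on_balls (hsm.continuous_mixedGrad i) R
      exact ⟨C, h0, fun x u t hx hu => hC _ _ hx hu⟩
  choose CK hCK0 hCK using hK
  refine ⟨CA + ∑ i, CK i, add_nonneg hCA0 (Finset.sum_nonneg fun i _ => hCK0 i), ?_⟩
  intro x u δ p lam ω hx hu hm
  have hm1 := hm.mass
  have hω0 : ∀ i, 0 ≤ ∫ t, ω i t ∂volOn P.T := fun i => integral_nonneg_of_ae (hm.ω_nonneg i)
  have hp0 : 0 ≤ ∫ t, ‖p t‖ ∂volOn P.T := integral_nonneg fun _ => norm_nonneg _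
  have hs0 : 0 ≤ ∑ i, ∫ t, ω i t ∂volOn P.T := Finset.sum_nonneg fun i _ => hω0 i
  have hp1 : ∫ t, ‖p t‖ ∂volOn P.T ≤ 1 := by linarith [norm_nonneg lam]
  have hω1 : ∀ i, ∫ t, ω i t ∂volOn P.T ≤ 1 := fun i => by
    have := Finset.single_le_sum (f := fun i => ∫ t, ω i t ∂volOn P.T) (fun i _ => hω0 i)
      (Finset.mem_univ i)
    linarith [norm_nonneg lam]
  have hi1 : Integrable (fun t => CA * ‖p t‖) (volOn P.T) := hm.p_int.norm.const_mul CA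
  have hi2 : ∀ i, Integrable (fun t => CK i * ω i t) (volOn P.T) := fun i =>
    (hm.ω_int i).const_mul _
  have hi3 := integrable_finsetSum Finset.univ fun i _ => hi2 i
  calc ∫ t, ‖P.costateDensity x u p ω t‖ ∂volOn P.T
      ≤ ∫ t, CA * ‖p t‖ + ∑ i, CK i * ω i t ∂volOn P.T := by
        refine integral_mono_of_nonneg (Eventually.of_forall fun _ => norm_nonneg _)
          (hi1.add hi3) ?_
        have hpos : ∀ᵐ t ∂volOn P.T, ∀ i, 0 ≤ ω i t := ae_all_iff.2 hm.ω_nonneg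
        filter_upwards [hu, ae_volOn_mem, hpos] with t h1 ht h2
        refine (norm_add_le _ _).trans (add_le_add ?_ (norm_sum_le_of_le _ fun i _ => ?_))
        · refine (ContinuousLinearMap.le_opNorm _ _).trans ?_
          rw [LinearIsometryEquiv.norm_map]
          exact mul_le_mul_of_nonneg_right (hCA _ _ (hx t ht) h1) (norm_nonneg _)
        · rw [norm_smul, Real.norm_of_nonneg (h2 i), mul_comm]
          exact mul_le_mul_of_nonneg_right (hCK i x u t (hx t ht) h1) (h2 i)
    _ = CA * ∫ t, ‖p t‖ ∂volOn P.T + ∑ i, CK i * ∫ t, ω i t ∂volOn P.T := by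
        rw [integral_add hi1 hi3, integral_const_mul, integral_finsetSum _ fun i _ => hi2 i]
        simp only [integral_const_mul]
    _ ≤ _ := by
        refine add_le_add (mul_le_of_le_one_right hCA0 hp1) (Finset.sum_le_sum fun i _ => ?_)
        exact mul_le_of_le_one_right (hCK0 i) (hω1 i)

theorem residual_parts {T : ℝ} {ι : Type*} [Fintype ι] {A : ℝ → Vec n →L[ℝ] Vec n}
    {B : ℝ → Vec m →L[ℝ] Vec n} {H₁ H₂ : Vec n →L[ℝ] Vec nh} {k : ι → ℝ → ℝ} {K : ι → ℝ → Vec n}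
    {D : ι → ℝ → Vec m} {δ : ℝ} {p : ℝ → Vec n} {lam : Vec nh} {ω : ι → ℝ → ℝ}
    (h : ApproxMultiplier T A B H₁ H₂ k K D δ p lam ω)
    (hk : ∀ i, 0 ≤ ∫ t, ω i t * (-k i t) ∂volOn T) :
    ∫ t, ‖costate T A K H₂ p lam ω t - p t‖ ∂volOn T ≤ δ ∧
    ∫ t, ‖(B t).adjoint (p t) + ∑ i, ω i t • D i t‖ ∂volOn T ≤ δ ∧
    ‖H₁.adjoint lam + costate T A K H₂ p lam ω 0‖ ≤ δ ∧
    ∀ S : Finset ι, ∑ i ∈ S, ∫ t, ω i t * (-k i t) ∂volOn T ≤ δ := by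
  have h1 : 0 ≤ ∫ t, ‖costate T A K H₂ p lam ω t - p t‖ ∂volOn T :=
    integral_nonneg fun _ => norm_nonneg _
  have h2 : 0 ≤ ∫ t, ‖(B t).adjoint (p t) + ∑ i, ω i t • D i t‖ ∂volOn T :=
    integral_nonneg fun _ => norm_nonneg _
  have h3 := norm_nonneg (H₁.adjoint lam + costate T A K H₂ p lam ω 0)
  have h4 : 0 ≤ ∑ i, ∫ t, ω i t * (-k i t) ∂volOn T := Finset.sum_nonneg fun i _ => hk i
  have h5 := h.residual
  refine ⟨by linarith, by linarith, by linarith, fun S => ?_⟩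
  have := Finset.sum_le_sum_of_subset_of_nonneg (Finset.subset_univ S)
    (f := fun i => ∫ t, ω i t * (-k i t) ∂volOn T) fun i _ _ => hk i
  linarith

end

end OCP

end

noncomputable section

namespace OCP

open Topology

variable {n m nh ng nc : ℕ} {P : OCP n m nh ng nc}

theorem tendsto_clm_apply {E F : Type*} [NormedAddCommGroup E] [NormedSpace ℝ E]
    [NormedAddCommGroup F] [NormedSpace ℝ F] {H : ℕ → E →L[ℝ] F} {Hbar : E →L[ℝ] F}
    {lam : ℕ → E} {lambar : E} (hH : Tendsto H atTop (𝓝 Hbar))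
    (hlam : Tendsto lam atTop (𝓝 lambar)) :
    Tendsto (fun k => H k (lam k)) atTop (𝓝 (Hbar lambar)) := by
  have h₂ : Continuous fun z : (E →L[ℝ] F) × E => z.1 z.2 :=
    continuous_fst.clm_apply continuous_snd
  exact (h₂.tendsto' (Hbar, lambar) _ rfl).comp (hH.prodMk_nhds hlam)

theorem tendsto_adjoint_apply {H : ℕ → Vec n →L[ℝ] Vec nh} {Hbar : Vec n →L[ℝ] Vec nh}
    {lam : ℕ → Vec nh} {lambar : Vec nh} (hH : Tendsto H atTop (𝓝 Hbar))
    (hlam : Tendsto lam atTop (𝓝 lambar)) :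
    Tendsto (fun k => (H k).adjoint (lam k)) atTop (𝓝 (Hbar.adjoint lambar)) := by
  have h₁ : Tendsto (fun k => (H k).adjoint) atTop (𝓝 Hbar.adjoint) :=
    ((ContinuousLinearMap.adjoint (𝕜 := ℝ) (E := Vec n) (F := Vec nh)).continuous.tendsto
      Hbar).comp hH
  exact tendsto_clm_apply h₁ hlam

theorem IsAdmissible.constr_nonpos {x : ℝ → Vec n} {u : ℝ → Vec m} (h : P.IsAdmissible x u) :
    ∀ᵐ t ∂volOn P.T, ∀ i, P.constr x u i t ≤ 0 := by
  filter_upwards [h.mixed_le, ae_volOn_mem] with t h1 ht i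
  rcases i with i | i
  · exact h.state_le t ht i
  · exact h1 i

theorem _root_.MeasureLim.integral_split {T : ℝ} (hT : 0 ≤ T) {w : ℕ → ℝ → ℝ} {μ : Measure ℝ}
    (h : MeasureLim T w μ) {G : ℝ → Vec n} (hG : ContinuousOn G (Icc 0 T)) :
    ∫ s, G s ∂μ = (μ {0}).toReal • G 0 + ∫ s in Ioc 0 T, G s ∂μ := by
  have hi := h.integrable_of_bound hG
  have h1 : ∫ s, G s ∂μ = ∫ s in Icc 0 T, G s ∂μ := by
    rw [Measure.restrict_eq_self_of_ae_mem h.ae_mem]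
  have h2 : Icc (0 : ℝ) T = {0} ∪ Ioc 0 T := by
    rw [← Icc_self, Icc_union_Ioc_eq_Icc le_rfl hT]
  rw [h1, h2, setIntegral_union (by simp) measurableSet_Ioc
    hi.integrableOn hi.integrableOn, integral_singleton]
  rfl

section

variable {R : ℝ} {x : ℕ → ℝ → Vec n} {u : ℕ → ℝ → Vec m} {xbar : ℝ → Vec n} {ubar : ℝ → Vec m}
  {p : ℕ → ℝ → Vec n} {lam : ℕ → Vec nh} {ω : ℕ → Fin ng ⊕ Fin nc → ℝ → ℝ} {δ : ℕ → ℝ}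

/-- The approximate costates converge in `L¹`. -/
theorem StateLim.tendsto_costate (h : StateLim P.T R x u xbar ubar) (hsm : P.Smooth)
    (hT : 0 ≤ P.T) {lambar : Vec nh} (hlam : Tendsto lam atTop (𝓝 lambar))
    (hp : ∀ k, Integrable (p k) (volOn P.T))
    (hω : ∀ k i, Integrable (ω k i) (volOn P.T)) (hδ : Tendsto δ atTop (𝓝 0))
    {C : ℝ} (hC : ∀ k, ∫ t, ‖P.costateDensity (x k) (u k) (p k) (ω k) t‖ ∂volOn P.T ≤ C)
    (hres : ∀ k, ∫ t, ‖(P.hDeriv₁ (x k 0) (x k P.T)).adjoint (lam k)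
      + (∫ s in t..P.T, P.costateDensity (x k) (u k) (p k) (ω k) s) - p k t‖ ∂volOn P.T ≤ δ k)
    {tail : ℝ → Vec n} (htail : ∀ᵐ t ∂volOn P.T, Tendsto
      (fun k => ∫ s in t..P.T, P.costateDensity (x k) (u k) (p k) (ω k) s) atTop (𝓝 (tail t))) :
    MemLp (fun t => (P.hDeriv₁ (xbar 0) (xbar P.T)).adjoint lambar + tail t) ⊤ (volOn P.T) ∧
    Tendsto (fun k => ∫ t, ‖p k t
      - ((P.hDeriv₁ (xbar 0) (xbar P.T)).adjoint lambar + tail t)‖ ∂volOn P.T) atTop (𝓝 0) := by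
  have h0m : (0 : ℝ) ∈ Icc 0 P.T := ⟨le_rfl, hT⟩
  have hTm : P.T ∈ Icc 0 P.T := ⟨hT, le_rfl⟩
  have hwi : ∀ k, Integrable (P.costateDensity (x k) (u k) (p k) (ω k)) (volOn P.T) := fun k =>
    integrable_costateDensity hsm (h.cont k) (memLp_top_of_bound (h.weak.meas k) R (h.weak.bound k))
      (hp k) (hω k)
  set H : ℕ → Vec n := fun k => (P.hDeriv₁ (x k 0) (x k P.T)).adjoint (lam k) with hH
  set Hbar : Vec n := (P.hDeriv₁ (xbar 0) (xbar P.T)).adjoint lambar with hHbar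
  have hHlim : Tendsto H atTop (𝓝 Hbar) := by
    have h1 : Tendsto (fun k => P.hDeriv₁ (x k 0) (x k P.T)) atTop
        (𝓝 (P.hDeriv₁ (xbar 0) (xbar P.T))) :=
      (hsm.continuous_hDeriv₁.tendsto (xbar 0, xbar P.T)).comp
        ((h.tendsto_at h0m).prodMk_nhds (h.tendsto_at hTm))
    exact tendsto_adjoint_apply h1 hlam
  obtain ⟨B, hB⟩ := hHlim.norm.bddAbove_range
  have hB' : ∀ k, ‖H k‖ ≤ B := fun k => hB ⟨k, rfl⟩
  set c : ℕ → ℝ → Vec n := fun k t =>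
    H k + ∫ s in t..P.T, P.costateDensity (x k) (u k) (p k) (ω k) s with hc
  have hcc : ∀ k, ContinuousOn (c k) (Icc 0 P.T) := fun k =>
    continuousOn_const.add (continuousOn_intervalIntegral_volOn_left (hwi k) hT)
  have hcm : ∀ k, AEStronglyMeasurable (c k) (volOn P.T) := fun k =>
    (hcc k).aestronglyMeasurable measurableSet_Icc
  have hcb : ∀ k, ∀ᵐ t ∂volOn P.T, ‖c k t‖ ≤ B + C := by
    intro k
    filter_upwards [ae_volOn_mem] with t ht
    exact (norm_add_le _ _).trans (add_le_add (hB' k)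
      ((norm_intervalIntegral_le_volOn (hwi k) ht hTm).trans (hC k)))
  have hclim : ∀ᵐ t ∂volOn P.T, Tendsto (fun k => c k t) atTop (𝓝 (Hbar + tail t)) := by
    filter_upwards [htail] with t ht using hHlim.add ht
  have hQm : AEStronglyMeasurable (fun t => Hbar + tail t) (volOn P.T) :=
    aestronglyMeasurable_of_tendsto_ae atTop hcm hclim
  have hQb : ∀ᵐ t ∂volOn P.T, ‖Hbar + tail t‖ ≤ B + C := by
    filter_upwards [hclim, ae_all_iff.2 hcb] with t h1 h2
    exact le_of_tendsto' h1.norm h2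
  have hQ : MemLp (fun t => Hbar + tail t) ⊤ (volOn P.T) := memLp_top_of_bound hQm _ hQb
  refine ⟨hQ, ?_⟩
  have hci : ∀ k, Integrable (c k) (volOn P.T) := fun k => (hcc k).integrableOn_Icc
  have hQi := hQ.integrable (μ := volOn P.T) le_top
  have h1 : Tendsto (fun k => ∫ t, ‖c k t - (Hbar + tail t)‖ ∂volOn P.T) atTop (𝓝 0) := by
    have := tendsto_integral_of_dominated_convergence (μ := volOn P.T)
      (F := fun k t => ‖c k t - (Hbar + tail t)‖) (f := fun _ => (0 : ℝ))
      (fun _ => (B + C) + (B + C)) (fun k => ((hcm k).sub hQm).norm) (integrable_const _)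
      (fun k => by
        filter_upwards [hcb k, hQb] with t h1 h2
        rw [norm_norm]
        exact (norm_sub_le _ _).trans (add_le_add h1 h2))
      (by
        filter_upwards [hclim] with t ht
        exact tendsto_iff_norm_sub_tendsto_zero.1 ht)
    simpa using this
  refine squeeze_zero (fun k => integral_nonneg fun _ => norm_nonneg _) (fun k => ?_)
    (by simpa using hδ.add h1)
  refine le_trans ?_ (add_le_add (hres k) le_rfl)
  have hi1 : Integrable (fun t => ‖c k t - p k t‖) (volOn P.T) := ((hci k).sub (hp k)).norm
  have hi2 : Integrable (fun t => ‖c k t - (Hbar + tail t)‖) (volOn P.T) := ((hci k).sub hQi).norm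
  rw [← integral_add hi1 hi2]
  refine integral_mono ((hp k).sub hQi).norm (hi1.add hi2) fun t => ?_
  have e : p k t - (Hbar + tail t) = (c k t - (Hbar + tail t)) - (c k t - p k t) := by abel
  simp only [e]
  exact (norm_sub_le _ _).trans (add_comm _ _).le

theorem ω_defect_nonneg {x : ℝ → Vec n} {u : ℝ → Vec m} (hadm : P.IsAdmissible x u)
    {ω : Fin ng ⊕ Fin nc → ℝ → ℝ} (hω : ∀ i, ∀ᵐ t ∂volOn P.T, 0 ≤ ω i t) (i : Fin ng ⊕ Fin nc) :
    0 ≤ ∫ t, ω i t * (-P.constr x u i t) ∂volOn P.T := by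
  refine integral_nonneg_of_ae ?_
  filter_upwards [hω i, hadm.constr_nonpos] with t h1 h2
  exact mul_nonneg h1 (neg_nonneg.2 (h2 i))

/-- A limit of approximate multipliers along admissible trajectories is a singular multiplier. -/
theorem StateLim.exists_isSingular (h : StateLim P.T R x u xbar ubar) (hsm : P.Smooth)
    (hT : 0 ≤ P.T) (hR : 0 ≤ R) (hqual : P.MixedQualified)
    (hxu : ∀ k, P.IsAdmissible (x k) (u k)) (hadm : P.IsAdmissible xbar ubar)
    (happ : ∀ k, P.IsApproxMultiplier (x k) (u k) (δ k) (p k) (lam k) (ω k))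
    (hδ : Tendsto δ atTop (𝓝 0)) {lambar : Vec nh} (hlam : Tendsto lam atTop (𝓝 lambar))
    {μ : Fin ng → Measure ℝ} (hμ : ∀ i, MeasureLim P.T (fun k => ω k (Sum.inl i)) (μ i))
    {tail : ℝ → Vec n} (htail : ∀ᵐ t ∂volOn P.T, Tendsto
      (fun k => ∫ s in t..P.T, P.costateDensity (x k) (u k) (p k) (ω k) s) atTop (𝓝 (tail t))) :
    ∃ (q : ℝ → Vec n) (ν : Fin nc → ℝ → ℝ), P.IsSingular xbar ubar q μ ν lambar ∧
      ‖lambar‖ + ∫ t, ‖q t‖ ∂volOn P.T + (∑ i, (μ i).real univ + ∑ i, ∫ t, ν i t ∂volOn P.T)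
        = 1 := by
  have h0m : (0 : ℝ) ∈ Icc 0 P.T := ⟨le_rfl, hT⟩
  have hTm : P.T ∈ Icc 0 P.T := ⟨hT, le_rfl⟩
  have hp := fun k => (happ k).p_int
  have hω := fun k => (happ k).ω_int
  have hu : ∀ k, MemLp (u k) ⊤ (volOn P.T) := fun k =>
    memLp_top_of_bound (h.weak.meas k) R (h.weak.bound k)
  have hub : MemLp ubar ⊤ (volOn P.T) := memLp_top_of_bound h.weak.meas_lim R h.weak.bound_lim
  have hres := fun k => residual_parts (happ k) (ω_defect_nonneg (hxu k) (happ k).ω_nonneg)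
  obtain ⟨C, -, hC⟩ := exists_costateDensity_bound hsm R
  obtain ⟨hQ, hpQ⟩ := h.tendsto_costate hsm hT hlam hp hω hδ
    (fun k => hC _ _ _ _ _ _ (h.bound k) (h.weak.bound k) (happ k)) (fun k => (hres k).1) htail
  set Hbar : Vec n := (P.hDeriv₁ (xbar 0) (xbar P.T)).adjoint lambar with hHbar
  set Q : ℝ → Vec n := fun t => Hbar + tail t with hQdef
  have hω0 : ∀ k i, 0 ≤ ∫ t, ω k i t ∂volOn P.T := fun k i =>
    integral_nonneg_of_ae ((happ k).ω_nonneg i)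
  have hω1 : ∀ k i, ∫ t, ω k i t ∂volOn P.T ≤ 1 := fun k i => by
    have h1 := Finset.single_le_sum (f := fun i => ∫ t, ω k i t ∂volOn P.T)
      (fun i _ => hω0 k i) (Finset.mem_univ i)
    have h2 := (happ k).mass
    have h3 : 0 ≤ ∫ t, ‖p k t‖ ∂volOn P.T := integral_nonneg fun _ => norm_nonneg _
    linarith [norm_nonneg (lam k)]
  obtain ⟨ν, hν, hν0, hνlim, hstat, hcompl⟩ := h.exists_mixed_limit hsm hR hqual hadm hp hQ hpQ
    (ν := fun i k => ω k (Sum.inr i)) (ρ := δ) (fun i k => hω k _)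
    (fun i k => (happ k).ω_nonneg _) (fun i k => hω1 k _) hδ
    (fun k => by
      have := (hres k).2.1
      simpa [Fintype.sum_sum_type, constrU] using this)
    (fun k => by
      have := (hres k).2.2.2 (Finset.univ.map Function.Embedding.inr)
      simpa [constr] using this)
  -- the limit of the densities of the costates
  set F : (ℝ → Vec n) → ℝ → Vec n := fun q s => (P.dynDeriv (xbar s) (ubar s)).adjoint (q s)
    + ∑ i, ν i s • P.mixedGrad i (xbar s) (ubar s) with hF
  have hFi1 : Integrable (fun s => (P.dynDeriv (xbar s) (ubar s)).adjoint (Q s)) (volOn P.T) :=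
    (memLp_adjoint_apply (hsm.memLp_dynDeriv h.cont_lim hub) hQ).integrable le_top
  have hFi2 : ∀ i, Integrable (fun s => ν i s • P.mixedGrad i (xbar s) (ubar s)) (volOn P.T) :=
    fun i => integrable_smul_memLp ((hν i).integrable le_top)
      (hsm.memLp_mixedGrad i h.cont_lim hub)
  have hFi : Integrable (F Q) (volOn P.T) := hFi1.add (integrable_finsetSum _ fun i _ => hFi2 i)
  have hsplit : ∀ t ∈ Icc 0 P.T, ∀ Γ : Fin ng → Vec n,
      (∀ i, Tendsto (fun k => ∫ s in t..P.T,
        ω k (Sum.inl i) s • gradient (P.g i) (x k s)) atTop (𝓝 (Γ i))) →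
      Tendsto (fun k => ∫ s in t..P.T, P.costateDensity (x k) (u k) (p k) (ω k) s) atTop
        (𝓝 ((∫ s in t..P.T, F Q s) + ∑ i, Γ i)) := by
    intro t ht Γ hΓ
    have h1 := h.tendsto_dyn hsm hp hQ hpQ ht
    have h2 := tendsto_finsetSum (Finset.univ : Finset (Fin nc)) fun i _ =>
      h.tendsto_mixed hsm i (ν := fun k => ω k (Sum.inr i)) (fun k => hω k _) (hν i) (hνlim i) ht
    have h3 := tendsto_finsetSum (Finset.univ : Finset (Fin ng)) fun i _ => hΓ i
    have h4 : (∫ s in t..P.T, F Q s) = (∫ s in t..P.T, (P.dynDeriv (xbar s) (ubar s)).adjoint (Q s))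
        + ∑ i, ∫ s in t..P.T, ν i s • P.mixedGrad i (xbar s) (ubar s) := by
      rw [intervalIntegral.integral_add (integrable_volOn_intervalIntegrable hFi1 ht hTm)
        (integrable_volOn_intervalIntegrable (integrable_finsetSum _ fun i _ => hFi2 i) ht hTm),
        intervalIntegral.integral_finsetSum fun i _ =>
          integrable_volOn_intervalIntegrable (hFi2 i) ht hTm]
    rw [h4]
    refine ((h1.add h2).add h3).congr fun k => ?_
    have hi1 : Integrable (fun s => (P.dynDeriv (x k s) (u k s)).adjoint (p k s)) (volOn P.T) :=
      memLp_one_iff_integrable.1 (memLp_adjoint_apply (hsm.memLp_dynDeriv (h.cont k) (hu k))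
        (memLp_one_iff_integrable.2 (hp k)))
    have hi2 : ∀ i, Integrable (fun s => ω k i s • P.constrX (x k) (u k) i s) (volOn P.T) :=
      fun i => integrable_smul_memLp (hω k i) (hsm.memLp_constrX (h.cont k) (hu k) i)
    simp only [costateDensity]
    rw [intervalIntegral.integral_add (integrable_volOn_intervalIntegrable hi1 ht hTm)
        (integrable_volOn_intervalIntegrable (integrable_finsetSum _ fun i _ => hi2 i) ht hTm),
      intervalIntegral.integral_finsetSum fun i _ =>
        integrable_volOn_intervalIntegrable (hi2 i) ht hTm, Fintype.sum_sum_type]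
    simp only [constrX, Sum.elim_inl, Sum.elim_inr]
    abel
  set q : ℝ → Vec n := fun t => Hbar + (∫ s in t..P.T, F Q s)
    + ∑ i, ∫ s in Ioc t P.T, gradient (P.g i) (xbar s) ∂μ i with hq
  have hG : ∀ i, ContinuousOn (fun s => gradient (P.g i) (xbar s)) (Icc 0 P.T) := fun i =>
    (hsm.continuous_gradient_g i).comp_continuousOn h.cont_lim
  have hGi : ∀ i, Integrable (fun s => gradient (P.g i) (xbar s)) (μ i) := fun i =>
    (hμ i).integrable_of_bound (hG i)
  have hqQ : ∀ᵐ t ∂volOn P.T, q t = Q t := by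
    filter_upwards [htail, ae_volOn_mem, ae_all_iff.2 fun i => (hμ i).ae_no_atom] with t h1 ht h2
    have h3 := hsplit t ht _ fun i => h.tendsto_state_Ioc hsm i (hμ i) ht (h2 i)
    simp only [hq, hQdef]
    rw [add_assoc, tendsto_nhds_unique h3 h1]
  have hFq : ∀ t ∈ Icc 0 P.T, (∫ s in t..P.T, F q s) = ∫ s in t..P.T, F Q s := by
    intro t ht
    rw [intervalIntegral_eq_volOn ht.1 ht.2 le_rfl, intervalIntegral_eq_volOn ht.1 ht.2 le_rfl]
    refine integral_congr_ae (ae_restrict_of_ae ?_)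
    filter_upwards [hqQ] with s hs
    simp only [hF, hs]
  refine ⟨q, ν, ?_, ?_⟩
  · refine ⟨boundedVariationOn_tail hT hFi hGi, fun i => (hμ i).finite, fun i => (hμ i).supp, hν,
      hν0, ?_, ?_, ?_, ?_, ?_⟩
    · intro t ht
      simp only [hsm.fderiv_f, hsm.fderiv_h₁, hsm.gradient_c]
      have := hFq t ht
      simp only [hF] at this
      rw [this]
    · simp only [hsm.fderiv_h₀]
      have h1 := hsplit 0 h0m _ fun i => h.tendsto_state hsm hT i (hμ i)
      have hH0 : Tendsto (fun k => (P.hDeriv₀ (x k 0) (x k P.T)).adjoint (lam k)) atTop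
          (𝓝 ((P.hDeriv₀ (xbar 0) (xbar P.T)).adjoint lambar)) :=
        tendsto_adjoint_apply ((hsm.continuous_hDeriv₀.tendsto (xbar 0, xbar P.T)).comp
          ((h.tendsto_at h0m).prodMk_nhds (h.tendsto_at hTm))) hlam
      have hH1 : Tendsto (fun k => (P.hDeriv₁ (x k 0) (x k P.T)).adjoint (lam k)) atTop (𝓝 Hbar) :=
        tendsto_adjoint_apply ((hsm.continuous_hDeriv₁.tendsto (xbar 0, xbar P.T)).comp
          ((h.tendsto_at h0m).prodMk_nhds (h.tendsto_at hTm))) hlam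
      have h2 := (hH0.add (hH1.add h1)).norm
      have h3 := le_of_tendsto_of_tendsto' h2 hδ fun k => (hres k).2.2.1
      have h4 := norm_le_zero_iff.1 h3
      simp only [fun i => MeasureLim.integral_split hT (hμ i) (hG i), Finset.sum_add_distrib] at h4
      rw [eq_neg_iff_add_eq_zero, ← h4]
      simp only [hq]
      abel
    · filter_upwards [hqQ, hstat] with t h1 h2
      rw [h1]
      exact h2
    · intro i
      have hgc := (hsm.g_C2 i).continuous
      have h1 := tendsto_real_of_error (hμ i) (fun k => hgc.comp_continuousOn (h.cont k))
        (hgc.comp_continuousOn h.cont_lim) (h.unif_comp hgc)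
      have h2 : Tendsto (fun k => ∫ t, ω k (Sum.inl i) t * (-P.g i (x k t)) ∂volOn P.T) atTop
          (𝓝 0) := by
        refine squeeze_zero (fun k => ω_defect_nonneg (hxu k) (happ k).ω_nonneg (Sum.inl i))
          (fun k => ?_) hδ
        have := (hres k).2.2.2 {Sum.inl i}
        simpa [constr] using this
      simp only [mul_neg, integral_neg] at h2
      have h3 := h2.neg
      simp only [neg_neg, neg_zero] at h3
      exact tendsto_nhds_unique h1 h3
    · intro i
      exact integral_eq_zero_of_ae (hcompl i)
  · have h1 : Tendsto (fun k => ∫ t, ‖p k t‖ ∂volOn P.T) atTop (𝓝 (∫ t, ‖q t‖ ∂volOn P.T)) := by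
      have hqe : ∫ t, ‖q t‖ ∂volOn P.T = ∫ t, ‖Q t‖ ∂volOn P.T :=
        integral_congr_ae (by filter_upwards [hqQ] with t ht; rw [ht])
      rw [hqe, tendsto_iff_norm_sub_tendsto_zero]
      refine squeeze_zero (fun _ => norm_nonneg _) (fun k => ?_) hpQ
      have hQi := hQ.integrable (μ := volOn P.T) le_top
      rw [← integral_sub (hp k).norm hQi.norm]
      refine norm_integral_le_of_norm_le ((hp k).sub hQi).norm (Eventually.of_forall fun t => ?_)
      exact abs_norm_sub_norm_le _ _
    have h2 : ∀ i, Tendsto (fun k => ∫ t, ω k (Sum.inl i) t ∂volOn P.T) atTop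
        (𝓝 ((μ i).real univ)) := by
      intro i
      have := (hμ i).tendsto (fun _ => 1) continuousOn_const
      simpa using this
    have h3 : ∀ i, Tendsto (fun k => ∫ t, ω k (Sum.inr i) t ∂volOn P.T) atTop
        (𝓝 (∫ t, ν i t ∂volOn P.T)) := by
      intro i
      have hνi := (hν i).integrable (μ := volOn P.T) le_top
      rw [tendsto_iff_norm_sub_tendsto_zero]
      refine squeeze_zero (fun _ => norm_nonneg _) (fun k => ?_) (hνlim i)
      rw [← integral_sub (hω k _) hνi]
      exact norm_integral_le_integral_norm _
    have h4 := (hlam.norm.add h1).add ((tendsto_finsetSum (Finset.univ : Finset (Fin ng))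
      fun i _ => h2 i).add (tendsto_finsetSum (Finset.univ : Finset (Fin nc)) fun i _ => h3 i))
    refine tendsto_nhds_unique (h4.congr fun k => ?_) tendsto_const_nhds
    rw [← (happ k).mass, Fintype.sum_sum_type]

end

/-- There is no approximate multiplier of small enough parameter, uniformly among the admissible
trajectories. -/
theorem exists_no_approxMultiplier (hT : 0 ≤ P.T) (hsm : P.Smooth) (hbdd : P.BoundedAdmissible)
    (hstates : P.BoundedStates) (hqual : P.MixedQualified) (hsing : P.NoSingularMultiplier) :
    ∃ δ > (0 : ℝ), ∀ x u, P.IsAdmissible x u →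
      ¬ ∃ p lam ω, P.IsApproxMultiplier x u δ p lam ω := by
  by_contra! hcon
  obtain ⟨R, hR0, hR⟩ := exists_admissible_bound hT hsm hbdd hstates
  choose x u hxu p lam ω happ using fun k : ℕ => hcon (1 / ((k : ℝ) + 1)) (by positivity)
  obtain ⟨φ₀, xbar, ubar, hφ₀, hadm, hx, hu⟩ := exists_admissible_limit hT hsm hR0 hR x u hxu
  have hlim : StateLim P.T R (fun k => x (φ₀ k)) (fun k => u (φ₀ k)) xbar ubar :=
    ⟨fun k => (hxu _).continuousOn, hadm.continuousOn, fun k => (hR _ _ (hxu _)).1,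
      (hR _ _ hadm).1, hx, hu⟩
  obtain ⟨C, -, hC⟩ := exists_costateDensity_bound hsm R
  have hω0 : ∀ k i, 0 ≤ ∫ t, ω k i t ∂volOn P.T := fun k i =>
    integral_nonneg_of_ae ((happ k).ω_nonneg i)
  have hp0 : ∀ k, 0 ≤ ∫ t, ‖p k t‖ ∂volOn P.T := fun k => integral_nonneg fun _ => norm_nonneg _
  have hω1 : ∀ k i, ∫ t, ω k i t ∂volOn P.T ≤ 1 := fun k i => by
    have h1 := Finset.single_le_sum (f := fun i => ∫ t, ω k i t ∂volOn P.T)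
      (fun i _ => hω0 k i) (Finset.mem_univ i)
    linarith [norm_nonneg (lam k), (happ k).mass, hp0 k]
  have hlam1 : ∀ k, ‖lam k‖ ≤ 1 := fun k => by
    have h1 := Finset.sum_nonneg (s := Finset.univ) fun i _ => hω0 k i
    linarith [(happ k).mass, hp0 k]
  obtain ⟨φ₁, hφ₁, hμ⟩ := exists_strictMono_forall
    (fun (i : Fin ng) φ => ∃ μ, MeasureLim P.T (fun k => ω (φ₀ (φ k)) (Sum.inl i)) μ)
    (fun i φ ψ hψ ⟨μ, hμ⟩ => ⟨μ, hμ.comp hψ⟩)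
    (fun i φ hφ => by
      obtain ⟨μ, ψ, hψ, hμ⟩ := exists_measureLim hT
        (fun k => ω (φ₀ (φ k)) (Sum.inl i)) (fun k => (happ _).ω_int _)
        (fun k => (happ _).ω_nonneg _) (fun k => hω1 _ _)
      exact ⟨ψ, hψ, μ, hμ⟩)
  choose μ hμ using hμ
  obtain ⟨lambar, -, φ₂, hφ₂, hlam⟩ := tendsto_subseq_of_bounded
    (Metric.isBounded_closedBall (x := (0 : Vec nh)) (r := 1))
    (x := fun k => lam (φ₀ (φ₁ k))) (fun k => mem_closedBall_zero_iff.2 (hlam1 _))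
  obtain ⟨φ₃, tail, hφ₃, htail⟩ := exists_tail_limit hT
    (fun k => P.costateDensity (x (φ₀ (φ₁ (φ₂ k)))) (u (φ₀ (φ₁ (φ₂ k)))) (p (φ₀ (φ₁ (φ₂ k))))
      (ω (φ₀ (φ₁ (φ₂ k)))))
    (fun k => integrable_costateDensity hsm (hxu _).continuousOn (hxu _).control (happ _).p_int
      (happ _).ω_int)
    (fun k => hC _ _ _ _ _ _ (hR _ _ (hxu _)).1 (hR _ _ (hxu _)).2 (happ _))
  have hφ : StrictMono fun k => φ₁ (φ₂ (φ₃ k)) := hφ₁.comp (hφ₂.comp hφ₃)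
  have hδ : Tendsto (fun k => 1 / ((φ₀ (φ₁ (φ₂ (φ₃ k))) : ℕ) + 1 : ℝ)) atTop (𝓝 0) :=
    tendsto_one_div_add_atTop_nhds_zero_nat.comp (hφ₀.comp hφ).tendsto_atTop
  obtain ⟨q, ν, hsingular, hmass⟩ := (hlim.comp hφ).exists_isSingular hsm hT hR0 hqual
    (fun k => hxu _) hadm (fun k => happ _) hδ (hlam.comp hφ₃.tendsto_atTop)
    (fun i => (hμ i).comp (hφ₂.comp hφ₃)) htail
  obtain ⟨hq0, hμ0, hν0, hlam0⟩ := hsing _ _ hadm _ _ _ _ hsingular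
  have h1 : ∫ t, ‖q t‖ ∂volOn P.T = 0 := integral_eq_zero_of_ae (by
    filter_upwards [ae_volOn_mem] with t ht
    simp [hq0 t ht])
  have h2 : ∀ i, ∫ t, ν i t ∂volOn P.T = 0 := fun i => integral_eq_zero_of_ae (hν0 i)
  simp [hlam0, h1, h2, hμ0] at hmass

variable (P) in
/-- Directions of the problem linearized at a trajectory that decrease all constraints, at a rate
`δ`, and for which the linearized initial-final constraint takes the value `r`. -/
structure IsInwardDirection (x : ℝ → Vec n) (u : ℝ → Vec m) (δ : ℝ) (r : Vec nh)
    (ζ : ℝ → Vec n) (v : ℝ → Vec m) (z₀ : Vec n) : Prop where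
  meas_state : AEStronglyMeasurable ζ (volOn P.T)
  meas_control : AEStronglyMeasurable v (volOn P.T)
  bound_state : ∀ᵐ t ∂volOn P.T, ‖ζ t‖ ≤ 1
  bound_control : ∀ᵐ t ∂volOn P.T, ‖v t‖ ≤ 1
  bound_init : ‖z₀‖ ≤ 1
  linearized : ∀ᵐ t ∂volOn P.T, ζ t = P.dynDeriv (x t) (u t) (z₀ + ∫ s in (0 : ℝ)..t, ζ s)
    + P.f₂ (x t) (v t)
  endpoints : P.hDeriv₀ (x 0) (x P.T) z₀
    + P.hDeriv₁ (x 0) (x P.T) (z₀ + ∫ s in (0 : ℝ)..P.T, ζ s) = r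
  decrease : ∀ᵐ t ∂volOn P.T, ∀ i, P.constr x u i t
    + inner ℝ (P.constrX x u i t) (z₀ + ∫ s in (0 : ℝ)..t, ζ s)
    + inner ℝ (P.constrU x i t) (v t) ≤ -δ

/-- Uniform qualification of the constraints. -/
theorem exists_uniform_inwardDirection (hT : 0 ≤ P.T) (hsm : P.Smooth)
    (hbdd : P.BoundedAdmissible) (hstates : P.BoundedStates) (hqual : P.MixedQualified)
    (hsing : P.NoSingularMultiplier) :
    ∃ δ > (0 : ℝ), ∀ x u, P.IsAdmissible x u → ∀ r : Vec nh, ‖r‖ ≤ δ →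
      ∃ ζ v z₀, P.IsInwardDirection x u δ r ζ v z₀ := by
  obtain ⟨δ, hδ, hno⟩ := exists_no_approxMultiplier hT hsm hbdd hstates hqual hsing
  refine ⟨δ, hδ, fun x u hxu r hr => ?_⟩
  have hu : MemLp u ⊤ (volOn P.T) := hxu.control
  rcases linear_system_alternative (H₁ := P.hDeriv₀ (x 0) (x P.T))
    (H₂ := P.hDeriv₁ (x 0) (x P.T)) hT (hsm.memLp_dynDeriv hxu.continuousOn hu)
    (memLp_continuousOn (hsm.f₂.continuous.comp_continuousOn hxu.continuousOn) ⊤)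
    (hsm.memLp_constr hxu.continuousOn hu) (hsm.memLp_constrX hxu.continuousOn hu)
    (hsm.memLp_constrU hxu.continuousOn) hδ hr with h | h
  · obtain ⟨ζ, v, z₀, h1, h2, h3, h4, h5, h6, h7, h8⟩ := h
    exact ⟨ζ, v, z₀, h1, h2, h3, h4, h5, h6, h7, h8⟩
  · exact (hno x u hxu h).elim

end OCP

end

noncomputable section

/-- A function of class `C¹` is strictly differentiable, uniformly on balls. -/
theorem exists_uniform_strictDeriv {E F : Type*} [NormedAddCommGroup E] [NormedSpace ℝ E]
    [ProperSpace E] [NormedAddCommGroup F] [NormedSpace ℝ F] {G : E → F} (hG : ContDiff ℝ 1 G)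
    (R : ℝ) {ε : ℝ} (hε : 0 < ε) : ∃ η > (0 : ℝ), ∀ a b c : E, ‖c‖ ≤ R → ‖a - c‖ ≤ η →
      ‖b - c‖ ≤ η → ‖G a - G b - fderiv ℝ G c (a - b)‖ ≤ ε * ‖a - b‖ := by
  have hu := (isCompact_closedBall (0 : E) (R + 1)).uniformContinuousOn_of_continuous
    (hG.continuous_fderiv one_ne_zero).continuousOn
  obtain ⟨η, hη, h⟩ := Metric.uniformContinuousOn_iff.1 hu ε hε
  refine ⟨min (η / 2) 1, by positivity, fun a b c hc ha hb => ?_⟩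
  have hball : ∀ z ∈ Metric.closedBall c (min (η / 2) 1), z
      ∈ Metric.closedBall (0 : E) (R + 1) := by
    intro z hz
    rw [mem_closedBall_iff_norm] at hz
    rw [mem_closedBall_zero_iff]
    have h1 := norm_add_le (z - c) c
    rw [sub_add_cancel] at h1
    linarith [min_le_right (η / 2) 1]
  refine (convex_closedBall c (min (η / 2) 1)).norm_image_sub_le_of_norm_hasFDerivWithin_le'
    (f' := fderiv ℝ G)
    (fun z _ => (hG.differentiable one_ne_zero z).hasFDerivAt.hasFDerivWithinAt)
    (fun z hz => ?_) (mem_closedBall_iff_norm.2 hb) (mem_closedBall_iff_norm.2 ha)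
  have h2 := h z (hball z hz) c (hball c (Metric.mem_closedBall_self (by positivity))) (by
    rw [Metric.mem_closedBall] at hz
    linarith [min_le_left (η / 2) 1])
  rw [dist_eq_norm] at h2
  exact h2.le

namespace OCP

open Topology

variable {n m nh ng nc : ℕ} {P : OCP n m nh ng nc}

theorem Smooth.fderiv_dynamics (h : P.Smooth) (x : Vec n) (u : Vec m) (y : Vec n) (v : Vec m) :
    fderiv ℝ (fun z : Vec n × Vec m => P.f z.1 z.2) (x, u) (y, v)
      = P.dynDeriv x u y + P.f₂ x v := by
  have hF := (h.f_C2.differentiable two_ne_zero (x, u)).hasFDerivAt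
  have h1 := (HasFDerivAt.comp (f := fun z => (z, u)) x hF
    (hasFDerivAt_prodMk_left x u)).unique (h.hasFDerivAt_f x u)
  have h2 := (HasFDerivAt.comp (f := fun w => (x, w)) u hF
    (hasFDerivAt_prodMk_right x u)).unique
    (((P.f₂ x).hasFDerivAt (x := u)).const_add (P.f₁ x))
  have e : (y, v) = (y, (0 : Vec m)) + ((0 : Vec n), v) := by simp
  rw [e, map_add, ← h1, ← h2]
  rfl

theorem Smooth.fderiv_mixed (h : P.Smooth) (i : Fin nc) (x : Vec n) (u : Vec m) (y : Vec n)
    (v : Vec m) : fderiv ℝ (fun z : Vec n × Vec m => P.c i z.1 z.2) (x, u) (y, v)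
      = inner ℝ (P.mixedGrad i x u) y + inner ℝ (P.a i x) v := by
  have hF := ((h.c_C2 i).differentiable two_ne_zero (x, u)).hasFDerivAt
  have h1 := HasFDerivAt.comp (f := fun z => (z, u)) x hF (hasFDerivAt_prodMk_left x u)
  have h2 := (HasFDerivAt.comp (f := fun w => (x, w)) u hF
    (hasFDerivAt_prodMk_right x u)).unique
    (((innerSL ℝ (P.a i x)).hasFDerivAt (x := u)).add_const (P.b i x))
  have e : (y, v) = (y, (0 : Vec m)) + ((0 : Vec n), v) := by simp
  have h3 : inner ℝ (P.mixedGrad i x u) y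
      = fderiv ℝ (fun z : Vec n × Vec m => P.c i z.1 z.2) (x, u) (y, 0) := by
    rw [← h.gradient_c, gradient, InnerProductSpace.toDual_symm_apply]
    exact congrArg (fun L : Vec n →L[ℝ] ℝ => L y) h1.fderiv
  rw [e, map_add, h3, add_right_inj]
  exact congrArg (fun L : Vec m →L[ℝ] ℝ => L v) h2

variable (P) in
/-- Families, depending linearly on a parameter, of solutions of the linearized dynamics. -/
structure IsLinearFamily {W : Type*} [NormedAddCommGroup W] (x : ℝ → Vec n)
    (u : ℝ → Vec m) (V : W → ℝ → Vec m) (Z : W → ℝ → Vec n) (C : ℝ) : Prop where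
  nonneg : 0 ≤ C
  V_sub : ∀ α β t, V (α - β) t = V α t - V β t
  Z_sub : ∀ α β t, Z (α - β) t = Z α t - Z β t
  V_meas : ∀ α, AEStronglyMeasurable (V α) (volOn P.T)
  V_bound : ∀ α, ∀ᵐ t ∂volOn P.T, ‖V α t‖ ≤ C * ‖α‖
  Z_cont : ∀ α, ContinuousOn (Z α) (Icc 0 P.T)
  Z_bound : ∀ α, ∀ t ∈ Icc 0 P.T, ‖Z α t‖ ≤ C * ‖α‖
  Z_eq : ∀ α, ∀ t ∈ Icc 0 P.T, Z α t
    = Z α 0 + ∫ s in (0 : ℝ)..t, (P.dynDeriv (x s) (u s) (Z α s) + P.f₂ (x s) (V α s))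

/-- Bounds between `L∞` functions and integrals on subintervals. -/
theorem norm_intervalIntegral_le_of_ae {T : ℝ} {E : Type*} [NormedAddCommGroup E]
    [NormedSpace ℝ E] {f : ℝ → E} {g : ℝ → ℝ} (hg : Integrable g (volOn T))
    (h : ∀ᵐ s ∂volOn T, ‖f s‖ ≤ g s) {t : ℝ} (ht : t ∈ Icc 0 T) :
    ‖∫ s in (0 : ℝ)..t, f s‖ ≤ ∫ s in (0 : ℝ)..t, g s := by
  refine intervalIntegral.norm_integral_le_of_norm_le ht.1 ?_
    (integrable_volOn_intervalIntegrable hg ⟨le_rfl, ht.1.trans ht.2⟩ ht)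
  have h' : ∀ᵐ s, s ∈ Icc 0 T → ‖f s‖ ≤ g s := (ae_restrict_iff' measurableSet_Icc).1 h
  filter_upwards [h'] with s hs hst using hs ⟨hst.1.le, hst.2.trans ht.2⟩

/-- The flow of the controlled dynamics, along a linear family of perturbations of the control and
of the initial state, is strictly differentiable, uniformly in time. -/
theorem IsLinearFamily.exists_flow {W : Type*} [NormedAddCommGroup W] {x : ℝ → Vec n}
    {u : ℝ → Vec m} {V : W → ℝ → Vec m} {Z : W → ℝ → Vec n} {C : ℝ}
    (h : P.IsLinearFamily x u V Z C) (hT : 0 ≤ P.T) (hsm : P.Smooth) (hstates : P.BoundedStates)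
    (hxu : P.IsTrajectory x u) :
    ∃ Y : W → ℝ → Vec n, (∀ α, P.IsTrajectory (Y α) (fun t => u t + V α t)) ∧
      (∀ α, Y α 0 = x 0 + Z α 0) ∧ EqOn (Y 0) x (Icc 0 P.T) ∧
      ∀ ε > (0 : ℝ), ∃ η > (0 : ℝ), ∀ α β, ‖α‖ ≤ η → ‖β‖ ≤ η → ∀ t ∈ Icc 0 P.T,
        ‖Y α t - Y β t - Z (α - β) t‖ ≤ ε * ‖α - β‖ := by
  have h0m : (0 : ℝ) ∈ Icc 0 P.T := ⟨le_rfl, hT⟩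
  have hC := h.nonneg
  have hum : MemLp u ⊤ (volOn P.T) := hxu.control
  obtain ⟨U, hU0, hU⟩ := memLp_top_ae_bound hum
  obtain ⟨X, hX⟩ := isCompact_Icc.exists_bound_of_continuousOn hxu.continuousOn
  have hX0 : 0 ≤ X := (norm_nonneg _).trans (hX 0 h0m)
  have hVm : ∀ α, MemLp (V α) ⊤ (volOn P.T) := fun α =>
    memLp_top_of_bound (h.V_meas α) _ (h.V_bound α)
  have hcm : ∀ α, P.IsControl (fun t => u t + V α t) := fun α => hum.add (hVm α)
  -- existence of the flow
  have hex : ∀ α, ∃ y, P.IsTrajectory y (fun t => u t + V α t) ∧ y 0 = x 0 + Z α 0 := fun α => by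
    obtain ⟨Rx, hRx⟩ := hstates ((∫ t, ‖u t + V α t‖ ∂P.vol) + ‖x 0 + Z α 0‖)
    obtain ⟨y, hy, hy0, -⟩ := hRx _ (x 0 + Z α 0) (hcm α) le_rfl
    exact ⟨y, hy, hy0⟩
  choose Y hY hY0 using hex
  have hV0 : ∀ t, V 0 t = 0 := fun t => by simpa using h.V_sub 0 0 t
  have hZ0 : ∀ t, Z 0 t = 0 := fun t => by simpa using h.Z_sub 0 0 t
  have hYx : EqOn (Y 0) x (Icc 0 P.T) := by
    have := hY 0
    simp only [hV0, add_zero] at this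
    exact this.eqOn hT hsm hxu (by rw [hY0, hZ0, add_zero])
  refine ⟨Y, hY, hY0, hYx, ?_⟩
  -- uniform bounds
  obtain ⟨Rx, hRx⟩ := hstates ((U + C) * P.T + (X + C))
  have hYb : ∀ α, ‖α‖ ≤ 1 → ∀ t ∈ Icc 0 P.T, ‖Y α t‖ ≤ Rx := by
    intro α hα t ht
    have hCα : C * ‖α‖ ≤ C := mul_le_of_le_one_right hC hα
    obtain ⟨y, hy, hy0, hyb⟩ := hRx _ (x 0 + Z α 0) (hcm α) (by
      refine add_le_add ?_ ((norm_add_le _ _).trans (add_le_add (hX 0 h0m)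
        ((h.Z_bound α 0 h0m).trans hCα)))
      have : ∀ᵐ t ∂volOn P.T, ‖‖u t + V α t‖‖ ≤ U + C := by
        filter_upwards [hU, h.V_bound α] with t h1 h2
        rw [norm_norm]
        exact (norm_add_le _ _).trans (add_le_add h1 (h2.trans hCα))
      refine (le_abs_self _).trans ((norm_integral_le_of_norm_le_const this).trans_eq ?_)
      simp [Measure.real, hT])
    rw [(hY α).eqOn hT hsm hy (by rw [hY0, hy0]) ht]
    exact hyb t ht
  set R : ℝ := max Rx (max X (U + C)) with hR
  have hRx' : Rx ≤ R := le_max_left _ _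
  have hXR : X ≤ R := (le_max_left _ _).trans (le_max_right _ _)
  have hUR : U + C ≤ R := (le_max_right _ _).trans (le_max_right _ _)
  obtain ⟨L, hL⟩ := ((hsm.f_C2.of_le one_le_two).locallyLipschitz.locallyLipschitzOn
    (s := Metric.closedBall (0 : Vec n × Vec m) R)).exists_lipschitzOnWith_of_compact
    (isCompact_closedBall _ _)
  have hdiff : ∀ α β, ∀ t ∈ Icc 0 P.T, Y α t - Y β t = Z (α - β) 0
      + ∫ s in (0 : ℝ)..t, (P.f (Y α s) (u s + V α s) - P.f (Y β s) (u s + V β s)) := by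
    intro α β t ht
    rw [(hY α).integral_eq t ht, (hY β).integral_eq t ht, hY0, hY0, intervalIntegral.integral_sub
        (integrable_volOn_intervalIntegrable
          (IsTrajectory.integrable hsm (hY α).continuousOn (hcm α)) h0m ht)
        (integrable_volOn_intervalIntegrable
          (IsTrajectory.integrable hsm (hY β).continuousOn (hcm β)) h0m ht), h.Z_sub]
    abel
  have hVsub : ∀ α β s, (u s + V α s) - (u s + V β s) = V (α - β) s := fun α β s => by
    rw [h.V_sub]; abel
  have hI : ∀ α β, ContinuousOn (fun s => ‖Y α s - Y β s‖) (Icc 0 P.T) := fun α β =>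
    ((hY α).continuousOn.sub (hY β).continuousOn).norm
  -- Lipschitz estimate
  set Λ : ℝ := (C + L * C * P.T) * Real.exp (L * P.T) with hΛ
  have hΛ0 : 0 ≤ Λ := by positivity
  have hlip : ∀ α β, ‖α‖ ≤ 1 → ‖β‖ ≤ 1 → ∀ t ∈ Icc 0 P.T, ‖Y α t - Y β t‖ ≤ Λ * ‖α - β‖ := by
    intro α β hα hβ t ht
    have hg := le_mul_exp_of_le_add_mul_integral (c := (C + L * C * P.T) * ‖α - β‖) hT L.2 (hI α β)
      (fun t _ => norm_nonneg _) (fun t ht => ?_) t ht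
    · refine hg.trans_eq ?_
      rw [hΛ]; simp only [NNReal.val_eq_coe]; ring
    · have hgi : Integrable (fun s => L * ‖Y α s - Y β s‖ + L * (C * ‖α - β‖)) (volOn P.T) :=
        ((hI α β).integrableOn_Icc.const_mul _).add (integrable_const _)
      have h1 := norm_intervalIntegral_le_of_ae hgi (f := fun s =>
        P.f (Y α s) (u s + V α s) - P.f (Y β s) (u s + V β s)) (by
          filter_upwards [ae_volOn_mem, hU, h.V_bound α, h.V_bound β, h.V_bound (α - β)]
            with s hs h1 h2 h3 h4
          have hm : ∀ γ, ‖γ‖ ≤ 1 → ‖V γ s‖ ≤ C * ‖γ‖ →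
              (Y γ s, u s + V γ s) ∈ Metric.closedBall (0 : Vec n × Vec m) R := by
            intro γ hγ hγs
            rw [mem_closedBall_zero_iff]
            refine max_le ((hYb γ hγ s hs).trans hRx') (le_trans ?_ hUR)
            exact (norm_add_le _ _).trans (add_le_add h1
              (hγs.trans (mul_le_of_le_one_right hC hγ)))
          have h5 := hL.norm_sub_le (hm α hα h2) (hm β hβ h3)
          refine h5.trans ?_
          rw [← mul_add]
          refine mul_le_mul_of_nonneg_left ?_ L.2
          have h6 : ‖(Y α s, u s + V α s) - (Y β s, u s + V β s)‖
              ≤ ‖Y α s - Y β s‖ + ‖V (α - β) s‖ := by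
            rw [Prod.mk_sub_mk, hVsub]
            exact max_le (le_add_of_nonneg_right (norm_nonneg _))
              (le_add_of_nonneg_left (norm_nonneg _))
          linarith) ht
      rw [hdiff α β t ht]
      refine (norm_add_le _ _).trans ((add_le_add (h.Z_bound _ 0 h0m) h1).trans ?_)
      rw [intervalIntegral.integral_add
        (integrable_volOn_intervalIntegrable ((hI α β).integrableOn_Icc.const_mul _) h0m ht)
        (intervalIntegrable_const), intervalIntegral.integral_const_mul,
        intervalIntegral.integral_const, sub_zero, smul_eq_mul]
      have h7 : t * (L * (C * ‖α - β‖)) ≤ P.T * (L * (C * ‖α - β‖)) :=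
        mul_le_mul_of_nonneg_right ht.2 (by positivity)
      simp only [NNReal.val_eq_coe]
      linarith
  -- strict differentiability
  intro ε hε
  obtain ⟨A, hA0, hA⟩ := exists_bound_on_balls hsm.continuous_dynDeriv R
  set D : ℝ := (Λ + C) * P.T * Real.exp (A * P.T) with hD
  have hD0 : 0 ≤ D := by positivity
  obtain ⟨η, hη, hstrict⟩ := exists_uniform_strictDeriv (hsm.f_C2.of_le one_le_two) R
    (ε := ε / (D + 1)) (by positivity)
  refine ⟨min 1 (η / (Λ + C + 1)), by positivity, fun α β hα hβ => ?_⟩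
  have hsmall : ∀ γ : W, ‖γ‖ ≤ min 1 (η / (Λ + C + 1)) → Λ * ‖γ‖ ≤ η ∧ C * ‖γ‖ ≤ η := by
    intro γ hγ
    have h1 := hγ.trans (min_le_right _ _)
    rw [le_div_iff₀ (by positivity)] at h1
    have h2 : 0 ≤ ‖γ‖ := norm_nonneg _
    have h3 := mul_nonneg hΛ0 h2
    have h4 := mul_nonneg hC h2
    constructor <;> nlinarith
  have hα1 := hα.trans (min_le_left _ _)
  have hβ1 := hβ.trans (min_le_left _ _)
  have hclose : ∀ γ : W, ‖γ‖ ≤ min 1 (η / (Λ + C + 1)) → ∀ s ∈ Icc 0 P.T, ‖V γ s‖ ≤ C * ‖γ‖ →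
      ‖(Y γ s, u s + V γ s) - (x s, u s)‖ ≤ η := by
    intro γ hγ s hs hγs
    rw [Prod.mk_sub_mk, add_sub_cancel_left]
    refine max_le ?_ (hγs.trans (hsmall γ hγ).2)
    have := hlip γ 0 (hγ.trans (min_le_left _ _)) (by simp) s hs
    rw [hYx hs, sub_zero] at this
    exact this.trans (hsmall γ hγ).1
  set w : ℝ → Vec n := fun t => Y α t - Y β t - Z (α - β) t with hw
  have hwc : ContinuousOn w (Icc 0 P.T) :=
    ((hY α).continuousOn.sub (hY β).continuousOn).sub (h.Z_cont _)
  have hZi : Integrable (fun s => P.dynDeriv (x s) (u s) (Z (α - β) s)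
      + P.f₂ (x s) (V (α - β) s)) (volOn P.T) :=
    ((memLp_top_clm_apply (hsm.memLp_dynDeriv hxu.continuousOn hum)
      (memLp_continuousOn (h.Z_cont (α - β)) ⊤)).add (memLp_top_clm_apply
      (memLp_continuousOn (hsm.f₂.continuous.comp_continuousOn hxu.continuousOn) ⊤)
      (hVm (α - β)))).integrable le_top
  have hfi : ∀ γ, Integrable (fun s => P.f (Y γ s) (u s + V γ s)) (volOn P.T) := fun γ =>
    IsTrajectory.integrable hsm (hY γ).continuousOn (hcm γ)
  have hweq : ∀ t ∈ Icc 0 P.T, w t = ∫ s in (0 : ℝ)..t,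
      ((P.f (Y α s) (u s + V α s) - P.f (Y β s) (u s + V β s))
        - (P.dynDeriv (x s) (u s) (Z (α - β) s) + P.f₂ (x s) (V (α - β) s))) := by
    intro t ht
    have hfd : Integrable (fun s => P.f (Y α s) (u s + V α s) - P.f (Y β s) (u s + V β s))
        (volOn P.T) := (hfi α).sub (hfi β)
    rw [intervalIntegral.integral_sub (integrable_volOn_intervalIntegrable hfd h0m ht)
      (integrable_volOn_intervalIntegrable hZi h0m ht)]
    simp only [hw]
    rw [hdiff α β t ht, h.Z_eq (α - β) t ht]
    abel
  intro t ht
  have hg := le_mul_exp_of_le_add_mul_integral (φ := fun s => ‖w s‖)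
    (c := ε / (D + 1) * ((Λ + C) * ‖α - β‖) * P.T) (L := A) hT hA0 hwc.norm
    (fun t _ => norm_nonneg _) (fun t ht => ?_) t ht
  · refine hg.trans ?_
    have e : ε / (D + 1) * ((Λ + C) * ‖α - β‖) * P.T * Real.exp (A * P.T)
        = ε * (D / (D + 1)) * ‖α - β‖ := by rw [hD]; ring
    rw [e]
    refine mul_le_mul_of_nonneg_right (mul_le_of_le_one_right hε.le ?_) (norm_nonneg _)
    rw [div_le_one (by positivity)]
    linarith
  · have hgi : Integrable (fun s => ε / (D + 1) * ((Λ + C) * ‖α - β‖) + A * ‖w s‖) (volOn P.T) :=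
      (integrable_const _).add (hwc.norm.integrableOn_Icc.const_mul _)
    have h1 := norm_intervalIntegral_le_of_ae hgi (f := fun s =>
      ((P.f (Y α s) (u s + V α s) - P.f (Y β s) (u s + V β s))
        - (P.dynDeriv (x s) (u s) (Z (α - β) s) + P.f₂ (x s) (V (α - β) s)))) (by
      filter_upwards [ae_volOn_mem, hU, h.V_bound α, h.V_bound β, h.V_bound (α - β)]
        with s hs h1 h2 h3 h4
      have h5 := hstrict (Y α s, u s + V α s) (Y β s, u s + V β s) (x s, u s)
        (max_le ((hX s hs).trans hXR) (h1.trans ((le_add_of_nonneg_right hC).trans hUR)))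
        (hclose α hα s hs h2) (hclose β hβ s hs h3)
      rw [Prod.mk_sub_mk, hVsub, hsm.fderiv_dynamics] at h5
      have h6 : ‖(Y α s - Y β s, V (α - β) s)‖ ≤ (Λ + C) * ‖α - β‖ := by
        have h7 := hlip α β hα1 hβ1 s hs
        rw [add_mul]
        refine max_le ?_ ?_
        · exact h7.trans (le_add_of_nonneg_right (by positivity))
        · exact h4.trans (le_add_of_nonneg_left (by positivity))
      have h8 := h5.trans (mul_le_mul_of_nonneg_left h6 (by positivity))
      have e : (P.f (Y α s) (u s + V α s) - P.f (Y β s) (u s + V β s))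
          - (P.dynDeriv (x s) (u s) (Z (α - β) s) + P.f₂ (x s) (V (α - β) s))
          = (P.f (Y α s) (u s + V α s) - P.f (Y β s) (u s + V β s)
            - (P.dynDeriv (x s) (u s) (Y α s - Y β s) + P.f₂ (x s) (V (α - β) s)))
            + P.dynDeriv (x s) (u s) (w s) := by
        simp only [hw, map_sub]
        abel
      rw [e]
      refine (norm_add_le _ _).trans (add_le_add h8 ?_)
      refine (ContinuousLinearMap.le_opNorm _ _).trans (mul_le_mul_of_nonneg_right ?_
        (norm_nonneg _))
      exact hA _ _ ((hX s hs).trans hXR) (h1.trans ((le_add_of_nonneg_right hC).trans hUR))) ht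
    rw [hweq t ht]
    refine h1.trans ?_
    rw [intervalIntegral.integral_add intervalIntegrable_const
      (integrable_volOn_intervalIntegrable (hwc.norm.integrableOn_Icc.const_mul _) h0m ht),
      intervalIntegral.integral_const, intervalIntegral.integral_const_mul, sub_zero, smul_eq_mul]
    have h9 : t * (ε / (D + 1) * ((Λ + C) * ‖α - β‖))
        ≤ P.T * (ε / (D + 1) * ((Λ + C) * ‖α - β‖)) :=
      mul_le_mul_of_nonneg_right ht.2 (by positivity)
    linarith

end OCP

end

noncomputable section

namespace OCP

open Topology

variable {n m nh ng nc : ℕ} {P : OCP n m nh ng nc}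

/-- The state of a direction. -/
def dirState (ζ : ℝ → Vec n) (z₀ : Vec n) (t : ℝ) : Vec n := z₀ + ∫ s in (0 : ℝ)..t, ζ s

theorem dirState_zero (ζ : ℝ → Vec n) (z₀ : Vec n) : dirState ζ z₀ 0 = z₀ := by
  simp [dirState]

section

variable {x : ℝ → Vec n} {u : ℝ → Vec m} {δ : ℝ} {r : Vec nh} {ζ : ℝ → Vec n} {v : ℝ → Vec m}
  {z₀ : Vec n}

theorem IsInwardDirection.integrable (h : P.IsInwardDirection x u δ r ζ v z₀) :
    Integrable ζ (volOn P.T) := Integrable.of_bound h.meas_state 1 h.bound_state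

theorem IsInwardDirection.continuousOn (h : P.IsInwardDirection x u δ r ζ v z₀) (hT : 0 ≤ P.T) :
    ContinuousOn (dirState ζ z₀) (Icc 0 P.T) :=
  continuousOn_const.add (continuousOn_intervalIntegral_volOn h.integrable hT)

theorem IsInwardDirection.norm_le (h : P.IsInwardDirection x u δ r ζ v z₀) {t : ℝ}
    (ht : t ∈ Icc 0 P.T) : ‖dirState ζ z₀ t‖ ≤ 1 + P.T := by
  refine (norm_add_le _ _).trans (add_le_add h.bound_init ?_)
  have := norm_intervalIntegral_le_of_ae (integrable_const (1 : ℝ)) h.bound_state ht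
  refine this.trans ?_
  simpa using ht.2

theorem IsInwardDirection.state_eq (h : P.IsInwardDirection x u δ r ζ v z₀) {t : ℝ}
    (ht : t ∈ Icc 0 P.T) : dirState ζ z₀ t = dirState ζ z₀ 0
      + ∫ s in (0 : ℝ)..t, (P.dynDeriv (x s) (u s) (dirState ζ z₀ s) + P.f₂ (x s) (v s)) := by
  rw [dirState_zero, dirState, intervalIntegral_eq_volOn le_rfl ht.1 ht.2,
    intervalIntegral_eq_volOn le_rfl ht.1 ht.2]
  congr 1
  refine integral_congr_ae (ae_restrict_of_ae ?_)
  filter_upwards [h.linearized] with s hs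
  exact hs

end

section

variable {x : ℝ → Vec n} {u : ℝ → Vec m} {δ : ℝ} {ζ : ℝ → Vec n} {v : ℝ → Vec m} {z₀ : Vec n}
  {ζe : Fin nh → ℝ → Vec n} {ve : Fin nh → ℝ → Vec m} {ze : Fin nh → Vec n}

/-- Combinations of a direction and of auxiliary directions, with coefficients in `ℝ × ℝᵏ`. -/
def combine {E : Type*} [AddCommGroup E] [Module ℝ E] (a : ℝ → E) (b : Fin nh → ℝ → E)
    (α : ℝ × Vec nh) (t : ℝ) : E := α.1 • a t + ∑ j, α.2 j • b j t

theorem combine_sub {E : Type*} [AddCommGroup E] [Module ℝ E] (a : ℝ → E) (b : Fin nh → ℝ → E)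
    (α β : ℝ × Vec nh) (t : ℝ) :
    combine a b (α - β) t = combine a b α t - combine a b β t := by
  simp only [combine, Prod.fst_sub, Prod.snd_sub, PiLp.sub_apply, sub_smul, Finset.sum_sub_distrib]
  abel

theorem norm_combine_le {E : Type*} [NormedAddCommGroup E] [NormedSpace ℝ E] {a : ℝ → E}
    {b : Fin nh → ℝ → E} {t B : ℝ} (ha : ‖a t‖ ≤ B) (hb : ∀ j, ‖b j t‖ ≤ B)
    (α : ℝ × Vec nh) : ‖combine a b α t‖ ≤ (1 + nh) * B * ‖α‖ := by
  have h1 : ‖α.1 • a t‖ ≤ ‖α‖ * B := by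
    rw [norm_smul]
    exact mul_le_mul (norm_fst_le α) ha (norm_nonneg _) (norm_nonneg _)
  have h2 : ∀ j, ‖α.2 j • b j t‖ ≤ ‖α‖ * B := fun j => by
    rw [norm_smul]
    exact mul_le_mul ((PiLp.norm_apply_le α.2 j).trans (norm_snd_le α)) (hb j) (norm_nonneg _)
      (norm_nonneg _)
  calc ‖combine a b α t‖ ≤ ‖α.1 • a t‖ + ∑ j, ‖α.2 j • b j t‖ :=
        (norm_add_le _ _).trans (add_le_add le_rfl (norm_sum_le _ _))
    _ ≤ ‖α‖ * B + ∑ _j : Fin nh, ‖α‖ * B := add_le_add h1 (Finset.sum_le_sum fun j _ => h2 j)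
    _ = (1 + nh) * B * ‖α‖ := by
        rw [Finset.sum_const, Finset.card_univ, Fintype.card_fin, nsmul_eq_mul]
        ring

theorem aestronglyMeasurable_combine {E : Type*} [NormedAddCommGroup E] [NormedSpace ℝ E]
    {μ : Measure ℝ} {a : ℝ → E} {b : Fin nh → ℝ → E} (ha : AEStronglyMeasurable a μ)
    (hb : ∀ j, AEStronglyMeasurable (b j) μ) (α : ℝ × Vec nh) :
    AEStronglyMeasurable (combine a b α) μ := by
  have h1 : AEStronglyMeasurable (fun t => α.1 • a t) μ := ha.const_smul _
  have h2 : AEStronglyMeasurable (fun t => ∑ j, α.2 j • b j t) μ :=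
    Finset.aestronglyMeasurable_fun_sum _ fun j _ => (hb j).const_smul _
  exact h1.add h2

theorem continuousOn_combine {E : Type*} [NormedAddCommGroup E] [NormedSpace ℝ E] {S : Set ℝ}
    {a : ℝ → E} {b : Fin nh → ℝ → E} (ha : ContinuousOn a S) (hb : ∀ j, ContinuousOn (b j) S)
    (α : ℝ × Vec nh) : ContinuousOn (combine a b α) S := by
  have h1 : ContinuousOn (fun t => α.1 • a t) S := ha.const_smul _
  have h2 : ContinuousOn (fun t => ∑ j, α.2 j • b j t) S :=
    continuousOn_finsetSum _ fun j _ => (hb j).const_smul _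
  exact h1.add h2

theorem combine_dirState_eq (hT : 0 ≤ P.T) (hsm : P.Smooth) (hxu : P.IsTrajectory x u)
    {r : Vec nh} {re : Fin nh → Vec nh} (h : P.IsInwardDirection x u δ r ζ v z₀)
    (he : ∀ j, P.IsInwardDirection x u δ (re j) (ζe j) (ve j) (ze j)) (α : ℝ × Vec nh) {t : ℝ}
    (ht : t ∈ Icc 0 P.T) :
    combine (dirState ζ z₀) (fun j => dirState (ζe j) (ze j)) α t
      = combine (dirState ζ z₀) (fun j => dirState (ζe j) (ze j)) α 0
        + ∫ s in (0 : ℝ)..t, (P.dynDeriv (x s) (u s)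
          (combine (dirState ζ z₀) (fun j => dirState (ζe j) (ze j)) α s)
          + P.f₂ (x s) (combine v ve α s)) := by
  have h0m : (0 : ℝ) ∈ Icc 0 P.T := ⟨le_rfl, hT⟩
  have hi : ∀ {r : Vec nh} {ζ : ℝ → Vec n} {v : ℝ → Vec m} {z₀ : Vec n},
      P.IsInwardDirection x u δ r ζ v z₀ → Integrable (fun s =>
        P.dynDeriv (x s) (u s) (dirState ζ z₀ s) + P.f₂ (x s) (v s)) (volOn P.T) := by
    intro r ζ v z₀ h
    have h1 : MemLp (fun s => P.dynDeriv (x s) (u s) (dirState ζ z₀ s)) ⊤ (volOn P.T) :=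
      memLp_top_clm_apply (hsm.memLp_dynDeriv hxu.continuousOn hxu.control)
        (memLp_continuousOn (h.continuousOn hT) ⊤)
    have h2 : MemLp (fun s => P.f₂ (x s) (v s)) ⊤ (volOn P.T) := memLp_top_clm_apply
      (memLp_continuousOn (hsm.f₂.continuous.comp_continuousOn hxu.continuousOn) ⊤)
      (memLp_top_of_bound h.meas_control 1 h.bound_control)
    exact (h1.integrable le_top).add (h2.integrable le_top)
  have e : ∀ s, P.dynDeriv (x s) (u s) (combine (dirState ζ z₀)
        (fun j => dirState (ζe j) (ze j)) α s) + P.f₂ (x s) (combine v ve α s)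
      = α.1 • (P.dynDeriv (x s) (u s) (dirState ζ z₀ s) + P.f₂ (x s) (v s))
        + ∑ j, α.2 j • (P.dynDeriv (x s) (u s) (dirState (ζe j) (ze j) s)
          + P.f₂ (x s) (ve j s)) := by
    intro s
    simp only [combine, map_add, map_smul, map_sum, smul_add, Finset.sum_add_distrib]
    abel
  simp only [e]
  have hi1 : Integrable (fun s => α.1 • (P.dynDeriv (x s) (u s) (dirState ζ z₀ s)
      + P.f₂ (x s) (v s))) (volOn P.T) := (hi h).smul α.1
  have hi2 : ∀ j, Integrable (fun s => α.2 j • (P.dynDeriv (x s) (u s)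
      (dirState (ζe j) (ze j) s) + P.f₂ (x s) (ve j s))) (volOn P.T) := fun j => (hi (he j)).smul
        (α.2 j)
  rw [intervalIntegral.integral_add (integrable_volOn_intervalIntegrable hi1 h0m ht)
    (integrable_volOn_intervalIntegrable (integrable_finsetSum _ fun j _ => hi2 j) h0m ht),
    intervalIntegral.integral_finsetSum fun j _ =>
      integrable_volOn_intervalIntegrable (hi2 j) h0m ht]
  simp only [intervalIntegral.integral_smul]
  simp only [combine]
  rw [h.state_eq ht, Finset.sum_congr rfl fun j _ => by rw [(he j).state_eq ht]]
  simp only [smul_add, Finset.sum_add_distrib]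
  abel

theorem isLinearFamily_combine (hT : 0 ≤ P.T) (hsm : P.Smooth) (hxu : P.IsTrajectory x u)
    {r : Vec nh} {re : Fin nh → Vec nh} (h : P.IsInwardDirection x u δ r ζ v z₀)
    (he : ∀ j, P.IsInwardDirection x u δ (re j) (ζe j) (ve j) (ze j)) :
    P.IsLinearFamily x u (combine v ve) (combine (dirState ζ z₀) fun j => dirState (ζe j) (ze j))
      ((1 + nh) * (1 + P.T)) where
  nonneg := by positivity
  V_sub := combine_sub _ _
  Z_sub := combine_sub _ _
  V_meas := aestronglyMeasurable_combine h.meas_control fun j => (he j).meas_control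
  V_bound α := by
    filter_upwards [h.bound_control, ae_all_iff.2 fun j => (he j).bound_control] with t h1 h2
    refine norm_combine_le (by linarith) (fun j => ?_) α
    linarith [h2 j]
  Z_cont := continuousOn_combine (h.continuousOn hT) fun j => (he j).continuousOn hT
  Z_bound α t ht := norm_combine_le (h.norm_le ht) (fun j => (he j).norm_le ht) α
  Z_eq α _ ht := combine_dirState_eq hT hsm hxu h he α ht

end

/-- Strict differentiability of the initial-final constraint along a flow. -/
theorem hasStrictFDerivAt_endpoints {W : Type*} [NormedAddCommGroup W] [NormedSpace ℝ W]
    (hT : 0 ≤ P.T) (hsm : P.Smooth) {x : ℝ → Vec n} {Y Z : W → ℝ → Vec n} {C : ℝ} (hC : 0 ≤ C)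
    (hZ : ∀ α, ∀ t ∈ Icc 0 P.T, ‖Z α t‖ ≤ C * ‖α‖) (hY0 : EqOn (Y 0) x (Icc 0 P.T))
    (hYZ : ∀ ε > (0 : ℝ), ∃ η > (0 : ℝ), ∀ α β, ‖α‖ ≤ η → ‖β‖ ≤ η → ∀ t ∈ Icc 0 P.T,
        ‖Y α t - Y β t - Z (α - β) t‖ ≤ ε * ‖α - β‖) {L : W →L[ℝ] Vec nh}
    (hL : ∀ α, P.hDeriv₀ (x 0) (x P.T) (Z α 0) + P.hDeriv₁ (x 0) (x P.T) (Z α P.T) = L α) :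
    HasStrictFDerivAt (fun α => P.h (Y α 0, Y α P.T)) L 0 := by
  have h0m : (0 : ℝ) ∈ Icc 0 P.T := ⟨le_rfl, hT⟩
  have hTm : P.T ∈ Icc 0 P.T := ⟨hT, le_rfl⟩
  rw [hasStrictFDerivAt_iff_isLittleO, Asymptotics.isLittleO_iff]
  intro ε hε
  set H := fderiv ℝ P.h (x 0, x P.T) with hH
  obtain ⟨η₁, hη₁, h1⟩ := exists_uniform_strictDeriv hsm.h_C1 ‖(x 0, x P.T)‖
    (ε := ε / (2 * (C + 1))) (by positivity)
  obtain ⟨η₂, hη₂, h2⟩ := hYZ (min 1 (ε / (2 * (‖H‖ + 1)))) (by positivity)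
  have hev : ∀ᶠ α : W in 𝓝 0, ‖α‖ ≤ min η₂ (η₁ / (C + 1)) := by
    have : Tendsto (fun α : W => ‖α‖) (𝓝 0) (𝓝 0) := tendsto_norm_zero
    exact this.eventually_le_const (by positivity)
  have hev2 : ∀ᶠ q : W × W in 𝓝 (0, 0), ‖q.1‖ ≤ min η₂ (η₁ / (C + 1)) ∧
      ‖q.2‖ ≤ min η₂ (η₁ / (C + 1)) := by
    rw [nhds_prod_eq]
    exact hev.prod_mk hev
  filter_upwards [hev2] with q hq
  obtain ⟨α, β⟩ := q
  simp only at hq ⊢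
  have hlip : ∀ α β : W, ‖α‖ ≤ min η₂ (η₁ / (C + 1)) → ‖β‖ ≤ min η₂ (η₁ / (C + 1)) →
      ∀ t ∈ Icc 0 P.T, ‖Y α t - Y β t‖ ≤ (C + 1) * ‖α - β‖ := by
    intro α β hα hβ t ht
    have h3 := h2 α β (hα.trans (min_le_left _ _)) (hβ.trans (min_le_left _ _)) t ht
    have h4 : min 1 (ε / (2 * (‖H‖ + 1))) * ‖α - β‖ ≤ 1 * ‖α - β‖ :=
      mul_le_mul_of_nonneg_right (min_le_left _ _) (norm_nonneg _)
    have h5 := norm_add_le (Y α t - Y β t - Z (α - β) t) (Z (α - β) t)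
    rw [sub_add_cancel] at h5
    linarith [hZ (α - β) t ht]
  have hclose : ∀ γ : W, ‖γ‖ ≤ min η₂ (η₁ / (C + 1)) →
      ‖(Y γ 0, Y γ P.T) - (x 0, x P.T)‖ ≤ η₁ := by
    intro γ hγ
    have h3 : ∀ t ∈ Icc 0 P.T, ‖Y γ t - x t‖ ≤ η₁ := by
      intro t ht
      have h4 := hlip γ 0 hγ (by rw [norm_zero]; positivity) t ht
      rw [hY0 ht, sub_zero] at h4
      refine h4.trans ?_
      have h5 := hγ.trans (min_le_right _ _)
      rw [le_div_iff₀ (by positivity)] at h5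
      linarith
    exact max_le (h3 0 h0m) (h3 P.T hTm)
  have h3 := h1 (Y α 0, Y α P.T) (Y β 0, Y β P.T) (x 0, x P.T) le_rfl (hclose α hq.1)
    (hclose β hq.2)
  rw [← hH] at h3
  have h4 : ‖(Y α 0, Y α P.T) - (Y β 0, Y β P.T)‖ ≤ (C + 1) * ‖α - β‖ :=
    max_le (hlip α β hq.1 hq.2 0 h0m) (hlip α β hq.1 hq.2 P.T hTm)
  have h5 : L (α - β) = H (Z (α - β) 0, Z (α - β) P.T) := by
    rw [← hL]
    have e : (Z (α - β) 0, Z (α - β) P.T) = (Z (α - β) 0, (0 : Vec n))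
        + ((0 : Vec n), Z (α - β) P.T) := by simp
    rw [e, map_add]
    rfl
  have h6 : ‖H ((Y α 0, Y α P.T) - (Y β 0, Y β P.T)) - L (α - β)‖ ≤ ε / 2 * ‖α - β‖ := by
    rw [h5, ← map_sub]
    refine (ContinuousLinearMap.le_opNorm _ _).trans ?_
    have h7 : ‖(Y α 0, Y α P.T) - (Y β 0, Y β P.T) - (Z (α - β) 0, Z (α - β) P.T)‖
        ≤ ε / (2 * (‖H‖ + 1)) * ‖α - β‖ := by
      have h8 : ∀ t ∈ Icc 0 P.T, ‖Y α t - Y β t - Z (α - β) t‖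
          ≤ ε / (2 * (‖H‖ + 1)) * ‖α - β‖ := fun t ht =>
        (h2 α β (hq.1.trans (min_le_left _ _)) (hq.2.trans (min_le_left _ _)) t ht).trans
          (mul_le_mul_of_nonneg_right (min_le_right _ _) (norm_nonneg _))
      exact max_le (h8 0 h0m) (h8 P.T hTm)
    calc ‖H‖ * _ ≤ ‖H‖ * (ε / (2 * (‖H‖ + 1)) * ‖α - β‖) := by gcongr
      _ = ‖H‖ / (‖H‖ + 1) * (ε / 2 * ‖α - β‖) := by field_simp
      _ ≤ 1 * (ε / 2 * ‖α - β‖) := by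
          refine mul_le_mul_of_nonneg_right ?_ (by positivity)
          rw [div_le_one (by positivity)]
          linarith
      _ = _ := one_mul _
  have h7 : ε / (2 * (C + 1)) * ‖(Y α 0, Y α P.T) - (Y β 0, Y β P.T)‖ ≤ ε / 2 * ‖α - β‖ := by
    calc _ ≤ ε / (2 * (C + 1)) * ((C + 1) * ‖α - β‖) := by gcongr
      _ = _ := by field_simp
  have e : P.h (Y α 0, Y α P.T) - P.h (Y β 0, Y β P.T) - L (α - β)
      = (P.h (Y α 0, Y α P.T) - P.h (Y β 0, Y β P.T)
        - H ((Y α 0, Y α P.T) - (Y β 0, Y β P.T)))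
        + (H ((Y α 0, Y α P.T) - (Y β 0, Y β P.T)) - L (α - β)) := by abel
  rw [e]
  refine (norm_add_le _ _).trans ?_
  linarith

/-- A direction of the linearized problem is tangent to a path of feasible trajectories. -/
theorem exists_feasible_path (hT : 0 ≤ P.T) (hsm : P.Smooth) (hstates : P.BoundedStates) {δ : ℝ}
    (hδ : 0 < δ) {x : ℝ → Vec n} {u : ℝ → Vec m} (hxu : P.IsFeasible x u)
    (hdir : ∀ r : Vec nh, ‖r‖ ≤ δ → ∃ ζ v z₀, P.IsInwardDirection x u δ r ζ v z₀)
    {ζ : ℝ → Vec n} {v : ℝ → Vec m} {z₀ : Vec n} (h : P.IsInwardDirection x u δ 0 ζ v z₀) {ε : ℝ}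
    (hε : 0 < ε) : ∀ᶠ s in 𝓝[>] (0 : ℝ), ∃ y w, P.IsFeasible y w ∧
      (∀ t ∈ Icc 0 P.T, ‖y t - x t - s • dirState ζ z₀ t‖ ≤ ε * s) ∧
      ∀ᵐ t ∂volOn P.T, ‖w t - u t - s • v t‖ ≤ ε * s := by
  have hTm : P.T ∈ Icc 0 P.T := ⟨hT, le_rfl⟩
  choose ζe ve ze he using fun j : Fin nh => hdir (δ • EuclideanSpace.single j (1 : ℝ)) (by
    rw [norm_smul, Real.norm_of_nonneg hδ.le, PiLp.norm_single]; simp)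
  have hfam := isLinearFamily_combine hT hsm hxu.toIsTrajectory h he
  set V := combine v ve with hV
  set Z := combine (dirState ζ z₀) fun j => dirState (ζe j) (ze j) with hZ
  set C : ℝ := (1 + nh) * (1 + P.T) with hC
  obtain ⟨Y, hY, hY0, hYx, hYZ⟩ := hfam.exists_flow hT hsm hstates hxu.toIsTrajectory
  have hL : ∀ α : ℝ × Vec nh, P.hDeriv₀ (x 0) (x P.T) (Z α 0) + P.hDeriv₁ (x 0) (x P.T) (Z α P.T)
      = (δ • ContinuousLinearMap.snd ℝ ℝ (Vec nh)) α := by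
    intro α
    have h1 := h.endpoints
    have h2 := fun j => (he j).endpoints
    have e : P.hDeriv₀ (x 0) (x P.T) (Z α 0) + P.hDeriv₁ (x 0) (x P.T) (Z α P.T)
        = α.1 • (P.hDeriv₀ (x 0) (x P.T) z₀ + P.hDeriv₁ (x 0) (x P.T) (dirState ζ z₀ P.T))
          + ∑ j, α.2 j • (P.hDeriv₀ (x 0) (x P.T) (ze j)
            + P.hDeriv₁ (x 0) (x P.T) (dirState (ζe j) (ze j) P.T)) := by
      simp only [hZ, combine, dirState_zero, map_add, map_smul, map_sum, smul_add,
        Finset.sum_add_distrib]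
      abel
    rw [e]
    simp only [dirState, h1, h2, smul_zero, zero_add]
    ext k
    simp [Finset.sum_apply, mul_comm, Pi.single_apply]
  have hstrict := hasStrictFDerivAt_endpoints hT hsm hfam.nonneg hfam.Z_bound hYx hYZ hL
  have hinv : ((δ • ContinuousLinearMap.snd ℝ ℝ (Vec nh)) ∘L
      ContinuousLinearMap.inr ℝ ℝ (Vec nh)).IsInvertible := by
    refine ⟨ContinuousLinearEquiv.smulLeft (Units.mk0 δ hδ.ne'), ?_⟩
    ext θ
    simp [Units.smul_def]
  set ψ := hstrict.implicitFunctionOfProdDomain hinv with hψ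
  have hψ1 := hstrict.eventually_apply_implicitFunctionOfProdDomain hinv
  have hψ0 : ψ 0 = 0 := by
    have := (hstrict.eventually_apply_eq_iff_implicitFunctionOfProdDomain hinv).self_of_nhds.1 rfl
    simpa using this
  have hψ' : HasFDerivAt ψ (0 : ℝ →L[ℝ] Vec nh) 0 := by
    have h1 := (hstrict.hasStrictFDerivAt_implicitFunctionOfProdDomain hinv).hasFDerivAt
    have e : (δ • ContinuousLinearMap.snd ℝ ℝ (Vec nh)) ∘L
        ContinuousLinearMap.inl ℝ ℝ (Vec nh) = 0 := by ext; simp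
    rw [e, ContinuousLinearMap.comp_zero, neg_zero] at h1
    exact h1
  set κ : ℝ := min 1 (ε / (2 * (C + 1))) with hκ
  have hC0 : 0 ≤ C := hfam.nonneg
  have hκ0 : 0 < κ := by positivity
  obtain ⟨η, hη, hclose⟩ := hYZ (ε / 2) (by positivity)
  have hψs : ∀ᶠ s in 𝓝 (0 : ℝ), ‖ψ s‖ ≤ κ * ‖s‖ := by
    have h1 := (hasFDerivAt_iff_isLittleO_nhds_zero.1 hψ')
    have h2 := Asymptotics.isLittleO_iff.1 h1 hκ0
    simpa [hψ0] using h2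
  have hsη : ∀ᶠ s in 𝓝[>] (0 : ℝ), s ≤ η :=
    (eventually_nhdsWithin_of_eventually_nhds
      ((tendsto_id (α := ℝ) (x := 𝓝 0)).eventually_le_const hη))
  filter_upwards [eventually_nhdsWithin_of_eventually_nhds hψs,
    eventually_nhdsWithin_of_eventually_nhds hψ1, hsη, self_mem_nhdsWithin] with s h1 h2 h3 hs
  have hs0 : (0 : ℝ) < s := hs
  rw [Real.norm_of_nonneg hs0.le] at h1
  have h4 : ‖ψ s‖ ≤ s := h1.trans (mul_le_of_le_one_left hs0.le (min_le_left _ _))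
  have h5 : ‖(s, ψ s)‖ ≤ s := max_le (Real.norm_of_nonneg hs0.le).le h4
  have h6 : C * ‖((0 : ℝ), ψ s)‖ ≤ ε / 2 * s := by
    have h7 : ‖((0 : ℝ), ψ s)‖ ≤ ε / (2 * (C + 1)) * s := by
      refine max_le (by rw [norm_zero]; positivity) (h1.trans ?_)
      exact mul_le_mul_of_nonneg_right (min_le_right _ _) hs0.le
    calc _ ≤ C * (ε / (2 * (C + 1)) * s) := by gcongr
      _ = C / (C + 1) * (ε / 2 * s) := by field_simp
      _ ≤ 1 * (ε / 2 * s) := by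
          refine mul_le_mul_of_nonneg_right ?_ (by positivity)
          rw [div_le_one (by positivity)]
          linarith
      _ = _ := one_mul _
  have hcomb : ∀ {E : Type} [NormedAddCommGroup E] [NormedSpace ℝ E] (a : ℝ → E)
      (b : Fin nh → ℝ → E) (t : ℝ),
      combine a b (s, ψ s) t - s • a t = combine a b ((0 : ℝ), ψ s) t := by
    intro E _ _ a b t
    simp [combine]
  refine ⟨Y (s, ψ s), fun t => u t + V (s, ψ s) t, ⟨hY _, ?_⟩, fun t ht => ?_, ?_⟩
  · have h7 := hxu.initial_final
    have h0m : (0 : ℝ) ∈ Icc 0 P.T := ⟨le_rfl, hT⟩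
    rw [← hYx h0m, ← hYx hTm] at h7
    exact h2.trans h7
  · have h8 := hclose (s, ψ s) 0 (h5.trans h3) (by rw [norm_zero]; exact hη.le) t ht
    rw [hYx ht, sub_zero] at h8
    have h9 : ‖Z ((0 : ℝ), ψ s) t‖ ≤ ε / 2 * s := (hfam.Z_bound _ t ht).trans h6
    have h10 := hcomb (dirState ζ z₀) (fun j => dirState (ζe j) (ze j)) t
    have e : Y (s, ψ s) t - x t - s • dirState ζ z₀ t
        = (Y (s, ψ s) t - x t - Z (s, ψ s) t) + Z ((0 : ℝ), ψ s) t := by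
      rw [hZ, ← h10]
      abel
    rw [e]
    refine (norm_add_le _ _).trans ?_
    have h11 : ε / 2 * ‖(s, ψ s)‖ ≤ ε / 2 * s := by gcongr
    linarith
  · filter_upwards [hfam.V_bound ((0 : ℝ), ψ s)] with t ht
    rw [add_sub_cancel_left, hV, hcomb]
    refine (ht.trans h6).trans ?_
    have : 0 < ε * s := by positivity
    linarith

end OCP

end

noncomputable section

namespace OCP

open Topology

variable {n m nh ng nc : ℕ} {P : OCP n m nh ng nc}

variable (P) in
/-- The constraints as functions of the state and of the control. -/
def constrFun : Fin ng ⊕ Fin nc → Vec n × Vec m → ℝ :=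
  Sum.elim (fun i z => P.g i z.1) (fun i z => P.c i z.1 z.2)

theorem constr_eq (x : ℝ → Vec n) (u : ℝ → Vec m) (i : Fin ng ⊕ Fin nc) (t : ℝ) :
    P.constr x u i t = P.constrFun i (x t, u t) := by
  rcases i with i | i <;> rfl

theorem Smooth.contDiff_constrFun (hsm : P.Smooth) (i : Fin ng ⊕ Fin nc) :
    ContDiff ℝ 1 (P.constrFun i) := by
  rcases i with i | i
  · exact ((hsm.g_C2 i).comp contDiff_fst).of_le one_le_two
  · exact (hsm.c_C2 i).of_le one_le_two

theorem Smooth.fderiv_constrFun (hsm : P.Smooth) (x : ℝ → Vec n) (u : ℝ → Vec m)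
    (i : Fin ng ⊕ Fin nc) (t : ℝ) (y : Vec n) (v : Vec m) :
    fderiv ℝ (P.constrFun i) (x t, u t) (y, v)
      = inner ℝ (P.constrX x u i t) y + inner ℝ (P.constrU x i t) v := by
  rcases i with i | i
  · have hg := ((hsm.g_C2 i).differentiable two_ne_zero (x t)).hasFDerivAt
    have h1 := (HasFDerivAt.comp (f := Prod.fst) (x t, u t) hg hasFDerivAt_fst).fderiv
    have h2 : fderiv ℝ (P.constrFun (Sum.inl i)) (x t, u t) (y, v) = fderiv ℝ (P.g i) (x t) y :=
      congrArg (fun L : Vec n × Vec m →L[ℝ] ℝ => L (y, v)) h1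
    rw [h2]
    simp only [constrX, constrU, Sum.elim_inl, inner_zero_left, add_zero, gradient,
      InnerProductSpace.toDual_symm_apply]
  · exact hsm.fderiv_mixed i (x t) (u t) y v

/-- A direction that decreases the constraints is tangent to a path of feasible trajectories along
which they decrease. -/
theorem exists_decreasing_path (hT : 0 ≤ P.T) (hsm : P.Smooth) (hstates : P.BoundedStates) {δ : ℝ}
    (hδ : 0 < δ) {x : ℝ → Vec n} {u : ℝ → Vec m} (hxu : P.IsFeasible x u)
    (hdir : ∀ r : Vec nh, ‖r‖ ≤ δ → ∃ ζ v z₀, P.IsInwardDirection x u δ r ζ v z₀) :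
    ∀ᶠ s in 𝓝[>] (0 : ℝ), ∃ y w, P.IsFeasible y w ∧
      (∀ t ∈ Icc 0 P.T, ‖y t - x t‖ ≤ (2 + P.T) * s) ∧
      (∀ᵐ t ∂volOn P.T, ‖w t - u t‖ ≤ (2 + P.T) * s) ∧
      ∀ᵐ t ∂volOn P.T, ∀ i, P.constr y w i t ≤ (1 - s) * P.constr x u i t - s * (δ / 2) := by
  obtain ⟨ζ, v, z₀, h⟩ := hdir 0 (by simpa using hδ.le)
  obtain ⟨U, hU0, hU⟩ := memLp_top_ae_bound (T := P.T) hxu.control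
  obtain ⟨X, hX⟩ := isCompact_Icc.exists_bound_of_continuousOn hxu.continuousOn
  set R : ℝ := max X U with hR
  have hbd : ∀ᵐ t ∂volOn P.T, ‖(x t, u t)‖ ≤ R := by
    filter_upwards [ae_volOn_mem, hU] with t ht h1
    exact max_le ((hX t ht).trans (le_max_left _ _)) (h1.trans (le_max_right _ _))
  have hM : ∀ i : Fin ng ⊕ Fin nc, ∃ M : ℝ, 0 ≤ M ∧ ∀ z, ‖z‖ ≤ R →
      ‖fderiv ℝ (P.constrFun i) z‖ ≤ M := by
    intro i
    obtain ⟨M, hM⟩ := (isCompact_closedBall (0 : Vec n × Vec m) R).exists_bound_of_continuousOn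
      ((hsm.contDiff_constrFun i).continuous_fderiv one_ne_zero).continuousOn
    exact ⟨max M 0, le_max_right _ _, fun z hz =>
      (hM z (mem_closedBall_zero_iff.2 hz)).trans (le_max_left _ _)⟩
  choose M' hM'0 hM' using hM
  set M : ℝ := ∑ i, M' i with hMdef
  have hM0 : 0 ≤ M := Finset.sum_nonneg fun i _ => hM'0 i
  have hM : ∀ i, ∀ z, ‖z‖ ≤ R → ‖fderiv ℝ (P.constrFun i) z‖ ≤ M := fun i z hz =>
    (hM' i z hz).trans (Finset.single_le_sum (f := M') (fun i _ => hM'0 i) (Finset.mem_univ i))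
  have hstrict := fun i => exists_uniform_strictDeriv (hsm.contDiff_constrFun i) R
    (ε := δ / (4 * (2 + P.T))) (by positivity)
  choose η hη hclose using hstrict
  have hpath := exists_feasible_path hT hsm hstates hδ hxu hdir h
    (ε := min 1 (δ / (4 * (M + 1)))) (by positivity)
  have hsmall : ∀ᶠ s in 𝓝[>] (0 : ℝ), ∀ i, (2 + P.T) * s ≤ η i := by
    refine eventually_all.2 fun i => eventually_nhdsWithin_of_eventually_nhds ?_
    have : Tendsto (fun s : ℝ => (2 + P.T) * s) (𝓝 0) (𝓝 0) := by
      simpa using (tendsto_id (α := ℝ) (x := 𝓝 0)).const_mul (2 + P.T)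
    exact this.eventually_le_const (hη i)
  filter_upwards [hpath, hsmall, self_mem_nhdsWithin] with s h1 h2 hs
  have hs0 : (0 : ℝ) < s := hs
  obtain ⟨y, w, hyw, hy, hw⟩ := h1
  have hε1 : min 1 (δ / (4 * (M + 1))) * s ≤ s := mul_le_of_le_one_left hs0.le (min_le_left _ _)
  have hy' : ∀ t ∈ Icc 0 P.T, ‖y t - x t‖ ≤ (2 + P.T) * s := by
    intro t ht
    have h3 := norm_add_le (y t - x t - s • dirState ζ z₀ t) (s • dirState ζ z₀ t)
    rw [sub_add_cancel, norm_smul, Real.norm_of_nonneg hs0.le] at h3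
    have h4 := mul_le_mul_of_nonneg_left (h.norm_le ht) hs0.le
    linarith [hy t ht]
  have hw' : ∀ᵐ t ∂volOn P.T, ‖w t - u t‖ ≤ (2 + P.T) * s := by
    filter_upwards [hw, h.bound_control] with t h3 h4
    have h5 := norm_add_le (w t - u t - s • v t) (s • v t)
    rw [sub_add_cancel, norm_smul, Real.norm_of_nonneg hs0.le] at h5
    have h6 := mul_le_mul_of_nonneg_left h4 hs0.le
    have h7 : 0 ≤ P.T * s := by positivity
    linarith
  refine ⟨y, w, hyw, hy', hw', ?_⟩
  filter_upwards [hw, hw', ae_volOn_mem, hbd, h.decrease] with t h3 h4 ht h5 h6 i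
  have h7 : ‖(y t, w t) - (x t, u t)‖ ≤ (2 + P.T) * s := max_le (hy' t ht) h4
  have h8 := hclose i (y t, w t) (x t, u t) (x t, u t) h5 (h7.trans (h2 i))
    (by rw [sub_self, norm_zero]; exact (hη i).le)
  have h9 : ‖(y t - x t - s • dirState ζ z₀ t, w t - u t - s • v t)‖
      ≤ min 1 (δ / (4 * (M + 1))) * s := max_le (hy t ht) h3
  set F := fderiv ℝ (P.constrFun i) (x t, u t) with hF
  have e : (y t, w t) - (x t, u t) = s • (dirState ζ z₀ t, v t)
      + (y t - x t - s • dirState ζ z₀ t, w t - u t - s • v t) := by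
    ext1 <;> simp
  have h10 : F ((y t, w t) - (x t, u t)) = s * F (dirState ζ z₀ t, v t)
      + F (y t - x t - s • dirState ζ z₀ t, w t - u t - s • v t) := by
    rw [e, map_add, map_smul, smul_eq_mul]
  have h11 : F (y t - x t - s • dirState ζ z₀ t, w t - u t - s • v t) ≤ δ / 4 * s := by
    refine (le_abs_self _).trans ((F.le_opNorm _).trans ?_)
    have h12 : min 1 (δ / (4 * (M + 1))) * s ≤ δ / (4 * (M + 1)) * s :=
      mul_le_mul_of_nonneg_right (min_le_right _ _) hs0.le
    calc ‖F‖ * _ ≤ M * (δ / (4 * (M + 1)) * s) :=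
          mul_le_mul (hM i _ h5) (h9.trans h12) (norm_nonneg _) hM0
      _ = M / (M + 1) * (δ / 4 * s) := by field_simp
      _ ≤ 1 * (δ / 4 * s) := by
          refine mul_le_mul_of_nonneg_right ?_ (by positivity)
          rw [div_le_one (by positivity)]
          linarith
      _ = _ := one_mul _
  have h13 : δ / (4 * (2 + P.T)) * ‖(y t, w t) - (x t, u t)‖ ≤ δ / 4 * s := by
    calc _ ≤ δ / (4 * (2 + P.T)) * ((2 + P.T) * s) := by gcongr
      _ = _ := by field_simp
  have h14 := (le_abs_self _).trans (h8.trans h13)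
  have h15 : F (dirState ζ z₀ t, v t) ≤ -δ - P.constr x u i t := by
    have h16 := h6 i
    rw [hF, hsm.fderiv_constrFun]
    simp only [dirState]
    linarith
  have h17 := mul_le_mul_of_nonneg_left h15 hs0.le
  rw [constr_eq y w, constr_eq x u] at *
  linarith

/-- The cost is Lipschitz continuous, uniformly on bounded sets of trajectories. -/
theorem exists_J_lipschitz (hT : 0 ≤ P.T) (hsm : P.Smooth) (R : ℝ) :
    ∃ C : ℝ, 0 ≤ C ∧ ∀ (x y : ℝ → Vec n) (u w : ℝ → Vec m) (d : ℝ),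
      P.IsTrajectory x u → P.IsTrajectory y w →
      (∀ t ∈ Icc 0 P.T, ‖x t‖ ≤ R) → (∀ t ∈ Icc 0 P.T, ‖y t‖ ≤ R) →
      (∀ᵐ t ∂volOn P.T, ‖u t‖ ≤ R) → (∀ᵐ t ∂volOn P.T, ‖w t‖ ≤ R) →
      (∀ t ∈ Icc 0 P.T, ‖y t - x t‖ ≤ d) → (∀ᵐ t ∂volOn P.T, ‖w t - u t‖ ≤ d) →
      P.J y w - P.J x u ≤ C * d := by
  have hTm : P.T ∈ Icc 0 P.T := ⟨hT, le_rfl⟩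
  obtain ⟨K₁, hK₁⟩ := (hsm.φ_C1.locallyLipschitz.locallyLipschitzOn
    (s := Metric.closedBall (0 : Vec n) R)).exists_lipschitzOnWith_of_compact
    (isCompact_closedBall _ _)
  obtain ⟨K₂, hK₂⟩ := ((hsm.ℓ_C2.of_le one_le_two).locallyLipschitz.locallyLipschitzOn
    (s := Metric.closedBall (0 : Vec n × Vec m) R)).exists_lipschitzOnWith_of_compact
    (isCompact_closedBall _ _)
  refine ⟨K₁ + K₂ * P.T, by positivity, fun x y u w d hx hy hxb hyb hub hwb hxy huw => ?_⟩
  have hℓ : ∀ (x : ℝ → Vec n) (u : ℝ → Vec m), P.IsTrajectory x u →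
      Integrable (fun t => P.ℓ (x t) (u t)) (volOn P.T) := by
    intro x u hxu
    have h1 : MemLp (fun t => P.ℓ₁ (x t)) ⊤ (volOn P.T) :=
      memLp_continuousOn (hsm.ℓ₁.continuous.comp_continuousOn hxu.continuousOn) ⊤
    have h2 : MemLp (fun t => innerSL ℝ (P.ℓ₂ (x t)) (u t)) ⊤ (volOn P.T) :=
      memLp_top_clm_apply (K := fun t => innerSL ℝ (P.ℓ₂ (x t)))
        (memLp_continuousOn (((innerSL ℝ).continuous.comp
          hsm.ℓ₂.continuous).comp_continuousOn hxu.continuousOn) ⊤) hxu.control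
    exact (h1.integrable le_top).add (h2.integrable le_top)
  have h1 : P.φ (y P.T) - P.φ (x P.T) ≤ K₁ * d := by
    refine (le_abs_self _).trans ((hK₁.norm_sub_le (mem_closedBall_zero_iff.2 (hyb _ hTm))
      (mem_closedBall_zero_iff.2 (hxb _ hTm))).trans ?_)
    exact mul_le_mul_of_nonneg_left (hxy _ hTm) K₁.2
  have h2 : ∫ t, P.ℓ (y t) (w t) ∂volOn P.T - ∫ t, P.ℓ (x t) (u t) ∂volOn P.T ≤ K₂ * P.T * d := by
    rw [← integral_sub (hℓ y w hy) (hℓ x u hx)]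
    have h3 : ∀ᵐ t ∂volOn P.T, ‖P.ℓ (y t) (w t) - P.ℓ (x t) (u t)‖ ≤ K₂ * d := by
      filter_upwards [hub, hwb, huw, ae_volOn_mem] with t h4 h5 h6 ht
      refine (hK₂.norm_sub_le (x := (y t, w t)) (y := (x t, u t))
        (mem_closedBall_zero_iff.2 (max_le (hyb t ht) h5))
        (mem_closedBall_zero_iff.2 (max_le (hxb t ht) h4))).trans ?_
      exact mul_le_mul_of_nonneg_left (max_le (hxy t ht) h6) K₂.2
    refine (le_abs_self _).trans ((norm_integral_le_of_norm_le_const h3).trans_eq ?_)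
    simp [Measure.real, hT]
    ring
  have h3 : P.J y w - P.J x u = (P.φ (y P.T) - P.φ (x P.T))
      + (∫ t, P.ℓ (y t) (w t) ∂volOn P.T - ∫ t, P.ℓ (x t) (u t) ∂volOn P.T) := by
    simp only [J, vol]
    ring
  rw [h3]
  linarith

end OCP

end

noncomputable section

section Barrier

open Topology

theorem logBarrier_of_neg {s : ℝ} (hs : s < 0) : logBarrier s = ((-Real.log (-s) : ℝ) : EReal) :=
  if_pos hs

theorem logBarrier_of_nonneg {s : ℝ} (hs : 0 ≤ s) : logBarrier s = ⊤ := if_neg hs.not_gt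

theorem logBarrier_ne_bot (s : ℝ) : logBarrier s ≠ ⊥ := by
  rcases lt_or_ge s 0 with hs | hs
  · rw [logBarrier_of_neg hs]
    exact EReal.coe_ne_bot _
  · rw [logBarrier_of_nonneg hs]
    exact top_ne_bot

theorem logBarrierDeriv_of_neg {s : ℝ} (hs : s < 0) : logBarrierDeriv s = 1 / -s := by
  have h1 : (fun r : ℝ => (logBarrier r).toReal) =ᶠ[𝓝 s] fun r => -Real.log (-r) := by
    filter_upwards [eventually_lt_nhds hs] with r hr
    rw [logBarrier_of_neg hr, EReal.toReal_coe]
  have h2 : HasDerivAt (fun r : ℝ => -Real.log (-r)) (-(-1 / -s)) s :=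
    ((hasDerivAt_id s).neg.log (neg_ne_zero.2 hs.ne)).neg
  rw [logBarrierDeriv, h1.deriv_eq, h2.deriv]
  ring

theorem sum_ne_bot_of_forall {ι : Type*} (S : Finset ι) {f : ι → EReal} (h : ∀ i, f i ≠ ⊥) :
    ∑ i ∈ S, f i ≠ ⊥ := by
  classical
  induction S using Finset.induction_on with
  | empty => simp
  | insert i S hi ih =>
    rw [Finset.sum_insert hi]
    exact EReal.add_ne_bot_iff.2 ⟨h i, ih⟩

variable {ι : Type*} [Fintype ι]

theorem sum_logBarrier_of_neg {k : ι → ℝ} (h : ∀ i, k i < 0) :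
    ∑ i, logBarrier (k i) = ((∑ i, -Real.log (-k i) : ℝ) : EReal) := by
  classical
  have : ∀ S : Finset ι, ∑ i ∈ S, logBarrier (k i)
      = ((∑ i ∈ S, -Real.log (-k i) : ℝ) : EReal) := by
    intro S
    induction S using Finset.induction_on with
    | empty => simp
    | insert i S hi ih =>
      rw [Finset.sum_insert hi, Finset.sum_insert hi, ih, logBarrier_of_neg (h i), EReal.coe_add]
  exact this _

theorem sum_logBarrier_of_exists {k : ι → ℝ} (h : ∃ i, 0 ≤ k i) :
    ∑ i, logBarrier (k i) = ⊤ := by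
  classical
  obtain ⟨i, hi⟩ := h
  rw [← Finset.add_sum_erase _ _ (Finset.mem_univ i), logBarrier_of_nonneg hi]
  exact EReal.top_add_of_ne_bot (sum_ne_bot_of_forall _ fun i => logBarrier_ne_bot _)

variable {T : ℝ}

theorem extIntegral_eq_of_ae {w : ℝ → EReal} {W : ℝ → ℝ} (hW : Integrable W (volOn T))
    (h : ∀ᵐ t ∂volOn T, w t = (W t : EReal)) :
    extIntegral T w = ((∫ t, W t ∂volOn T : ℝ) : EReal) := by
  have h1 : ∫⁻ t in Icc 0 T, (w t).toENNReal = ∫⁻ t, ENNReal.ofReal (W t) ∂volOn T :=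
    lintegral_congr_ae (by filter_upwards [h] with t ht; rw [ht, EReal.real_coe_toENNReal])
  have h2 : ∫⁻ t in Icc 0 T, (-w t).toENNReal = ∫⁻ t, ENNReal.ofReal (-W t) ∂volOn T :=
    lintegral_congr_ae (by
      filter_upwards [h] with t ht
      rw [ht, ← EReal.coe_neg, EReal.real_coe_toENNReal])
  have h3 : ∀ {V : ℝ → ℝ}, Integrable V (volOn T) →
      ∫⁻ t, ENNReal.ofReal (V t) ∂volOn T ≠ ⊤ := fun {V} hV =>
    (lt_of_le_of_lt (lintegral_mono fun t => Real.ofReal_le_enorm (V t)) hV.2).ne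
  rw [extIntegral, h1, h2, integral_eq_lintegral_pos_part_sub_lintegral_neg_part hW, EReal.coe_sub,
    EReal.coe_ennreal_toReal (h3 hW)]
  exact congrArg _ (EReal.coe_ennreal_toReal (h3 hW.neg)).symm

theorem extIntegral_logBarrier {k : ι → ℝ → ℝ} (hk : ∀ i, MemLp (k i) ⊤ (volOn T))
    (h : extIntegral T (fun t => ∑ i, logBarrier (k i t)) ≠ ⊤) :
    (∀ᵐ t ∂volOn T, ∀ i, k i t < 0) ∧
      Integrable (fun t => ∑ i, -Real.log (-k i t)) (volOn T) := by
  -- lower bound of the barriers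
  have hB : ∃ B : ℝ, 0 ≤ B ∧ ∀ᵐ t ∂volOn T, ∀ i, |k i t| ≤ Real.exp B := by
    choose C hC0 hC using fun i => memLp_top_ae_bound (hk i)
    refine ⟨Real.log (1 + ∑ i, C i), Real.log_nonneg (le_add_of_nonneg_right
      (Finset.sum_nonneg fun i _ => hC0 i)), ?_⟩
    have h0 : 0 ≤ ∑ i, C i := Finset.sum_nonneg fun i _ => hC0 i
    filter_upwards [ae_all_iff.2 hC] with t ht i
    rw [Real.exp_log (by positivity)]
    have := Finset.single_le_sum (f := C) (fun i _ => hC0 i) (Finset.mem_univ i)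
    have h2 := ht i
    rw [Real.norm_eq_abs] at h2
    linarith
  obtain ⟨B, hB0, hB⟩ := hB
  have hlow : ∀ t, (∀ i, |k i t| ≤ Real.exp B) → (∀ i, k i t < 0) →
      -(Fintype.card ι * B) ≤ ∑ i, -Real.log (-k i t) := by
    intro t h1 h2
    have : ∀ i, -B ≤ -Real.log (-k i t) := fun i => by
      rw [neg_le_neg_iff, Real.log_le_iff_le_exp (neg_pos.2 (h2 i))]
      exact (neg_le_abs _).trans (h1 i)
    calc -(Fintype.card ι * B) = ∑ _i : ι, -B := by
          rw [Finset.sum_const, Finset.card_univ, nsmul_eq_mul]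
          ring
      _ ≤ _ := Finset.sum_le_sum fun i _ => this i
  have hN : ∫⁻ t in Icc 0 T, (-∑ i, logBarrier (k i t)).toENNReal ≠ ⊤ := by
    refine ne_top_of_le_ne_top (b := ∫⁻ _t in Icc 0 T, ENNReal.ofReal (Fintype.card ι * B)) ?_
      (lintegral_mono_ae ?_)
    · rw [lintegral_const]
      exact ENNReal.mul_ne_top ENNReal.ofReal_ne_top (measure_ne_top _ _)
    · filter_upwards [hB] with t ht
      by_cases hneg : ∀ i, k i t < 0
      · rw [sum_logBarrier_of_neg hneg, ← EReal.coe_neg, EReal.real_coe_toENNReal]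
        exact ENNReal.ofReal_le_ofReal (by linarith [hlow t ht hneg])
      · push Not at hneg
        rw [sum_logBarrier_of_exists hneg, EReal.neg_top, EReal.toENNReal_bot]
        exact zero_le
  have hP : ∫⁻ t in Icc 0 T, (∑ i, logBarrier (k i t)).toENNReal ≠ ⊤ := by
    intro hP
    refine h ?_
    rw [extIntegral, hP, EReal.coe_ennreal_top, ← EReal.coe_ennreal_toReal hN, EReal.top_sub_coe]
  have hneg : ∀ᵐ t ∂volOn T, ∀ i, k i t < 0 := by
    rw [ae_all_iff]
    intro i
    have hS : NullMeasurableSet {t | 0 ≤ k i t} (volOn T) :=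
      nullMeasurableSet_le aemeasurable_const (hk i).1.aemeasurable
    have h1 : ∫⁻ t, {t | 0 ≤ k i t}.indicator (fun _ => (⊤ : ENNReal)) t ∂volOn T ≠ ⊤ := by
      refine ne_top_of_le_ne_top hP (lintegral_mono fun t => ?_)
      by_cases ht : 0 ≤ k i t
      · rw [sum_logBarrier_of_exists ⟨i, ht⟩, EReal.toENNReal_top]
        exact le_top
      · rw [indicator_of_notMem (show t ∉ {t | 0 ≤ k i t} from ht)]
        exact zero_le
    filter_upwards [ae_lt_top' (aemeasurable_const.indicator₀ hS) h1] with t ht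
    by_contra hcon
    rw [indicator_of_mem (show t ∈ {t | 0 ≤ k i t} from not_lt.1 hcon)] at ht
    exact lt_irrefl _ ht
  refine ⟨hneg, ?_, ?_⟩
  · have hm : AEMeasurable (fun t => ∑ i, -Real.log (-k i t)) (volOn T) :=
      Finset.aemeasurable_fun_sum _ fun i _ => (Real.measurable_log.comp_aemeasurable
        (hk i).1.aemeasurable.neg).neg
    exact hm.aestronglyMeasurable
  · have h1 : ∫⁻ t, ‖∑ i, -Real.log (-k i t)‖ₑ ∂volOn T
        ≤ ∫⁻ t, ((∑ i, logBarrier (k i t)).toENNReal + ENNReal.ofReal (2 * (Fintype.card ι * B)))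
          ∂volOn T := by
      refine lintegral_mono_ae ?_
      filter_upwards [hB, hneg] with t h1 h2
      rw [sum_logBarrier_of_neg h2, EReal.real_coe_toENNReal, ← ofReal_norm]
      have h3 := hlow t h1 h2
      have h4 : 0 ≤ Fintype.card ι * B := by positivity
      refine le_trans (ENNReal.ofReal_le_ofReal (q := max (∑ i, -Real.log (-k i t)) 0
        + 2 * (Fintype.card ι * B)) ?_) ?_
      · rw [Real.norm_eq_abs, abs_le]
        constructor
        · linarith [le_max_right (∑ i, -Real.log (-k i t)) 0]
        · linarith [le_max_left (∑ i, -Real.log (-k i t)) 0]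
      · refine ENNReal.ofReal_add_le.trans (add_le_add ?_ le_rfl)
        rw [ENNReal.ofReal_max, ENNReal.ofReal_zero]
        exact max_le le_rfl zero_le
    refine lt_of_le_of_lt h1 ?_
    rw [lintegral_add_right _ measurable_const, lintegral_const]
    exact ENNReal.add_lt_top.2 ⟨hP.lt_top, ENNReal.mul_lt_top ENNReal.ofReal_lt_top
      (measure_lt_top _ _)⟩

/-- Fatou's lemma for the difference quotients of the barrier. -/
theorem lintegral_barrier_le_of_eventually {κ : ℝ → ℝ} {d : ℝ} {C : ENNReal}
    (hκ : AEStronglyMeasurable κ (volOn T)) (hpos : ∀ᵐ t ∂volOn T, 0 < κ t)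
    (hev : ∀ᶠ s in 𝓝[>] (0 : ℝ),
      ∫⁻ t, ENNReal.ofReal ((d - κ t) / (κ t + s * (d - κ t)) + 2) ∂volOn T ≤ C) :
    ∫⁻ t, ENNReal.ofReal (d / κ t + 1) ∂volOn T ≤ C := by
  have hseq : Tendsto (fun j : ℕ => 1 / ((j : ℝ) + 1)) atTop (𝓝[>] 0) :=
    tendsto_nhdsWithin_of_tendsto_nhds_of_eventually_within _
      tendsto_one_div_add_atTop_nhds_zero_nat
      (Eventually.of_forall fun j => by simp only [mem_Ioi]; positivity)
  have hm := hκ.aemeasurable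
  have hfatou := lintegral_liminf_le' (μ := volOn T) (u := atTop) (f := fun (j : ℕ) t =>
    ENNReal.ofReal ((d - κ t) / (κ t + 1 / ((j : ℝ) + 1) * (d - κ t)) + 2)) fun j =>
      ENNReal.measurable_ofReal.comp_aemeasurable (((aemeasurable_const.sub hm).div
        (hm.add ((aemeasurable_const.sub hm).const_mul _))).add_const _)
  refine le_trans (le_of_eq (lintegral_congr_ae ?_)) (hfatou.trans
    (liminf_le_of_frequently_le' (hseq.eventually hev).frequently))
  filter_upwards [hpos] with t ht
  have h1 : Tendsto (fun j : ℕ => (d - κ t) / (κ t + 1 / ((j : ℝ) + 1) * (d - κ t)) + 2) atTop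
      (𝓝 ((d - κ t) / (κ t + 0 * (d - κ t)) + 2)) := by
    refine (Tendsto.div tendsto_const_nhds (tendsto_const_nhds.add
      (tendsto_one_div_add_atTop_nhds_zero_nat.mul_const _)) ?_).add_const _
    simpa using ht.ne'
  have h2 : (d - κ t) / (κ t + 0 * (d - κ t)) + 2 = d / κ t + 1 := by
    have := ht.ne'
    rw [zero_mul, add_zero]
    field_simp
    ring
  rw [h2] at h1
  exact ((ENNReal.continuous_ofReal.tendsto _).comp h1).liminf_eq.symm

/-- Comparison of the logarithms with their difference quotients. -/
theorem mul_div_le_log_sub_log {κ κ' d s : ℝ} (hκ : 0 < κ) (hd : 0 < d) (hs : 0 < s) (hs1 : s < 1)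
    (h : (1 - s) * κ + s * d ≤ κ') :
    s * ((d - κ) / (κ + s * (d - κ))) ≤ Real.log κ' - Real.log κ := by
  have h1 : 0 < κ + s * (d - κ) := by nlinarith [mul_pos hs hd, mul_pos (sub_pos.2 hs1) hκ]
  have h2 : κ + s * (d - κ) ≤ κ' := by linarith
  have h3 := Real.one_sub_inv_le_log_of_pos (div_pos h1 hκ)
  rw [Real.log_div h1.ne' hκ.ne', inv_div] at h3
  have h4 := Real.log_le_log h1 h2
  have h5 : s * ((d - κ) / (κ + s * (d - κ))) = 1 - κ / (κ + s * (d - κ)) := by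
    field_simp
    ring
  linarith

theorem neg_two_le_quotient {κ d s : ℝ} (hκ : 0 < κ) (hd : 0 < d) (hs : 0 < s) (hs1 : s ≤ 1 / 2) :
    0 ≤ (d - κ) / (κ + s * (d - κ)) + 2 ∧ (d - κ) / (κ + s * (d - κ)) ≤ 1 / s := by
  have h1 : 0 < κ + s * (d - κ) := by nlinarith [mul_pos hs hd]
  constructor
  · rw [← neg_le_iff_add_nonneg, le_div_iff₀ h1]
    nlinarith [mul_pos hs hd]
  · rw [div_le_div_iff₀ h1 hs]
    linarith

theorem integrable_log_of_le {k : ι → ℝ → ℝ} (hk : ∀ i, MemLp (k i) ⊤ (volOn T)) {η : ℝ}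
    (hη : 0 < η) (h : ∀ᵐ t ∂volOn T, ∀ i, k i t ≤ -η) :
    Integrable (fun t => ∑ i, -Real.log (-k i t)) (volOn T) := by
  refine integrable_finsetSum _ fun i _ => ?_
  obtain ⟨C, hC0, hC⟩ := memLp_top_ae_bound (hk i)
  refine Integrable.of_bound (C := |Real.log η| + |Real.log (max C 1)|)
    (Real.measurable_log.comp_aemeasurable (hk i).1.aemeasurable.neg).neg.aestronglyMeasurable ?_
  filter_upwards [h, hC] with t h1 h2
  have h3 := h1 i
  rw [Real.norm_eq_abs] at h2
  have h4 : Real.log η ≤ Real.log (-k i t) := Real.log_le_log hη (by linarith)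
  have h5 : Real.log (-k i t) ≤ Real.log (max C 1) :=
    Real.log_le_log (by linarith) (((neg_le_abs _).trans h2).trans (le_max_left _ _))
  rw [norm_neg, Real.norm_eq_abs, abs_le]
  constructor
  · linarith [neg_abs_le (Real.log η), abs_nonneg (Real.log (max C 1))]
  · linarith [le_abs_self (Real.log (max C 1)), abs_nonneg (Real.log η)]

/-- Bound on the difference quotients of a barrier from a bound on the decrease of the total
penalty. -/
theorem lintegral_quotient_le (hT : 0 ≤ T) {k k' : ι → ℝ → ℝ}
    (hk : ∀ i, AEStronglyMeasurable (k i) (volOn T)) {d s A : ℝ} (hd : 0 < d) (hs : 0 < s)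
    (hs1 : s ≤ 1 / 2) (hneg : ∀ᵐ t ∂volOn T, ∀ i, k i t < 0)
    (hint : Integrable (fun t => ∑ i, -Real.log (-k i t)) (volOn T))
    (hint' : Integrable (fun t => ∑ i, -Real.log (-k' i t)) (volOn T))
    (h : ∀ᵐ t ∂volOn T, ∀ i, k' i t ≤ (1 - s) * k i t - s * d)
    (hA : (∫ t, ∑ i, -Real.log (-k i t) ∂volOn T) - ∫ t, ∑ i, -Real.log (-k' i t) ∂volOn T
      ≤ A * s) (i : ι) :
    ∫⁻ t, ENNReal.ofReal ((d - -k i t) / (-k i t + s * (d - -k i t)) + 2) ∂volOn T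
      ≤ ENNReal.ofReal (A + 2 * Fintype.card ι * T) := by
  set q : ι → ℝ → ℝ := fun i t => (d - -k i t) / (-k i t + s * (d - -k i t)) with hq
  have hq2 : ∀ᵐ t ∂volOn T, ∀ i, 0 ≤ q i t + 2 ∧ q i t ≤ 1 / s := by
    filter_upwards [hneg] with t ht i using neg_two_le_quotient (neg_pos.2 (ht i)) hd hs hs1
  have hqi : ∀ i, Integrable (q i) (volOn T) := fun i => by
    have hm := (hk i).aemeasurable.neg
    refine Integrable.of_bound (C := 2 + 1 / s) ((aemeasurable_const.sub hm).div
      (hm.add ((aemeasurable_const.sub hm).const_mul _))).aestronglyMeasurable ?_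
    filter_upwards [hq2] with t ht
    have := one_div_pos.2 hs
    rw [Real.norm_eq_abs, abs_le]
    constructor <;> linarith [(ht i).1, (ht i).2]
  have hsum : ∫ t, ∑ j, q j t ∂volOn T ≤ A := by
    refine le_of_mul_le_mul_left ?_ hs
    rw [mul_comm s A, ← integral_const_mul]
    refine le_trans ?_ hA
    rw [← integral_sub hint hint']
    refine integral_mono_ae ((integrable_finsetSum _ fun j _ => hqi j).const_mul s)
      (hint.sub hint') ?_
    filter_upwards [hneg, h] with t h1 h2
    rw [Finset.mul_sum, ← Finset.sum_sub_distrib]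
    refine Finset.sum_le_sum fun j _ => ?_
    have := mul_div_le_log_sub_log (neg_pos.2 (h1 j)) hd hs (by linarith)
      (κ' := -k' j t) (by linarith [h2 j])
    linarith
  have hI : Integrable (fun t => ∑ j, (q j t + 2)) (volOn T) :=
    integrable_finsetSum _ fun j _ => (hqi j).add (integrable_const _)
  have hle : ∫ t, ∑ j, (q j t + 2) ∂volOn T ≤ A + 2 * Fintype.card ι * T := by
    have h1 : ∀ t, ∑ j, (q j t + 2) = ∑ j, q j t + Fintype.card ι * 2 := fun t => by
      rw [Finset.sum_add_distrib, Finset.sum_const, Finset.card_univ, nsmul_eq_mul]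
    have hI : Integrable (fun t => ∑ j, q j t) (volOn T) :=
      integrable_finsetSum _ fun j _ => hqi j
    have h2 : (volOn T).real univ = T := by
      simp [volOn, measureReal_def, hT]
    rw [integral_congr_ae (Eventually.of_forall h1), integral_add hI (integrable_const _),
      integral_const, h2, smul_eq_mul]
    linarith
  calc ∫⁻ t, ENNReal.ofReal (q i t + 2) ∂volOn T
      ≤ ∫⁻ t, ENNReal.ofReal (∑ j, (q j t + 2)) ∂volOn T := by
        refine lintegral_mono_ae ?_
        filter_upwards [hq2] with t ht
        exact ENNReal.ofReal_le_ofReal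
          (Finset.single_le_sum (f := fun j => q j t + 2) (fun j _ => (ht j).1) (Finset.mem_univ i))
    _ = ENNReal.ofReal (∫ t, ∑ j, (q j t + 2) ∂volOn T) :=
        (ofReal_integral_eq_lintegral_ofReal hI (by
          filter_upwards [hq2] with t ht
          exact Finset.sum_nonneg fun j _ => (ht j).1)).symm
    _ ≤ _ := ENNReal.ofReal_le_ofReal hle

end Barrier

end

noncomputable section

namespace OCP

open Topology

variable {n m nh ng nc : ℕ} {P : OCP n m nh ng nc} {x : ℝ → Vec n} {u : ℝ → Vec m} {ε : ℝ}

theorem Jpen_eq_add_extIntegral (ε : ℝ) (x : ℝ → Vec n) (u : ℝ → Vec m) :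
    P.Jpen ε x u = (P.J x u : EReal)
      + (ε : EReal) * extIntegral P.T fun t => ∑ i, logBarrier (P.constr x u i t) := by
  simp only [Fintype.sum_sum_type]
  rfl

theorem neg_of_Jpen_ne_top (hε : 0 < ε) (hsm : P.Smooth) (hxu : P.IsTrajectory x u)
    (h : P.Jpen ε x u ≠ ⊤) :
    (∀ᵐ t ∂volOn P.T, ∀ i, P.constr x u i t < 0) ∧
      Integrable (fun t => ∑ i, -Real.log (-P.constr x u i t)) (volOn P.T) := by
  refine extIntegral_logBarrier (fun i => hsm.memLp_constr hxu.continuousOn hxu.control i)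
    fun hcon => h ?_
  rw [Jpen_eq_add_extIntegral, hcon, EReal.coe_mul_top_of_pos hε, EReal.coe_add_top]

theorem Jpen_eq_coe (hneg : ∀ᵐ t ∂volOn P.T, ∀ i, P.constr x u i t < 0)
    (hint : Integrable (fun t => ∑ i, -Real.log (-P.constr x u i t)) (volOn P.T)) :
    P.Jpen ε x u
      = ((P.J x u + ε * ∫ t, ∑ i, -Real.log (-P.constr x u i t) ∂volOn P.T : ℝ) : EReal) := by
  rw [Jpen_eq_add_extIntegral, extIntegral_eq_of_ae hint, EReal.coe_add, EReal.coe_mul]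
  filter_upwards [hneg] with t ht using sum_logBarrier_of_neg ht

theorem IsFeasible.isAdmissible (hxu : P.IsFeasible x u) (hT : 0 < P.T) (hsm : P.Smooth)
    (hneg : ∀ᵐ t ∂volOn P.T, ∀ i, P.constr x u i t < 0) : P.IsAdmissible x u := by
  refine ⟨hxu, fun t ht i => ?_, ?_⟩
  · have h1 : EqOn (fun t => max (P.g i (x t)) 0) (fun _ => 0) (Icc 0 P.T) :=
      Measure.eqOn_Icc_of_ae_eq (μ := volume) hT.ne (by
        have : ∀ᵐ t ∂volOn P.T, max (P.g i (x t)) 0 = 0 := by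
          filter_upwards [hneg] with t ht using max_eq_right (ht (Sum.inl i)).le
        exact this)
        (((hsm.g_C2 i).continuous.comp_continuousOn hxu.continuousOn).sup continuousOn_const)
        continuousOn_const
    exact max_eq_right_iff.1 (h1 ht)
  · have : ∀ᵐ t ∂volOn P.T, ∀ i, P.c i (x t) (u t) ≤ 0 := by
      filter_upwards [hneg] with t ht i using (ht (Sum.inr i)).le
    exact this

theorem dist_le {y : ℝ → Vec n} {w : ℝ → Vec m} {d : ℝ} (hT : 0 ≤ P.T)
    (h : ‖y 0 - x 0‖ ≤ d) (hw : ∀ᵐ t ∂volOn P.T, ‖w t - u t‖ ≤ d) :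
    P.dist x u y w ≤ (1 + P.T) * d := by
  have h1 : ∫ t, ‖w t - u t‖ ∂volOn P.T ≤ ∫ _t, d ∂volOn P.T :=
    integral_mono_of_nonneg (Eventually.of_forall fun t => norm_nonneg _) (integrable_const _) hw
  have h2 : ∫ _t, d ∂volOn P.T = P.T * d := by simp [volOn, measureReal_def, hT]
  have h3 : P.dist x u y w = (∫ t, ‖w t - u t‖ ∂volOn P.T) + ‖y 0 - x 0‖ := rfl
  linarith

/-- Bound, uniform over the local solutions of the penalized problems, on the barriers. -/
theorem exists_lintegral_barrier_le (hT : 0 < P.T) (hsm : P.Smooth) (hbdd : P.BoundedAdmissible)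
    (hstates : P.BoundedStates) (hqual : P.MixedQualified) (hsing : P.NoSingularMultiplier) :
    ∃ d > (0 : ℝ), ∃ C : ℝ, 0 ≤ C ∧ ∀ ε > (0 : ℝ), ∀ x u, P.IsPenalizedLocalSolution ε x u →
      (∀ᵐ t ∂volOn P.T, ∀ i, P.constr x u i t < 0) ∧
      ∀ i, ∫⁻ t, ENNReal.ofReal (d / -P.constr x u i t + 1) ∂volOn P.T
        ≤ ENNReal.ofReal (C / ε + 2 * (ng + nc) * P.T) := by
  obtain ⟨δ, hδ, hdir⟩ := exists_uniform_inwardDirection hT.le hsm hbdd hstates hqual hsing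
  obtain ⟨R, hR0, hR⟩ := exists_admissible_bound hT.le hsm hbdd hstates
  obtain ⟨C, hC0, hC⟩ := exists_J_lipschitz hT.le hsm (R + 1)
  have hB : 0 < 2 + P.T := by linarith
  refine ⟨δ / 2, half_pos hδ, C * (2 + P.T), by positivity, fun ε hε x u hxu => ?_⟩
  obtain ⟨hfeas, htop, ρ, hρ, hopt⟩ := hxu
  obtain ⟨hneg, hint⟩ := neg_of_Jpen_ne_top hε hsm hfeas.toIsTrajectory htop
  have hadm := hfeas.isAdmissible hT hsm hneg
  obtain ⟨hxR, huR⟩ := hR x u hadm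
  refine ⟨hneg, fun i => ?_⟩
  have hk := fun i => hsm.memLp_constr hfeas.continuousOn hfeas.control i
  have hκpos : ∀ᵐ t ∂volOn P.T, 0 < -P.constr x u i t := by
    filter_upwards [hneg] with t ht using neg_pos.2 (ht i)
  refine lintegral_barrier_le_of_eventually (hk i).1.neg hκpos ?_
  have hsmall : ∀ c : ℝ, 0 < c → ∀ᶠ s in 𝓝[>] (0 : ℝ), s ≤ c := fun c hc =>
    nhdsWithin_le_nhds (eventually_le_nhds hc)
  filter_upwards [exists_decreasing_path hT.le hsm hstates hδ hfeas (hdir x u hadm),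
    self_mem_nhdsWithin, hsmall (1 / 2) one_half_pos, hsmall (1 / (2 + P.T)) (by positivity),
    hsmall (ρ / ((1 + P.T) * (2 + P.T))) (by positivity)] with s hpath hs hs1 hs2 hs3
  obtain ⟨y, w, hyw, hy, hw, hdec⟩ := hpath
  have hs : 0 < s := hs
  have hBs : (2 + P.T) * s ≤ 1 := by
    rw [le_div_iff₀ hB] at hs2
    linarith
  have hdist : P.dist x u y w ≤ ρ := by
    refine (dist_le hT.le (hy 0 ⟨le_rfl, hT.le⟩) hw).trans ?_
    rw [le_div_iff₀ (by positivity)] at hs3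
    linarith
  have hy_le : ∀ᵐ t ∂volOn P.T, ∀ i, P.constr y w i t ≤ -(s * (δ / 2)) := by
    filter_upwards [hdec, hneg] with t h1 h2 i
    have := mul_nonneg (by linarith : 0 ≤ 1 - s) (neg_pos.2 (h2 i)).le
    linarith [h1 i]
  have hη : 0 < s * (δ / 2) := by positivity
  have hint' := integrable_log_of_le
    (fun i => hsm.memLp_constr hyw.continuousOn hyw.control i) hη hy_le
  have hneg' : ∀ᵐ t ∂volOn P.T, ∀ i, P.constr y w i t < 0 := by
    filter_upwards [hy_le] with t ht i
    linarith [ht i]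
  have hcost := hopt y w hyw hdist
  rw [Jpen_eq_coe hneg hint, Jpen_eq_coe hneg' hint', EReal.coe_le_coe_iff] at hcost
  have hlip := hC x y u w ((2 + P.T) * s) hfeas.toIsTrajectory hyw.toIsTrajectory
    (fun t ht => (hxR t ht).trans (by linarith))
    (fun t ht => by
      have := norm_le_norm_add_norm_sub' (y t) (x t)
      linarith [hxR t ht, hy t ht])
    (by filter_upwards [huR] with t ht using ht.trans (by linarith))
    (by
      filter_upwards [huR, hw] with t h1 h2
      have := norm_le_norm_add_norm_sub' (w t) (u t)
      linarith) hy hw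
  have hquot := lintegral_quotient_le hT.le (fun i => (hk i).1) (half_pos hδ) hs hs1 hneg hint hint'
    hdec (A := C * (2 + P.T) / ε) (by
      rw [div_mul_eq_mul_div, le_div_iff₀ hε]
      linarith) i
  simpa [Fintype.card_sum] using hquot

end OCP

end

theorem lemma4p2 {n m nh ng nc : ℕ} (P : OCP n m nh ng nc)
    (hT : 0 < P.T)
    (hsmooth : P.Smooth)
    (haccess : P.InteriorAccessible)
    (hends : P.BoundedEndpoints)
    (hbdd : P.BoundedAdmissible)
    (hstates : P.BoundedStates)
    (hqual : P.MixedQualified)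
    (hsing : P.NoSingularMultiplier)
    (ε₀ : ℝ) (hε₀ : 0 < ε₀) :
    ∃ K : ℝ, ∀ ε : ℝ, 0 < ε → ε < ε₀ →
      ∀ x u, P.IsPenalizedLocalSolution ε x u → ∀ i : Fin nc,
        (∀ᵐ t ∂P.vol, P.c i (x t) (u t) < 0) ∧
        MemLp (fun t => ε * logBarrierDeriv (P.c i (x t) (u t))) 1 P.vol ∧
        eLpNorm (fun t => ε * logBarrierDeriv (P.c i (x t) (u t))) 1 P.vol
          ≤ ENNReal.ofReal K := by
  obtain ⟨d, hd, C, hC, h⟩ :=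
    P.exists_lintegral_barrier_le hT hsmooth hbdd hstates hqual hsing
  refine ⟨(C + 2 * (ng + nc) * P.T * ε₀) / d, fun ε hε hεε₀ x u hxu i => ?_⟩
  obtain ⟨hneg, hle⟩ := h ε hε x u hxu
  set κ : ℝ → ℝ := fun t => -P.c i (x t) (u t) with hκ
  have hκpos : ∀ᵐ t ∂volOn P.T, 0 < κ t := by
    filter_upwards [hneg] with t ht using neg_pos.2 (ht (Sum.inr i))
  have hκm : AEMeasurable κ (volOn P.T) :=
    (hsmooth.memLp_constr hxu.1.continuousOn hxu.1.control (Sum.inr i)).1.aemeasurable.neg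
  have heq : (fun t => ε * logBarrierDeriv (P.c i (x t) (u t))) =ᵐ[volOn P.T]
      fun t => ε / κ t := by
    filter_upwards [hκpos] with t ht
    rw [logBarrierDeriv_of_neg (neg_pos.1 ht), mul_one_div]
  have hnorm : eLpNorm (fun t => ε * logBarrierDeriv (P.c i (x t) (u t))) 1 P.vol
      ≤ ENNReal.ofReal ((C + 2 * (ng + nc) * P.T * ε₀) / d) := by
    calc eLpNorm (fun t => ε * logBarrierDeriv (P.c i (x t) (u t))) 1 (volOn P.T)
        = ∫⁻ t, ‖ε / κ t‖ₑ ∂volOn P.T := by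
          rw [eLpNorm_congr_ae heq, eLpNorm_one_eq_lintegral_enorm]
      _ ≤ ∫⁻ t, ENNReal.ofReal (ε / d) * ENNReal.ofReal (d / κ t + 1) ∂volOn P.T := by
          refine lintegral_mono_ae ?_
          filter_upwards [hκpos] with t ht
          have h1 : ε / κ t = ε / d * (d / κ t) := by field_simp
          rw [← ENNReal.ofReal_mul (by positivity), ← ofReal_norm,
            Real.norm_of_nonneg (by positivity), h1]
          gcongr
          linarith
      _ = ENNReal.ofReal (ε / d) * ∫⁻ t, ENNReal.ofReal (d / κ t + 1) ∂volOn P.T :=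
          lintegral_const_mul' _ _ ENNReal.ofReal_ne_top
      _ ≤ ENNReal.ofReal (ε / d) * ENNReal.ofReal (C / ε + 2 * (ng + nc) * P.T) := by
          gcongr
          exact hle (Sum.inr i)
      _ ≤ _ := by
          rw [← ENNReal.ofReal_mul (by positivity)]
          refine ENNReal.ofReal_le_ofReal ?_
          have h1 : ε / d * (C / ε + 2 * (ng + nc) * P.T)
              = (C + 2 * (ng + nc) * P.T * ε) / d := by
            field_simp
          rw [h1]
          gcongr
  refine ⟨?_, ⟨?_, hnorm.trans_lt ENNReal.ofReal_lt_top⟩, hnorm⟩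
  · have : ∀ᵐ t ∂volOn P.T, P.c i (x t) (u t) < 0 := by
      filter_upwards [hneg] with t ht using ht (Sum.inr i)
    exact this
  · exact ((aemeasurable_const.div hκm).aestronglyMeasurable (f := fun t => ε / κ t)).congr heq.symm
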